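/- Let $\mathbf k$ be a field and $d$ an integer. **Graphs.** Consider finite directed graphs $\gamma$ (not necessarily connected, loops and multiple edges allowed, the empty graph included) with a cyclic ordering of the half-edges at each vertex. The type of a vertex is its number of outgoing edges; a vertex of type $1$ is required to have at least two incoming edges. The inputs of $\gamma$ are its vertices of type $0$, the outputs are the boundary components of the thickened graph (a vertex without edges has one boundary component); both are numbered. An orientation of $\gamma$ is a word in which every edge (of degree $1$) and every vertex of type $n\ge 1$ (of degree $n(2-d)+(d-4)$) occurs exactly once, up to the Koszul sign rule; the sum of these degrees is called the orientation degree. Let $\mathcal{DG}_\infty^\bullet(i,j)$ be the $\mathbf k$-vector space generated by the oriented graphs with $i$ inputs and $j$ outputs, modulo isomorphism and the Koszul sign rule for orientations, and for $k=1,2,3,\dots$ let $\mathcal{DG}_k^\bullet(i,j)$ be the subspace spanned by the graphs all of whose vertices have type at most $k$. The superscript refers to the grading in which a vertex of type $0$ with $m\ge1$ incoming edges contributes $m-1$ to the degree, a vertex without edges contributes $0$, and a vertex of type $n\ge1$ with $m$ incoming edges contributes $2n+m-4$. **Operations.** The symmetric groups renumber inputs and outputs. The tensor product is the disjoint union, and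 the identity of $n$ is the graph with $n$ vertices and no edges. The composition $\gamma_1\circ\gamma_2$ (where $\gamma_1$ has as many outputs as $\gamma_2$ has inputs) is the sum over all ways to remove the inputs of $\gamma_2$ and to attach the edges at each input $j$ of $\gamma_2$ to the boundary component $j$ of $\gamma_1$, respecting cyclic orders. In $\circ$ and $\otimes$ the orientation of the second graph is appended on the right to that of the first. The map $D$ sends a graph to the sum of all admissible graphs with the same number of vertices of type $0$ from which it is obtained by collapsing one edge; for the orientation, the expanded vertex is brought to the front and replaced by the new edge followed by the source and the target of this edge (vertices of type $0$ being omitted). **Proposition.** These operations are well defined, and for every $k\in\{1,2,3,\dots,\infty\}$ they make $\mathcal{DG}_k^\bullet$ a $\mathbf k$-linear PROP, graded by the orientation degree (with Koszul signs), on which $D$ is a derivation of degree $-1$ with respect to $\circ$ and $\otimes$ commuting with the symmetric group actions. If $d$ is even or $\mathbf k$ has characteristic $2$, then $D^2=0$, so that $\mathcal{DG}_k^\bullet$ is a differential graded PROP. The grading $\bullet$ is concentrated in non-negative degrees and $D$ lowers it by $1$. There is a sequence of inclusions of PROPs $$\mathcal{DG}_1^\bullet\hookrightarrow\mathcal{DG}_2^\bullet\hookrightarrow\mathcal{DG}_3^\bullet\hookrightarrow\cdots\hookrightarrow\mathcal{DG}_\infty^\bullet,$$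 that is, all inclusions $\mathcal{DG}_k^\bullet\hookrightarrow\mathcal{DG}_l^\bullet$, $1\le k\le l\le\infty$, are injective and compatible with both gradings, the symmetric group actions, $\circ$, $\otimes$, the identities and $D$. -/

import Mathlib

/-!
Directed ribbon graphs with numbered inputs and outputs, the spaces they span, the edge-expansion
differential, gluing, and graded `𝕜`-linear PROPs with a differential.
-/

noncomputable section

open scoped Classical

namespace RibbonProp

/-! ### Directed ribbon graphs -/

/-- The involution exchanging the two ends of each edge.  A half-edge is a pair `(e, b)`:
`(e, true)` is the end of `e` at its source, `(e, false)` the end of `e` at its target. -/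
def flip (E : Type) : Equiv.Perm (E × Bool) :=
  Equiv.prodCongr (Equiv.refl E) Equiv.boolNot

/-- The boundary walk of a thickened graph with cyclic orderings `next`.  The half-edge `h` stands
for the corner (sector) between `h` and `next h`.  Following the boundary from this corner, one
runs along the edge of `next h` and reaches the corner that comes after the other end of it. -/
def walkOf {E : Type} (next : Equiv.Perm (E × Bool)) : Equiv.Perm (E × Bool) :=
  next.trans (flip E)

/-- `FirstReturn τ s y z`: the first element of `s` met after `y`, when `τ` is iterated, is `z`. -/
def FirstReturn {Y : Type} (τ : Equiv.Perm Y) (s : Set Y) (y z : Y) : Prop :=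
  ∃ k : ℕ, 0 < k ∧ (τ ^ k) y = z ∧ z ∈ s ∧ ∀ l : ℕ, 0 < l → l < k → (τ ^ l) y ∉ s

/-- A directed graph with edge set `E`, with set of vertices of type `0` equal to `I` (the inputs)
and set of vertices of positive type equal to `V`, a cyclic ordering of the half-edges at every
vertex, and outputs labelled by `J`.  The type of a vertex is the number of its outgoing edges.
The outputs are the boundary components of the thickened graph; each of them is a cycle of the
boundary walk or the circumference of a vertex without edges. -/
structure Graph (I J E V : Type) where
  /-- the vertex at which a half-edge sits -/
  vtx : E × Bool → I ⊕ V
  /-- the cyclic ordering: the successor of a half-edge at its vertex -/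
  next : Equiv.Perm (E × Bool)
  sameCycle_next : ∀ h h', next.SameCycle h h' ↔ vtx h = vtx h'
  /-- the label of the boundary component through the corner between `h` and `next h` -/
  out : E × Bool → J
  /-- the label of the boundary component around a vertex without edges -/
  outTriv : ∀ i : I, (∀ h, vtx h ≠ Sum.inl i) → J
  sameCycle_walk : ∀ h h', (walkOf next).SameCycle h h' ↔ out h = out h'
  outTriv_injective : ∀ i i' hi hi', outTriv i hi = outTriv i' hi' → i = i'
  out_ne_outTriv : ∀ h i hi, out h ≠ outTriv i hi
  out_surjective : ∀ j, (∃ h, out h = j) ∨ ∃ i hi, outTriv i hi = j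
  /-- vertices in `I` have type `0` -/
  source_ne : ∀ e i, vtx (e, true) ≠ Sum.inl i
  /-- vertices in `V` have positive type -/
  exists_source : ∀ v, ∃ e, vtx (e, true) = Sum.inr v
  /-- vertices of type `1` have at least two incoming edges -/
  two_le_of_type_one : ∀ v, Nat.card {e : E // vtx (e, true) = Sum.inr v} = 1 →
    2 ≤ Nat.card {e : E // vtx (e, false) = Sum.inr v}

namespace Graph

variable {I J E V : Type}

/-- The boundary walk on the corners given by half-edges. -/
def walk (γ : Graph I J E V) : Equiv.Perm (E × Bool) := walkOf γ.next

/-- The type of a vertex: its number of outgoing edges. -/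
def type (γ : Graph I J E V) (v : V) : ℕ := Nat.card {e : E // γ.vtx (e, true) = Sum.inr v}

/-- The number of incoming edges of a vertex. -/
def indeg (γ : Graph I J E V) (w : I ⊕ V) : ℕ := Nat.card {e : E // γ.vtx (e, false) = w}

/-- The vertex `i` of type `0` has no edges. -/
def Trivial (γ : Graph I J E V) (i : I) : Prop := ∀ h, γ.vtx h ≠ Sum.inl i

/-- There are only finitely many graphs on given finite sets; so all sums over graphs below are
finite sums. -/
instance [Finite I] [Finite J] [Finite E] [Finite V] : Finite (Graph I J E V) := by
  let F : Graph I J E V → (Σ p : (E × Bool → I ⊕ V) × Equiv.Perm (E × Bool) × (E × Bool → J),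
      (∀ i : I, (∀ h, p.1 h ≠ Sum.inl i) → J)) :=
    fun γ => ⟨(γ.vtx, γ.next, γ.out), γ.outTriv⟩
  refine Finite.of_injective F ?_
  rintro ⟨a, b, _, c, t⟩ ⟨a', b', _, c', t'⟩ h
  simp only [F, Sigma.mk.injEq, Prod.mk.injEq] at h
  obtain ⟨⟨rfl, rfl, rfl⟩, h⟩ := h
  cases h
  rfl

/-- The degree of a generator of the orientation space: an edge has degree `1`, a vertex of
type `n` has degree `n (2 - d) + (d - 4)`. -/
def letterDeg (d : ℤ) (γ : Graph I J E V) : E ⊕ V → ℤ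
  | Sum.inl _ => 1
  | Sum.inr v => (γ.type v : ℤ) * (2 - d) + (d - 4)

/-- The degree of a graph: a vertex of type `0` with `m` incoming edges contributes `m - 1`
(and `0` if `m = 0`), a vertex of type `n ≥ 1` with `m` incoming edges contributes
`2 n + m - 4`. -/
def degree (γ : Graph I J E V) : ℤ :=
  (∑ᶠ i : I, ((γ.indeg (Sum.inl i) - 1 : ℕ) : ℤ)) +
    ∑ᶠ v : V, (2 * (γ.type v : ℤ) + (γ.indeg (Sum.inr v) : ℤ) - 4)

/-- The bijections `a` of the edges and `b` of the vertices of positive type form an isomorphism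
of graphs (which respects the numbering of the inputs and of the outputs). -/
structure IsIso {E' V' : Type} (γ : Graph I J E V) (γ' : Graph I J E' V')
    (a : E ≃ E') (b : V ≃ V') : Prop where
  vtx : ∀ e s, γ'.vtx (a e, s) = Sum.map id b (γ.vtx (e, s))
  next : ∀ e s, γ'.next (a e, s) = Prod.map a id (γ.next (e, s))
  out : ∀ e s, γ'.out (a e, s) = γ.out (e, s)
  outTriv : ∀ i hi hi', γ'.outTriv i hi' = γ.outTriv i hi

/-! ### Renumbering, identities, disjoint unions, expansions, gluings -/

/-- The graph `γ` with its inputs and outputs renumbered by `α` and `β`. -/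
def relabel {I' J' : Type} (α : I ≃ I') (β : J ≃ J') (γ : Graph I J E V) : Graph I' J' E V where
  vtx h := Sum.map α id (γ.vtx h)
  next := γ.next
  sameCycle_next h h' := by
    rw [γ.sameCycle_next]
    exact (α.injective.sumMap Function.injective_id).eq_iff.symm
  out h := β (γ.out h)
  outTriv i hi := β (γ.outTriv (α.symm i) fun h hh => hi h (by simp [hh]))
  sameCycle_walk h h' := by rw [γ.sameCycle_walk]; exact β.injective.eq_iff.symm
  outTriv_injective i i' hi hi' h :=
    α.symm.injective (γ.outTriv_injective _ _ _ _ (β.injective h))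
  out_ne_outTriv h i hi hh := γ.out_ne_outTriv _ _ _ (β.injective hh)
  out_surjective j := by
    rcases γ.out_surjective (β.symm j) with ⟨h, hh⟩ | ⟨i, hi, hh⟩
    · exact Or.inl ⟨h, by rw [hh]; simp⟩
    · refine Or.inr ⟨α i, fun h hh' => hi h ?_, ?_⟩
      · have : Sum.map α id (γ.vtx h) = Sum.map α id (Sum.inl i) := hh'
        exact (α.injective.sumMap Function.injective_id) this
      · rw [← β.eq_symm_apply, ← hh]
        congr 1
        simp
  source_ne e i h := by
    rcases hv : γ.vtx (e, true) with i' | v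
    · exact γ.source_ne e i' hv
    · simp [hv] at h
  exists_source v := by
    obtain ⟨e, he⟩ := γ.exists_source v
    exact ⟨e, by simp [he]⟩
  two_le_of_type_one v := by
    have key : ∀ s, {e : E // Sum.map α id (γ.vtx (e, s)) = Sum.inr v} =
        {e : E // γ.vtx (e, s) = Sum.inr v} := by
      intro s
      congr 1
      ext e
      rcases γ.vtx (e, s) with i' | v' <;> simp
    rw [key, key]
    exact γ.two_le_of_type_one v

/-- The graph without edges whose vertices are the elements of `I`, each of them being both an
input and an output. -/
def trivial (I : Type) : Graph I I Empty Empty where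
  vtx h := h.1.elim
  next := Equiv.refl _
  sameCycle_next h := h.1.elim
  out h := h.1.elim
  outTriv i _ := i
  sameCycle_walk h := h.1.elim
  outTriv_injective _ _ _ _ h := h
  out_ne_outTriv h := h.1.elim
  out_surjective i := Or.inr ⟨i, fun h => h.1.elim, rfl⟩
  source_ne e := e.elim
  exists_source v := v.elim
  two_le_of_type_one v := v.elim

/-- The permutation of the half-edges of a disjoint union given by permutations of the half-edges
of the two parts. -/
def sumPerm {E₁ E₂ : Type} (σ₁ : Equiv.Perm (E₁ × Bool)) (σ₂ : Equiv.Perm (E₂ × Bool)) :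
    Equiv.Perm ((E₁ ⊕ E₂) × Bool) :=
  (Equiv.sumProdDistrib E₁ E₂ Bool).trans
    ((Equiv.sumCongr σ₁ σ₂).trans (Equiv.sumProdDistrib E₁ E₂ Bool).symm)

theorem sumPerm_left {E₁ E₂ : Type} (σ₁ : Equiv.Perm (E₁ × Bool)) (σ₂ : Equiv.Perm (E₂ × Bool))
    (h : E₁ × Bool) : sumPerm σ₁ σ₂ (Prod.map Sum.inl id h) = Prod.map Sum.inl id (σ₁ h) := rfl

theorem sumPerm_right {E₁ E₂ : Type} (σ₁ : Equiv.Perm (E₁ × Bool)) (σ₂ : Equiv.Perm (E₂ × Bool))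
    (h : E₂ × Bool) : sumPerm σ₁ σ₂ (Prod.map Sum.inr id h) = Prod.map Sum.inr id (σ₂ h) := rfl

theorem sumPerm_zpow {E₁ E₂ : Type} (σ₁ : Equiv.Perm (E₁ × Bool)) (σ₂ : Equiv.Perm (E₂ × Bool))
    (z : ℤ) : sumPerm σ₁ σ₂ ^ z = sumPerm (σ₁ ^ z) (σ₂ ^ z) := by
  let F : Equiv.Perm (E₁ × Bool) × Equiv.Perm (E₂ × Bool) →* Equiv.Perm ((E₁ ⊕ E₂) × Bool) :=
    { toFun := fun p => sumPerm p.1 p.2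
      map_one' := by ext1 ⟨e | e, s⟩ <;> rfl
      map_mul' := by rintro ⟨a, b⟩ ⟨a', b'⟩; ext1 ⟨e | e, s⟩ <;> rfl }
  exact (map_zpow F (σ₁, σ₂) z).symm

theorem sameCycle_sumPerm {E₁ E₂ X₁ X₂ : Type} {σ₁ : Equiv.Perm (E₁ × Bool)}
    {σ₂ : Equiv.Perm (E₂ × Bool)} {f : (E₁ ⊕ E₂) × Bool → X₁ ⊕ X₂}
    {f₁ : E₁ × Bool → X₁} {f₂ : E₂ × Bool → X₂}
    (hf₁ : ∀ e s, f (Sum.inl e, s) = Sum.inl (f₁ (e, s)))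
    (hf₂ : ∀ e s, f (Sum.inr e, s) = Sum.inr (f₂ (e, s)))
    (h₁ : ∀ h h', σ₁.SameCycle h h' ↔ f₁ h = f₁ h')
    (h₂ : ∀ h h', σ₂.SameCycle h h' ↔ f₂ h = f₂ h') (h h') :
    (sumPerm σ₁ σ₂).SameCycle h h' ↔ f h = f h' := by
  have hl : Function.Injective (Prod.map Sum.inl id : E₁ × Bool → (E₁ ⊕ E₂) × Bool) :=
    Sum.inl_injective.prodMap Function.injective_id
  have hr : Function.Injective (Prod.map Sum.inr id : E₂ × Bool → (E₁ ⊕ E₂) × Bool) :=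
    Sum.inr_injective.prodMap Function.injective_id
  unfold Equiv.Perm.SameCycle at *
  simp only [sumPerm_zpow]
  rcases h with ⟨e | e, s⟩ <;> rcases h' with ⟨e' | e', s'⟩
  · rw [hf₁, hf₁, Sum.inl.injEq, ← h₁]
    exact exists_congr fun z => hl.eq_iff (a := (σ₁ ^ z) (e, s)) (b := (e', s'))
  · rw [hf₁, hf₂]
    refine iff_of_false ?_ (by simp)
    rintro ⟨z, hz⟩
    exact absurd (congrArg Prod.fst hz) Sum.inl_ne_inr
  · rw [hf₁, hf₂]
    refine iff_of_false ?_ (by simp)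
    rintro ⟨z, hz⟩
    exact absurd (congrArg Prod.fst hz) Sum.inr_ne_inl
  · rw [hf₂, hf₂, Sum.inr.injEq, ← h₂]
    exact exists_congr fun z => hr.eq_iff (a := (σ₂ ^ z) (e, s)) (b := (e', s'))

theorem walkOf_sumPerm {E₁ E₂ : Type} (σ₁ : Equiv.Perm (E₁ × Bool))
    (σ₂ : Equiv.Perm (E₂ × Bool)) :
    walkOf (sumPerm σ₁ σ₂) = sumPerm (walkOf σ₁) (walkOf σ₂) := by
  ext1 ⟨e | e, s⟩ <;> rfl

/-- Both summands of a disjoint union of graphs keep their half-edges at their vertices. -/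
def unionVtx {I' E₁ V₁ E₂ V₂ : Type} (v₁ : E₁ × Bool → I ⊕ V₁) (v₂ : E₂ × Bool → I' ⊕ V₂) :
    (E₁ ⊕ E₂) × Bool → (I ⊕ I') ⊕ (V₁ ⊕ V₂)
  | (Sum.inl e, s) => Sum.map Sum.inl Sum.inl (v₁ (e, s))
  | (Sum.inr e, s) => Sum.map Sum.inr Sum.inr (v₂ (e, s))

theorem card_union {I' E₁ V₁ E₂ V₂ : Type} (v₁ : E₁ × Bool → I ⊕ V₁)
    (v₂ : E₂ × Bool → I' ⊕ V₂) (s : Bool) :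
    (∀ v, Nat.card {e // unionVtx v₁ v₂ (e, s) = Sum.inr (Sum.inl v)} =
      Nat.card {e // v₁ (e, s) = Sum.inr v}) ∧
    (∀ v, Nat.card {e // unionVtx v₁ v₂ (e, s) = Sum.inr (Sum.inr v)} =
      Nat.card {e // v₂ (e, s) = Sum.inr v}) := by
  have el : ∀ w v, Sum.map (Sum.inl : I → I ⊕ I') (Sum.inl : V₁ → V₁ ⊕ V₂) w =
      Sum.inr (Sum.inl v) ↔ w = Sum.inr v := by rintro (w | w) v <;> simp
  have er : ∀ w v, Sum.map (Sum.inr : I' → I ⊕ I') (Sum.inr : V₂ → V₁ ⊕ V₂) w =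
      Sum.inr (Sum.inr v) ↔ w = Sum.inr v := by rintro (w | w) v <;> simp
  constructor
  · intro v
    refine (Nat.card_congr (Equiv.ofBijective
      (fun e : {e // v₁ (e, s) = Sum.inr v} => ⟨Sum.inl e.1, (el _ _).mpr e.2⟩) ⟨?_, ?_⟩)).symm
    · rintro ⟨a, ha⟩ ⟨b, hb⟩ h
      exact Subtype.ext (Sum.inl_injective (congrArg Subtype.val h))
    · rintro ⟨e | e, he⟩
      · exact ⟨⟨e, (el _ _).mp he⟩, rfl⟩
      · exfalso
        change Sum.map Sum.inr Sum.inr (v₂ (e, s)) = _ at he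
        rcases hh : v₂ (e, s) with w | w <;> simp [hh] at he
  · intro v
    refine (Nat.card_congr (Equiv.ofBijective
      (fun e : {e // v₂ (e, s) = Sum.inr v} => ⟨Sum.inr e.1, (er _ _).mpr e.2⟩) ⟨?_, ?_⟩)).symm
    · rintro ⟨a, ha⟩ ⟨b, hb⟩ h
      exact Subtype.ext (Sum.inr_injective (congrArg Subtype.val h))
    · rintro ⟨e | e, he⟩
      · exfalso
        change Sum.map Sum.inl Sum.inl (v₁ (e, s)) = _ at he
        rcases hh : v₁ (e, s) with w | w <;> simp [hh] at he
      · exact ⟨⟨e, (er _ _).mp he⟩, rfl⟩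

/-- The disjoint union of two graphs. -/
def disjUnion {I' J' E₁ V₁ E₂ V₂ : Type} (γ₁ : Graph I J E₁ V₁) (γ₂ : Graph I' J' E₂ V₂) :
    Graph (I ⊕ I') (J ⊕ J') (E₁ ⊕ E₂) (V₁ ⊕ V₂) where
  vtx := unionVtx γ₁.vtx γ₂.vtx
  next := sumPerm γ₁.next γ₂.next
  sameCycle_next h h' := by
    rw [sameCycle_sumPerm (f := fun h => Equiv.sumSumSumComm I I' V₁ V₂
      (unionVtx γ₁.vtx γ₂.vtx h)) (f₁ := γ₁.vtx) (f₂ := γ₂.vtx) ?_ ?_ γ₁.sameCycle_next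
      γ₂.sameCycle_next]
    · exact (Equiv.injective _).eq_iff
    · intro e s
      change Equiv.sumSumSumComm _ _ _ _ (Sum.map Sum.inl Sum.inl (γ₁.vtx (e, s))) = _
      rcases γ₁.vtx (e, s) with i | v <;> rfl
    · intro e s
      change Equiv.sumSumSumComm _ _ _ _ (Sum.map Sum.inr Sum.inr (γ₂.vtx (e, s))) = _
      rcases γ₂.vtx (e, s) with i | v <;> rfl
  out h := Sum.map γ₁.out γ₂.out (Equiv.sumProdDistrib E₁ E₂ Bool h)
  outTriv
    | Sum.inl i, hi => Sum.inl (γ₁.outTriv i fun h hh => hi (Prod.map Sum.inl id h) (by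
        change Sum.map Sum.inl Sum.inl (γ₁.vtx h) = _
        rw [hh]; rfl))
    | Sum.inr i, hi => Sum.inr (γ₂.outTriv i fun h hh => hi (Prod.map Sum.inr id h) (by
        change Sum.map Sum.inr Sum.inr (γ₂.vtx h) = _
        rw [hh]; rfl))
  sameCycle_walk h h' := by
    rw [walkOf_sumPerm]
    exact sameCycle_sumPerm
      (f := fun h => Sum.map γ₁.out γ₂.out (Equiv.sumProdDistrib E₁ E₂ Bool h))
      (fun _ _ => rfl) (fun _ _ => rfl) γ₁.sameCycle_walk γ₂.sameCycle_walk h h'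
  outTriv_injective := by
    rintro (i | i) (i' | i') hi hi' h
    · exact congrArg _ (γ₁.outTriv_injective _ _ _ _ (Sum.inl_injective h))
    · exact absurd h Sum.inl_ne_inr
    · exact absurd h Sum.inr_ne_inl
    · exact congrArg _ (γ₂.outTriv_injective _ _ _ _ (Sum.inr_injective h))
  out_ne_outTriv := by
    rintro ⟨e | e, s⟩ (i | i) hi h
    · exact γ₁.out_ne_outTriv _ _ _ (Sum.inl_injective h)
    · exact absurd h Sum.inl_ne_inr
    · exact absurd h Sum.inr_ne_inl
    · exact γ₂.out_ne_outTriv _ _ _ (Sum.inr_injective h)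
  out_surjective := by
    rintro (j | j)
    · rcases γ₁.out_surjective j with ⟨h, rfl⟩ | ⟨i, hi, rfl⟩
      · exact Or.inl ⟨(Sum.inl h.1, h.2), rfl⟩
      · refine Or.inr ⟨Sum.inl i, ?_, rfl⟩
        rintro ⟨e | e, s⟩ he
        · change Sum.map Sum.inl Sum.inl (γ₁.vtx (e, s)) = _ at he
          rcases hh : γ₁.vtx (e, s) with w | w <;> simp [hh] at he
          exact hi (e, s) (by rw [hh, he])
        · change Sum.map Sum.inr Sum.inr (γ₂.vtx (e, s)) = _ at he
          rcases hh : γ₂.vtx (e, s) with w | w <;> simp [hh] at he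
    · rcases γ₂.out_surjective j with ⟨h, rfl⟩ | ⟨i, hi, rfl⟩
      · exact Or.inl ⟨(Sum.inr h.1, h.2), rfl⟩
      · refine Or.inr ⟨Sum.inr i, ?_, rfl⟩
        rintro ⟨e | e, s⟩ he
        · change Sum.map Sum.inl Sum.inl (γ₁.vtx (e, s)) = _ at he
          rcases hh : γ₁.vtx (e, s) with w | w <;> simp [hh] at he
        · change Sum.map Sum.inr Sum.inr (γ₂.vtx (e, s)) = _ at he
          rcases hh : γ₂.vtx (e, s) with w | w <;> simp [hh] at he
          exact hi (e, s) (by rw [hh, he])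
  source_ne := by
    rintro (e | e) (i | i) he
    · change Sum.map Sum.inl Sum.inl (γ₁.vtx (e, true)) = _ at he
      rcases hh : γ₁.vtx (e, true) with w | w <;> simp [hh] at he
      exact γ₁.source_ne _ _ hh
    · change Sum.map Sum.inl Sum.inl (γ₁.vtx (e, true)) = _ at he
      rcases hh : γ₁.vtx (e, true) with w | w <;> simp [hh] at he
    · change Sum.map Sum.inr Sum.inr (γ₂.vtx (e, true)) = _ at he
      rcases hh : γ₂.vtx (e, true) with w | w <;> simp [hh] at he
    · change Sum.map Sum.inr Sum.inr (γ₂.vtx (e, true)) = _ at he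
      rcases hh : γ₂.vtx (e, true) with w | w <;> simp [hh] at he
      exact γ₂.source_ne _ _ hh
  exists_source := by
    rintro (v | v)
    · obtain ⟨e, he⟩ := γ₁.exists_source v
      exact ⟨Sum.inl e, congrArg (Sum.map Sum.inl Sum.inl) he⟩
    · obtain ⟨e, he⟩ := γ₂.exists_source v
      exact ⟨Sum.inr e, congrArg (Sum.map Sum.inr Sum.inr) he⟩
  two_le_of_type_one := by
    rintro (v | v)
    · rw [(card_union _ _ _).1, (card_union _ _ _).1]
      exact γ₁.two_le_of_type_one v
    · rw [(card_union _ _ _).2, (card_union _ _ _).2]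
      exact γ₂.two_le_of_type_one v

/-- `γ'` arises from `γ` by expanding an edge at the vertex `u`: it has one new edge `none`,
which runs from a new vertex `none` to `u`, and collapsing this edge gives back `γ`.  As `γ'` has
the same vertices of type `0` as `γ`, their number is preserved.  Collapsing an edge deletes its
two sides from the boundary walk, which determines the cyclic orderings of the collapsed graph. -/
structure IsExpansion (γ : Graph I J E V) (u : I ⊕ V) (γ' : Graph I J (Option E) (Option V)) :
    Prop where
  source : γ'.vtx (none, true) = Sum.inr none
  target : γ'.vtx (none, false) = Sum.map id some u
  vtx : ∀ e s, Sum.elim Sum.inl (fun v => v.elim u Sum.inr) (γ'.vtx (some e, s)) = γ.vtx (e, s)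
  walk : ∀ e s, FirstReturn γ'.walk (Set.range (Prod.map some id)) (some e, s)
    (Prod.map some id (γ.walk (e, s)))
  out : ∀ e s, γ'.out (some e, s) = γ.out (e, s)
  outTriv : ∀ i hi hi', γ'.outTriv i hi' = γ.outTriv i hi

/-- For a graph with edges `E₁ ⊕ E₂`: the walk along the boundary of the part with edges `E₁`,
which also records the half-edges of edges in `E₂` that are attached along the way. -/
def gluingWalk {E₁ E₂ W : Type} (γ : Graph I J (E₁ ⊕ E₂) W) : Equiv.Perm ((E₁ ⊕ E₂) × Bool) :=
  γ.next.trans (sumPerm (flip E₁) (Equiv.refl (E₂ × Bool)))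

/-- `γ` is obtained from `γ₁` and `γ₂` by removing the inputs of `γ₂` and attaching the edges at
each input `j` of `γ₂` to the output `j` of `γ₁`, respecting the cyclic orders of these edges and
of the boundary component `j` of `γ₁`. -/
structure IsGluing {K E₁ V₁ E₂ V₂ : Type} (γ₁ : Graph I J E₁ V₁) (γ₂ : Graph J K E₂ V₂)
    (γ : Graph I K (E₁ ⊕ E₂) (V₁ ⊕ V₂)) : Prop where
  /-- the half-edges of `γ₁` stay at their vertices -/
  vtx_left : ∀ e s, γ.vtx (Sum.inl e, s) = Sum.map id Sum.inl (γ₁.vtx (e, s))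
  /-- the half-edges of `γ₂` at vertices of positive type stay at their vertices -/
  vtx_right : ∀ e s v, γ₂.vtx (e, s) = Sum.inr v → γ.vtx (Sum.inr e, s) = Sum.inr (Sum.inr v)
  /-- deleting the edges of `γ₂` from the walk gives the boundary walk of `γ₁` -/
  walk_left : ∀ e s, FirstReturn γ.gluingWalk (Set.range (Prod.map Sum.inl id)) (Sum.inl e, s)
    (Prod.map Sum.inl id (γ₁.walk (e, s)))
  /-- deleting the edges of `γ₁` from the walk gives the cyclic orders at the vertices of `γ₂`,
  in particular at its inputs -/
  walk_right : ∀ e s, FirstReturn γ.gluingWalk (Set.range (Prod.map Sum.inr id)) (Sum.inr e, s)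
    (Prod.map Sum.inr id (γ₂.next (e, s)))
  /-- the edges at the input `j` of `γ₂` are attached to the boundary component `j` of `γ₁`,
  which may be the circumference of a vertex without edges -/
  attach : ∀ e s j, γ₂.vtx (e, s) = Sum.inl j →
    (∃ h : E₁ × Bool, γ₁.out h = j ∧
      γ.gluingWalk.SameCycle (Prod.map Sum.inl id h) (Sum.inr e, s)) ∨
    (∃ i hi, γ₁.outTriv i hi = j ∧ γ.vtx (Sum.inr e, s) = Sum.inl i)
  /-- the outputs of `γ` are those of `γ₂` -/
  out_right : ∀ e s, γ.out (Sum.inr e, s) = γ₂.out (e, s)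
  /-- a boundary component of `γ₁` glued to an input of `γ₂` without edges -/
  out_left : ∀ e s hj, γ.out (Sum.inl e, s) = γ₂.outTriv (γ₁.out (e, s)) hj
  /-- a vertex without edges of `γ₁` glued to an input of `γ₂` without edges -/
  outTriv : ∀ i hi hi₁ hj, γ.outTriv i hi = γ₂.outTriv (γ₁.outTriv i hi₁) hj

end Graph

/-! ### Oriented graphs and the spaces which they generate -/

/-- A finite directed ribbon graph with an orientation, given by a word in which every edge and
every vertex of positive type occurs exactly once. -/
structure OGraph (I J : Type) where
  E : Type
  V : Type
  finE : Finite E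
  finV : Finite V
  graph : Graph I J E V
  word : List (E ⊕ V)
  nodup : word.Nodup
  complete : ∀ x, x ∈ word

attribute [instance] OGraph.finE OGraph.finV

namespace OGraph

variable {I J : Type}

/-- All vertices have type at most `k`. -/
def TypeLE (k : ℕ∞) (Γ : OGraph I J) : Prop := ∀ v, (Γ.graph.type v : ℕ∞) ≤ k

/-- The degree of the orientation. -/
def orientationDegree (d : ℤ) (Γ : OGraph I J) : ℤ := (Γ.word.map (Γ.graph.letterDeg d)).sum

/-- The same graph with another orientation word. -/
def reorient (Γ : OGraph I J) (w : List (Γ.E ⊕ Γ.V)) (hw : w.Perm Γ.word) : OGraph I J :=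
  { Γ with
    word := w
    nodup := hw.nodup_iff.mpr Γ.nodup
    complete := fun x => hw.mem_iff.mpr (Γ.complete x) }

end OGraph

/-- The relations between oriented graphs.  Exchanging two adjacent letters `x`, `y` of the
orientation costs the Koszul sign `(-1) ^ (deg x * deg y)`; isomorphic oriented graphs are
equal. -/
inductive Relation (𝕜 : Type*) [Field 𝕜] (d : ℤ) (I J : Type) : (OGraph I J →₀ 𝕜) → Prop
  | swap (Γ : OGraph I J) (l₁ l₂ : List (Γ.E ⊕ Γ.V)) (x y : Γ.E ⊕ Γ.V)
      (hw : Γ.word = l₁ ++ x :: y :: l₂) :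
      Relation 𝕜 d I J (Finsupp.single Γ 1 -
        (Γ.graph.letterDeg d x * Γ.graph.letterDeg d y).negOnePow •
          Finsupp.single (Γ.reorient (l₁ ++ y :: x :: l₂)
            (hw ▸ (List.Perm.swap x y l₂).append_left l₁)) 1)
  | iso (Γ Γ' : OGraph I J) (a : Γ.E ≃ Γ'.E) (b : Γ.V ≃ Γ'.V)
      (h : Γ.graph.IsIso Γ'.graph a b) (hw : Γ'.word = Γ.word.map (Sum.map a b)) :
      Relation 𝕜 d I J (Finsupp.single Γ 1 - Finsupp.single Γ' 1)

/-- The vector space generated by the oriented directed graphs with inputs `I` and outputs `J`. -/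
abbrev DGInf (𝕜 : Type*) [Field 𝕜] (d : ℤ) (I J : Type) :=
  (OGraph I J →₀ 𝕜) ⧸ Submodule.span 𝕜 {r | Relation 𝕜 d I J r}

/-- The element given by an oriented graph. -/
def cls (𝕜 : Type*) [Field 𝕜] (d : ℤ) {I J : Type} (Γ : OGraph I J) : DGInf 𝕜 d I J :=
  Submodule.Quotient.mk (Finsupp.single Γ 1)

/-- The subspace given by the graphs with vertices of type at most `k`. -/
def DG (𝕜 : Type*) [Field 𝕜] (d : ℤ) (k : ℕ∞) (I J : Type) : Submodule 𝕜 (DGInf 𝕜 d I J) :=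
  Submodule.span 𝕜 {x | ∃ Γ : OGraph I J, Γ.TypeLE k ∧ x = cls 𝕜 d Γ}

theorem DG_mono (𝕜 : Type*) [Field 𝕜] (d : ℤ) (I J : Type) {k l : ℕ∞} (h : k ≤ l) :
    DG 𝕜 d k I J ≤ DG 𝕜 d l I J := by
  refine Submodule.span_mono ?_
  rintro x ⟨Γ, hΓ, hx⟩
  exact ⟨Γ, fun v => (hΓ v).trans h, hx⟩

/-- For `k = ∞` there is no restriction on the types of the vertices. -/
theorem DG_top (𝕜 : Type*) [Field 𝕜] (d : ℤ) (I J : Type) : DG 𝕜 d ⊤ I J = ⊤ := by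
  refine eq_top_iff.mpr fun x _ => ?_
  obtain ⟨f, rfl⟩ := Submodule.Quotient.mk_surjective _ x
  induction f using Finsupp.induction_linear with
  | zero => exact Submodule.zero_mem _
  | add f g hf hg => exact Submodule.add_mem _ (hf _root_.trivial) (hg _root_.trivial)
  | single Γ c =>
    have : Finsupp.single Γ c = c • (Finsupp.single Γ 1 : OGraph I J →₀ 𝕜) := by simp
    rw [this]
    have hΓ : cls 𝕜 d Γ ∈ DG 𝕜 d ⊤ I J := Submodule.subset_span ⟨Γ, fun _ => le_top, rfl⟩
    exact Submodule.smul_mem _ c hΓ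

/-- The generator of `DG 𝕜 d k I J` given by an oriented graph with vertices of type at most
`k`. -/
def gen (𝕜 : Type*) [Field 𝕜] (d : ℤ) {k : ℕ∞} {I J : Type} (Γ : OGraph I J) (h : Γ.TypeLE k) :
    DG 𝕜 d k I J :=
  ⟨cls 𝕜 d Γ, Submodule.subset_span ⟨Γ, h, rfl⟩⟩

/-! ### The operations on oriented graphs -/

namespace OGraph

/-- Renumbering of inputs and outputs. -/
def relabel {I J I' J' : Type} (α : I ≃ I') (β : J ≃ J') (Γ : OGraph I J) : OGraph I' J' :=
  { Γ with graph := Γ.graph.relabel α β }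

/-- The identity: vertices without edges. -/
def trivial (I : Type) : OGraph I I where
  E := Empty
  V := Empty
  finE := inferInstance
  finV := inferInstance
  graph := Graph.trivial I
  word := []
  nodup := List.nodup_nil
  complete x := x.elim Empty.elim Empty.elim

variable {I J K I' J' : Type}

/-- A graph on the disjoint union of the edges and vertices of positive type of `Γ₁` and `Γ₂`,
with the orientation of `Γ₂` attached to that of `Γ₁` on the right. -/
def join (Γ₁ : OGraph I J) (Γ₂ : OGraph I' J') {A B : Type}
    (γ : Graph A B (Γ₁.E ⊕ Γ₂.E) (Γ₁.V ⊕ Γ₂.V)) : OGraph A B where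
  E := Γ₁.E ⊕ Γ₂.E
  V := Γ₁.V ⊕ Γ₂.V
  finE := inferInstance
  finV := inferInstance
  graph := γ
  word := Γ₁.word.map (Sum.map Sum.inl Sum.inl) ++ Γ₂.word.map (Sum.map Sum.inr Sum.inr)
  nodup := by
    refine List.Nodup.append
      (Γ₁.nodup.map (Sum.inl_injective.sumMap Sum.inl_injective))
      (Γ₂.nodup.map (Sum.inr_injective.sumMap Sum.inr_injective)) ?_
    intro x hx hy
    obtain ⟨a, -, rfl⟩ := List.mem_map.mp hx
    obtain ⟨b, -, hb⟩ := List.mem_map.mp hy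
    rcases a with a | a <;> rcases b with b | b <;> simp at hb
  complete := by
    rintro ((e | e) | (v | v))
    · exact List.mem_append_left _ (List.mem_map.mpr ⟨Sum.inl e, Γ₁.complete _, rfl⟩)
    · exact List.mem_append_right _ (List.mem_map.mpr ⟨Sum.inl e, Γ₂.complete _, rfl⟩)
    · exact List.mem_append_left _ (List.mem_map.mpr ⟨Sum.inr v, Γ₁.complete _, rfl⟩)
    · exact List.mem_append_right _ (List.mem_map.mpr ⟨Sum.inr v, Γ₂.complete _, rfl⟩)

/-- The disjoint union of oriented graphs, with the inputs and outputs of `Γ₁` numbered first. -/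
def disjUnion {m n m' n' : ℕ} (Γ₁ : OGraph (Fin m) (Fin n)) (Γ₂ : OGraph (Fin m') (Fin n')) :
    OGraph (Fin (m + m')) (Fin (n + n')) :=
  Γ₁.join Γ₂ ((Γ₁.graph.disjUnion Γ₂.graph).relabel finSumFinEquiv finSumFinEquiv)

/-- An expansion at a vertex of type `0`: the orientation is the new edge, followed by the new
vertex (the other vertex has type `0`), followed by the old orientation. -/
def expandInput (Γ : OGraph I J) (γ' : Graph I J (Option Γ.E) (Option Γ.V)) : OGraph I J where
  E := Option Γ.E
  V := Option Γ.V
  finE := inferInstance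
  finV := inferInstance
  graph := γ'
  word := Sum.inl none :: Sum.inr none :: Γ.word.map (Sum.map some some)
  nodup := by
    have hinj : Function.Injective (Sum.map (some : Γ.E → _) (some : Γ.V → _)) :=
      (Option.some_injective _).sumMap (Option.some_injective _)
    refine List.nodup_cons.mpr ⟨?_, List.nodup_cons.mpr ⟨?_, Γ.nodup.map hinj⟩⟩ <;> simp
  complete := by
    rintro ((_ | e) | (_ | v))
    · simp
    · exact List.mem_cons_of_mem _ (List.mem_cons_of_mem _
        (List.mem_map.mpr ⟨Sum.inl e, Γ.complete _, rfl⟩))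
    · simp
    · exact List.mem_cons_of_mem _ (List.mem_cons_of_mem _
        (List.mem_map.mpr ⟨Sum.inr v, Γ.complete _, rfl⟩))

/-- An expansion at a vertex `v` of positive type, after `v` has been brought to the front of the
orientation: `v` is replaced by the new edge, its source, and its target. -/
def expandVertex (Γ : OGraph I J) (v : Γ.V) (γ' : Graph I J (Option Γ.E) (Option Γ.V)) :
    OGraph I J where
  E := Option Γ.E
  V := Option Γ.V
  finE := inferInstance
  finV := inferInstance
  graph := γ'
  word := Sum.inl none :: Sum.inr none :: Sum.inr (some v) ::
    (Γ.word.filter (· ≠ Sum.inr v)).map (Sum.map some some)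
  nodup := by
    have hinj : Function.Injective (Sum.map (some : Γ.E → _) (some : Γ.V → _)) :=
      (Option.some_injective _).sumMap (Option.some_injective _)
    refine List.nodup_cons.mpr ⟨?_, List.nodup_cons.mpr ⟨?_, List.nodup_cons.mpr
      ⟨?_, (Γ.nodup.filter _).map hinj⟩⟩⟩ <;> simp
  complete := by
    rintro ((_ | e) | (_ | w))
    · simp
    · refine List.mem_cons_of_mem _ (List.mem_cons_of_mem _ (List.mem_cons_of_mem _
        (List.mem_map.mpr ⟨Sum.inl e, ?_, rfl⟩)))
      simp [Γ.complete]
    · simp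
    · by_cases h : w = v
      · simp [h]
      · refine List.mem_cons_of_mem _ (List.mem_cons_of_mem _ (List.mem_cons_of_mem _
          (List.mem_map.mpr ⟨Sum.inr w, ?_, rfl⟩)))
        simp [Γ.complete, h]

/-- The sign for bringing the vertex `v` to the front of the orientation. -/
def frontSign (d : ℤ) (Γ : OGraph I J) (v : Γ.V) : ℤˣ :=
  (Γ.graph.letterDeg d (Sum.inr v) *
    ((Γ.word.takeWhile (· ≠ Sum.inr v)).map (Γ.graph.letterDeg d)).sum).negOnePow

/-- The differential of an oriented graph: the sum over all expansions of an edge. -/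
def diff (𝕜 : Type*) [Field 𝕜] (d : ℤ) (Γ : OGraph I J) : DGInf 𝕜 d I J :=
  (∑ᶠ i : I, ∑ᶠ γ' : {γ' // Γ.graph.IsExpansion (Sum.inl i) γ'},
    cls 𝕜 d (Γ.expandInput γ'.1)) +
  ∑ᶠ v : Γ.V, ∑ᶠ γ' : {γ' // Γ.graph.IsExpansion (Sum.inr v) γ'},
    Γ.frontSign d v • cls 𝕜 d (Γ.expandVertex v γ'.1)

/-- The composition of two oriented graphs: the sum over all ways of attaching the edges at the
inputs of `Γ₂` to the corresponding outputs of `Γ₁`. -/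
def glue (𝕜 : Type*) [Field 𝕜] (d : ℤ) (Γ₁ : OGraph I J) (Γ₂ : OGraph J K) : DGInf 𝕜 d I K :=
  ∑ᶠ γ : {γ // Γ₁.graph.IsGluing Γ₂.graph γ}, cls 𝕜 d (Γ₁.join Γ₂ γ.1)

end OGraph

/-! ### PROPs -/

/-- A graded `𝕜`-linear PROP with a derivation `D` of degree `-1`, on the spaces `P m n` of
operations with `m` inputs and `n` outputs; the signs follow the Koszul rule.  The symmetric groups
act through renumbering along bijections `Fin m ≃ Fin m'` (for which `m = m'`), which also serves
to identify `P m n` and `P m' n'` in case `m = m'` and `n = n'`.  The composition `comp a b` is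
`a` followed by `b`. -/
structure DerivProp (𝕜 : Type*) [Field 𝕜] (P : ℕ → ℕ → Type*) [∀ m n, AddCommGroup (P m n)]
    [∀ m n, Module 𝕜 (P m n)] where
  gr : ∀ m n, ℤ → Submodule 𝕜 (P m n)
  act : ∀ {m n m' n' : ℕ}, (Fin m ≃ Fin m') → (Fin n ≃ Fin n') → P m n →ₗ[𝕜] P m' n'
  comp : ∀ {l m n : ℕ}, P l m →ₗ[𝕜] P m n →ₗ[𝕜] P l n
  tens : ∀ {m n m' n' : ℕ}, P m n →ₗ[𝕜] P m' n' →ₗ[𝕜] P (m + m') (n + n')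
  one : ∀ n, P n n
  D : ∀ {m n : ℕ}, P m n →ₗ[𝕜] P m n
  -- grading
  isInternal : ∀ m n, DirectSum.IsInternal (gr m n)
  act_mem : ∀ {m n m' n' : ℕ} (α : Fin m ≃ Fin m') (β : Fin n ≃ Fin n') {p : ℤ} {a : P m n},
    a ∈ gr m n p → act α β a ∈ gr m' n' p
  comp_mem : ∀ {l m n : ℕ} {p q : ℤ} {a : P l m} {b : P m n},
    a ∈ gr l m p → b ∈ gr m n q → comp a b ∈ gr l n (p + q)
  tens_mem : ∀ {m n m' n' : ℕ} {p q : ℤ} {a : P m n} {b : P m' n'},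
    a ∈ gr m n p → b ∈ gr m' n' q → tens a b ∈ gr (m + m') (n + n') (p + q)
  one_mem : ∀ n, one n ∈ gr n n 0
  D_mem : ∀ {m n : ℕ} {p : ℤ} {a : P m n}, a ∈ gr m n p → D a ∈ gr m n (p - 1)
  -- action
  act_refl : ∀ {m n : ℕ} (a : P m n), act (Equiv.refl _) (Equiv.refl _) a = a
  act_act : ∀ {m n m' n' m'' n'' : ℕ} (α : Fin m ≃ Fin m') (β : Fin n ≃ Fin n')
    (α' : Fin m' ≃ Fin m'') (β' : Fin n' ≃ Fin n'') (a : P m n),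
    act α' β' (act α β a) = act (α.trans α') (β.trans β') a
  act_one : ∀ {n n' : ℕ} (α : Fin n ≃ Fin n'), act α α (one n) = one n'
  act_comp : ∀ {l m n l' m' n' : ℕ} (α : Fin l ≃ Fin l') (β : Fin m ≃ Fin m')
    (δ : Fin n ≃ Fin n') (a : P l m) (b : P m n),
    comp (act α β a) (act β δ b) = act α δ (comp a b)
  act_tens : ∀ {m n m' n' p q p' q' : ℕ} (α : Fin m ≃ Fin p) (β : Fin n ≃ Fin q)
    (α' : Fin m' ≃ Fin p') (β' : Fin n' ≃ Fin q') (a : P m n) (b : P m' n'),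
    tens (act α β a) (act α' β' b) =
      act (finSumFinEquiv.symm.trans ((Equiv.sumCongr α α').trans finSumFinEquiv))
        (finSumFinEquiv.symm.trans ((Equiv.sumCongr β β').trans finSumFinEquiv)) (tens a b)
  -- composition
  comp_assoc : ∀ {k l m n : ℕ} (a : P k l) (b : P l m) (c : P m n),
    comp (comp a b) c = comp a (comp b c)
  one_comp : ∀ {m n : ℕ} (a : P m n), comp (one m) a = a
  comp_one : ∀ {m n : ℕ} (a : P m n), comp a (one n) = a
  -- tensor product
  tens_assoc : ∀ {m n m' n' m'' n'' : ℕ} (a : P m n) (b : P m' n') (c : P m'' n''),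
    act (finCongr (Nat.add_assoc m m' m'')) (finCongr (Nat.add_assoc n n' n''))
      (tens (tens a b) c) = tens a (tens b c)
  one_tens : ∀ {m n : ℕ} (a : P m n),
    act (finCongr (Nat.zero_add m)) (finCongr (Nat.zero_add n)) (tens (one 0) a) = a
  tens_one : ∀ {m n : ℕ} (a : P m n),
    act (finCongr (Nat.add_zero m)) (finCongr (Nat.add_zero n)) (tens a (one 0)) = a
  one_tens_one : ∀ m n, tens (one m) (one n) = one (m + n)
  tens_comm : ∀ {m n m' n' : ℕ} {p q : ℤ} {a : P m n} {b : P m' n'},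
    a ∈ gr m n p → b ∈ gr m' n' q →
      act finAddFlip finAddFlip (tens a b) = (p * q).negOnePow • tens b a
  interchange : ∀ {l m n l' m' n' : ℕ} {p q : ℤ} (a : P l m) {b : P l' m'} {c : P m n}
    (e : P m' n'), b ∈ gr l' m' p → c ∈ gr m n q →
      comp (tens a b) (tens c e) = (p * q).negOnePow • tens (comp a c) (comp b e)
  -- derivation
  D_act : ∀ {m n m' n' : ℕ} (α : Fin m ≃ Fin m') (β : Fin n ≃ Fin n') (a : P m n),
    D (act α β a) = act α β (D a)
  D_one : ∀ n, D (one n) = 0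
  D_comp : ∀ {l m n : ℕ} {p : ℤ} {a : P l m} (b : P m n), a ∈ gr l m p →
    D (comp a b) = comp (D a) b + p.negOnePow • comp a (D b)
  D_tens : ∀ {m n m' n' : ℕ} {p : ℤ} {a : P m n} (b : P m' n'), a ∈ gr m n p →
    D (tens a b) = tens (D a) b + p.negOnePow • tens a (D b)

/-- The derivation is a differential, that is, the PROP is a differential graded PROP. -/
def DerivProp.IsDG {𝕜 : Type*} [Field 𝕜] {P : ℕ → ℕ → Type*} [∀ m n, AddCommGroup (P m n)]
    [∀ m n, Module 𝕜 (P m n)] (S : DerivProp 𝕜 P) : Prop :=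
  ∀ {m n : ℕ} (a : P m n), S.D (S.D a) = 0

/-- The maps `f` form a morphism of graded PROPs with derivation. -/
structure IsPropHom {𝕜 : Type*} [Field 𝕜] {P Q : ℕ → ℕ → Type*} [∀ m n, AddCommGroup (P m n)]
    [∀ m n, Module 𝕜 (P m n)] [∀ m n, AddCommGroup (Q m n)] [∀ m n, Module 𝕜 (Q m n)]
    (S : DerivProp 𝕜 P) (T : DerivProp 𝕜 Q) (f : ∀ m n, P m n →ₗ[𝕜] Q m n) : Prop where
  gr : ∀ {m n : ℕ} {p : ℤ} {a : P m n}, a ∈ S.gr m n p → f m n a ∈ T.gr m n p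
  act : ∀ {m n m' n' : ℕ} (α : Fin m ≃ Fin m') (β : Fin n ≃ Fin n') (a : P m n),
    f m' n' (S.act α β a) = T.act α β (f m n a)
  comp : ∀ {l m n : ℕ} (a : P l m) (b : P m n),
    f l n (S.comp a b) = T.comp (f l m a) (f m n b)
  tens : ∀ {m n m' n' : ℕ} (a : P m n) (b : P m' n'),
    f (m + m') (n + n') (S.tens a b) = T.tens (f m n a) (f m' n' b)
  one : ∀ n, f n n (S.one n) = T.one n
  D : ∀ {m n : ℕ} (a : P m n), f m n (S.D a) = T.D (f m n a)

/-- The space of operations with `m` inputs and `n` outputs given by the graphs with vertices of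
type at most `k`. -/
abbrev DGFin (𝕜 : Type*) [Field 𝕜] (d : ℤ) (k : ℕ∞) (m n : ℕ) : Type _ :=
  DG 𝕜 d k (Fin m) (Fin n)

instance (𝕜 : Type*) [Field 𝕜] (d : ℤ) (k : ℕ∞) (m n : ℕ) : AddCommGroup (DGFin 𝕜 d k m n) :=
  Submodule.addCommGroup _

instance (𝕜 : Type*) [Field 𝕜] (d : ℤ) (k : ℕ∞) (m n : ℕ) : Module 𝕜 (DGFin 𝕜 d k m n) :=
  Submodule.module _

/-- The operations of `S` on the spaces of graphs are those given by the graphs: renumbering,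
gluing, disjoint union, vertices without edges, and expansion of edges; the degree is that of
the orientation. -/
structure IsGraphProp {𝕜 : Type*} [Field 𝕜] {d : ℤ} {k : ℕ∞}
    (S : DerivProp 𝕜 (DGFin 𝕜 d k)) : Prop where
  gr : ∀ m n p, S.gr m n p = Submodule.span 𝕜
    {x | ∃ (Γ : OGraph (Fin m) (Fin n)) (h : Γ.TypeLE k),
      Γ.orientationDegree d = p ∧ x = gen 𝕜 d Γ h}
  act : ∀ {m n m' n' : ℕ} (α : Fin m ≃ Fin m') (β : Fin n ≃ Fin n')
    (Γ : OGraph (Fin m) (Fin n)) (h : Γ.TypeLE k),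
    (S.act α β (gen 𝕜 d Γ h) : DGInf 𝕜 d (Fin m') (Fin n')) = cls 𝕜 d (Γ.relabel α β)
  comp : ∀ {l m n : ℕ} (Γ₁ : OGraph (Fin l) (Fin m)) (Γ₂ : OGraph (Fin m) (Fin n))
    (h₁ : Γ₁.TypeLE k) (h₂ : Γ₂.TypeLE k),
    (S.comp (gen 𝕜 d Γ₁ h₁) (gen 𝕜 d Γ₂ h₂) : DGInf 𝕜 d (Fin l) (Fin n)) = Γ₁.glue 𝕜 d Γ₂
  tens : ∀ {m n m' n' : ℕ} (Γ₁ : OGraph (Fin m) (Fin n)) (Γ₂ : OGraph (Fin m') (Fin n'))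
    (h₁ : Γ₁.TypeLE k) (h₂ : Γ₂.TypeLE k),
    (S.tens (gen 𝕜 d Γ₁ h₁) (gen 𝕜 d Γ₂ h₂) : DGInf 𝕜 d (Fin (m + m')) (Fin (n + n'))) =
      cls 𝕜 d (Γ₁.disjUnion Γ₂)
  one : ∀ n, (S.one n : DGInf 𝕜 d (Fin n) (Fin n)) = cls 𝕜 d (OGraph.trivial (Fin n))
  D : ∀ {m n : ℕ} (Γ : OGraph (Fin m) (Fin n)) (h : Γ.TypeLE k),
    (S.D (gen 𝕜 d Γ h) : DGInf 𝕜 d (Fin m) (Fin n)) = Γ.diff 𝕜 d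

/-- The part of degree `p` of `DG 𝕜 d k I J`. -/
def DGdeg (𝕜 : Type*) [Field 𝕜] (d : ℤ) (k : ℕ∞) (I J : Type) (p : ℤ) :
    Submodule 𝕜 (DG 𝕜 d k I J) :=
  Submodule.span 𝕜 {x | ∃ (Γ : OGraph I J) (h : Γ.TypeLE k),
    Γ.graph.degree = p ∧ x = gen 𝕜 d Γ h}

end RibbonProp

end

/-!
A graph of the kind considered is a ribbon surface (`Rib`): a permutation `next` of the half-edges,
whose cycles are the vertices, and the flip `φ`, such that the cycles of `φ * next` are the boundary
components; vertices without edges are recorded by a relation between vertices and boundary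
components.  Types and directions of edges play no role for most of the combinatorics, and without
them vertices and boundary components may be exchanged (`Rib.dual`).

**Gluing.** Attaching the vertices of `γ2` to the boundary components of `γ1` is a statement about
first return maps: `next` of the result induces `next` of `γ1` on the half-edges of `γ1`, and its
boundary walk induces the one of `γ2` on those of `γ2` (`Gl`).  The result is determined by its
cyclic order, and every compatible cyclic order occurs (`Gl.unique`, `Shuffle.exists_gl`).  As first
return maps compose (`Induces.trans`, `Induces.cancel`), gluing is associative (`Gl.assoc`): every
graph with edges in three groups is an iterated gluing in both ways or in neither.  This gives
associativity of the composition (`glueMap_assoc`).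

**Expansion.** Expanding the vertex `u` into an edge is the gluing of the surface `eps u`, which has
this edge only, with the given surface (`IsExp.gl`, `Gl.isExp`).  Hence, by associativity, an
expansion of a gluing of `γ1` and `γ2` is a gluing of a surface `ρ` with `γ2`, where `ρ` is an
expansion of the surface of `γ1` (`IsExpGl`).  There are three cases.
* The source of the new edge has no other half-edge in `ρ`.  Then only edges of `γ2` are attached to
  this vertex: these are the gluings of `γ1` with the expansions of `γ2` at an input or at a vertex
  of positive type (`Graph.exists_expansion_right_iff`).
* An end of the new edge has exactly one other half-edge in `ρ`, of an edge `f` of `γ1`.  Then the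
  new edge and `f` subdivide an edge of `γ1`, at a vertex to which edges of `γ2` are attached.  Such
  a graph occurs twice, for either of the two edges as the new one, with opposite signs
  (`expTerm_swapNew`, `expGlSum_bivalent_add`).
* Otherwise `ρ` is a graph with the required valences: these are the gluings of the expansions of
  `γ1` with `γ2` (`Graph.exists_expansion_left_iff`).

This is the Leibniz rule for the composition (`expMap_glueMap`).

**Disjoint unions.** The disjoint union of `a` and `b` is the composition of `a ⊗ 1` and `1 ⊗ b`
(`glueMap_one_one`), and adding vertices without edges commutes with composition and expansion
(`glueMap_unionMap_one`, `expMap_unionMap_one`).  So the unit laws, the interchange law and the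
Leibniz rule for `⊗` follow from the properties of the composition.

**The square of the differential.** A twofold expansion of `γ` remains one if the names of its two
new edges are exchanged and the vertices are renamed suitably (`Graph.IsExpansion.exists_swap`).
This is an involution without fixed points (`Graph.IsExpansionTwo.map_next_ne`).  If `d` is even or
the characteristic is `2`, then the order of the vertices in an orientation is irrelevant, while the
two new edges have odd degree or signs are irrelevant.  So the terms cancel in pairs
(`wcls_swap_two`, `expMap_expMap`).

**Gradings.** A graph with `e` edges and `v` vertices of positive type has orientation degree
`e (3 - d) + v (d - 4)` (`wordDeg_eq`), and `3 e - 4 v` minus the number of inputs with edges is its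
degree (`Graph.degree_eq`).  Both are invariant under isomorphisms, so that the space of graphs is
the direct sum of the parts of each degree (`isInternal_span`).  Non-negativity holds vertex by
vertex.  Gluings keep the types of the vertices, and for `k ≥ 1` the expansions of vertices of type
at most `k` have type at most `k` (`Graph.IsExpansion.type_le`), so that all operations restrict to
the subspaces.
-/

noncomputable section

open scoped Classical

open Equiv

open Sum (inl inr)

set_option linter.unusedSectionVars false

namespace RibbonProp

/-! ### Induced permutations -/

section Perm

variable {X Y Z : Type}

theorem firstReturn_iff {τ : Perm Y} {s : Set Y} {y z : Y} :
    FirstReturn τ s y z ↔ (τ y = z ∧ z ∈ s) ∨ (τ y ∉ s ∧ FirstReturn τ s (τ y) z) := by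
  constructor
  · rintro ⟨k, hk, e, hz, hl⟩
    obtain _ | _ | k := k
    · exact absurd hk (lt_irrefl _)
    · exact Or.inl ⟨by simpa using e, hz⟩
    · refine Or.inr ⟨by simpa using hl 1 one_pos (by omega), k + 1, by omega, ?_, hz, ?_⟩
      · rw [← e, pow_succ τ (k + 1), Perm.mul_apply]
      · intro l h0 h1
        rw [← Perm.mul_apply, ← pow_succ]
        exact hl _ (by omega) (by omega)
  · rintro (⟨h, hz⟩ | ⟨h, k, hk, e, hz, hl⟩)
    · exact ⟨1, one_pos, by simpa using h, hz, fun l h0 h1 => by omega⟩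
    · refine ⟨k + 1, by omega, by rw [pow_succ, Perm.mul_apply, e], hz, ?_⟩
      rintro (_ | _ | l) h0 h1
      · exact absurd h0 (lt_irrefl _)
      · simpa using h
      · rw [pow_succ, Perm.mul_apply]
        exact hl _ (by omega) (by omega)

theorem FirstReturn.mem {τ : Perm Y} {s : Set Y} {y z : Y} (h : FirstReturn τ s y z) : z ∈ s := by
  obtain ⟨k, _, _, hz, _⟩ := h
  exact hz

theorem FirstReturn.sameCycle {τ : Perm Y} {s : Set Y} {y z : Y}
    (h : FirstReturn τ s y z) : τ.SameCycle y z := by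
  obtain ⟨k, _, rfl, _, _⟩ := h
  exact ⟨k, rfl⟩

theorem FirstReturn.of_apply {τ : Perm Y} {s : Set Y} {y z : Y} (h : τ y = z)
    (hz : z ∈ s) : FirstReturn τ s y z := firstReturn_iff.mpr (Or.inl ⟨h, hz⟩)

theorem FirstReturn.of_apply_notMem {τ : Perm Y} {s : Set Y} {y z : Y} (h : τ y ∉ s)
    (hz : FirstReturn τ s (τ y) z) : FirstReturn τ s y z := firstReturn_iff.mpr (Or.inr ⟨h, hz⟩)

/-- Induction along the path from a point to its first return. -/
theorem FirstReturn.path_induction {τ : Perm Y} {s : Set Y} {z : Y} {motive : Y → Prop}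
    (base : z ∈ s → ∀ y, τ y = z → motive y)
    (step : ∀ y, τ y ∉ s → FirstReturn τ s (τ y) z → motive (τ y) → motive y)
    {y : Y} (h : FirstReturn τ s y z) : motive y := by
  obtain ⟨k, hk⟩ := h
  induction k generalizing y with
  | zero => exact absurd hk.1 (lt_irrefl _)
  | succ k ih =>
    obtain ⟨h0, e, hz, hl⟩ := hk
    obtain _ | k := k
    · exact base hz y (by simpa using e)
    · have h1 : τ y ∉ s := by simpa using hl 1 one_pos (by omega)
      have h2 : 0 < k + 1 ∧ (τ ^ (k + 1)) (τ y) = z ∧ z ∈ s ∧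
          ∀ l : ℕ, 0 < l → l < k + 1 → (τ ^ l) (τ y) ∉ s := by
        refine ⟨by omega, ?_, hz, ?_⟩
        · rw [← e, pow_succ τ (k + 1), Perm.mul_apply]
        · intro l h0 h1
          rw [← Perm.mul_apply, ← pow_succ]
          exact hl _ (by omega) (by omega)
      exact step y h1 ⟨_, h2⟩ (ih h2)

theorem FirstReturn.unique {τ : Perm Y} {s : Set Y} {y z z' : Y}
    (h : FirstReturn τ s y z) (h' : FirstReturn τ s y z') : z = z' := by
  revert h'
  refine h.path_induction (motive := fun y => FirstReturn τ s y z' → z = z')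
    (fun hz y hy h' => ?_) (fun y hy _ ih h' => ?_)
  · rcases firstReturn_iff.mp h' with h' | h'
    · exact hy.symm.trans h'.1
    · exact absurd (hy ▸ hz) h'.1
  · rcases firstReturn_iff.mp h' with h' | h'
    · exact absurd (h'.1.symm ▸ h'.2) hy
    · exact ih h'.2

theorem FirstReturn.mono {τ : Perm Y} {s t : Set Y} {y z : Y} (h : FirstReturn τ s y z)
    (hts : t ⊆ s) (hz : z ∈ t) : FirstReturn τ t y z :=
  h.path_induction (motive := fun y => FirstReturn τ t y z) (fun _ _ e => .of_apply e hz)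
    (fun _ hy _ ih => .of_apply_notMem (fun h => hy (hts h)) ih)

theorem FirstReturn.trans {τ : Perm Y} {s t : Set Y} {y w z : Y}
    (h : FirstReturn τ s y w) (hts : t ⊆ s) (hw : w ∉ t) (h' : FirstReturn τ t w z) :
    FirstReturn τ t y z :=
  h.path_induction (motive := fun y => FirstReturn τ t y z)
    (fun _ y e => .of_apply_notMem (by rwa [e]) (by rwa [e]))
    (fun _ hy _ ih => .of_apply_notMem (fun h => hy (hts h)) ih)

theorem exists_firstReturn [Finite Y] (τ : Perm Y) {s : Set Y} {y : Y} (hy : y ∈ s) :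
    ∃ z, FirstReturn τ s y z := by
  have hex : ∃ k, 0 < k ∧ (τ ^ k) y ∈ s :=
    ⟨orderOf τ, orderOf_pos τ, by rw [pow_orderOf_eq_one]; exact hy⟩
  refine ⟨_, Nat.find hex, (Nat.find_spec hex).1, rfl, (Nat.find_spec hex).2, ?_⟩
  intro l h0 h1 h2
  exact Nat.find_min hex h1 ⟨h0, h2⟩

theorem FirstReturn.left_unique {τ : Perm Y} {s : Set Y} {y y' z : Y}
    (h : FirstReturn τ s y z) (h' : FirstReturn τ s y' z) (hy : y ∈ s) (hy' : y' ∈ s) :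
    y = y' := by
  obtain ⟨k, hk, e, hz, hl⟩ := h
  obtain ⟨k', hk', e', hz', hl'⟩ := h'
  have key : ∀ {k k' : ℕ} {y y' : Y}, k ≤ k' → 0 < k → y ∈ s → (τ ^ k) y = z →
      (τ ^ k') y' = z → (∀ l : ℕ, 0 < l → l < k' → (τ ^ l) y' ∉ s) → y = y' := by
    intro k k' y y' hkk hk hy e e' hl
    have h1 : (τ ^ (k' - k)) y' = y := by
      apply (τ ^ k).injective
      rw [e, ← Perm.mul_apply, ← pow_add, Nat.add_sub_cancel' hkk, e']
    rcases Nat.eq_zero_or_pos (k' - k) with h0 | h0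
    · rw [h0] at h1; exact h1.symm
    · exact absurd (h1 ▸ hy) (hl _ h0 (by omega))
  rcases le_total k k' with hkk | hkk
  · exact key hkk hk hy e e' hl'
  · exact (key hkk hk' hy' e' e hl).symm

/-- `ρ` is the permutation induced by `σ` along the embedding `ι`: it sends a point to the next
point of the image of `ι` on its `σ`-cycle. -/
def Induces (ι : X → Y) (σ : Perm Y) (ρ : Perm X) : Prop :=
  ∀ x, FirstReturn σ (Set.range ι) (ι x) (ι (ρ x))

theorem induces_iff_of_surjective {ι : X → Y} (hs : Function.Surjective ι) {σ : Perm Y}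
    {ρ : Perm X} : Induces ι σ ρ ↔ ∀ x, σ (ι x) = ι (ρ x) := by
  refine forall_congr' fun x => ⟨fun h => ?_, fun h => .of_apply h ⟨_, rfl⟩⟩
  rcases firstReturn_iff.mp h with h | h
  · exact h.1
  · exact absurd (hs _) h.1

theorem Induces.unique {ι : X → Y} (hι : Function.Injective ι) {σ : Perm Y}
    {ρ ρ' : Perm X} (h : Induces ι σ ρ) (h' : Induces ι σ ρ') : ρ = ρ' :=
  Equiv.ext fun x => hι ((h x).unique (h' x))

theorem exists_induces [Finite Y] {ι : X → Y} (hι : Function.Injective ι) (σ : Perm Y) :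
    ∃ ρ, Induces ι σ ρ := by
  have h1 : ∀ x, ∃ x', FirstReturn σ (Set.range ι) (ι x) (ι x') := fun x => by
    obtain ⟨z, hz⟩ := exists_firstReturn σ (s := Set.range ι) ⟨x, rfl⟩
    obtain ⟨x', rfl⟩ := hz.mem
    exact ⟨x', hz⟩
  choose f hf using h1
  have hinj : Function.Injective f := fun x x' h =>
    hι ((hf x).left_unique (h ▸ hf x') ⟨x, rfl⟩ ⟨x', rfl⟩)
  have : Finite X := Finite.of_injective ι hι
  exact ⟨ofBijective f (Finite.injective_iff_bijective.mp hinj), hf⟩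

theorem Induces.firstReturn {ι : X → Y} {κ : Z → X} (hι : Function.Injective ι)
    {σ : Perm Y} {ρ : Perm X}
    (h : Induces ι σ ρ) {x z : X} (h' : FirstReturn ρ (Set.range κ) x z) :
    FirstReturn σ (Set.range (ι ∘ κ)) (ι x) (ι z) := by
  have hsub : Set.range (ι ∘ κ) ⊆ Set.range ι := Set.range_comp_subset_range κ ι
  have hmem : ∀ w, ι w ∈ Set.range (ι ∘ κ) ↔ w ∈ Set.range κ := by
    intro w
    constructor
    · rintro ⟨c, hc⟩
      exact ⟨c, hι hc⟩
    · rintro ⟨c, rfl⟩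
      exact ⟨c, rfl⟩
  refine h'.path_induction (motive := fun x => FirstReturn σ (Set.range (ι ∘ κ)) (ι x) (ι z))
    (fun hz y e => ?_) (fun y hy _ ih => ?_)
  · have := h y
    rw [e] at this
    exact this.mono hsub ((hmem _).mpr hz)
  · exact (h y).trans hsub (fun hh => hy ((hmem _).mp hh)) ih

theorem Induces.trans {ι : X → Y} {κ : Z → X} (hι : Function.Injective ι) {σ : Perm Y}
    {ρ : Perm X} {τ : Perm Z} (h : Induces ι σ ρ) (h' : Induces κ ρ τ) :
    Induces (ι ∘ κ) σ τ := fun z => h.firstReturn hι (h' z)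

/-- If the first return map of `σ` to a subset is `ρ`, then the first return maps of `σ` to smaller
subsets are those of `ρ`. -/
theorem Induces.cancel [Finite X] {ι : X → Y} {κ : Z → X} (hι : Function.Injective ι)
    {σ : Perm Y} {ρ : Perm X} {τ : Perm Z} (h : Induces ι σ ρ)
    (h' : Induces (ι ∘ κ) σ τ) : Induces κ ρ τ := by
  intro z
  obtain ⟨w, hw⟩ := exists_firstReturn ρ (s := Set.range κ) (y := κ z) ⟨z, rfl⟩
  rwa [← hι ((h.firstReturn hι hw).unique (h' z))]

/-- Multiplication by a permutation that only moves points of the image of `ι`. -/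
theorem Induces.mul {ι : X → Y} {σ : Perm Y} {ρ : Perm X} (h : Induces ι σ ρ)
    {f : Perm Y} {g : Perm X} (hfg : ∀ x, f (ι x) = ι (g x))
    (hf : ∀ y, y ∉ Set.range ι → f y = y) : Induces ι (f * σ) (g * ρ) := by
  intro x
  refine (h x).path_induction
    (motive := fun y => FirstReturn (f * σ) (Set.range ι) y (ι ((g * ρ) x)))
    (fun _ y e => ?_) (fun y hy _ ih => ?_)
  · exact .of_apply (by rw [Perm.mul_apply, e, hfg]; rfl) ⟨_, rfl⟩
  · have : (f * σ) y = σ y := by rw [Perm.mul_apply, hf _ hy]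
    exact .of_apply_notMem (by rwa [this]) (by rwa [this])

theorem _root_.Equiv.Perm.SameCycle.eq_of_invariant {σ : Perm Y} {y y' : Y}
    (h : σ.SameCycle y y') {f : Y → Z} (hf : ∀ y, f (σ y) = f y) : f y = f y' := by
  obtain ⟨n, rfl⟩ := h
  have hf' : ∀ y, f (σ⁻¹ y) = f y := fun y => by rw [← hf (σ⁻¹ y)]; simp
  induction n with
  | zero => rfl
  | succ n ih => rw [add_comm, zpow_add, zpow_one, Perm.mul_apply, hf, ih]
  | pred n ih => rw [sub_eq_add_neg, add_comm, zpow_add, zpow_neg_one, Perm.mul_apply, hf', ih]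

/-- Two permutations that agree on a cycle of one of them have this cycle in common. -/
theorem sameCycle_iff_of_agree {σ τ : Perm Y} {a : Y}
    (h : ∀ y, σ.SameCycle a y → τ y = σ y) (b : Y) : τ.SameCycle a b ↔ σ.SameCycle a b := by
  have key : ∀ n : ℤ, (τ ^ n) a = (σ ^ n) a := by
    intro n
    induction n with
    | zero => rfl
    | succ n ih =>
      rw [add_comm, zpow_add, zpow_add, zpow_one, zpow_one, Perm.mul_apply, Perm.mul_apply, ih]
      exact h _ ⟨n, rfl⟩
    | pred n ih =>
      rw [sub_eq_add_neg, add_comm, zpow_add, zpow_neg_one, Perm.mul_apply, ih,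
        Perm.inv_eq_iff_eq, h _ ⟨_, rfl⟩, zpow_add, zpow_neg_one, Perm.mul_apply]
      simp
  exact exists_congr fun n => by rw [key]

/-- The cycles of an induced permutation are the traces of the cycles. -/
theorem Induces.sameCycle_iff [Finite Y] {ι : X → Y} (hι : Function.Injective ι)
    {σ : Perm Y} {ρ : Perm X} (h : Induces ι σ ρ) (x x' : X) :
    ρ.SameCycle x x' ↔ σ.SameCycle (ι x) (ι x') := by
  have : Finite X := Finite.of_injective ι hι
  constructor
  · intro hx
    obtain ⟨n, rfl⟩ := hx.exists_nat_pow_eq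
    induction n with
    | zero => exact .refl _ _
    | succ n ih =>
      rw [pow_succ', Perm.mul_apply]
      exact (ih ⟨n, rfl⟩).trans (h _).sameCycle
  · intro hx
    obtain ⟨n, hn⟩ := hx.exists_nat_pow_eq
    induction n using Nat.strong_induction_on generalizing x with
    | _ n ih =>
      rcases Nat.eq_zero_or_pos n with rfl | h0
      · exact hι hn ▸ .refl _ _
      · obtain ⟨k, hk, e, hz, hl⟩ := h x
        rcases le_or_gt k n with hkn | hkn
        · have h1 : (σ ^ (n - k)) (ι (ρ x)) = ι x' := by
            rw [← e, ← Perm.mul_apply, ← pow_add, Nat.sub_add_cancel hkn, hn]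
          exact Perm.sameCycle_apply_left.mp (ih _ (by omega) _ ⟨(n - k : ℕ), h1⟩ h1)
        · exact absurd ⟨x', hn.symm⟩ (hl n h0 hkn)

/-- The permutation of `Y` which is `σ` on the image of the embedding `ι` and fixes all other
points. -/
def extendPerm (ι : X → Y) (σ : Perm X) : Perm Y :=
  if h : Function.Injective ι then σ.viaEmbedding ⟨ι, h⟩ else 1

theorem extendPerm_apply {ι : X → Y} (hι : Function.Injective ι) (σ : Perm X) (x : X) :
    extendPerm ι σ (ι x) = ι (σ x) := by
  rw [extendPerm, dif_pos hι]
  exact σ.viaEmbedding_apply ⟨ι, hι⟩ x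

theorem extendPerm_of_notMem (ι : X → Y) (σ : Perm X) {y : Y} (hy : y ∉ Set.range ι) :
    extendPerm ι σ y = y := by
  rw [extendPerm]
  split_ifs with h
  · exact σ.viaEmbedding_apply_of_notMem ⟨ι, h⟩ y hy
  · rfl

/-- The permutation induced on two points exchanges them if they are in one cycle. -/
theorem induces_not_iff [Finite Y] {ι : Bool → Y} (hι : Function.Injective ι)
    {σ : Perm Y} : Induces ι σ boolNot ↔ σ.SameCycle (ι true) (ι false) := by
  constructor
  · intro h
    rw [← h.sameCycle_iff hι]
    exact ⟨1, rfl⟩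
  · intro h
    obtain ⟨ρ, hρ⟩ := exists_induces hι σ
    rw [← hρ.sameCycle_iff hι] at h
    have h1 : ρ true = false := by
      by_contra hne
      have : ρ true = true := by simpa using hne
      exact absurd (h.eq_of_left this) (by decide)
    have : ρ = boolNot := by
      ext b
      cases b
      · cases hb : ρ false
        · exact absurd (ρ.injective (h1.trans hb.symm)) (by decide)
        · rfl
      · rw [h1]; rfl
    exact this ▸ hρ

/-- The permutation induced on two points is trivial if they are in different cycles. -/
theorem induces_one_iff [Finite Y] {ι : Bool → Y} (hι : Function.Injective ι)
    {σ : Perm Y} : Induces ι σ 1 ↔ ¬ σ.SameCycle (ι true) (ι false) := by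
  constructor
  · intro h
    rw [← h.sameCycle_iff hι]
    simp
  · intro h
    obtain ⟨ρ, hρ⟩ := exists_induces hι σ
    rw [← hρ.sameCycle_iff hι] at h
    have h1 : ρ true = true := by
      by_contra hne
      exact h ⟨1, by simpa using hne⟩
    have : ρ = 1 := by
      ext b
      cases b
      · cases hb : ρ false
        · rfl
        · exact absurd (ρ.injective (h1.trans hb.symm)) (by decide)
      · rw [h1]; rfl
    exact this ▸ hρ

end Perm

/-! ### Ribbon surfaces with labelled vertices and boundary components, and their gluing -/

section Perm

variable {X Y : Type}

theorem extendPerm_inv_mul (ι : X → Y) (φ : Perm X) (σ : Perm Y) :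
    extendPerm ι φ⁻¹ * (extendPerm ι φ * σ) = σ := by
  ext y
  simp only [Perm.mul_apply]
  by_cases hι : Function.Injective ι
  · by_cases h : σ y ∈ Set.range ι
    · obtain ⟨x, hx⟩ := h
      rw [← hx, extendPerm_apply hι, extendPerm_apply hι]
      simp
    · rw [extendPerm_of_notMem ι φ h, extendPerm_of_notMem ι _ h]
  · simp [extendPerm, hι]

/-- Multiplying by a permutation supported on the image of `ι` does not affect the cycles that
avoid this image. -/
theorem sameCycle_extendPerm_mul {ι : X → Y} (φ : Perm X) {σ : Perm Y} {a : Y}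
    (h : ∀ x, ¬ σ.SameCycle a (ι x)) (b : Y) :
    (extendPerm ι φ * σ).SameCycle a b ↔ σ.SameCycle a b := by
  refine sameCycle_iff_of_agree (fun y hy => ?_) b
  refine extendPerm_of_notMem ι φ ?_
  rintro ⟨x, hx⟩
  exact h x (hx ▸ Perm.sameCycle_apply_right.mpr hy)

theorem exists_sameCycle_of_extendPerm_mul {ι : X → Y} {φ : Perm X} {σ : Perm Y}
    {a : Y} {x : X} (h : (extendPerm ι φ * σ).SameCycle a (ι x)) :
    ∃ x', σ.SameCycle a (ι x') := by
  by_contra hne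
  push Not at hne
  exact hne x ((sameCycle_extendPerm_mul φ hne _).mp h)

theorem exists_extendPerm_mul_sameCycle {ι : X → Y} (φ : Perm X) {σ : Perm Y}
    {a : Y} {x : X} (h : σ.SameCycle a (ι x)) :
    ∃ x', (extendPerm ι φ * σ).SameCycle a (ι x') := by
  rw [← extendPerm_inv_mul ι φ σ] at h
  exact exists_sameCycle_of_extendPerm_mul h

end Perm

/-- A set `H` of half-edges with flip `φ` is split into two parts, both closed under `φ`. -/
structure Split {H1 H2 H : Type} (i1 : H1 → H) (i2 : H2 → H) (φ1 : Perm H1)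
    (φ2 : Perm H2) (φ : Perm H) : Prop where
  inj1 : Function.Injective i1
  inj2 : Function.Injective i2
  ne : ∀ h x, i1 h ≠ i2 x
  cover : ∀ y, (∃ h, i1 h = y) ∨ ∃ x, i2 x = y
  map1 : ∀ h, φ (i1 h) = i1 (φ1 h)
  map2 : ∀ x, φ (i2 x) = i2 (φ2 x)

/-- A ribbon surface in which all vertices are labelled by `P` and all boundary components by `J`.
Neither directions of edges nor conditions on the vertices are recorded.  The relation `T p j`
says that `p` is a vertex without edges and `j` the boundary component around it. -/
@[ext]
structure Rib (P J : Type) {H : Type} (φ : Perm H) where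
  vtx : H → P
  next : Perm H
  out : H → J
  T : P → J → Prop
  sameCycle_next : ∀ h h', next.SameCycle h h' ↔ vtx h = vtx h'
  sameCycle_walk : ∀ h h', (φ * next).SameCycle h h' ↔ out h = out h'
  T_left : ∀ p, (∃ j, T p j) ↔ ∀ h, vtx h ≠ p
  T_right : ∀ j, (∃ p, T p j) ↔ ∀ h, out h ≠ j
  T_fun : ∀ p j j', T p j → T p j' → j = j'
  T_inj : ∀ p p' j, T p j → T p' j → p = p'

section Glue

variable {P J K H1 H2 H : Type} {φ1 : Perm H1} {φ2 : Perm H2} {φ : Perm H}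
  {i1 : H1 → H} {i2 : H2 → H} {γ1 : Rib P J φ1} {γ2 : Rib J K φ2} {γ : Rib P K φ}

namespace Rib

/-- The boundary walk. -/
def walk (γ : Rib P K φ) : Perm H := φ * γ.next

/-- The dual surface, in which vertices and boundary components are exchanged. -/
def dual (γ : Rib P K φ) : Rib K P φ⁻¹ where
  vtx := γ.out
  next := φ * γ.next
  out := γ.vtx
  T j p := γ.T p j
  sameCycle_next := γ.sameCycle_walk
  sameCycle_walk h h' := by rw [inv_mul_cancel_left]; exact γ.sameCycle_next h h'
  T_left := γ.T_right
  T_right := γ.T_left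
  T_fun p j j' := γ.T_inj j j' p
  T_inj p p' j := γ.T_fun j p p'

end Rib

theorem Rib.dual_dual (γ : Rib P K φ) : (γ.dual.dual : Rib P K φ) = γ :=
  Rib.ext rfl (inv_mul_cancel_left φ γ.next) rfl rfl

theorem Split.dual (S : Split i1 i2 φ1 φ2 φ) : Split i2 i1 φ2⁻¹ φ1⁻¹ φ⁻¹ where
  inj1 := S.inj2
  inj2 := S.inj1
  ne h x hh := S.ne _ _ hh.symm
  cover y := (S.cover y).symm
  map1 x := by rw [Perm.inv_eq_iff_eq, S.map2]; simp
  map2 x := by rw [Perm.inv_eq_iff_eq, S.map1]; simp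

theorem Split.notMem2 (S : Split i1 i2 φ1 φ2 φ) (h : H1) : i1 h ∉ Set.range i2 := by
  rintro ⟨x, hx⟩
  exact S.ne _ _ hx.symm

theorem Split.notMem1 (S : Split i1 i2 φ1 φ2 φ) (x : H2) : i2 x ∉ Set.range i1 := by
  rintro ⟨h, hx⟩
  exact S.ne _ _ hx

theorem Split.extendPerm_mul (S : Split i1 i2 φ1 φ2 φ) (N : Perm H) :
    extendPerm i2 φ2⁻¹ * (φ * N) = extendPerm i1 φ1 * N := by
  ext y
  simp only [Perm.mul_apply]
  rcases S.cover (N y) with ⟨h, e⟩ | ⟨x, e⟩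
  · rw [← e, S.map1, extendPerm_apply S.inj1, extendPerm_of_notMem _ _ (S.notMem2 _)]
  · rw [← e, S.map2, extendPerm_apply S.inj2, extendPerm_of_notMem _ _ (S.notMem1 _)]
    simp

theorem Split.extendPerm_mul' (S : Split i1 i2 φ1 φ2 φ) (N : Perm H) :
    extendPerm i2 φ2 * (extendPerm i1 φ1 * N) = φ * N := by
  rw [← S.extendPerm_mul]
  simpa using extendPerm_inv_mul i2 φ2⁻¹ (φ * N)

/-- The permutation `N` of the half-edges is a possible cyclic ordering for a gluing of `γ1` and
`γ2`: deleting the edges of `γ2` from the surface leaves `γ1`, contracting the edges of `γ1`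
leaves `γ2`, and the boundary components of `γ1` are glued to the vertices of `γ2` with the same
label. -/
structure Shuffle (i1 : H1 → H) (i2 : H2 → H) (φ : Perm H) (γ1 : Rib P J φ1)
    (γ2 : Rib J K φ2) (N : Perm H) : Prop where
  ind1 : Induces i1 N γ1.next
  ind2 : Induces i2 (φ * N) γ2.walk
  glue : ∀ h x, (extendPerm i1 φ1 * N).SameCycle (i1 h) (i2 x) ↔ γ1.out h = γ2.vtx x

/-- `γ` is a gluing of the boundary components of `γ1` to the vertices of `γ2` with the same
label. -/
structure Gl (i1 : H1 → H) (i2 : H2 → H) (γ1 : Rib P J φ1) (γ2 : Rib J K φ2)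
    (γ : Rib P K φ) : Prop extends Shuffle i1 i2 φ γ1 γ2 γ.next where
  vtx1 : ∀ h, γ.vtx (i1 h) = γ1.vtx h
  out2 : ∀ x, γ.out (i2 x) = γ2.out x
  vtx2 : ∀ x p, γ1.T p (γ2.vtx x) → γ.vtx (i2 x) = p
  out1 : ∀ h k, γ2.T (γ1.out h) k → γ.out (i1 h) = k
  T_iff : ∀ p k, γ.T p k ↔ ∃ j, γ1.T p j ∧ γ2.T j k

namespace Shuffle

variable {N : Perm H}

theorem induces_left (S : Split i1 i2 φ1 φ2 φ) (h : Shuffle i1 i2 φ γ1 γ2 N) :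
    Induces i1 (extendPerm i1 φ1 * N) γ1.walk :=
  h.ind1.mul (extendPerm_apply S.inj1 _) (fun _ => extendPerm_of_notMem _ _)

theorem induces_right (S : Split i1 i2 φ1 φ2 φ) (h : Shuffle i1 i2 φ γ1 γ2 N) :
    Induces i2 (extendPerm i1 φ1 * N) γ2.next := by
  have := h.ind2.mul (extendPerm_apply S.inj2 φ2⁻¹) (fun _ => extendPerm_of_notMem _ _)
  rwa [S.extendPerm_mul, Rib.walk, inv_mul_cancel_left] at this

/-- Duality exchanges the roles of the two surfaces. -/
theorem dual (S : Split i1 i2 φ1 φ2 φ) (h : Shuffle i1 i2 φ γ1 γ2 N) :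
    Shuffle i2 i1 φ⁻¹ γ2.dual γ1.dual (φ * N) where
  ind1 := h.ind2
  ind2 := by
    rw [Rib.walk, Rib.dual, inv_mul_cancel_left, inv_mul_cancel_left]
    exact h.ind1
  glue x y := by
    rw [S.extendPerm_mul, Perm.sameCycle_comm, h.glue]
    exact eq_comm

/-- The cycles of the half-edges attached to a vertex without edges of `γ1` have only half-edges
of `γ2`. -/
theorem not_sameCycle_of_T (h : Shuffle i1 i2 φ γ1 γ2 N) {p : P} {x : H2}
    (hp : γ1.T p (γ2.vtx x)) (y : H1) :
    ¬ (extendPerm i1 φ1 * N).SameCycle (i2 x) (i1 y) := by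
  rw [Perm.sameCycle_comm, h.glue]
  exact (γ1.T_right _).mp ⟨p, hp⟩ y

theorem sameCycle_iff_of_T (h : Shuffle i1 i2 φ γ1 γ2 N) {p : P}
    {x : H2} (hp : γ1.T p (γ2.vtx x)) (y : H) :
    N.SameCycle (i2 x) y ↔ (extendPerm i1 φ1 * N).SameCycle (i2 x) y := by
  conv_lhs => rw [← extendPerm_inv_mul i1 φ1 N]
  exact sameCycle_extendPerm_mul _ (h.not_sameCycle_of_T hp) y

theorem exists_sameCycle_of_eq (h : Shuffle i1 i2 φ γ1 γ2 N)
    {y : H1} {x : H2} (hxy : γ1.out y = γ2.vtx x) : ∃ y', N.SameCycle (i2 x) (i1 y') := by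
  rw [← h.glue, Perm.sameCycle_comm] at hxy
  exact exists_sameCycle_of_extendPerm_mul hxy

/-- Every half-edge of `γ2` is attached to a vertex without edges of `γ1`, or to a corner of
`γ1`. -/
theorem attached (h : Shuffle i1 i2 φ γ1 γ2 N) (x : H2) :
    (∃ p, γ1.T p (γ2.vtx x)) ∨ ∃ y, N.SameCycle (i2 x) (i1 y) := by
  by_cases hp : ∃ p, γ1.T p (γ2.vtx x)
  · exact Or.inl hp
  · rw [γ1.T_right] at hp
    push Not at hp
    obtain ⟨y, hy⟩ := hp
    exact Or.inr (h.exists_sameCycle_of_eq hy)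

/-- The vertices of a gluing. -/
theorem exists_vtx [Finite H] (S : Split i1 i2 φ1 φ2 φ) (h : Shuffle i1 i2 φ γ1 γ2 N) :
    ∃ vtx : H → P, (∀ y, vtx (i1 y) = γ1.vtx y) ∧ (∀ x p, γ1.T p (γ2.vtx x) → vtx (i2 x) = p) ∧
      ∀ y y', N.SameCycle y y' ↔ vtx y = vtx y' := by
  let lab (y : H) (p : P) : Prop := (∃ z, N.SameCycle y (i1 z) ∧ γ1.vtx z = p) ∨
    ∃ x, N.SameCycle y (i2 x) ∧ γ1.T p (γ2.vtx x)
  have hex : ∀ y, ∃ p, lab y p := by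
    intro y
    rcases S.cover y with ⟨z, rfl⟩ | ⟨x, rfl⟩
    · exact ⟨_, Or.inl ⟨z, .refl _ _, rfl⟩⟩
    · rcases h.attached x with ⟨p, hp⟩ | ⟨z, hz⟩
      · exact ⟨p, Or.inr ⟨x, .refl _ _, hp⟩⟩
      · exact ⟨_, Or.inl ⟨z, hz, rfl⟩⟩
  have hmix : ∀ z x p, γ1.T p (γ2.vtx x) → ¬ N.SameCycle (i1 z) (i2 x) := by
    intro z x p hp hh
    exact h.not_sameCycle_of_T hp z ((h.sameCycle_iff_of_T hp _).mp hh.symm)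
  have hlab : ∀ y y' p p', lab y p → lab y' p' → (N.SameCycle y y' ↔ p = p') := by
    rintro y y' p p' (⟨z, hz, rfl⟩ | ⟨x, hx, hp⟩) (⟨z', hz', rfl⟩ | ⟨x', hx', hp'⟩)
    · rw [← γ1.sameCycle_next, h.ind1.sameCycle_iff S.inj1]
      exact ⟨fun e => (hz.symm.trans e).trans hz', fun e => (hz.trans e).trans hz'.symm⟩
    · refine iff_of_false (fun e => hmix _ _ _ hp' ((hz.symm.trans e).trans hx')) (fun e => ?_)
      exact (γ1.T_left p').mp ⟨_, hp'⟩ z e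
    · refine iff_of_false (fun e => hmix _ _ _ hp ((hz'.symm.trans e.symm).trans hx))
        (fun e => ?_)
      exact (γ1.T_left p).mp ⟨_, hp⟩ z' e.symm
    · have h1 : N.SameCycle (i2 x) (i2 x') ↔ p = p' := by
        rw [h.sameCycle_iff_of_T hp, ← (h.induces_right S).sameCycle_iff S.inj2,
          γ2.sameCycle_next]
        constructor
        · intro e
          exact γ1.T_inj _ _ _ (e ▸ hp) hp'
        · rintro rfl
          exact γ1.T_fun _ _ _ hp hp'
      rw [← h1]
      exact ⟨fun e => (hx.symm.trans e).trans hx', fun e => (hx.trans e).trans hx'.symm⟩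
  choose vtx hvtx using hex
  refine ⟨vtx, fun y => ?_, fun x p hp => ?_, fun y y' => hlab _ _ _ _ (hvtx y) (hvtx y')⟩
  · exact (hlab _ _ _ _ (hvtx _) (Or.inl ⟨y, .refl _ _, rfl⟩)).mp (.refl _ _)
  · exact (hlab _ _ _ _ (hvtx _) (Or.inr ⟨x, .refl _ _, hp⟩)).mp (.refl _ _)

/-- The vertices without edges of a gluing. -/
theorem T_left_of_vtx (S : Split i1 i2 φ1 φ2 φ) (h : Shuffle i1 i2 φ γ1 γ2 N) {vtx : H → P}
    (h1 : ∀ y, vtx (i1 y) = γ1.vtx y) (h2 : ∀ x p, γ1.T p (γ2.vtx x) → vtx (i2 x) = p)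
    (hN : ∀ y y', N.SameCycle y y' ↔ vtx y = vtx y') (p : P) :
    (∃ k, ∃ j, γ1.T p j ∧ γ2.T j k) ↔ ∀ y, vtx y ≠ p := by
  constructor
  · rintro ⟨k, j, hj, hk⟩ y rfl
    have hv := (γ1.T_left _).mp ⟨_, hj⟩
    rcases S.cover y with ⟨z, rfl⟩ | ⟨x, rfl⟩
    · exact hv z (h1 z).symm
    · rcases h.attached x with ⟨p, hp⟩ | ⟨z, hz⟩
      · rw [h2 x p hp] at hj
        exact (γ2.T_left j).mp ⟨k, hk⟩ x (γ1.T_fun _ _ _ hp hj)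
      · rw [hN, h1] at hz
        exact hv z hz.symm
  · intro hp
    obtain ⟨j, hj⟩ := (γ1.T_left p).mpr fun y hy => hp (i1 y) (by rw [h1, hy])
    obtain ⟨k, hk⟩ := (γ2.T_left j).mpr fun x hx => hp (i2 x) (h2 x p (hx ▸ hj))
    exact ⟨k, j, hj, hk⟩

/-- The cyclic ordering determines a gluing, and every possible one occurs. -/
theorem exists_gl [Finite H] (S : Split i1 i2 φ1 φ2 φ) (h : Shuffle i1 i2 φ γ1 γ2 N) :
    ∃ γ : Rib P K φ, γ.next = N ∧ Gl i1 i2 γ1 γ2 γ := by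
  obtain ⟨vtx, hv1, hv2, hv⟩ := h.exists_vtx S
  obtain ⟨out, ho2, ho1, ho⟩ := (h.dual S).exists_vtx S.dual
  let γ : Rib P K φ :=
    { vtx := vtx
      next := N
      out := out
      T := fun p k => ∃ j, γ1.T p j ∧ γ2.T j k
      sameCycle_next := hv
      sameCycle_walk := ho
      T_left := h.T_left_of_vtx S hv1 hv2 hv
      T_right := fun k => by
        rw [← (h.dual S).T_left_of_vtx S.dual ho2 ho1 ho k]
        exact exists_congr fun p => exists_congr fun j => and_comm
      T_fun := by
        rintro p k k' ⟨j, hj, hk⟩ ⟨j', hj', hk'⟩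
        obtain rfl := γ1.T_fun _ _ _ hj hj'
        exact γ2.T_fun _ _ _ hk hk'
      T_inj := by
        rintro p p' k ⟨j, hj, hk⟩ ⟨j', hj', hk'⟩
        obtain rfl := γ2.T_inj _ _ _ hk hk'
        exact γ1.T_inj _ _ _ hj hj' }
  exact ⟨γ, rfl, { h with
    vtx1 := hv1
    out2 := ho2
    vtx2 := hv2
    out1 := ho1
    T_iff := fun _ _ => Iff.rfl }⟩

end Shuffle

namespace Gl

/-- The dual of a gluing of `γ1` and `γ2` is a gluing of the duals of `γ2` and `γ1`. -/
theorem dual (S : Split i1 i2 φ1 φ2 φ) (h : Gl i1 i2 γ1 γ2 γ) :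
    Gl i2 i1 γ2.dual γ1.dual γ.dual where
  toShuffle := h.toShuffle.dual S
  vtx1 := h.out2
  out2 := h.vtx1
  vtx2 := h.out1
  out1 := h.vtx2
  T_iff k p := (h.T_iff p k).trans (exists_congr fun _ => and_comm)

theorem of_dual (S : Split i1 i2 φ1 φ2 φ) (h : Gl i2 i1 γ2.dual γ1.dual γ.dual) :
    Gl i1 i2 γ1 γ2 γ where
  ind1 := by
    have := h.ind2
    rwa [Rib.walk, Rib.dual, Rib.dual, inv_mul_cancel_left, inv_mul_cancel_left] at this
  ind2 := h.ind1
  glue x y := by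
    rw [← S.extendPerm_mul, Perm.sameCycle_comm]
    exact (h.glue y x).trans eq_comm
  vtx1 := h.out2
  out2 := h.vtx1
  vtx2 := h.out1
  out1 := h.vtx2
  T_iff k p := (h.T_iff p k).trans (exists_congr fun _ => and_comm)

theorem vtx_unique (S : Split i1 i2 φ1 φ2 φ) {γ' : Rib P K φ} (h : Gl i1 i2 γ1 γ2 γ)
    (h' : Gl i1 i2 γ1 γ2 γ') (hn : γ.next = γ'.next) : γ.vtx = γ'.vtx := by
  ext y
  rcases S.cover y with ⟨z, rfl⟩ | ⟨x, rfl⟩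
  · rw [h.vtx1, h'.vtx1]
  · rcases h.attached x with ⟨p, hp⟩ | ⟨z, hz⟩
    · rw [h.vtx2 x p hp, h'.vtx2 x p hp]
    · have hz' := hn ▸ hz
      rw [γ.sameCycle_next] at hz
      rw [γ'.sameCycle_next] at hz'
      rw [hz, hz', h.vtx1, h'.vtx1]

/-- A gluing is determined by its cyclic ordering. -/
theorem unique (S : Split i1 i2 φ1 φ2 φ) {γ' : Rib P K φ} (h : Gl i1 i2 γ1 γ2 γ)
    (h' : Gl i1 i2 γ1 γ2 γ') (hn : γ.next = γ'.next) : γ = γ' := by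
  refine Rib.ext (h.vtx_unique S h' hn) hn ?_ ?_
  · exact (h.dual S).vtx_unique S.dual (h'.dual S) (congrArg (φ * ·) hn)
  · ext p k
    rw [h.T_iff, h'.T_iff]

/-- A boundary component of `γ1` glued to a vertex with edges of `γ2` becomes part of a boundary
component through these edges. -/
theorem exists_walk_sameCycle (S : Split i1 i2 φ1 φ2 φ) (h : Gl i1 i2 γ1 γ2 γ) {y : H1} {x : H2}
    (hxy : γ1.out y = γ2.vtx x) : ∃ x', γ.walk.SameCycle (i1 y) (i2 x') :=
  (h.dual S).exists_sameCycle_of_eq (y := x) (x := y) hxy.symm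

end Gl
end Glue

section Assoc

variable {P J K L H1 H2 H3 H12 H23 H : Type} {φ1 : Perm H1} {φ2 : Perm H2}
  {φ3 : Perm H3} {φ12 : Perm H12} {φ23 : Perm H23} {φ : Perm H}
  {a1 : H1 → H12} {a2 : H2 → H12} {i12 : H12 → H} {i3 : H3 → H}
  {b2 : H2 → H23} {b3 : H3 → H23} {i1 : H1 → H} {i23 : H23 → H}

/-- A set of half-edges that is split into three parts. -/
structure Split3 (a1 : H1 → H12) (a2 : H2 → H12) (i12 : H12 → H) (i3 : H3 → H)
    (b2 : H2 → H23) (b3 : H3 → H23) (i1 : H1 → H) (i23 : H23 → H) (φ1 : Perm H1)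
    (φ2 : Perm H2) (φ3 : Perm H3) (φ12 : Perm H12) (φ23 : Perm H23)
    (φ : Perm H) : Prop where
  split12 : Split a1 a2 φ1 φ2 φ12
  split123 : Split i12 i3 φ12 φ3 φ
  split23 : Split b2 b3 φ2 φ3 φ23
  split123' : Split i1 i23 φ1 φ23 φ
  comp1 : ∀ x, i12 (a1 x) = i1 x
  comp2 : ∀ x, i12 (a2 x) = i23 (b2 x)
  comp3 : ∀ x, i23 (b3 x) = i3 x

theorem Split3.dual (S : Split3 a1 a2 i12 i3 b2 b3 i1 i23 φ1 φ2 φ3 φ12 φ23 φ) :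
    Split3 b3 b2 i23 i1 a2 a1 i3 i12 φ3⁻¹ φ2⁻¹ φ1⁻¹ φ23⁻¹ φ12⁻¹ φ⁻¹ where
  split12 := S.split23.dual
  split123 := S.split123'.dual
  split23 := S.split12.dual
  split123' := S.split123.dual
  comp1 := S.comp3
  comp2 x := (S.comp2 x).symm
  comp3 := S.comp1

variable {γ1 : Rib P J φ1} {γ2 : Rib J K φ2} {γ3 : Rib K L φ3} {γ12 : Rib P K φ12} {γ : Rib P L φ}

/-- Gluing is associative. -/
theorem Gl.assoc [Finite H] (S : Split3 a1 a2 i12 i3 b2 b3 i1 i23 φ1 φ2 φ3 φ12 φ23 φ)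
    (hA : Gl a1 a2 γ1 γ2 γ12) (hB : Gl i12 i3 γ12 γ3 γ) :
    ∃ γ23 : Rib J L φ23, Gl b2 b3 γ2 γ3 γ23 ∧ Gl i1 i23 γ1 γ23 γ := by
  obtain ⟨S12, S123, S23, S', c1, c2, c3⟩ := S
  have : Finite H23 := Finite.of_injective _ S'.inj2
  have : Finite H12 := Finite.of_injective _ S123.inj1
  obtain rfl : (fun x => i12 (a1 x)) = i1 := funext c1
  obtain rfl : (fun x => i23 (b3 x)) = i3 := funext c3
  set N := γ.next with hN
  set M := extendPerm (fun x => i12 (a1 x)) φ1 * N with hM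
  have c2' : i12 ∘ a2 = i23 ∘ b2 := funext c2
  -- contracting the edges of `γ1`
  have hM12 : Induces i12 M (extendPerm a1 φ1 * γ12.next) := by
    refine hB.ind1.mul (fun z => ?_) (fun y hy => extendPerm_of_notMem _ _ ?_)
    · rcases S12.cover z with ⟨w, rfl⟩ | ⟨w, rfl⟩
      · rw [extendPerm_apply S12.inj1]
        exact extendPerm_apply S'.inj1 φ1 w
      · rw [extendPerm_of_notMem _ _ (S12.notMem1 _), c2]
        exact extendPerm_of_notMem _ _ (S'.notMem1 _)
    · rintro ⟨w, rfl⟩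
      exact hy ⟨_, rfl⟩
  obtain ⟨N23, hN23⟩ := exists_induces S'.inj2 M
  have hW : Induces i23 (φ * N) (φ23 * N23) := by
    rw [← S'.extendPerm_mul' N]
    exact hN23.mul (extendPerm_apply S'.inj2 _) (fun _ => extendPerm_of_notMem _ _)
  have hE : extendPerm i12 φ12 * N = extendPerm (i23 ∘ b2) φ2 * M := by
    ext y
    simp only [hM, Perm.mul_apply]
    have hinj := S'.inj2.comp S23.inj1
    rcases S123.cover (N y) with ⟨z, e⟩ | ⟨x, e⟩
    · rw [← e, extendPerm_apply S123.inj1]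
      rcases S12.cover z with ⟨w, rfl⟩ | ⟨w, rfl⟩
      · rw [extendPerm_apply S'.inj1 φ1 w, S12.map1, extendPerm_of_notMem]
        rintro ⟨v, hv⟩
        exact S'.ne _ _ hv.symm
      · rw [extendPerm_of_notMem _ φ1, S12.map2, c2, c2]
        · exact (extendPerm_apply hinj φ2 w).symm
        · rw [c2]
          exact S'.notMem1 _
    · rw [← e, extendPerm_of_notMem _ _ (S123.notMem1 _),
        extendPerm_of_notMem _ _ (S'.notMem1 _), extendPerm_of_notMem]
      rintro ⟨v, hv⟩
      exact S23.ne _ _ (S'.inj2 hv)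
  have hG : Induces i23 (extendPerm i12 φ12 * N) (extendPerm b2 φ2 * N23) := by
    rw [hE]
    refine hN23.mul (fun z => ?_) (fun y hy => extendPerm_of_notMem _ _ ?_)
    · rcases S23.cover z with ⟨w, rfl⟩ | ⟨w, rfl⟩
      · rw [extendPerm_apply S23.inj1]
        exact extendPerm_apply (S'.inj2.comp S23.inj1) φ2 w
      · rw [extendPerm_of_notMem _ _ (S23.notMem1 _), extendPerm_of_notMem]
        rintro ⟨v, hv⟩
        exact S23.ne _ _ (S'.inj2 hv)
    · rintro ⟨w, rfl⟩
      exact hy ⟨_, rfl⟩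
  have hsh : Shuffle b2 b3 φ23 γ2 γ3 N23 :=
    { ind1 := hN23.cancel S'.inj2 (c2' ▸ hM12.trans S123.inj1 (hA.induces_right S12))
      ind2 := hW.cancel S'.inj2 hB.ind2
      glue := fun x y => by
        rw [hG.sameCycle_iff S'.inj2, ← c2, hB.glue, hA.out2] }
  obtain ⟨γ23, hγ, hC⟩ := hsh.exists_gl S23
  refine ⟨γ23, hC, ?_⟩
  rw [← hγ] at hW hN23 hG hsh
  have attach : ∀ z, (∃ j, γ2.T j (γ3.vtx z)) ∨
      ∃ x, γ23.vtx (b3 z) = γ2.vtx x ∧ M.SameCycle (i23 (b3 z)) (i23 (b2 x)) := by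
    intro z
    refine (hC.attached z).imp_right ?_
    rintro ⟨x, hx⟩
    exact ⟨x, by rwa [← hC.vtx1, ← γ23.sameCycle_next], (hN23.sameCycle_iff S'.inj2 _ _).mp hx⟩
  have glue2 : ∀ h x, M.SameCycle (i12 (a1 h)) (i23 (b2 x)) ↔ γ1.out h = γ2.vtx x := by
    intro h x
    rw [← c2, ← hM12.sameCycle_iff S123.inj1, hA.glue]
  refine
    { ind1 := hB.ind1.trans S123.inj1 hA.ind1
      ind2 := hW
      glue := fun h y => ?_
      vtx1 := fun h => by rw [hB.vtx1, hA.vtx1]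
      out2 := fun y => ?_
      vtx2 := fun y p hp => ?_
      out1 := fun h l hl => ?_
      T_iff := fun p l => ?_ }
  · rcases S23.cover y with ⟨x, rfl⟩ | ⟨z, rfl⟩
    · rw [hC.vtx1]
      exact glue2 h x
    · rcases attach z with ⟨j, hj⟩ | ⟨x, hx, hx'⟩
      · have hn : ∀ x, ¬ M.SameCycle (i23 (b3 z)) (i23 (b2 x)) := by
          intro x hx
          rw [← hN23.sameCycle_iff S'.inj2, γ23.sameCycle_next, hC.vtx1, hC.vtx2 z j hj] at hx
          exact (γ2.T_left j).mp ⟨_, hj⟩ x hx.symm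
        have hc : ∀ b, M.SameCycle (i23 (b3 z)) b ↔
            (extendPerm i12 φ12 * N).SameCycle (i23 (b3 z)) b := by
          intro b
          rw [hE]
          exact (sameCycle_extendPerm_mul (ι := i23 ∘ b2) φ2 hn b).symm
        change M.SameCycle _ _ ↔ _
        rw [Perm.sameCycle_comm, hc, Perm.sameCycle_comm, hB.glue, hC.vtx2 z j hj]
        constructor
        · intro h1
          have h2 : ∃ k, γ2.T (γ1.out h) k := by
            rw [γ2.T_left]
            intro x hx
            obtain ⟨x', hx'⟩ := hA.exists_walk_sameCycle S12 hx.symm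
            rw [Rib.walk, γ12.sameCycle_walk, h1, hA.out2] at hx'
            exact (γ2.T_right _).mp ⟨j, hj⟩ x' hx'.symm
          obtain ⟨k, hk⟩ := h2
          obtain rfl := (hA.out1 h k hk).symm.trans h1
          exact γ2.T_inj _ _ _ hk hj
        · rintro rfl
          exact hA.out1 _ _ hj
      · rw [hx, ← glue2]
        exact ⟨fun e => e.trans hx', fun e => e.trans hx'.symm⟩
  · rcases S23.cover y with ⟨x, rfl⟩ | ⟨z, rfl⟩
    · by_cases hl : ∃ l, γ3.T (γ2.out x) l
      · obtain ⟨l, hl⟩ := hl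
        rw [hC.out1 x l hl, ← c2, hB.out1 (a2 x) l (by rwa [hA.out2])]
      · rw [γ3.T_left] at hl
        push Not at hl
        obtain ⟨z, hz⟩ := hl
        obtain ⟨z', hz'⟩ := hC.exists_walk_sameCycle S23 hz.symm
        have h1 := (hW.sameCycle_iff S'.inj2 _ _).mp hz'
        rw [γ.sameCycle_walk] at h1
        rw [Rib.walk, γ23.sameCycle_walk, hC.out2] at hz'
        rw [h1, hz', hB.out2]
    · rw [hC.out2, hB.out2]
  · rcases S23.cover y with ⟨x, rfl⟩ | ⟨z, rfl⟩
    · rw [hC.vtx1] at hp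
      rw [← c2, hB.vtx1, hA.vtx2 x p hp]
    · rcases attach z with ⟨j, hj⟩ | ⟨x, hx, hx'⟩
      · rw [hC.vtx2 z j hj] at hp
        exact hB.vtx2 z p ((hA.T_iff _ _).mpr ⟨j, hp, hj⟩)
      · rw [hx] at hp
        have hn : ∀ h, ¬ M.SameCycle (i23 (b3 z)) (i12 (a1 h)) := by
          intro h hh
          have := (hh.symm.trans hx')
          rw [glue2] at this
          exact (γ1.T_right _).mp ⟨p, hp⟩ h this
        have h1 : N.SameCycle (i23 (b3 z)) (i23 (b2 x)) := by
          rw [← extendPerm_inv_mul (fun x => i12 (a1 x)) φ1 N]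
          exact (sameCycle_extendPerm_mul _ hn _).mpr hx'
        rw [γ.sameCycle_next] at h1
        rw [h1, ← c2, hB.vtx1, hA.vtx2 x p hp]
  · rw [hC.T_iff] at hl
    obtain ⟨k, hk, hl⟩ := hl
    rw [hB.out1 (a1 h) l]
    rwa [hA.out1 h k hk]
  · rw [hB.T_iff]
    constructor
    · rintro ⟨k, hk, hl⟩
      obtain ⟨j, hj, hk⟩ := (hA.T_iff _ _).mp hk
      exact ⟨j, hj, (hC.T_iff _ _).mpr ⟨k, hk, hl⟩⟩
    · rintro ⟨j, hj, hl⟩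
      obtain ⟨k, hk, hl⟩ := (hC.T_iff _ _).mp hl
      exact ⟨k, (hA.T_iff _ _).mpr ⟨j, hj, hk⟩, hl⟩

/-- The converse direction of associativity is the dual statement of `Gl.assoc`. -/
theorem Gl.assoc' [Finite H] (S : Split3 a1 a2 i12 i3 b2 b3 i1 i23 φ1 φ2 φ3 φ12 φ23 φ)
    {γ23 : Rib J L φ23} (hA : Gl b2 b3 γ2 γ3 γ23) (hB : Gl i1 i23 γ1 γ23 γ) :
    ∃ γ12 : Rib P K φ12, Gl a1 a2 γ1 γ2 γ12 ∧ Gl i12 i3 γ12 γ3 γ := by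
  obtain ⟨ρ, h1, h2⟩ := (hA.dual S.split23).assoc S.dual (hB.dual S.split123')
  rw [← ρ.dual_dual] at h1 h2
  exact ⟨ρ.dual, Gl.of_dual S.split12 h1, Gl.of_dual S.split123 h2⟩

end Assoc

/-! ### Renaming, and surfaces with additional vertices without edges -/

section Perm

variable {X X' Y Y' : Type}

theorem permCongr_mul (e : Y ≃ Y') (σ τ : Perm Y) :
    e.permCongr (σ * τ) = e.permCongr σ * e.permCongr τ := by
  ext y
  simp [permCongr_apply]

theorem sameCycle_permCongr (e : Y ≃ Y') (σ : Perm Y) (y y' : Y) :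
    (e.permCongr σ).SameCycle (e y) (e y') ↔ σ.SameCycle y y' := by
  have key : ∀ n : ℤ, (e.permCongr σ) ^ n = e.permCongr (σ ^ n) := fun n =>
    (map_zpow e.permCongrHom σ n).symm
  refine exists_congr fun n => ?_
  rw [key, permCongr_apply, symm_apply_apply]
  exact e.injective.eq_iff

theorem Induces.permCongr {ι : X → Y} (hι : Function.Injective ι) {ι' : X' → Y'} (e : Y ≃ Y')
    (f : X ≃ X') (hef : ∀ x, e (ι x) = ι' (f x)) {σ : Perm Y} {ρ : Perm X}
    (h : Induces ι σ ρ) : Induces ι' (e.permCongr σ) (f.permCongr ρ) := by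
  have h1 : Induces e (e.permCongr σ) σ :=
    (induces_iff_of_surjective e.surjective).mpr fun x => by simp [permCongr_apply]
  have h2 : Induces f.symm ρ (f.permCongr ρ) :=
    (induces_iff_of_surjective f.symm.surjective).mpr fun x => by simp [permCongr_apply]
  have h3 := h1.trans e.injective (h.trans hι h2)
  have : ι' = e ∘ ι ∘ f.symm := by
    ext x
    simp [hef]
  rwa [this]

theorem extendPerm_permCongr {ι : X → Y} (hι : Function.Injective ι) {ι' : X' → Y'} (e : Y ≃ Y')
    (f : X ≃ X') (hef : ∀ x, e (ι x) = ι' (f x)) {φ : Perm X} {φ' : Perm X'}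
    (hφ : ∀ x, φ' (f x) = f (φ x)) : extendPerm ι' φ' = e.permCongr (extendPerm ι φ) := by
  have hι' : Function.Injective ι' := by
    have : ι' = e ∘ ι ∘ f.symm := by
      ext x
      simp [hef]
    rw [this]
    exact e.injective.comp (hι.comp f.symm.injective)
  ext y
  obtain ⟨y, rfl⟩ := e.surjective y
  rw [permCongr_apply, symm_apply_apply]
  by_cases hy : y ∈ Set.range ι
  · obtain ⟨x, rfl⟩ := hy
    rw [hef, extendPerm_apply hι', extendPerm_apply hι, hef, hφ]
  · rw [extendPerm_of_notMem ι _ hy, extendPerm_of_notMem]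
    rintro ⟨x, hx⟩
    obtain ⟨x, rfl⟩ := f.surjective x
    rw [← hef] at hx
    exact hy ⟨x, e.injective hx⟩

/-- Replacing a marked point by its predecessor, if this one is not marked, does not change the
induced permutation. -/
theorem Induces.slide {ι ι' : X → Y} (hι : Function.Injective ι) {σ : Perm Y}
    {ρ : Perm X} (h : Induces ι σ ρ) (x0 : X) (h0 : σ (ι' x0) = ι x0)
    (hne : ι' x0 ∉ Set.range ι) (heq : ∀ x, x ≠ x0 → ι' x = ι x) : Induces ι' σ ρ := by
  have key : ∀ y w, FirstReturn σ (Set.range ι) y (ι w) → y ≠ ι' x0 →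
      FirstReturn σ (Set.range ι') y (ι' w) := by
    intro y w hy
    refine hy.path_induction
      (motive := fun y => y ≠ ι' x0 → FirstReturn σ (Set.range ι') y (ι' w))
      (fun _ y e hy => ?_) (fun y hy hr ih hy' => ?_)
    · have hw : w ≠ x0 := by
        rintro rfl
        exact hy (σ.injective (e.trans h0.symm))
      exact .of_apply (e.trans (heq w hw).symm) ⟨_, rfl⟩
    · by_cases h1 : σ y = ι' x0
      · rw [h1] at hr
        obtain rfl := hι (hr.unique (.of_apply h0 ⟨_, rfl⟩))
        exact .of_apply h1 ⟨_, rfl⟩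
      · refine .of_apply_notMem ?_ (ih h1)
        rintro ⟨v, hv⟩
        by_cases hv' : v = x0
        · exact h1 (hv' ▸ hv.symm)
        · exact hy ⟨v, by rw [← heq v hv', hv]⟩
  intro x
  have h1 : ι x ≠ ι' x0 := fun hx => hne ⟨x, hx⟩
  by_cases hx : x = x0
  · subst hx
    refine .of_apply_notMem ?_ (h0.symm ▸ key _ _ (h x) h1)
    rw [h0]
    rintro ⟨v, hv⟩
    by_cases hv' : v = x
    · exact h1 (by rw [← hv, hv'])
    · rw [heq v hv'] at hv
      exact hv' (hι hv)
  · rw [heq x hx]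
    exact key _ _ (h x) h1

end Perm

section Map

variable {P P' J J' K K' H H' : Type} {φ : Perm H} {φ' : Perm H'}

namespace Rib

/-- Renaming of the vertices, the boundary components and the half-edges. -/
def map (γ : Rib P J φ) (α : P ≃ P') (β : J ≃ J') (e : H ≃ H') (he : ∀ h, φ' (e h) = e (φ h)) :
    Rib P' J' φ' where
  vtx h := α (γ.vtx (e.symm h))
  next := e.permCongr γ.next
  out h := β (γ.out (e.symm h))
  T p j := γ.T (α.symm p) (β.symm j)
  sameCycle_next h h' := by
    obtain ⟨h, rfl⟩ := e.surjective h
    obtain ⟨h', rfl⟩ := e.surjective h'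
    rw [sameCycle_permCongr, γ.sameCycle_next, e.symm_apply_apply, e.symm_apply_apply,
      α.injective.eq_iff]
  sameCycle_walk h h' := by
    obtain ⟨h, rfl⟩ := e.surjective h
    obtain ⟨h', rfl⟩ := e.surjective h'
    have : φ' * e.permCongr γ.next = e.permCongr (φ * γ.next) := by
      ext y
      simp [permCongr_apply, he]
    rw [this, sameCycle_permCongr, γ.sameCycle_walk, e.symm_apply_apply, e.symm_apply_apply,
      β.injective.eq_iff]
  T_left p := by
    rw [← β.exists_congr_left (p := fun j => γ.T (α.symm p) j), γ.T_left, e.forall_congr_left]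
    exact forall_congr' fun h => not_congr (by rw [eq_symm_apply])
  T_right j := by
    rw [← α.exists_congr_left (p := fun p => γ.T p (β.symm j)), γ.T_right, e.forall_congr_left]
    exact forall_congr' fun h => not_congr (by rw [eq_symm_apply])
  T_fun p j j' h h' := β.symm.injective (γ.T_fun _ _ _ h h')
  T_inj p p' j h h' := α.symm.injective (γ.T_inj _ _ _ h h')

theorem map_walk (γ : Rib P J φ) (α : P ≃ P') (β : J ≃ J') (e : H ≃ H')
    (he : ∀ h, φ' (e h) = e (φ h)) : (γ.map α β e he).walk = e.permCongr γ.walk := by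
  ext y
  simp [walk, map, permCongr_apply, he]

/-- The surface `γ` with further vertices without edges, labelled by `Q`. -/
def add (γ : Rib P J φ) (Q : Type) : Rib (P ⊕ Q) (J ⊕ Q) φ where
  vtx h := inl (γ.vtx h)
  next := γ.next
  out h := inl (γ.out h)
  T p j := (∃ p' j', p = inl p' ∧ j = inl j' ∧ γ.T p' j') ∨
    ∃ q, p = inr q ∧ j = inr q
  sameCycle_next h h' := by rw [γ.sameCycle_next, Sum.inl.injEq]
  sameCycle_walk h h' := by rw [γ.sameCycle_walk, Sum.inl.injEq]
  T_left p := by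
    rcases p with p | q
    · simpa using γ.T_left p
    · simp
  T_right j := by
    rcases j with j | q
    · simpa using γ.T_right j
    · simp
  T_fun := by
    rintro p j j' (⟨p, k, rfl, rfl, h⟩ | ⟨q, rfl, rfl⟩) (⟨p', k', hp, rfl, h'⟩ | ⟨q', hp, rfl⟩)
    · obtain rfl := Sum.inl_injective hp
      rw [γ.T_fun _ _ _ h h']
    all_goals simp_all
  T_inj := by
    rintro p p' j (⟨p, k, rfl, rfl, h⟩ | ⟨q, rfl, rfl⟩) (⟨p', k', rfl, hp, h'⟩ | ⟨q', rfl, hp⟩)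
    · obtain rfl := Sum.inl_injective hp
      rw [γ.T_inj _ _ _ h h']
    all_goals simp_all

@[simp] theorem add_T_inl (γ : Rib P J φ) (Q : Type) (p : P) (j : J) :
    (γ.add Q).T (inl p) (inl j) ↔ γ.T p j := by simp [add]

@[simp] theorem add_T_inr (γ : Rib P J φ) (Q : Type) (p q : Q) :
    (γ.add Q).T (inr p) (inr q) ↔ p = q := by simp [add, eq_comm]

@[simp] theorem add_T_inl_inr (γ : Rib P J φ) (Q : Type) (p : P) (q : Q) :
    ¬ (γ.add Q).T (inl p) (inr q) := by simp [add]

@[simp] theorem add_T_inr_inl (γ : Rib P J φ) (Q : Type) (q : Q) (j : J) :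
    ¬ (γ.add Q).T (inr q) (inl j) := by simp [add]

/-- The surface `γ` with one further vertex without edges, labelled `none`. -/
def addPoint (γ : Rib P J φ) : Rib (Option P) (Option J) φ :=
  (γ.add Unit).map (optionEquivSumPUnit P).symm (optionEquivSumPUnit J).symm
    (.refl H) (fun _ => rfl)

@[simp] theorem addPoint_out (γ : Rib P J φ) (h : H) : γ.addPoint.out h = some (γ.out h) := rfl

@[simp] theorem addPoint_T_some (γ : Rib P J φ) (p : P) (j : J) :
    γ.addPoint.T (some p) (some j) ↔ γ.T p j := γ.add_T_inl Unit p j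

@[simp] theorem addPoint_T_none (γ : Rib P J φ) : γ.addPoint.T none none :=
  (γ.add_T_inr Unit () ()).mpr rfl

@[simp] theorem addPoint_T_some_none (γ : Rib P J φ) (p : P) : ¬ γ.addPoint.T (some p) none :=
  γ.add_T_inl_inr Unit p ()

@[simp] theorem addPoint_T_none_some (γ : Rib P J φ) (j : J) : ¬ γ.addPoint.T none (some j) :=
  γ.add_T_inr_inl Unit () j

end Rib

variable {H1 H2 H1' H2' : Type} {φ1 : Perm H1} {φ2 : Perm H2} {φ1' : Perm H1'} {φ2' : Perm H2'}
  {i1 : H1 → H} {i2 : H2 → H} {i1' : H1' → H'} {i2' : H2' → H'}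
  {γ1 : Rib P J φ1} {γ2 : Rib J K φ2} {γ : Rib P K φ}

theorem Gl.map (S : Split i1 i2 φ1 φ2 φ) (h : Gl i1 i2 γ1 γ2 γ) (α : P ≃ P') (β : J ≃ J')
    (δ : K ≃ K') (e1 : H1 ≃ H1') (e2 : H2 ≃ H2') (e : H ≃ H')
    (he1 : ∀ h, φ1' (e1 h) = e1 (φ1 h)) (he2 : ∀ h, φ2' (e2 h) = e2 (φ2 h))
    (he : ∀ h, φ' (e h) = e (φ h)) (c1 : ∀ x, e (i1 x) = i1' (e1 x))
    (c2 : ∀ x, e (i2 x) = i2' (e2 x)) :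
    Gl i1' i2' (γ1.map α β e1 he1) (γ2.map β δ e2 he2) (γ.map α δ e he) := by
  have d1 : ∀ x, e.symm (i1' (e1 x)) = i1 x := fun x => by rw [← c1, e.symm_apply_apply]
  have d2 : ∀ x, e.symm (i2' (e2 x)) = i2 x := fun x => by rw [← c2, e.symm_apply_apply]
  refine
    { ind1 := h.ind1.permCongr S.inj1 e e1 c1
      ind2 := ?_
      glue := fun x y => ?_
      vtx1 := fun x => ?_
      out2 := fun x => ?_
      vtx2 := fun x p hp => ?_
      out1 := fun x k hk => ?_
      T_iff := fun p k => ?_ }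
  · have h1 := (γ.map_walk α δ e he)
    rw [Rib.walk] at h1
    rw [h1, Rib.map_walk]
    exact h.ind2.permCongr S.inj2 e e2 c2
  · obtain ⟨x, rfl⟩ := e1.surjective x
    obtain ⟨y, rfl⟩ := e2.surjective y
    rw [extendPerm_permCongr S.inj1 e e1 c1 he1, Rib.map, ← permCongr_mul, ← c1, ← c2,
      sameCycle_permCongr, h.glue]
    simp [Rib.map]
  · obtain ⟨x, rfl⟩ := e1.surjective x
    simp [Rib.map, d1, h.vtx1]
  · obtain ⟨x, rfl⟩ := e2.surjective x
    simp [Rib.map, d2, h.out2]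
  · obtain ⟨x, rfl⟩ := e2.surjective x
    simp only [Rib.map, d2]
    rw [h.vtx2 x (α.symm p) (by simpa [Rib.map] using hp), α.apply_symm_apply]
  · obtain ⟨x, rfl⟩ := e1.surjective x
    simp only [Rib.map, d1]
    rw [h.out1 x (δ.symm k) (by simpa [Rib.map] using hk), δ.apply_symm_apply]
  · simp only [Rib.map]
    rw [h.T_iff, β.exists_congr_left]

theorem Gl.add (h : Gl i1 i2 γ1 γ2 γ) (Q : Type) : Gl i1 i2 (γ1.add Q) (γ2.add Q) (γ.add Q) where
  ind1 := h.ind1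
  ind2 := h.ind2
  glue x y := (h.glue x y).trans Sum.inl_injective.eq_iff.symm
  vtx1 x := congrArg inl (h.vtx1 x)
  out2 x := congrArg inl (h.out2 x)
  vtx2 := by
    rintro x (p | p) hp
    · exact congrArg inl (h.vtx2 x p (by simpa [Rib.add] using hp))
    · simp [Rib.add] at hp
  out1 := by
    rintro x (k | k) hk
    · exact congrArg inl (h.out1 x k (by simpa [Rib.add] using hk))
    · simp [Rib.add] at hk
  T_iff := by
    rintro (p | p) (k | k)
    · simp [h.T_iff]
    all_goals simp

/-- A gluing of surfaces with the same additional vertices without edges comes from a gluing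
without these vertices. -/
theorem Gl.exists_of_add [Finite H] (S : Split i1 i2 φ1 φ2 φ) {Q : Type}
    {ρ : Rib (P ⊕ Q) (K ⊕ Q) φ} (h : Gl i1 i2 (γ1.add Q) (γ2.add Q) ρ) :
    ∃ γ : Rib P K φ, ρ = γ.add Q ∧ Gl i1 i2 γ1 γ2 γ := by
  have hs : Shuffle i1 i2 φ γ1 γ2 ρ.next :=
    ⟨h.ind1, h.ind2, fun x y => (h.glue x y).trans Sum.inl_injective.eq_iff⟩
  obtain ⟨γ, hγ, hG⟩ := hs.exists_gl S
  exact ⟨γ, h.unique S (hG.add Q) hγ.symm, hG⟩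

end Map

/-! ### Expanding an edge as a gluing with the graph with one edge -/

section Eps

variable {P Q J H1 H : Type} {φ1 : Perm H1} {φ : Perm H}
  {ε : Bool → H} {i : H1 → H} {u : P} {β : Rib P J φ1} {ρ : Rib (Option P) J φ}

/-- The surface with one edge, which runs from the vertex `none` to the vertex `u`; all other
vertices are without edges.  Its only boundary component through the edge is labelled `u`. -/
def eps (u : P) : Rib (Option P) P boolNot where
  vtx b := if b then none else some u
  next := 1
  out _ := u
  T p j := p = some j ∧ j ≠ u
  sameCycle_next := by simp
  sameCycle_walk b b' := by
    have h : Perm.SameCycle boolNot true false := ⟨1, rfl⟩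
    cases b <;> cases b' <;> simp [h, h.symm, Perm.SameCycle.refl]
  T_left p := by
    rcases p with _ | p
    · simp
    · simp [eq_comm]
  T_right j := by simp [eq_comm]
  T_fun := by
    rintro p j j' ⟨rfl, -⟩ ⟨h, -⟩
    exact Option.some_injective _ h
  T_inj := by
    rintro p p' j ⟨rfl, -⟩ ⟨h, -⟩
    exact h.symm

@[simp] theorem eps_vtx_true (u : P) : (eps u).vtx true = none := rfl
@[simp] theorem eps_vtx_false (u : P) : (eps u).vtx false = some u := rfl
@[simp] theorem eps_out (u : P) (b : Bool) : (eps u).out b = u := rfl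
theorem eps_T (u : P) (p : Option P) (j : P) : (eps u).T p j ↔ p = some j ∧ j ≠ u := Iff.rfl

/-- `ρ` has an edge from the vertex `none` to the vertex `u`, whose contraction is `β`. -/
structure IsExp (ε : Bool → H) (i : H1 → H) (u : P) (β : Rib P J φ1) (ρ : Rib (Option P) J φ) :
    Prop where
  source : ρ.vtx (ε true) = none
  target : ρ.vtx (ε false) = some u
  vtx : ∀ x, (ρ.vtx (i x)).elim u id = β.vtx x
  walk : Induces i ρ.walk β.walk
  out : ∀ x, ρ.out (i x) = β.out x
  out_edge : ∀ k b, β.T u k → ρ.out (ε b) = k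
  T_iff : ∀ r k, r ≠ u → (ρ.T (some r) k ↔ β.T r k)

theorem Rib.not_T_vtx (ρ : Rib P J φ) (h : H) (k : J) : ¬ ρ.T (ρ.vtx h) k := fun hk =>
  (ρ.T_left _).mp ⟨k, hk⟩ h rfl

theorem Rib.not_T_out (ρ : Rib P J φ) (h : H) (p : P) : ¬ ρ.T p (ρ.out h) := fun hk =>
  (ρ.T_right _).mp ⟨p, hk⟩ h rfl

theorem IsExp.not_sameCycle (h : IsExp ε i u β ρ) : ¬ ρ.next.SameCycle (ε true) (ε false) := by
  rw [ρ.sameCycle_next, h.source, h.target]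
  simp

/-- An expanded surface is a gluing of the surface with one edge and the contracted surface. -/
theorem IsExp.gl [Finite H] (S : Split ε i boolNot φ1 φ) (h : IsExp ε i u β ρ) :
    Gl ε i (eps u) β ρ := by
  have ind1 : Induces ε ρ.next (eps u).next := (induces_one_iff S.inj1).mpr h.not_sameCycle
  have ind' : Induces ε (extendPerm ε boolNot * ρ.next) (boolNot * (eps u).next) :=
    ind1.mul (extendPerm_apply S.inj1 _) (fun _ => extendPerm_of_notMem _ _)
  have hε : ∀ b b', (extendPerm ε boolNot * ρ.next).SameCycle (ε b) (ε b') := by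
    intro b b'
    rw [← ind'.sameCycle_iff S.inj1]
    exact ((eps u).sameCycle_walk b b').mpr rfl
  have hvε : ∀ b, (ρ.vtx (ε b)).elim u id = u := by
    rintro (_ | _)
    · rw [h.target]; rfl
    · rw [h.source]; rfl
  have hinv : ∀ y, (ρ.vtx ((extendPerm ε boolNot * ρ.next) y)).elim u id =
      (ρ.vtx y).elim u id := by
    intro y
    have h1 : ρ.vtx (ρ.next y) = ρ.vtx y :=
      ((ρ.sameCycle_next _ _).mp ⟨1, by simp⟩ : ρ.vtx y = ρ.vtx (ρ.next y)).symm
    rw [← h1, Perm.mul_apply]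
    by_cases hy : ρ.next y ∈ Set.range ε
    · obtain ⟨b, hb⟩ := hy
      rw [← hb, extendPerm_apply S.inj1, hvε, hvε]
    · rw [extendPerm_of_notMem _ _ hy]
  refine
    { ind1 := ind1
      ind2 := h.walk
      glue := fun b x => ⟨fun hh => ?_, fun hh => ?_⟩
      vtx1 := ?_
      out2 := h.out
      vtx2 := ?_
      out1 := fun b k hk => h.out_edge k b hk
      T_iff := ?_ }
  · have := hh.eq_of_invariant (f := fun y => (ρ.vtx y).elim u id) hinv
    simp only [hvε, h.vtx] at this
    exact this
  · change u = β.vtx x at hh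
    have h1 : ∃ b, ρ.next.SameCycle (i x) (ε b) := by
      have := h.vtx x
      rw [← hh] at this
      rcases hv : ρ.vtx (i x) with _ | r
      · exact ⟨true, by rw [ρ.sameCycle_next, hv, h.source]⟩
      · rw [hv] at this
        exact ⟨false, by rw [ρ.sameCycle_next, hv, h.target]; exact congrArg some this⟩
    obtain ⟨b', hb'⟩ := h1
    obtain ⟨b'', hb''⟩ := exists_extendPerm_mul_sameCycle boolNot hb'
    exact (hε b b'').trans hb''.symm
  · rintro (_ | _)
    · exact h.target
    · exact h.source
  · rintro x p ⟨rfl, hne⟩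
    have := h.vtx x
    rcases hv : ρ.vtx (i x) with _ | r
    · rw [hv] at this
      exact absurd this.symm hne
    · rw [hv] at this
      exact congrArg some this
  · intro p k
    rcases p with _ | r
    · refine iff_of_false (h.source ▸ ρ.not_T_vtx _ _) ?_
      rintro ⟨j, ⟨hj, -⟩, -⟩
      simp at hj
    · by_cases hr : r = u
      · subst hr
        refine iff_of_false (h.target ▸ ρ.not_T_vtx _ _) ?_
        rintro ⟨j, ⟨hj, hj'⟩, -⟩
        exact hj' (Option.some_injective _ hj).symm
      · rw [h.T_iff r k hr]
        constructor
        · intro hT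
          exact ⟨r, ⟨rfl, hr⟩, hT⟩
        · rintro ⟨j, ⟨hj, -⟩, hT⟩
          rwa [Option.some_injective _ hj]

/-- Contracting the edge of `eps u` in a gluing of `eps u` and `β` gives `β`. -/
theorem Gl.isExp (h : Gl ε i (eps u) β ρ) :
    IsExp ε i u β ρ where
  source := h.vtx1 true
  target := h.vtx1 false
  vtx x := by
    by_cases hx : u = β.vtx x
    · have h1 := (h.glue true x).mpr hx
      rw [Perm.sameCycle_comm] at h1
      rcases h.attached x with ⟨p, hp⟩ | ⟨b, hb⟩
      · exact absurd hx.symm hp.2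
      · rw [ρ.sameCycle_next, h.vtx1] at hb
        rw [hb, ← hx]
        cases b <;> rfl
    · rw [h.vtx2 x _ ⟨rfl, fun hh => hx hh.symm⟩]
      rfl
  walk := h.ind2
  out := h.out2
  out_edge k b hk := h.out1 b k hk
  T_iff r k hr := by
    rw [h.T_iff]
    constructor
    · rintro ⟨j, ⟨hj, -⟩, hT⟩
      rwa [Option.some_injective _ hj]
    · intro hT
      exact ⟨r, ⟨rfl, hr⟩, hT⟩

/-- Expanding an edge whose source has no other half-edge is the same for the cyclic orderings as
for the boundary walk. -/
theorem Induces.of_fixed (S : Split ε i boolNot φ1 φ) {σ : Perm H}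
    {τ : Perm H1} (h0 : σ (ε true) = ε true) (h : Induces i σ τ) :
    Induces i (extendPerm ε boolNot * σ) τ := by
  have hf : ∀ b, extendPerm ε boolNot (ε b) = ε !b := extendPerm_apply S.inj1 _
  intro x
  refine (h x).path_induction (motive := fun y => y ≠ ε true →
    FirstReturn (extendPerm ε boolNot * σ) (Set.range i) y (i (τ x)))
    (fun _ y e _ => ?_) (fun y hy _ ih hne => ?_) (S.ne true x).symm
  · refine .of_apply ?_ ⟨_, rfl⟩
    rw [Perm.mul_apply, e, extendPerm_of_notMem _ _ (S.notMem1 _)]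
  · rcases S.cover (σ y) with ⟨b, hb⟩ | ⟨z, hz⟩
    · have hbf : b = false := by
        by_contra hb'
        have : b = true := by simpa using hb'
        exact hne (σ.injective (by rw [h0, ← hb, this]))
      subst hbf
      have h1 := ih (by rw [← hb]; exact fun hh => absurd (S.inj1 hh) (by decide))
      have h2 : (extendPerm ε boolNot * σ) y = ε true := by
        rw [Perm.mul_apply, ← hb, hf]; rfl
      have h3 : (extendPerm ε boolNot * σ) (ε true) = ε false := by
        rw [Perm.mul_apply, h0, hf]; rfl
      refine .of_apply_notMem (by rw [h2]; exact S.notMem2 _) ?_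
      rw [h2]
      refine .of_apply_notMem (by rw [h3]; exact S.notMem2 _) ?_
      rwa [h3, hb]
    · exact absurd ⟨z, hz⟩ hy

variable {γ : Rib P Q φ1} {ρ' : Rib (Option P) Q φ}

/-- An expansion of `γ` whose new vertex has no other half-edge is obtained by gluing an
edge to the boundary component of `γ` that contains this edge. -/
theorem IsExp.gl_addPoint [Finite H] (S : Split ε i boolNot φ1 φ)
    (S' : Split i ε φ1 boolNot φ) (h : IsExp ε i u γ ρ')
    (h0 : ρ'.next (ε true) = ε true) :
    Gl i ε γ.addPoint (eps (ρ'.out (ε true))) ρ' := by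
  have hG := h.gl S
  have : Finite H1 := Finite.of_injective _ S.inj2
  have hw : ρ'.walk (ε true) = ε false := by
    rw [Rib.walk, Perm.mul_apply, h0, S.map1]; rfl
  have hww : ρ'.walk.SameCycle (ε true) (ε false) := ⟨1, by rw [zpow_one, hw]⟩
  have hout : ∀ b, ρ'.out (ε b) = ρ'.out (ε true) := by
    rintro (_ | _)
    · exact ((ρ'.sameCycle_walk _ _).mp hww).symm
    · rfl
  have hvtx : ∀ x, ρ'.vtx (i x) = some (γ.vtx x) := by
    intro x
    have hv := h.vtx x
    rcases hh : ρ'.vtx (i x) with _ | r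
    · rw [← h.source, ← ρ'.sameCycle_next, Perm.sameCycle_comm] at hh
      exact absurd (hh.eq_of_left h0) (S.ne _ _)
    · rw [hh] at hv
      exact congrArg some hv
  have hE : extendPerm i φ1 * ρ'.next = extendPerm ε boolNot * ρ'.walk :=
    (S'.extendPerm_mul ρ'.next).symm
  have hfix : (extendPerm i φ1 * ρ'.next) (ε true) = ε true := by
    rw [Perm.mul_apply, h0, extendPerm_of_notMem _ _ (S.notMem2 _)]
  refine
    { ind1 := ?_
      ind2 := (induces_not_iff S.inj1).mpr hww
      glue := fun x b => ?_
      vtx1 := hvtx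
      out2 := hout
      vtx2 := ?_
      out1 := ?_
      T_iff := ?_ }
  · obtain ⟨τ, hτ⟩ := exists_induces S.inj2 ρ'.next
    have h1 := hτ.of_fixed S h0
    exact h1.unique S.inj2 (hG.induces_right S) ▸ hτ
  · cases b
    · rw [Rib.addPoint_out, eps_vtx_false, Option.some_inj, hE]
      constructor
      · intro hh
        obtain ⟨b, hb⟩ := exists_sameCycle_of_extendPerm_mul hh
        rw [Rib.walk, ρ'.sameCycle_walk, hout, h.out] at hb
        exact hb
      · intro hh
        have h1 : ρ'.walk.SameCycle (i x) (ε false) := by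
          rw [Rib.walk, ρ'.sameCycle_walk, h.out, hh, hout false]
        obtain ⟨b, hb⟩ := exists_extendPerm_mul_sameCycle boolNot h1
        cases b
        · exact hb
        · rw [← hE] at hb
          exact absurd (hb.eq_of_right hfix) (S.ne _ _).symm
    · rw [Rib.addPoint_out, eps_vtx_true]
      exact iff_of_false (fun hh => absurd (hh.eq_of_right hfix) (S.ne _ _).symm) (by simp)
  · rintro (_ | _) (_ | p) hp
    · simp at hp
    · rw [eps_vtx_false, Rib.addPoint_T_some] at hp
      rw [h.target]
      by_contra hne
      have hne' : p ≠ u := fun hh => hne (by rw [hh])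
      exact ρ'.not_T_out _ _ ((h.T_iff p _ hne').mpr hp)
    · exact h.source
    · simp at hp
  · rintro x k ⟨hk, -⟩
    rw [h.out]
    exact Option.some_injective _ hk
  · intro p k
    rcases p with _ | r
    · refine iff_of_false (h.source ▸ ρ'.not_T_vtx _ _) ?_
      rintro ⟨j, hj, rfl, -⟩
      simp at hj
    · by_cases hr : r = u
      · subst hr
        refine iff_of_false (h.target ▸ ρ'.not_T_vtx _ _) ?_
        rintro ⟨j, hj, rfl, hk⟩
        rw [Rib.addPoint_T_some] at hj
        exact hk (h.out_edge k true hj).symm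
      · rw [h.T_iff r k hr]
        constructor
        · intro hT
          refine ⟨some k, by simpa using hT, rfl, ?_⟩
          rintro rfl
          exact ρ'.not_T_out _ _ ((h.T_iff r _ hr).mpr hT)
        · rintro ⟨j, hj, rfl, -⟩
          simpa using hj

/-- Attaching an edge, whose source has no other half-edge, to a boundary component `q` of `γ` is an
expansion of a vertex of `γ` as well. -/
theorem Gl.exists_isExp_of_addPoint [Finite H] (S : Split ε i boolNot φ1 φ)
    (S' : Split i ε φ1 boolNot φ) {q : Q} (h : Gl i ε γ.addPoint (eps q) ρ') :
    ∃ u, IsExp ε i u γ ρ' ∧ ρ'.next (ε true) = ε true := by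
  have hind : Induces ε (extendPerm i φ1 * ρ'.next) (eps q).next := h.induces_right S'
  have hfix : (extendPerm i φ1 * ρ'.next) (ε true) = ε true := by
    have h1 : (extendPerm i φ1 * ρ'.next).SameCycle (ε true)
        ((extendPerm i φ1 * ρ'.next) (ε true)) := ⟨1, by simp⟩
    rcases S.cover ((extendPerm i φ1 * ρ'.next) (ε true)) with ⟨b, hb⟩ | ⟨x, hx⟩
    · rw [← hb] at h1 ⊢
      rw [← hind.sameCycle_iff S.inj1] at h1
      rw [show true = b by simpa [eps] using h1]
    · rw [← hx, Perm.sameCycle_comm, h.glue] at h1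
      simp at h1
  have h0 : ρ'.next (ε true) = ε true := by
    have h1 : ρ'.next = extendPerm i φ1⁻¹ * (extendPerm i φ1 * ρ'.next) :=
      (extendPerm_inv_mul i φ1 ρ'.next).symm
    rw [h1, Perm.mul_apply, hfix, extendPerm_of_notMem _ _ (S.notMem2 _)]
  have hu : ∃ u, ρ'.vtx (ε false) = some u := by
    rcases h.attached false with ⟨p, hp⟩ | ⟨y, hy⟩
    · rcases p with _ | p
      · simp at hp
      · exact ⟨p, h.vtx2 _ _ hp⟩
    · rw [ρ'.sameCycle_next, h.vtx1] at hy
      exact ⟨_, hy⟩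
  obtain ⟨u, hu⟩ := hu
  have hT : ∀ r k, γ.T r k → k ≠ q → ρ'.T (some r) k := fun r k hr hk =>
    (h.T_iff _ _).mpr ⟨some k, by simpa using hr, rfl, hk⟩
  refine ⟨u, ?_, h0⟩
  exact
    { source := h.vtx2 true none (by simp)
      target := hu
      vtx := fun x => by rw [h.vtx1]; rfl
      walk := by
        have h1 := (h.induces_left S').of_fixed S hfix
        rwa [S'.extendPerm_mul'] at h1
      out := fun x => by
        by_cases hx : γ.out x = q
        · obtain ⟨b, hb⟩ := h.exists_walk_sameCycle S' (y := x) (x := false)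
            (by simp [hx])
          rw [Rib.walk, ρ'.sameCycle_walk, h.out2] at hb
          rw [hb, hx]; rfl
        · exact h.out1 x _ ⟨rfl, hx⟩
      out_edge := fun k b hk => by
        rw [h.out2]
        by_contra hne
        exact hu ▸ ρ'.not_T_vtx (ε false) k <| hT u k hk fun hh => hne hh.symm
      T_iff := fun r k hr => by
        constructor
        · intro hk
          obtain ⟨j, hj, rfl, -⟩ := (h.T_iff _ _).mp hk
          simpa using hj
        · intro hk
          refine hT r k hk ?_
          rintro rfl
          refine hr (Option.some_injective _ ?_)
          rw [← hu]
          exact (h.vtx2 false (some r) (by simpa using hk)).symm }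

end Eps

/-! ### Two symmetries of expansions -/

section Bivalent

variable {P J H1 H : Type} {φ1 : Perm H1} {φ : Perm H}
  {ε : Bool → H} {i : H1 → H} {u : P} {β : Rib P J φ1} {ρ : Rib (Option P) J φ}

theorem sameCycle_of_two_cycle {Y : Type} {σ : Perm Y} {a b : Y} (h1 : σ a = b)
    (h2 : σ b = a) (y : Y) : σ.SameCycle a y ↔ y = a ∨ y = b := by
  constructor
  · intro h
    have hinv : ∀ y, (σ y = a ∨ σ y = b) ↔ (y = a ∨ y = b) := by
      intro y
      constructor
      · rintro (e | e)
        · exact Or.inr (σ.injective (e.trans h2.symm))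
        · exact Or.inl (σ.injective (e.trans h1.symm))
      · rintro (rfl | rfl)
        · exact Or.inr h1
        · exact Or.inl h2
    have := h.eq_of_invariant (f := fun y => (y = a ∨ y = b)) fun y => propext (hinv y)
    exact this.mp (Or.inl rfl)
  · rintro (rfl | rfl)
    · exact .refl _ _
    · exact ⟨1, by simpa using h1⟩

theorem injective_update_of_notMem {X Y : Type} {f : X → Y} (hf : Function.Injective f) {x : X}
    {y : Y} (hy : y ∉ Set.range f) : Function.Injective (Function.update f x y) := by
  intro a b h
  simp only [Function.update_apply] at h
  split_ifs at h with h1 h2 h2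
  · rw [h1, h2]
  · exact absurd ⟨b, h.symm⟩ hy
  · exact absurd ⟨a, h⟩ hy
  · exact hf h

/-- If one end of the expanded edge is a vertex with exactly one other half-edge, then one may
exchange the expanded edge with the edge `j` of this other half-edge. -/
theorem IsExp.swap [Finite H] (S : Split ε i boolNot φ1 φ) (h : IsExp ε i u β ρ)
    {j : Bool → H1} (hj : Function.Injective j) (hφ : ∀ s, φ1 (j s) = j !s) {b : Bool}
    (h1 : ρ.next (ε b) = i (j !b)) (h2 : ρ.next (i (j !b)) = ε b) (e : Perm H)
    (he1 : ∀ s, e (ε s) = i (j s)) (he2 : ∀ s, e (i (j s)) = ε s)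
    (he3 : ∀ x, x ∉ Set.range j → e (i x) = i x) (he : ∀ y, φ (e y) = e (φ y)) :
    ∃ u', IsExp ε i u' β (ρ.map (Equiv.swap none (some (β.vtx (j true)))) (.refl J) e he) := by
  have : Finite H1 := Finite.of_injective _ S.inj2
  have hs1 : ∀ s, e.symm (ε s) = i (j s) := fun s => by rw [symm_apply_eq, he2]
  have hs2 : ∀ s, e.symm (i (j s)) = ε s := fun s => by rw [symm_apply_eq, he1]
  have hs3 : ∀ x, x ∉ Set.range j → e.symm (i x) = i x := fun x hx => by
    rw [symm_apply_eq, he3 x hx]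
  have hw1 : ρ.walk (ε b) = i (j b) := by
    rw [Rib.walk, Perm.mul_apply, h1, S.map2, hφ, Bool.not_not]
  have hw2 : ρ.walk (i (j !b)) = ε !b := by
    rw [Rib.walk, Perm.mul_apply, h2, S.map1]; rfl
  have hout : ∀ s, ρ.out (ε s) = ρ.out (i (j s)) := by
    intro s
    rw [← ρ.sameCycle_walk]
    by_cases hsb : s = b
    · subst hsb
      exact ⟨1, by rw [zpow_one]; exact hw1⟩
    · obtain rfl : s = !b := by cases s <;> cases b <;> simp_all
      exact Perm.SameCycle.symm ⟨1, by rw [zpow_one]; exact hw2⟩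
  have hcyc : ∀ y, ρ.vtx y = ρ.vtx (ε b) ↔ y = ε b ∨ y = i (j !b) := by
    intro y
    rw [← sameCycle_of_two_cycle h1 h2, ρ.sameCycle_next, eq_comm]
  have hjne : ∀ s, i (j s) ≠ i (j !s) := fun s hh => by
    have := hj (S.inj2 hh)
    cases s <;> simp at this
  set A := β.vtx (j true) with hA
  have hvA : ρ.vtx (i (j true)) = some A := by
    have hv := h.vtx (j true)
    cases b
    · have h3 := (hcyc (i (j true))).mpr (Or.inr rfl)
      rw [h.target] at h3
      rw [h3] at hv ⊢
      exact congrArg some hv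
    · rcases hh : ρ.vtx (i (j true)) with _ | r
      · rw [← h.source, hcyc] at hh
        rcases hh with hh | hh
        · exact absurd hh.symm (S.ne _ _)
        · exact absurd hh (hjne true)
      · rw [hh] at hv
        exact congrArg some hv
  -- the walk
  have hwalk : Induces i (e.permCongr ρ.walk) β.walk := by
    let i1 : H1 → H := Function.update i (j b) (ε b)
    have hi1 : Induces i1 ρ.walk β.walk := by
      refine h.walk.slide S.inj2 (j b) ?_ ?_ (fun x hx => Function.update_of_ne hx _ _)
      · simpa [i1] using hw1
      · simpa [i1] using S.notMem2 b
    let i2 : H1 → H := Function.update i1 (j !b) (ε !b)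
    have hjb : j (!b) ≠ j b := fun hh => hjne b (congrArg i hh.symm)
    have hi1inj : Function.Injective i1 := injective_update_of_notMem S.inj2 (S.notMem2 b)
    have hε : ε (!b) ∉ Set.range i1 := by
      rintro ⟨x, hx⟩
      simp only [i1] at hx
      by_cases hxj : x = j b
      · rw [hxj, Function.update_self] at hx
        simpa using S.inj1 hx
      · rw [Function.update_of_ne hxj] at hx
        exact S.ne _ _ hx.symm
    have hi2inj : Function.Injective i2 := injective_update_of_notMem hi1inj hε
    obtain ⟨τ, hτ⟩ := exists_induces hi2inj ρ.walk
    have hi2 : Induces i1 ρ.walk τ := by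
      have h3 : i1 (j !b) = i (j !b) := Function.update_of_ne hjb _ _
      refine hτ.slide hi2inj (j !b) ?_ ?_ (fun x hx => (Function.update_of_ne hx _ _).symm)
      · rw [h3, hw2]
        simp only [i2, Function.update_self]
      · rintro ⟨x, hx⟩
        by_cases hxj : x = j !b
        · rw [hxj, h3] at hx
          simp only [i2, Function.update_self] at hx
          exact S.ne _ _ hx
        · exact hxj (hi1inj ((Function.update_of_ne hxj _ _).symm.trans hx))
    obtain rfl := hi2.unique hi1inj hi1
    have := hτ.permCongr (ι' := i) hi2inj e (.refl H1) (fun x => ?_)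
    · exact this
    · change e (i2 x) = i x
      simp only [i2, i1, Function.update_apply]
      split_ifs with h3 h4
      · rw [h3, he1]
      · rw [h4, he1]
      · refine he3 x ?_
        rintro ⟨s, rfl⟩
        by_cases hsb : s = b
        · exact h4 (hsb ▸ rfl)
        · exact h3 (congrArg j (by cases s <;> cases b <;> simp_all))
  -- the target of the new edge
  have hu' : ∃ u', Equiv.swap none (some A) (ρ.vtx (i (j false))) = some u' ∧
      ∃ x, β.vtx x = u' := by
    have hv := h.vtx (j false)
    rcases hh : ρ.vtx (i (j false)) with _ | r
    · exact ⟨A, swap_apply_left _ _, _, rfl⟩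
    · rw [hh] at hv
      have hr : r ≠ A := by
        rintro rfl
        rw [← hvA] at hh
        cases b
        · have h3 := (hcyc _).mpr (Or.inr rfl)
          rw [Bool.not_false, ← hh] at h3
          rcases (hcyc _).mp h3 with h4 | h4
          · exact S.ne _ _ h4.symm
          · exact hjne _ h4
        · have h3 := (hcyc _).mpr (Or.inr rfl)
          rw [Bool.not_true, hh, hvA, h.source] at h3
          simp at h3
      exact ⟨r, swap_apply_of_ne_of_ne (by simp) (by simpa using hr), _, hv.symm⟩
  obtain ⟨u', hu', hx'⟩ := hu'
  have hT' : ∀ k, ¬ β.T u' k := by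
    obtain ⟨x, rfl⟩ := hx'
    exact fun k => β.not_T_vtx x k
  -- the vertex of the new edge which disappears
  have hother : ∀ x, x ∉ Set.range j → ρ.vtx (i x) ≠ ρ.vtx (ε b) := by
    intro x hx hh
    rcases (hcyc _).mp hh with h3 | h3
    · exact S.ne _ _ h3.symm
    · exact hx ⟨_, (S.inj2 h3).symm⟩
  refine ⟨u', ?_⟩
  constructor
  · change Equiv.swap none (some A) (ρ.vtx (e.symm (ε true))) = none
    rw [hs1, hvA, swap_apply_right]
  · change Equiv.swap none (some A) (ρ.vtx (e.symm (ε false))) = some u'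
    rw [hs1, hu']
  · intro x
    change (Equiv.swap none (some A) (ρ.vtx (e.symm (i x)))).elim u' id = β.vtx x
    by_cases hx : x ∈ Set.range j
    · obtain ⟨s, rfl⟩ := hx
      rw [hs2]
      cases s
      · rw [h.target]
        cases b
        · have h3 := (hcyc (i (j true))).mpr (Or.inr rfl)
          rw [hvA, h.target] at h3
          rw [← h3, swap_apply_right]
          change u' = _
          have hv := h.vtx (j false)
          rcases hh : ρ.vtx (i (j false)) with _ | r
          · rw [hh] at hv hu'
            rw [swap_apply_left] at hu'
            rw [← hv, ← Option.some_injective _ hu']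
            exact Option.some_injective _ h3
          · rw [hh] at hv hu'
            rw [← hv]
            have hr : r ≠ A := by
              rintro rfl
              rw [swap_apply_right] at hu'
              simp at hu'
            rw [swap_apply_of_ne_of_ne (by simp) (by simpa using hr)] at hu'
            exact (Option.some_injective _ hu').symm
        · have h3 := (hcyc (i (j false))).mpr (Or.inr rfl)
          have hv := h.vtx (j false)
          rw [h3, h.source] at hv hu'
          rw [swap_apply_left] at hu'
          obtain rfl := Option.some_injective _ hu'
          by_cases huA : u = A
          · rw [huA, swap_apply_right, ← hv, huA]
          · rw [swap_apply_of_ne_of_ne (by simp) (by simpa using huA), ← hv]; rfl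
      · rw [h.source, swap_apply_left]
        rfl
    · rw [hs3 x hx]
      have hv := h.vtx x
      have ho := hother x hx
      rcases hh : ρ.vtx (i x) with _ | r
      · rw [hh] at hv ho
        cases b
        · rw [swap_apply_left, ← hv]
          have h3 := (hcyc (i (j true))).mpr (Or.inr rfl)
          rw [hvA, h.target] at h3
          exact Option.some_injective _ h3
        · exact absurd h.source.symm ho
      · rw [hh] at hv ho
        rw [← hv]
        by_cases hr : r = A
        · subst hr
          rw [swap_apply_right]
          cases b
          · have h3 := (hcyc (i (j true))).mpr (Or.inr rfl)
            rw [hvA] at h3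
            exact absurd h3 ho
          · have h3 := (hcyc (i (j false))).mpr (Or.inr rfl)
            rw [h3, h.source, swap_apply_left] at hu'
            exact (Option.some_injective _ hu').symm
        · rw [swap_apply_of_ne_of_ne (by simp) (by simpa using hr)]
          rfl
  · rw [Rib.map_walk]
    exact hwalk
  · intro x
    change ρ.out (e.symm (i x)) = β.out x
    by_cases hx : x ∈ Set.range j
    · obtain ⟨s, rfl⟩ := hx
      rw [hs2, hout, h.out]
    · rw [hs3 x hx, h.out]
  · exact fun k s hk => absurd hk (hT' k)
  · intro r k hr
    change ρ.T ((Equiv.swap none (some A)).symm (some r)) k ↔ _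
    rw [symm_swap]
    by_cases hrA : r = A
    · subst hrA
      rw [swap_apply_right]
      exact iff_of_false (h.source ▸ ρ.not_T_vtx _ _) (β.not_T_vtx _ _)
    · rw [swap_apply_of_ne_of_ne (by simp) (by simpa using hrA)]
      by_cases hru : r = u
      · subst hru
        refine iff_of_false (h.target ▸ ρ.not_T_vtx _ _) ?_
        cases b
        · have h3 := (hcyc (i (j true))).mpr (Or.inr rfl)
          rw [hvA, h.target] at h3
          exact absurd (Option.some_injective _ h3).symm hrA
        · have h3 := (hcyc (i (j false))).mpr (Or.inr rfl)
          have hv := h.vtx (j false)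
          rw [h3, h.source] at hv
          change r = _ at hv
          rw [hv]
          exact β.not_T_vtx _ _
      · exact h.T_iff r k hru

end Bivalent

section TwoEdges

variable {P J H H' H'' : Type} {φ : Perm H} {φ' : Perm H'} {φ'' : Perm H''}
  {ε1 : Bool → H'} {i1 : H → H'} {ε2 : Bool → H''} {i2 : H' → H''}
  {γ : Rib P J φ} {γ' : Rib (Option P) J φ'} {γ'' : Rib (Option (Option P)) J φ''}
  {u1 : P} {u2 : Option P}

theorem Rib.map_refl (γ : Rib P J φ) : γ.map (.refl P) (.refl J) (.refl H) (fun _ => rfl) = γ :=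
  Rib.ext rfl (by ext; rfl) rfl rfl

/-- The bijection of the vertices which accompanies the exchange of two expanded edges.  If the
edges have a common source, their targets are exchanged, and otherwise the new vertices. -/
def swapVertices (s t : Option (Option P)) : Perm (Option (Option P)) :=
  if s = none then swap (some none) t else swap none (some none)

/-- Exchange of the edges for surfaces with two edges. -/
theorem isExp_swap_eps {ρ : Rib (Option (Option P)) P (sumCongr boolNot boolNot)}
    (h : IsExp inl inr u2 (eps u1) ρ) (hG : Gl inl inr (eps u2) (eps u1) ρ)
    (S : Split inl inr boolNot boolNot
      (sumCongr boolNot boolNot)) :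
    ∃ u1' u2', IsExp inl inr u2' (eps u1')
      (ρ.map (swapVertices (ρ.vtx (inr true)) (ρ.vtx (inr false))) (.refl P)
        (sumComm Bool Bool) (φ' := sumCongr boolNot boolNot)
        (by rintro (s | s) <;> rfl)) := by
  have hs := h.vtx true
  have ht := h.vtx false
  rw [eps_vtx_true] at hs
  rw [eps_vtx_false] at ht
  have hout : ∀ b, ρ.out (inl b) = u2.elim u1 id := by
    intro b
    have key : ∀ b', (eps u1).vtx b' = u2 → ρ.out (inl b) = u1 := by
      intro b' hb'
      obtain ⟨x, hx⟩ := hG.exists_walk_sameCycle S (y := b) (x := b') hb'.symm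
      rw [Rib.walk, ρ.sameCycle_walk, h.out] at hx
      exact hx
    rcases u2 with _ | q
    · exact key true rfl
    · by_cases hq : q = u1
      · subst hq
        exact key false rfl
      · exact h.out_edge q b ⟨rfl, hq⟩
  have hT : ∀ p k, ρ.T p k ↔ p = some (some k) ∧ k ≠ u1 ∧ some k ≠ u2 := by
    intro p k
    rw [hG.T_iff]
    constructor
    · rintro ⟨j, ⟨rfl, hj⟩, rfl, hk⟩
      exact ⟨rfl, hk, hj⟩
    · rintro ⟨rfl, hk, hj⟩
      exact ⟨_, ⟨rfl, hj⟩, rfl, hk⟩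
  have key : ∀ (b : Perm (Option (Option P))) u2', b (ρ.vtx (inr true)) = none →
      b (ρ.vtx (inr false)) = some u2' → (b none).elim u2' id = none →
      (b (some u2)).elim u2' id = some (u2.elim u1 id) →
      (∀ k, u2' = some k → k ≠ u2.elim u1 id → k = u1) →
      (∀ r k, r ≠ u2' → ((b.symm (some r) = some (some k) ∧ k ≠ u1 ∧ some k ≠ u2) ↔
        (r = some k ∧ k ≠ u2.elim u1 id))) →
      ∃ u1' u2', IsExp inl inr u2' (eps u1')
        (ρ.map b (.refl P)
          (sumComm Bool Bool) (φ' := sumCongr boolNot boolNot)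
          (by rintro (s | s) <;> rfl)) := by
    intro b u2' h1 h2 h3 h4 h5 h6
    refine ⟨u2.elim u1 id, u2', h1, h2, ?_, ?_, fun s => hout s, ?_, ?_⟩
    · rintro (_ | _)
      · change (b (ρ.vtx (inl false))).elim u2' id = _
        rw [h.target, h4]; rfl
      · change (b (ρ.vtx (inl true))).elim u2' id = _
        rw [h.source, h3]; rfl
    · refine (induces_not_iff Sum.inr_injective).mpr ?_
      rw [Rib.walk, Rib.sameCycle_walk]
      exact (hout true).trans (hout false).symm
    · rintro k s ⟨hk, hk'⟩
      rw [h5 k hk hk']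
      exact h.out s
    · intro r k hr
      change ρ.T (b.symm (some r)) k ↔ _
      rw [hT, h6 r k hr]
      rfl
  unfold swapVertices
  rcases u2 with _ | q
  · have ht' : ρ.vtx (inr false) = some (some u1) := by
      rcases hh : ρ.vtx (inr false) with _ | r
      · rw [hh] at ht; simp at ht
      · rw [hh] at ht; exact congrArg some ht
    by_cases hs' : ρ.vtx (inr true) = none
    · rw [if_pos hs']
      refine key _ none ?_ ?_ ?_ ?_ ?_ ?_
      · rw [hs', ht']
        exact swap_apply_of_ne_of_ne (by simp) (by simp)
      · rw [swap_apply_right]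
      · rw [ht', swap_apply_of_ne_of_ne (by simp) (by simp)]; rfl
      · rw [ht', swap_apply_left]; rfl
      · simp
      · intro r k hr
        obtain ⟨r, rfl⟩ := Option.ne_none_iff_exists'.mp hr
        rw [ht', symm_swap]
        by_cases hru : r = u1
        · subst hru
          rw [swap_apply_right]
          simp only [Option.some_inj, reduceCtorEq, false_and, Option.elim_none, false_iff,
            not_and, not_not]
          exact fun hh => hh.symm
        · rw [swap_apply_of_ne_of_ne (by simp) (by simpa using hru)]
          simp
    · rw [if_neg hs']
      have hs'' : ρ.vtx (inr true) = some none := by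
        obtain ⟨r, hr⟩ := Option.ne_none_iff_exists'.mp hs'
        rw [hr] at hs ⊢
        exact congrArg some hs
      refine key _ (some u1) ?_ ?_ ?_ ?_ ?_ ?_
      · rw [hs'', swap_apply_right]
      · rw [ht', swap_apply_of_ne_of_ne (by simp) (by simp)]
      · rw [swap_apply_left]; rfl
      · rw [swap_apply_right]; rfl
      · intro k hk _
        exact (Option.some_injective _ hk).symm
      · intro r k hr
        rw [symm_swap]
        rcases r with _ | r
        · rw [swap_apply_right]; simp
        · rw [swap_apply_of_ne_of_ne (by simp) (by simp)]
          simp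
  · have hs'' : ρ.vtx (inr true) = some none := by
      rcases hh : ρ.vtx (inr true) with _ | r
      · rw [hh] at hs; simp at hs
      · rw [hh] at hs; exact congrArg some hs
    rw [if_neg (by rw [hs'']; simp)]
    rcases hh : ρ.vtx (inr false) with _ | r
    · rw [hh] at ht
      obtain rfl : q = u1 := Option.some_injective _ ht
      refine key _ none ?_ ?_ ?_ ?_ ?_ ?_
      · rw [hs'', swap_apply_right]
      · rw [hh, swap_apply_left]
      · rw [swap_apply_left]; rfl
      · rw [swap_apply_of_ne_of_ne (by simp) (by simp)]; rfl
      · simp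
      · intro r k hr
        obtain ⟨r, rfl⟩ := Option.ne_none_iff_exists'.mp hr
        rw [symm_swap, swap_apply_of_ne_of_ne (by simp) (by simp)]
        simp
    · rw [hh] at ht
      obtain rfl : r = some u1 := ht
      refine key _ (some u1) ?_ ?_ ?_ ?_ ?_ ?_
      · rw [hs'', swap_apply_right]
      · rw [hh, swap_apply_of_ne_of_ne (by simp) (by simp)]
      · rw [swap_apply_left]; rfl
      · rw [swap_apply_of_ne_of_ne (by simp) (by simp)]; rfl
      · intro k hk _
        exact (Option.some_injective _ hk).symm
      · intro r k hr
        rw [symm_swap]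
        rcases r with _ | r
        · rw [swap_apply_right]; simp
        · rw [swap_apply_of_ne_of_ne (by simp) (by simp)]
          have hr' : r ≠ u1 := fun hh => hr (congrArg some hh)
          simp only [Option.some_inj, ne_eq, Option.elim_some, id_eq]
          constructor
          · rintro ⟨rfl, -, h3⟩
            exact ⟨rfl, h3⟩
          · rintro ⟨rfl, h3⟩
            exact ⟨rfl, hr', h3⟩

/-- Two edges may be expanded in the other order. -/
theorem IsExp.swap_two [Finite H''] (S1 : Split ε1 i1 boolNot φ φ')
    (S2 : Split ε2 i2 boolNot φ' φ'') (h1 : IsExp ε1 i1 u1 γ γ')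
    (h2 : IsExp ε2 i2 u2 γ' γ'') (e : Perm H'') (he1 : ∀ s, e (ε2 s) = i2 (ε1 s))
    (he2 : ∀ s, e (i2 (ε1 s)) = ε2 s) (he3 : ∀ x, e (i2 (i1 x)) = i2 (i1 x))
    (he : ∀ y, φ'' (e y) = e (φ'' y)) :
    ∃ (u1' : P) (u2' : Option P) (γ1 : Rib (Option P) J φ'), IsExp ε1 i1 u1' γ γ1 ∧
      IsExp ε2 i2 u2' γ1 (γ''.map (swapVertices (γ''.vtx (i2 (ε1 true)))
        (γ''.vtx (i2 (ε1 false)))) (.refl J) e he) := by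
  have : Finite H' := Finite.of_injective _ S2.inj2
  have S : Split (inl : Bool → Bool ⊕ Bool) inr boolNot boolNot
      (sumCongr boolNot boolNot) :=
    ⟨Sum.inl_injective, Sum.inr_injective, fun _ _ => Sum.inl_ne_inr,
      fun y => by rcases y with y | y <;> simp, fun _ => rfl, fun _ => rfl⟩
  have S' : Split (Sum.elim ε2 (i2 ∘ ε1)) (i2 ∘ i1)
      (sumCongr boolNot boolNot) φ φ'' :=
    { inj1 := S2.inj1.sumElim (S2.inj2.comp S1.inj1) fun _ _ => S2.ne _ _
      inj2 := S2.inj2.comp S1.inj2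
      ne := by
        rintro (s | s) x
        · exact S2.ne _ _
        · exact fun hh => S1.ne _ _ (S2.inj2 hh)
      cover := fun y => by
        rcases S2.cover y with ⟨s, rfl⟩ | ⟨z, rfl⟩
        · exact Or.inl ⟨inl s, rfl⟩
        · rcases S1.cover z with ⟨s, rfl⟩ | ⟨x, rfl⟩
          · exact Or.inl ⟨inr s, rfl⟩
          · exact Or.inr ⟨x, rfl⟩
      map1 := by
        rintro (s | s)
        · exact S2.map1 s
        · exact (S2.map2 _).trans (congrArg i2 (S1.map1 s))
      map2 := fun x => (S2.map2 _).trans (congrArg i2 (S1.map2 x)) }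
  have S3 : Split3 inl inr (Sum.elim ε2 (i2 ∘ ε1)) (i2 ∘ i1) ε1 i1 ε2 i2 boolNot
      boolNot φ (sumCongr boolNot boolNot) φ' φ'' :=
    ⟨S, S', S1, S2, fun _ => rfl, fun _ => rfl, fun _ => rfl⟩
  -- By associativity, `γ''` is a gluing of a surface `ρ` with just the two new edges and `γ`, and
  -- only `ρ` has to be considered.
  obtain ⟨ρ, hA, hB⟩ := (h1.gl S1).assoc' S3 (h2.gl S2)
  obtain ⟨u1', u2', hu⟩ := isExp_swap_eps hA.isExp hA S
  have hv : ∀ s, ρ.vtx (inr s) = γ''.vtx (i2 (ε1 s)) := fun s => (hB.vtx1 (inr s)).symm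
  rw [hv, hv] at hu
  have hB' := hB.map S' (φ1' := sumCongr boolNot boolNot) (φ2' := φ)
    (φ' := φ'') (i1' := Sum.elim ε2 (i2 ∘ ε1)) (i2' := i2 ∘ i1)
    (swapVertices (γ''.vtx (i2 (ε1 true))) (γ''.vtx (i2 (ε1 false))))
    (.refl P) (.refl J) (sumComm Bool Bool) (.refl H) e
    (by rintro (s | s) <;> rfl) (fun _ => rfl) he
    (by
      rintro (s | s)
      · exact he1 s
      · exact he2 s) he3
  rw [Rib.map_refl] at hB'
  obtain ⟨γ1, h3, h4⟩ := (hu.gl S).assoc S3 hB'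
  exact ⟨u1', u2', γ1, h3.isExp, h4.isExp⟩

end TwoEdges

/-! ### Graphs as ribbon surfaces -/

section Ren

variable {P P' P'' J J' J'' K K' E E' E'' : Type}

namespace Rib

/-- Renaming of the vertices, the boundary components and the edges. -/
def ren (γ : Rib P J (flip E)) (α : P ≃ P') (β : J ≃ J') (a : E ≃ E') : Rib P' J' (flip E') :=
  γ.map α β (a.prodCongr (.refl Bool)) (fun _ => rfl)

@[simp] theorem ren_vtx (γ : Rib P J (flip E)) (α : P ≃ P') (β : J ≃ J') (a : E ≃ E') (e s) :
    (γ.ren α β a).vtx (e, s) = α (γ.vtx (a.symm e, s)) := rfl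

@[simp] theorem ren_out (γ : Rib P J (flip E)) (α : P ≃ P') (β : J ≃ J') (a : E ≃ E') (e s) :
    (γ.ren α β a).out (e, s) = β (γ.out (a.symm e, s)) := rfl

@[simp] theorem ren_next (γ : Rib P J (flip E)) (α : P ≃ P') (β : J ≃ J') (a : E ≃ E') (e s) :
    (γ.ren α β a).next (e, s) = Prod.map a id (γ.next (a.symm e, s)) := rfl

@[simp] theorem ren_T (γ : Rib P J (flip E)) (α : P ≃ P') (β : J ≃ J') (a : E ≃ E') (p j) :
    (γ.ren α β a).T p j ↔ γ.T (α.symm p) (β.symm j) := Iff.rfl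

theorem ren_ren (γ : Rib P J (flip E)) (α : P ≃ P') (β : J ≃ J') (a : E ≃ E') (α' : P' ≃ P'')
    (β' : J' ≃ J'') (a' : E' ≃ E'') :
    (γ.ren α β a).ren α' β' a' = γ.ren (α.trans α') (β.trans β') (a.trans a') := rfl

theorem ren_refl (γ : Rib P J (flip E)) : γ.ren (.refl P) (.refl J) (.refl E) = γ :=
  Rib.ext rfl (Equiv.ext fun _ => rfl) rfl rfl

theorem ren_injective (α : P ≃ P') (β : J ≃ J') (a : E ≃ E') :
    Function.Injective fun γ : Rib P J (flip E) => γ.ren α β a := by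
  intro γ γ' h
  have := congrArg (fun ρ : Rib P' J' (flip E') => ρ.ren α.symm β.symm a.symm) h
  simpa [ren_ren, ren_refl] using this

theorem add_ren (γ : Rib P J (flip E)) (α : P ≃ P') (β : J ≃ J') (a : E ≃ E') {Q Q' : Type}
    (q : Q ≃ Q') :
    (γ.add Q).ren (α.sumCongr q) (β.sumCongr q) a = (γ.ren α β a).add Q' := by
  refine Rib.ext rfl rfl rfl ?_
  ext p j
  rcases p with p | p <;> rcases j with j | j <;> simp

theorem add_injective (Q : Type) :
    Function.Injective fun γ : Rib P J (flip E) => γ.add Q := by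
  intro γ γ' h
  refine Rib.ext ?_ (congrArg Rib.next h :) ?_ ?_
  · ext x
    exact Sum.inl_injective (congrFun (congrArg Rib.vtx h :) x)
  · ext x
    exact Sum.inl_injective (congrFun (congrArg Rib.out h :) x)
  · ext p j
    rw [← add_T_inl γ Q, ← add_T_inl γ' Q]
    exact iff_of_eq (congrFun₂ (congrArg Rib.T h :) _ _)

/-- The number of edges with source (for `s = true`) or target (for `s = false`) `p`. -/
def deg (γ : Rib P J (flip E)) (s : Bool) (p : P) : ℕ := Nat.card {e : E // γ.vtx (e, s) = p}

theorem deg_ren (γ : Rib P J (flip E)) (α : P ≃ P') (β : J ≃ J') (a : E ≃ E') (s : Bool) (p : P) :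
    (γ.ren α β a).deg s (α p) = γ.deg s p :=
  Nat.card_congr (a.symm.subtypeEquiv fun e => by simp)

end Rib

theorem splitSum (E1 E2 : Type) : Split (Prod.map inl id : E1 × Bool → (E1 ⊕ E2) × Bool)
    (Prod.map inr id) (flip E1) (flip E2) (flip (E1 ⊕ E2)) where
  inj1 := Sum.inl_injective.prodMap Function.injective_id
  inj2 := Sum.inr_injective.prodMap Function.injective_id
  ne h x hh := absurd (congrArg Prod.fst hh) Sum.inl_ne_inr
  cover := by
    rintro ⟨e | e, s⟩
    · exact Or.inl ⟨(e, s), rfl⟩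
    · exact Or.inr ⟨(e, s), rfl⟩
  map1 _ := rfl
  map2 _ := rfl

theorem splitOption (E : Type) : Split (fun s => ((none : Option E), s))
    (Prod.map some id : E × Bool → Option E × Bool) boolNot (flip E) (flip (Option E)) where
  inj1 s s' h := congrArg Prod.snd h
  inj2 := (Option.some_injective E).prodMap Function.injective_id
  ne h x hh := absurd (congrArg Prod.fst hh) (by simp)
  cover := by
    rintro ⟨_ | e, s⟩
    · exact Or.inl ⟨s, rfl⟩
    · exact Or.inr ⟨(e, s), rfl⟩
  map1 _ := rfl
  map2 _ := rfl

theorem Gl.ren {E1 E1' E2 E2' : Type} {γ1 : Rib P J (flip E1)} {γ2 : Rib J K (flip E2)}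
    {γ : Rib P K (flip (E1 ⊕ E2))} (h : Gl (Prod.map inl id) (Prod.map inr id) γ1 γ2 γ)
    (α : P ≃ P') (β : J ≃ J') (δ : K ≃ K') (a1 : E1 ≃ E1') (a2 : E2 ≃ E2') :
    Gl (Prod.map inl id) (Prod.map inr id) (γ1.ren α β a1) (γ2.ren β δ a2)
      (γ.ren α δ (a1.sumCongr a2)) :=
  Gl.map (splitSum E1 E2) h α β δ _ _ _ _ _ _ (fun _ => rfl) (fun _ => rfl)

end Ren

variable {I I' I'' J J' J'' K K' E E' E'' V V' V'' : Type}

/-- The surface with inputs `I` and further vertices `V` is that of a directed graph with vertices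
`I` of type `0` and vertices `V` of positive type. -/
structure Rib.Admissible (ρ : Rib (I ⊕ V) J (flip E)) : Prop where
  source_ne : ∀ e i, ρ.vtx (e, true) ≠ inl i
  exists_source : ∀ v, ∃ e, ρ.vtx (e, true) = inr v
  two_le : ∀ v, ρ.deg true (inr v) = 1 → 2 ≤ ρ.deg false (inr v)

namespace Graph

/-- The surface of a graph. -/
def toRib (γ : Graph I J E V) : Rib (I ⊕ V) J (flip E) where
  vtx := γ.vtx
  next := γ.next
  out := γ.out
  T p j := ∃ i hi, p = inl i ∧ γ.outTriv i hi = j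
  sameCycle_next := γ.sameCycle_next
  sameCycle_walk := γ.sameCycle_walk
  T_left := by
    rintro (i | v)
    · constructor
      · rintro ⟨j, i', hi, h, -⟩
        obtain rfl := Sum.inl_injective h
        exact hi
      · exact fun h => ⟨_, i, h, rfl, rfl⟩
    · refine iff_of_false (by simp) ?_
      push Not
      exact (γ.exists_source v).imp' (fun e => (e, true)) fun _ h => h
  T_right j := by
    constructor
    · rintro ⟨_, i, hi, rfl, rfl⟩ h
      exact γ.out_ne_outTriv h i hi
    · intro h
      rcases γ.out_surjective j with ⟨h', hh⟩ | ⟨i, hi, hh⟩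
      · exact absurd hh (h h')
      · exact ⟨_, i, hi, rfl, hh⟩
  T_fun := by
    rintro p j j' ⟨i, hi, rfl, rfl⟩ ⟨i', hi', h, rfl⟩
    obtain rfl := Sum.inl_injective h
    rfl
  T_inj := by
    rintro p p' j ⟨i, hi, rfl, rfl⟩ ⟨i', hi', rfl, h⟩
    rw [γ.outTriv_injective _ _ _ _ h]

@[simp] theorem toRib_vtx (γ : Graph I J E V) : γ.toRib.vtx = γ.vtx := rfl
@[simp] theorem toRib_next (γ : Graph I J E V) : γ.toRib.next = γ.next := rfl
@[simp] theorem toRib_out (γ : Graph I J E V) : γ.toRib.out = γ.out := rfl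

theorem toRib_T (γ : Graph I J E V) (i : I) (j : J) :
    γ.toRib.T (inl i) j ↔ ∃ hi, γ.outTriv i hi = j := by
  constructor
  · rintro ⟨i', hi, h, hj⟩
    obtain rfl := Sum.inl_injective h
    exact ⟨hi, hj⟩
  · rintro ⟨hi, hj⟩
    exact ⟨i, hi, rfl, hj⟩

@[simp] theorem not_toRib_T (γ : Graph I J E V) (v : V) (j : J) : ¬ γ.toRib.T (inr v) j := by
  rintro ⟨i, hi, h, -⟩
  exact Sum.inr_ne_inl h

theorem toRib_admissible (γ : Graph I J E V) : γ.toRib.Admissible :=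
  ⟨γ.source_ne, γ.exists_source, γ.two_le_of_type_one⟩

theorem toRib_injective : Function.Injective (toRib : Graph I J E V → _) := by
  intro γ γ' h
  have hT : ∀ i hi hi', γ.outTriv i hi = γ'.outTriv i hi' := fun i hi hi' => by
    obtain ⟨_, h'⟩ := (γ'.toRib_T i _).mp (h ▸ (γ.toRib_T i _).mpr ⟨hi, rfl⟩)
    exact h'.symm
  have hv : γ.vtx = γ'.vtx := congrArg Rib.vtx h
  have hn : γ.next = γ'.next := congrArg Rib.next h
  have ho : γ.out = γ'.out := congrArg Rib.out h
  obtain ⟨v, n, _, o, t⟩ := γ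
  obtain ⟨v', n', _, o', t'⟩ := γ'
  obtain rfl : v = v' := hv
  obtain rfl : n = n' := hn
  obtain rfl : o = o' := ho
  obtain rfl : t = t' := funext fun i => funext fun hi => hT i hi hi
  rfl

/-- The graph of an admissible surface. -/
def ofRib (ρ : Rib (I ⊕ V) J (flip E)) (hρ : ρ.Admissible) : Graph I J E V where
  vtx := ρ.vtx
  next := ρ.next
  sameCycle_next := ρ.sameCycle_next
  out := ρ.out
  outTriv i hi := ((ρ.T_left (inl i)).mpr hi).choose
  sameCycle_walk := ρ.sameCycle_walk
  outTriv_injective i i' hi hi' h := by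
    have h1 := ((ρ.T_left (inl i)).mpr hi).choose_spec
    have h2 := ((ρ.T_left (inl i')).mpr hi').choose_spec
    exact Sum.inl_injective (ρ.T_inj _ _ _ h1 (h ▸ h2))
  out_ne_outTriv h i hi hh :=
    (ρ.T_right _).mp ⟨_, ((ρ.T_left (inl i)).mpr hi).choose_spec⟩ h hh
  out_surjective j := by
    by_cases hj : ∃ p, ρ.T p j
    · obtain ⟨p, hp⟩ := hj
      rcases p with i | v
      · have hi := (ρ.T_left (inl i)).mp ⟨j, hp⟩
        exact Or.inr ⟨i, hi, ρ.T_fun _ _ _ ((ρ.T_left (inl i)).mpr hi).choose_spec hp⟩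
      · obtain ⟨e, he⟩ := hρ.exists_source v
        exact absurd he ((ρ.T_left _).mp ⟨_, hp⟩ _)
    · rw [ρ.T_right] at hj
      push Not at hj
      exact Or.inl hj
  source_ne := hρ.source_ne
  exists_source := hρ.exists_source
  two_le_of_type_one := hρ.two_le

@[simp] theorem toRib_ofRib (ρ : Rib (I ⊕ V) J (flip E)) (hρ : ρ.Admissible) :
    (ofRib ρ hρ).toRib = ρ := by
  refine Rib.ext rfl rfl rfl ?_
  ext p j
  rcases p with i | v
  · rw [toRib_T]
    constructor
    · rintro ⟨hi, rfl⟩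
      exact ((ρ.T_left (inl i)).mpr hi).choose_spec
    · intro h
      have hi := (ρ.T_left (inl i)).mp ⟨j, h⟩
      exact ⟨hi, ρ.T_fun _ _ _ ((ρ.T_left (inl i)).mpr hi).choose_spec h⟩
  · refine iff_of_false (not_toRib_T _ _ _) fun h => ?_
    obtain ⟨e, he⟩ := hρ.exists_source v
    exact absurd he ((ρ.T_left _).mp ⟨_, h⟩ _)

end Graph

theorem Rib.Admissible.ren {ρ : Rib (I ⊕ V) J (flip E)} (h : ρ.Admissible) (α : I ≃ I')
    (β : J ≃ J') (a : E ≃ E') (b : V ≃ V') : (ρ.ren (α.sumCongr b) β a).Admissible where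
  source_ne e i hi := by
    rw [Rib.ren_vtx, ← eq_symm_apply] at hi
    exact h.source_ne _ _ hi
  exists_source v := by
    obtain ⟨e, he⟩ := h.exists_source (b.symm v)
    exact ⟨a e, by rw [Rib.ren_vtx, a.symm_apply_apply, he]; simp⟩
  two_le v := by
    have key : ∀ s, (ρ.ren (α.sumCongr b) β a).deg s (inr v) =
        ρ.deg s (inr (b.symm v)) := fun s => by
      rw [← ρ.deg_ren (α.sumCongr b) β a]
      simp
    rw [key, key]
    exact h.two_le _

namespace Graph

/-- Renaming of the inputs, the outputs, the edges and the vertices of positive type. -/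
def map (γ : Graph I J E V) (α : I ≃ I') (β : J ≃ J') (a : E ≃ E') (b : V ≃ V') :
    Graph I' J' E' V' :=
  ofRib _ (γ.toRib_admissible.ren α β a b)

@[simp] theorem toRib_map (γ : Graph I J E V) (α : I ≃ I') (β : J ≃ J') (a : E ≃ E')
    (b : V ≃ V') : (γ.map α β a b).toRib = γ.toRib.ren (α.sumCongr b) β a := toRib_ofRib _ _

theorem map_vtx (γ : Graph I J E V) (α : I ≃ I') (β : J ≃ J') (a : E ≃ E') (b : V ≃ V') (e s) :
    (γ.map α β a b).vtx (e, s) = Sum.map α b (γ.vtx (a.symm e, s)) := rfl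

theorem map_map (γ : Graph I J E V) (α : I ≃ I') (β : J ≃ J') (a : E ≃ E') (b : V ≃ V')
    (α' : I' ≃ I'') (β' : J' ≃ J'') (a' : E' ≃ E'') (b' : V' ≃ V'') :
    (γ.map α β a b).map α' β' a' b' =
      γ.map (α.trans α') (β.trans β') (a.trans a') (b.trans b') := by
  apply toRib_injective
  simp only [toRib_map, Rib.ren_ren]
  congr 1
  ext (i | v) <;> rfl

theorem map_refl (γ : Graph I J E V) : γ.map (.refl I) (.refl J) (.refl E) (.refl V) = γ := by
  apply toRib_injective
  rw [toRib_map, sumCongr_refl, Rib.ren_refl]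

theorem type_eq (γ : Graph I J E V) (v : V) : γ.type v = γ.toRib.deg true (inr v) := rfl

theorem type_map (γ : Graph I J E V) (α : I ≃ I') (β : J ≃ J') (a : E ≃ E') (b : V ≃ V') (v : V) :
    (γ.map α β a b).type (b v) = γ.type v := by
  rw [type_eq, type_eq, toRib_map, ← γ.toRib.deg_ren (α.sumCongr b) β a]
  rfl

theorem isIso_map (γ : Graph I J E V) (a : E ≃ E') (b : V ≃ V') :
    γ.IsIso (γ.map (.refl I) (.refl J) a b) a b where
  vtx e s := by rw [map_vtx, a.symm_apply_apply]; rfl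
  next e s := by
    change (γ.map (.refl I) (.refl J) a b).toRib.next _ = _
    rw [toRib_map, Rib.ren_next, a.symm_apply_apply]
    rfl
  out e s := by
    change (γ.map (.refl I) (.refl J) a b).toRib.out _ = _
    rw [toRib_map, Rib.ren_out, a.symm_apply_apply]
    rfl
  outTriv i hi hi' := by
    have h := (toRib_T _ i _).mpr ⟨hi', rfl⟩
    rw [toRib_map, Rib.ren_T] at h
    obtain ⟨_, h⟩ := (γ.toRib_T i _).mp h
    exact h.symm

theorem IsIso.eq_map {γ : Graph I J E V} {γ' : Graph I J E' V'} {a : E ≃ E'} {b : V ≃ V'}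
    (h : γ.IsIso γ' a b) : γ' = γ.map (.refl I) (.refl J) a b := by
  have hv : ∀ e s, γ'.vtx (e, s) = Sum.map id b (γ.vtx (a.symm e, s)) := fun e s => by
    rw [← h.vtx, a.apply_symm_apply]
  apply toRib_injective
  rw [toRib_map]
  refine Rib.ext (funext fun ⟨e, s⟩ => hv e s) (Equiv.ext fun ⟨e, s⟩ => ?_)
    (funext fun ⟨e, s⟩ => ?_) ?_
  · rw [Rib.ren_next, toRib_next, toRib_next]
    have := h.next (a.symm e) s
    rwa [a.apply_symm_apply] at this
  · rw [Rib.ren_out, toRib_out, toRib_out]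
    have := h.out (a.symm e) s
    rwa [a.apply_symm_apply] at this
  · ext p j
    rcases p with i | v
    · rw [Rib.ren_T]
      have key : (∀ x, γ'.vtx x ≠ inl i) ↔ ∀ x, γ.vtx x ≠ inl i := by
        refine ⟨fun hi x hx => hi (a x.1, x.2) ?_, fun hi x hx => hi (a.symm x.1, x.2) ?_⟩
        · rw [h.vtx]
          exact congrArg (Sum.map id b) hx
        · rw [show x = (x.1, x.2) from rfl, hv] at hx
          rcases hh : γ.vtx (a.symm x.1, x.2) with i' | v'
          · rw [hh] at hx
            exact congrArg inl (Sum.inl_injective hx)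
          · rw [hh] at hx
            exact absurd hx Sum.inr_ne_inl
      change _ ↔ γ.toRib.T (inl i) j
      rw [toRib_T, toRib_T]
      constructor
      · rintro ⟨hi, rfl⟩
        exact ⟨key.mp hi, (h.outTriv _ _ _).symm⟩
      · rintro ⟨hi, rfl⟩
        exact ⟨key.mpr hi, h.outTriv _ _ _⟩
    · rw [Rib.ren_T]
      exact iff_of_false (not_toRib_T _ _ _) (not_toRib_T _ _ _)

theorem relabel_eq_map (γ : Graph I J E V) (α : I ≃ I') (β : J ≃ J') :
    γ.relabel α β = γ.map α β (.refl E) (.refl V) := by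
  apply toRib_injective
  rw [toRib_map]
  refine Rib.ext ?_ (Equiv.ext fun _ => rfl) rfl ?_
  · ext x
    rcases x with ⟨e, s⟩
    rfl
  · ext p j
    rcases p with i | v
    · rw [Rib.ren_T]
      change _ ↔ γ.toRib.T (inl (α.symm i)) (β.symm j)
      rw [toRib_T, toRib_T]
      constructor
      · rintro ⟨hi, rfl⟩
        exact ⟨fun x hx => hi x (by change Sum.map α id (γ.vtx x) = _; rw [hx]; simp),
          (β.symm_apply_apply _).symm⟩
      · rintro ⟨hi, hh⟩
        refine ⟨fun x hx => hi x ?_, ?_⟩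
        · change Sum.map α id (γ.vtx x) = _ at hx
          rcases hv : γ.vtx x with i' | v'
          · rw [hv] at hx
            rw [← Sum.inl_injective hx]
            simp
          · rw [hv] at hx
            exact absurd hx Sum.inr_ne_inl
        · rw [eq_symm_apply] at hh
          exact hh
    · rw [Rib.ren_T]
      exact iff_of_false (not_toRib_T _ _ _) (not_toRib_T _ _ _)

end Graph

end RibbonProp

namespace RibbonProp

/-! ### Gluings and expansions of graphs in terms of their surfaces -/

variable {I I' J J' K K' E E' V V' E1 E1' V1 V1' E2 E2' V2 V2' : Type}

namespace Graph

section Gluing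

variable {γ1 : Graph I J E1 V1} {γ2 : Graph J K E2 V2} {γ : Graph I K (E1 ⊕ E2) (V1 ⊕ V2)}

theorem gluingWalk_eq (γ : Graph I K (E1 ⊕ E2) (V1 ⊕ V2)) : γ.gluingWalk =
    extendPerm (Prod.map inl id : E1 × Bool → (E1 ⊕ E2) × Bool) (flip E1) * γ.next := by
  have S := splitSum E1 E2
  ext1 y
  rw [Perm.mul_apply]
  change sumPerm _ _ (γ.next y) = _
  rcases S.cover (γ.next y) with ⟨h, hh⟩ | ⟨h, hh⟩
  · rw [← hh, extendPerm_apply S.inj1, sumPerm_left]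
  · rw [← hh, extendPerm_of_notMem _ _ (S.notMem1 _), sumPerm_right]
    rfl

/-- The surfaces glued in a composition `γ1 ∘ γ2` are that of `γ1` together with the vertices of
positive type of `γ2`, and that of `γ2`. -/
abbrev IsGl (γ1 : Graph I J E1 V1) (γ2 : Graph J K E2 V2)
    (γ : Graph I K (E1 ⊕ E2) (V1 ⊕ V2)) : Prop :=
  Gl (Prod.map inl id) (Prod.map inr id) (γ1.toRib.add V2) γ2.toRib
    (γ.toRib.ren (sumAssoc I V1 V2).symm (.refl K) (.refl (E1 ⊕ E2)))

theorem ren_refl_next (γ : Graph I K E V) {P : Type} (α : I ⊕ V ≃ P) :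
    (γ.toRib.ren α (.refl K) (.refl E)).next = γ.next := Equiv.ext fun _ => rfl

theorem ren_refl_walk (γ : Graph I K E V) {P : Type} (α : I ⊕ V ≃ P) :
    (γ.toRib.ren α (.refl K) (.refl E)).walk = γ.walk := Equiv.ext fun _ => rfl

theorem IsGluing.shuffle [Finite E1] [Finite E2] (h : IsGluing γ1 γ2 γ) :
    Shuffle (Prod.map inl id) (Prod.map inr id) (flip (E1 ⊕ E2)) (γ1.toRib.add V2)
      γ2.toRib γ.next := by
  have S := splitSum E1 E2
  have hG := γ.gluingWalk_eq
  have h1 : Induces (Prod.map inl id : E1 × Bool → (E1 ⊕ E2) × Bool) γ.gluingWalk γ1.walk :=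
    fun x => h.walk_left x.1 x.2
  have h2 : Induces (Prod.map inr id : E2 × Bool → (E1 ⊕ E2) × Bool) γ.gluingWalk γ2.next :=
    fun x => h.walk_right x.1 x.2
  refine ⟨?_, ?_, ?_⟩
  · have := h1.mul (extendPerm_apply S.inj1 (flip E1)⁻¹) (fun _ => extendPerm_of_notMem _ _)
    rw [hG, extendPerm_inv_mul] at this
    change Induces _ _ ((flip E1)⁻¹ * (flip E1 * γ1.next)) at this
    rwa [inv_mul_cancel_left] at this
  · have := h2.mul (extendPerm_apply S.inj2 (flip E2)) (fun _ => extendPerm_of_notMem _ _)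
    rw [hG, S.extendPerm_mul'] at this
    exact this
  · intro y x
    rw [← hG]
    constructor
    · intro hc
      -- a cycle which meets both parts passes through a vertex of the first graph
      have hv : ∃ y', γ.vtx (Prod.map inr id x) = γ.vtx (Prod.map inl id y') := by
        obtain ⟨y', hy'⟩ := exists_sameCycle_of_extendPerm_mul (hG ▸ hc.symm)
        exact ⟨y', (γ.sameCycle_next _ _).mp hy'⟩
      obtain ⟨⟨e', s'⟩, hv⟩ := hv
      change _ = γ.vtx (inl e', s') at hv
      rw [h.vtx_left] at hv
      obtain ⟨e, s⟩ := x
      rcases hx : γ2.vtx (e, s) with j | v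
      · rcases h.attach e s j hx with ⟨z, rfl, hz⟩ | ⟨i, hi, rfl, hz⟩
        · have hc' := hc.trans hz.symm
          rw [← h1.sameCycle_iff S.inj1] at hc'
          have := (γ1.sameCycle_walk _ _).mp hc'
          rw [toRib_vtx, hx, ← this]
          rfl
        · change γ.vtx (inr e, s) = _ at hv
          rw [hz] at hv
          rcases hh : γ1.vtx (e', s') with i' | v'
          · rw [hh] at hv
            exact absurd (hh.trans (congrArg inl (Sum.inl_injective hv.symm))) (hi _)
          · rw [hh] at hv
            exact absurd hv Sum.inl_ne_inr
      · have := h.vtx_right e s v hx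
        change γ.vtx (inr e, s) = _ at hv
        rw [this] at hv
        rcases hh : γ1.vtx (e', s') with i' | v' <;> simp [hh] at hv
    · intro hv
      obtain ⟨e, s⟩ := x
      rcases h.attach e s (γ1.out y) hv.symm with ⟨z, hz, hz'⟩ | ⟨i, hi, hi', -⟩
      · have := (γ1.sameCycle_walk _ _).mpr hz.symm
        exact ((h1.sameCycle_iff S.inj1 _ _).mp this).trans hz'
      · exact absurd hi'.symm (γ1.out_ne_outTriv _ _ _)

theorem IsGluing.isGl [Finite E1] [Finite E2] (h : IsGluing γ1 γ2 γ) : IsGl γ1 γ2 γ := by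
  have hS := h.shuffle
  have hS' := hS
  rw [← γ.ren_refl_next (sumAssoc I V1 V2).symm] at hS'
  have hv2 : ∀ x p, (γ1.toRib.add V2).T p (γ2.vtx x) →
      (sumAssoc I V1 V2).symm (γ.vtx (Prod.map inr id x)) = p := by
    rintro ⟨e, s⟩ p hp
    change (sumAssoc I V1 V2).symm (γ.vtx (inr e, s)) = p
    rcases hx : γ2.vtx (e, s) with j | v
    · rw [hx] at hp
      rcases p with (i | v') | q
      · rw [Rib.add_T_inl, toRib_T] at hp
        obtain ⟨hi, rfl⟩ := hp
        rcases h.attach e s _ hx with ⟨z, hz, -⟩ | ⟨i', hi', hh, hz⟩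
        · exact absurd hz (γ1.out_ne_outTriv _ _ _)
        · rw [hz, γ1.outTriv_injective _ _ _ _ hh]
          rfl
      · simp at hp
      · simp at hp
    · rw [hx] at hp
      rw [h.vtx_right e s v hx]
      rcases p with p | q
      · simp at hp
      · rw [Rib.add_T_inr] at hp
        rw [hp]
        rfl
  refine { toShuffle := hS', vtx1 := ?_, out2 := ?_, vtx2 := hv2, out1 := ?_, T_iff := ?_ }
  · rintro ⟨e, s⟩
    change (sumAssoc I V1 V2).symm (γ.vtx (inl e, s)) = inl (γ1.vtx (e, s))
    rw [h.vtx_left]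
    rcases γ1.vtx (e, s) with i | v <;> rfl
  · rintro ⟨e, s⟩
    exact h.out_right e s
  · rintro ⟨e, s⟩ k hk
    change γ2.toRib.T (inl (γ1.out (e, s))) k at hk
    rw [toRib_T] at hk
    obtain ⟨hj, rfl⟩ := hk
    exact h.out_left e s hj
  · intro p k
    rw [Rib.ren_T]
    rcases p with (i | v) | v
    · change γ.toRib.T (inl i) k ↔ _
      rw [toRib_T]
      constructor
      · rintro ⟨hi, rfl⟩
        have hi1 : ∀ x, γ1.vtx x ≠ inl i := fun x hx => hi (inl x.1, x.2) (by
          rw [h.vtx_left]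
          exact congrArg (Sum.map id inl) hx)
        have hj : ∀ x, γ2.vtx x ≠ inl (γ1.outTriv i hi1) := fun x hx => by
          have := hv2 x (inl (inl i)) (by
            rw [hx, Rib.add_T_inl, toRib_T]
            exact ⟨hi1, rfl⟩)
          rw [symm_apply_eq] at this
          exact hi _ this
        refine ⟨inl (γ1.outTriv i hi1), ?_, ?_⟩
        · rw [Rib.add_T_inl, toRib_T]
          exact ⟨hi1, rfl⟩
        · rw [toRib_T]
          exact ⟨hj, (h.outTriv _ _ _ _).symm⟩
      · rintro ⟨j | v, hj, hk⟩
        · rw [Rib.add_T_inl, toRib_T] at hj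
          rw [toRib_T] at hk
          obtain ⟨hi, rfl⟩ := hj
          obtain ⟨hj, rfl⟩ := hk
          have hi1 : ∀ e s, γ.vtx (inl e, s) ≠ inl i := fun e s hv => by
            rw [h.vtx_left] at hv
            rcases hh : γ1.vtx (e, s) with i' | v'
            · rw [hh] at hv
              exact hi _ (hh.trans (congrArg inl (Sum.inl_injective hv)))
            · rw [hh] at hv
              exact absurd hv Sum.inr_ne_inl
          have hγ : ∀ x, γ.vtx x ≠ inl i := by
            rintro ⟨e | e, s⟩ hv
            · exact hi1 e s hv
            · rcases hS.attached (e, s) with ⟨p, hp⟩ | ⟨y, hy⟩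
              · have hp' := hv2 _ _ hp
                rw [symm_apply_eq] at hp'
                change γ.vtx (inr e, s) = _ at hp'
                rw [hv] at hp'
                obtain rfl : p = inl (inl i) := by
                  rw [← symm_apply_eq] at hp'
                  exact hp'.symm
                have := (γ1.toRib.add V2).T_fun _ _ (inl (γ1.outTriv i hi)) hp (by
                  rw [Rib.add_T_inl, toRib_T]
                  exact ⟨hi, rfl⟩)
                exact hj _ this
              · rw [γ.sameCycle_next] at hy
                exact hi1 y.1 y.2 (hy.symm.trans hv)
          exact ⟨hγ, h.outTriv _ _ _ _⟩
        · simp at hj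
    · change γ.toRib.T (inr _) k ↔ _
      simp
    · change γ.toRib.T (inr _) k ↔ _
      simp

theorem IsGl.isGluing (h : IsGl γ1 γ2 γ) : IsGluing γ1 γ2 γ := by
  have S := splitSum E1 E2
  have hG := γ.gluingWalk_eq
  have hn := γ.ren_refl_next (sumAssoc I V1 V2).symm
  have hL := h.induces_left S
  have hR := h.induces_right S
  have hglue := h.glue
  rw [hn, ← hG] at hL hR hglue
  have hout : ∀ i hi j, γ1.outTriv i hi = j →
      (γ1.toRib.add V2).T (inl (inl i)) (inl j) := fun i hi j hj => by
    rw [Rib.add_T_inl, toRib_T]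
    exact ⟨hi, hj⟩
  constructor
  · intro e s
    have := h.vtx1 (e, s)
    change (sumAssoc I V1 V2).symm (γ.vtx (inl e, s)) = inl (γ1.vtx (e, s)) at this
    rw [symm_apply_eq] at this
    rw [this]
    rcases γ1.vtx (e, s) with i | v <;> rfl
  · intro e s v hv
    have := h.vtx2 (e, s) (inr v) (by rw [toRib_vtx, hv, Rib.add_T_inr])
    change (sumAssoc I V1 V2).symm (γ.vtx (inr e, s)) = inr v at this
    rw [symm_apply_eq] at this
    exact this
  · exact fun e s => hL (e, s)
  · exact fun e s => hR (e, s)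
  · intro e s j hj
    rcases γ1.out_surjective j with ⟨y, rfl⟩ | ⟨i, hi, hij⟩
    · refine Or.inl ⟨y, rfl, (hglue y (e, s)).mpr ?_⟩
      rw [toRib_vtx, hj]
      rfl
    · refine Or.inr ⟨i, hi, hij, ?_⟩
      have := h.vtx2 (e, s) (inl (inl i)) (by
        rw [toRib_vtx, hj]
        exact hout i hi j hij)
      change (sumAssoc I V1 V2).symm (γ.vtx (inr e, s)) = _ at this
      rw [symm_apply_eq] at this
      exact this
  · exact fun e s => h.out2 (e, s)
  · intro e s hj
    exact h.out1 (e, s) _ ((γ2.toRib_T _ _).mpr ⟨hj, rfl⟩)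
  · intro i hi hi1 hj
    have := (h.T_iff (inl (inl i)) (γ2.outTriv (γ1.outTriv i hi1) hj)).mpr
      ⟨_, hout i hi1 _ rfl, (γ2.toRib_T _ _).mpr ⟨hj, rfl⟩⟩
    obtain ⟨_, h'⟩ := (γ.toRib_T i _).mp this
    exact h'

/-- The definitions of gluings of graphs by walks along boundaries and by surfaces agree. -/
theorem isGluing_iff [Finite E1] [Finite E2] : IsGluing γ1 γ2 γ ↔ IsGl γ1 γ2 γ :=
  ⟨IsGluing.isGl, IsGl.isGluing⟩

end Gluing

section Expansion

/-- Names of the vertices of an expansion. -/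
def optionSum (I V : Type) : I ⊕ Option V ≃ Option (I ⊕ V) where
  toFun := Sum.elim (fun i => some (inl i)) fun v => v.elim none fun v => some (inr v)
  invFun p := p.elim (inr none) (Sum.map id some)
  left_inv := by rintro (i | _ | v) <;> rfl
  right_inv := by rintro (_ | i | v) <;> rfl

@[simp] theorem optionSum_inl (i : I) : optionSum I V (inl i) = some (inl i) := rfl

@[simp] theorem optionSum_none : optionSum I V (inr none) = none := rfl

@[simp] theorem optionSum_some (v : V) : optionSum I V (inr (some v)) = some (inr v) := rfl

@[simp] theorem optionSum_map (u : I ⊕ V) : optionSum I V (Sum.map id some u) = some u := by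
  rcases u with i | v <;> rfl

variable {γ : Graph I J E V} {u : I ⊕ V} {γ' : Graph I J (Option E) (Option V)}

/-- The surface of `γ'` is an expansion of that of `γ`. -/
abbrev IsEx (γ : Graph I J E V) (u : I ⊕ V) (γ' : Graph I J (Option E) (Option V)) : Prop :=
  IsExp (fun s => (none, s)) (Prod.map some id) u γ.toRib
    (γ'.toRib.ren (optionSum I V) (.refl J) (.refl (Option E)))

theorem elim_optionSum (u : I ⊕ V) (p : I ⊕ Option V) :
    (optionSum I V p).elim u id = Sum.elim inl (fun v => v.elim u inr) p := by
  rcases p with i | _ | v <;> rfl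

theorem IsExpansion.isEx (h : IsExpansion γ u γ') : IsEx γ u γ' := by
  have S := splitOption E
  have hin : ∀ r e s, γ'.vtx (some e, s) = Sum.map id some r → γ.vtx (e, s) = r := by
    intro r e s hr
    rw [← h.vtx, hr]
    rcases r with i | v <;> rfl
  have hu : ∀ i, (∀ x, γ.vtx x ≠ inl i) → inl i ≠ u → ∀ x, γ'.vtx x ≠ inl i := by
    rintro i hi hiu ⟨_ | e, s⟩ hx
    · cases s
      · rw [h.target] at hx
        rcases u with i' | v
        · exact hiu (congrArg inl (Sum.inl_injective hx).symm)
        · exact absurd hx Sum.inr_ne_inl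
      · rw [h.source] at hx
        exact absurd hx Sum.inr_ne_inl
    · exact hi _ (hin (inl i) e s hx)
  constructor
  · exact congrArg (optionSum I V) h.source
  · exact (congrArg (optionSum I V) h.target).trans (optionSum_map u)
  · rintro ⟨e, s⟩
    exact (elim_optionSum u _).trans (h.vtx e s)
  · rw [ren_refl_walk]
    exact fun x => h.walk x.1 x.2
  · exact fun x => h.out x.1 x.2
  · intro k b hk
    rcases u with i | v
    swap
    · simp at hk
    rw [toRib_T] at hk
    obtain ⟨hi, rfl⟩ := hk
    change γ'.out (none, b) = _
    -- the two new half-edges are alone at their vertices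
    have hfix : ∀ s, γ'.next (none, s) = (none, s) := by
      intro s
      have hv := (γ'.sameCycle_next (none, s) (γ'.next (none, s))).mp ⟨1, rfl⟩
      rcases hh : γ'.next (none, s) with ⟨_ | e, s'⟩
      · rw [hh] at hv
        cases s <;> cases s' <;> simp_all [h.source, h.target]
      · rw [hh] at hv
        refine absurd ?_ (hi (e, s'))
        rw [← h.vtx, ← hv]
        cases s
        · rw [h.target]; rfl
        · rw [h.source]; rfl
    have hsame : ∀ s, γ'.out (none, s) = γ'.out (none, !s) := fun s => by
      rw [← γ'.sameCycle_walk]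
      refine ⟨1, ?_⟩
      rw [zpow_one]
      change flip _ (γ'.next (none, s)) = _
      rw [hfix]
      rfl
    rcases γ'.out_surjective (γ.outTriv i hi) with ⟨⟨_ | e, s⟩, hs⟩ | ⟨i', hi', hh⟩
    · by_cases hsb : b = s
      · rw [hsb, hs]
      · rw [← hs, hsame b]
        congr
        cases b <;> cases s <;> first | rfl | exact absurd rfl hsb
    · rw [h.out] at hs
      exact absurd hs (γ.out_ne_outTriv _ _ _)
    · have hi'0 : ∀ x, γ.vtx x ≠ inl i' := fun x hx => by
        have h1 := h.vtx x.1 x.2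
        rw [hx] at h1
        rcases h2 : γ'.vtx (some x.1, x.2) with j | _ | v
        · rw [h2] at h1
          exact hi' _ (h2.trans (congrArg inl (Sum.inl_injective h1)))
        · rw [h2] at h1
          exact hi' (none, false) (h.target.trans (congrArg (Sum.map id some) h1))
        · rw [h2] at h1
          exact absurd h1 Sum.inr_ne_inl
      rw [h.outTriv i' hi'0 hi'] at hh
      obtain rfl := γ.outTriv_injective _ _ _ _ hh
      exact absurd h.target (hi' _)
  · intro r k hr
    rcases r with i | v
    · change γ'.toRib.T (inl i) k ↔ γ.toRib.T (inl i) k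
      rw [toRib_T, toRib_T]
      constructor
      · rintro ⟨hi', rfl⟩
        have hi : ∀ x, γ.vtx x ≠ inl i := fun x hx => by
          have h1 := h.vtx x.1 x.2
          rw [hx] at h1
          rcases h2 : γ'.vtx (some x.1, x.2) with j | _ | v
          · rw [h2] at h1
            exact hi' _ (h2.trans (congrArg inl (Sum.inl_injective h1)))
          · rw [h2] at h1
            exact hr h1.symm
          · rw [h2] at h1
            exact absurd h1 Sum.inr_ne_inl
        exact ⟨hi, (h.outTriv _ _ _).symm⟩
      · rintro ⟨hi, rfl⟩
        exact ⟨hu i hi hr, h.outTriv _ _ _⟩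
    · exact iff_of_false (not_toRib_T _ _ _) (not_toRib_T _ _ _)

theorem IsEx.isExpansion (h : IsEx γ u γ') : IsExpansion γ u γ' where
  source := (optionSum I V).injective h.source
  target := (optionSum I V).injective (h.target.trans (optionSum_map u).symm)
  vtx e s := (elim_optionSum u _).symm.trans (h.vtx (e, s))
  walk e s := by
    have := h.walk (e, s)
    rw [ren_refl_walk] at this
    exact this
  out e s := h.out (e, s)
  outTriv i hi hi' := by
    have hiu : inl i ≠ u := by
      rintro rfl
      exact hi' _ ((optionSum I V).injective h.target)
    obtain ⟨_, h'⟩ := (γ'.toRib_T i _).mp ((h.T_iff (inl i) _ hiu).mpr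
      ((γ.toRib_T i _).mpr ⟨hi, rfl⟩))
    exact h'

theorem isExpansion_iff : IsExpansion γ u γ' ↔ IsEx γ u γ' := ⟨IsExpansion.isEx, IsEx.isExpansion⟩

/-- The expansions of a graph are the gluings with the surface which has one edge. -/
theorem isExpansion_iff_gl [Finite E] : IsExpansion γ u γ' ↔
    Gl (fun s => (none, s)) (Prod.map some id) (eps u) γ.toRib
      (γ'.toRib.ren (optionSum I V) (.refl J) (.refl (Option E))) :=
  isExpansion_iff.trans ⟨fun h => h.gl (splitOption E), Gl.isExp⟩

end Expansion

end Graph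

end RibbonProp

namespace RibbonProp

/-! ### Finite sums -/

section Finsum

variable {A B M N : Type*} [AddCommGroup M] [AddCommGroup N]

theorem finsum_subtype_equiv {P : A → Prop} {Q : B → Prop} {f : A → M} {g : B → M} (e : A ≃ B)
    (h : ∀ x, P x ↔ Q (e x)) (hfg : ∀ x, P x → f x = g (e x)) :
    ∑ᶠ x : {x // P x}, f x = ∑ᶠ y : {y // Q y}, g y :=
  finsum_eq_of_bijective _ (e.subtypeEquiv h).bijective fun x => hfg x.1 x.2

theorem finsum_subtype_congr {P Q : A → Prop} {f g : A → M} (h : ∀ x, P x ↔ Q x)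
    (hfg : ∀ x, P x → f x = g x) : ∑ᶠ x : {x // P x}, f x = ∑ᶠ y : {y // Q y}, g y :=
  finsum_subtype_equiv (.refl A) h hfg

theorem finsum_finsum_subtype [Finite A] [Finite B] {Q : A → B → Prop}
    (hu : ∀ x x' y, Q x y → Q x' y → x = x') (f : B → M) :
    ∑ᶠ x : A, ∑ᶠ y : {y // Q x y}, f y = ∑ᶠ y : {y // ∃ x, Q x y}, f y := by
  have h1 : ∀ P : B → Prop, ∑ᶠ y : {y // P y}, f y = ∑ᶠ y ∈ {y | P y}, f y := fun P =>
    finsum_set_coe_eq_finsum_mem {y | P y}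
  simp only [h1]
  rw [← finsum_mem_iUnion (t := fun x => {y | Q x y}) ?_ fun _ => Set.toFinite _]
  · congr
    ext y
    simp
  · intro x x' hx
    refine Set.disjoint_left.mpr fun y hy hy' => hx (hu _ _ _ hy hy')

theorem finsum_subtype_finsum_subtype [Finite A] [Finite B] {P : A → Prop} {Q : A → B → Prop}
    (hu : ∀ x x' y, P x → P x' → Q x y → Q x' y → x = x') (f : B → M) :
    ∑ᶠ x : {x // P x}, ∑ᶠ y : {y // Q x y}, f y = ∑ᶠ y : {y // ∃ x, P x ∧ Q x y}, f y := by
  rw [finsum_finsum_subtype (Q := fun (x : {x // P x}) y => Q x y)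
    (fun x x' y h h' => Subtype.ext (hu _ _ _ x.2 x'.2 h h'))]
  exact finsum_subtype_congr (fun y => by simp [Subtype.exists, exists_prop]) fun _ _ => rfl

theorem finsum_subtype_add [Finite A] {P Q R : A → Prop} (h : ∀ x, R x ↔ P x ∨ Q x)
    (hd : ∀ x, P x → ¬ Q x) (f : A → M) :
    ∑ᶠ x : {x // R x}, f x = ∑ᶠ x : {x // P x}, f x + ∑ᶠ x : {x // Q x}, f x := by
  have h1 : ∀ P : A → Prop, ∑ᶠ y : {y // P y}, f y = ∑ᶠ y ∈ {y | P y}, f y := fun P =>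
    finsum_set_coe_eq_finsum_mem {y | P y}
  have hd' : Disjoint {x | P x} {x | Q x} := Set.disjoint_left.mpr hd
  have hR : {x | R x} = {x | P x} ∪ {x | Q x} := Set.ext h
  rw [h1, h1, h1, ← finsum_mem_union hd' (Set.toFinite _) (Set.toFinite _), hR]

theorem map_finsum_of_finite [Finite A] (L : M →+ N) (f : A → M) :
    L (∑ᶠ x, f x) = ∑ᶠ x, L (f x) := L.map_finsum (Set.toFinite _)

theorem units_smul_finsum (u : ℤˣ) (f : A → M) : u • ∑ᶠ x, f x = ∑ᶠ x, u • f x :=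
  AddEquiv.map_finsum (DistribMulAction.toAddEquiv M u) f

end Finsum

theorem map_units_smul {𝕜 M N : Type*} [Ring 𝕜] [AddCommGroup M] [AddCommGroup N] [Module 𝕜 M]
    [Module 𝕜 N] (L : M →ₗ[𝕜] N) (u : ℤˣ) (x : M) : L (u • x) = u • L x := by
  rw [Units.smul_def, Units.smul_def, map_zsmul]

/-! ### Oriented graphs given by graphs and words -/

variable {I I' J J' A B E E' V V' E1 E1' V1 V1' E2 E2' V2 V2' : Type}

/-- The word contains every edge and every vertex of positive type once. -/
def IsOrientation (w : List (E ⊕ V)) : Prop := w.Nodup ∧ ∀ x, x ∈ w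

theorem IsOrientation.perm {w w' : List (E ⊕ V)} (h : IsOrientation w) (hw : w.Perm w') :
    IsOrientation w' := ⟨hw.nodup_iff.mp h.1, fun x => hw.mem_iff.mp (h.2 x)⟩

theorem isOrientation_map (a : E ≃ E') (b : V ≃ V') (w : List (E ⊕ V)) :
    IsOrientation (w.map (Sum.map a b)) ↔ IsOrientation w := by
  have h : (Sum.map a b : E ⊕ V → E' ⊕ V') = a.sumCongr b := rfl
  refine and_congr (List.nodup_map_iff (by rw [h]; exact Equiv.injective _)) ?_
  rw [h, ← Equiv.forall_congr_right (a.sumCongr b)]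
  exact forall_congr' fun x => List.mem_map_of_injective (Equiv.injective _)

/-- The degree of a word. -/
def wordDeg (d : ℤ) (γ : Graph I J E V) (w : List (E ⊕ V)) : ℤ := (w.map (γ.letterDeg d)).sum

@[simp] theorem wordDeg_nil (d : ℤ) (γ : Graph I J E V) : wordDeg d γ [] = 0 := rfl

@[simp] theorem wordDeg_cons (d : ℤ) (γ : Graph I J E V) (x : E ⊕ V) (w : List (E ⊕ V)) :
    wordDeg d γ (x :: w) = γ.letterDeg d x + wordDeg d γ w := by simp [wordDeg]

@[simp] theorem wordDeg_append (d : ℤ) (γ : Graph I J E V) (w w' : List (E ⊕ V)) :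
    wordDeg d γ (w ++ w') = wordDeg d γ w + wordDeg d γ w' := by simp [wordDeg]

theorem wordDeg_map_eq (d : ℤ) (γ : Graph I J E V) (γ' : Graph I' J' E' V')
    {f : E ⊕ V → E' ⊕ V'} {w : List (E ⊕ V)}
    (h : ∀ x ∈ w, γ'.letterDeg d (f x) = γ.letterDeg d x) :
    wordDeg d γ' (w.map f) = wordDeg d γ w := by
  rw [wordDeg, List.map_map, wordDeg]
  exact congrArg List.sum (List.map_congr_left h)

section Word

variable (𝕜 : Type*) [Field 𝕜] (d : ℤ) [Finite E] [Finite V] [Finite E'] [Finite V']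

/-- The oriented graph given by a graph and a word. -/
def OGraph.ofWord (γ : Graph I J E V) (w : List (E ⊕ V)) (h : IsOrientation w) : OGraph I J :=
  ⟨E, V, inferInstance, inferInstance, γ, w, h.1, h.2⟩

/-- The element given by a graph and a word, which is zero if the word is not an orientation. -/
def wcls (γ : Graph I J E V) (w : List (E ⊕ V)) : DGInf 𝕜 d I J :=
  if h : IsOrientation w then cls 𝕜 d (OGraph.ofWord γ w h) else 0

theorem wcls_of_not {γ : Graph I J E V} {w : List (E ⊕ V)} (h : ¬ IsOrientation w) :
    wcls 𝕜 d γ w = 0 := dif_neg h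

theorem wcls_eq {γ : Graph I J E V} {w : List (E ⊕ V)} (h : IsOrientation w) :
    wcls 𝕜 d γ w = cls 𝕜 d (OGraph.ofWord γ w h) := dif_pos h

theorem OGraph.isOrientation (Γ : OGraph I J) : IsOrientation Γ.word := ⟨Γ.nodup, Γ.complete⟩

theorem cls_eq_wcls (Γ : OGraph I J) : cls 𝕜 d Γ = wcls 𝕜 d Γ.graph Γ.word :=
  (wcls_eq 𝕜 d Γ.isOrientation).symm

theorem cls_eq_of_relation {Γ Γ' : OGraph I J} {u : ℤˣ}
    (h : Relation 𝕜 d I J (Finsupp.single Γ 1 - u • Finsupp.single Γ' 1)) :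
    cls 𝕜 d Γ = u • cls 𝕜 d Γ' := by
  have h1 := (Submodule.Quotient.eq _).mpr (Submodule.subset_span (R := 𝕜) h)
  rw [cls, h1, cls, Units.smul_def, Units.smul_def]
  exact map_zsmul (Submodule.mkQ _) (u : ℤ) (Finsupp.single Γ' (1 : 𝕜))

theorem wcls_map (γ : Graph I J E V) (a : E ≃ E') (b : V ≃ V') (w : List (E ⊕ V)) :
    wcls 𝕜 d (γ.map (.refl I) (.refl J) a b) (w.map (Sum.map a b)) = wcls 𝕜 d γ w := by
  by_cases h : IsOrientation w
  · rw [wcls_eq 𝕜 d h, wcls_eq 𝕜 d ((isOrientation_map a b w).mpr h)]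
    have := cls_eq_of_relation 𝕜 d (u := 1) (by
      rw [one_smul]
      exact Relation.iso (OGraph.ofWord γ w h) (OGraph.ofWord _ _ ((isOrientation_map a b w).mpr h))
        a b (γ.isIso_map a b) rfl)
    exact (this.trans (one_smul ℤˣ _)).symm
  · rw [wcls_of_not 𝕜 d h, wcls_of_not 𝕜 d (fun h' => h ((isOrientation_map a b w).mp h'))]

theorem wcls_swap (γ : Graph I J E V) (l1 l2 : List (E ⊕ V)) (x y : E ⊕ V) :
    wcls 𝕜 d γ (l1 ++ x :: y :: l2) =
      (γ.letterDeg d x * γ.letterDeg d y).negOnePow • wcls 𝕜 d γ (l1 ++ y :: x :: l2) := by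
  have hp : (l1 ++ x :: y :: l2).Perm (l1 ++ y :: x :: l2) := (List.Perm.swap y x l2).append_left l1
  by_cases h : IsOrientation (l1 ++ x :: y :: l2)
  · rw [wcls_eq 𝕜 d h, wcls_eq 𝕜 d (h.perm hp)]
    exact cls_eq_of_relation 𝕜 d (Relation.swap (OGraph.ofWord γ _ h) l1 l2 x y rfl)
  · rw [wcls_of_not 𝕜 d h, wcls_of_not 𝕜 d (fun h' => h (h'.perm hp.symm)), smul_zero]

/-- The sign for moving a letter to the right across the word `m`. -/
theorem wcls_move (γ : Graph I J E V) (l1 m l2 : List (E ⊕ V)) (x : E ⊕ V) :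
    wcls 𝕜 d γ (l1 ++ x :: (m ++ l2)) =
      (γ.letterDeg d x * wordDeg d γ m).negOnePow • wcls 𝕜 d γ (l1 ++ (m ++ x :: l2)) := by
  induction m generalizing l1 with
  | nil => simp
  | cons y m ih =>
    have := ih (l1 ++ [y])
    simp only [List.append_assoc, List.cons_append, List.nil_append] at this ⊢
    rw [wcls_swap, this, smul_smul, ← Int.negOnePow_add, wordDeg_cons, mul_add]

/-- Exchange of two blocks in a word. -/
theorem wcls_block (γ : Graph I J E V) (l1 m1 m2 l2 : List (E ⊕ V)) :
    wcls 𝕜 d γ (l1 ++ (m1 ++ (m2 ++ l2))) =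
      (wordDeg d γ m1 * wordDeg d γ m2).negOnePow • wcls 𝕜 d γ (l1 ++ (m2 ++ (m1 ++ l2))) := by
  induction m1 generalizing l1 with
  | nil => simp
  | cons x m1 ih =>
    have := ih (l1 ++ [x])
    simp only [List.append_assoc, List.cons_append, List.nil_append] at this ⊢
    rw [this, wcls_move, smul_smul, ← Int.negOnePow_add, wordDeg_cons]
    congr 2
    ring

end Word

/-- A linear map on the space of graphs given by its values on graphs with words. -/
structure WordMap (𝕜 : Type*) [Field 𝕜] (d : ℤ) (I J : Type) (M : Type*) [AddCommGroup M]
    [Module 𝕜 M] where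
  toFun : ∀ {E V : Type} [Finite E] [Finite V], Graph I J E V → List (E ⊕ V) → M
  swap : ∀ {E V : Type} [Finite E] [Finite V] (γ : Graph I J E V) (l1 l2 : List (E ⊕ V))
    (x y : E ⊕ V), IsOrientation (l1 ++ x :: y :: l2) → toFun γ (l1 ++ x :: y :: l2) =
      (γ.letterDeg d x * γ.letterDeg d y).negOnePow • toFun γ (l1 ++ y :: x :: l2)
  iso : ∀ {E V E' V' : Type} [Finite E] [Finite V] [Finite E'] [Finite V'] (γ : Graph I J E V)
    (a : E ≃ E') (b : V ≃ V') (w : List (E ⊕ V)), IsOrientation w →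
    toFun (γ.map (.refl I) (.refl J) a b) (w.map (Sum.map a b)) = toFun γ w

section Lift

variable {𝕜 : Type*} [Field 𝕜] {d : ℤ} {M : Type*} [AddCommGroup M] [Module 𝕜 M]

/-- The linear map given by a `WordMap`. -/
def WordMap.lin (F : WordMap 𝕜 d I J M) : DGInf 𝕜 d I J →ₗ[𝕜] M :=
  Submodule.liftQ _ (Finsupp.linearCombination 𝕜 fun Γ : OGraph I J => F.toFun Γ.graph Γ.word) <| by
    rw [Submodule.span_le]
    rintro r (⟨Γ, l1, l2, x, y, hw⟩ | ⟨Γ, Γ', a, b, h, hw⟩)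
    · rw [SetLike.mem_coe, LinearMap.mem_ker, map_sub, map_units_smul]
      simp only [Finsupp.linearCombination_single, one_smul]
      rw [sub_eq_zero]
      change F.toFun Γ.graph Γ.word = _ • F.toFun Γ.graph (l1 ++ y :: x :: l2)
      rw [hw, F.swap _ _ _ _ _ (hw ▸ Γ.isOrientation)]
    · rw [SetLike.mem_coe, LinearMap.mem_ker, map_sub]
      simp only [Finsupp.linearCombination_single, one_smul]
      rw [sub_eq_zero, hw, h.eq_map, F.iso _ _ _ _ Γ.isOrientation]

theorem WordMap.lin_cls (F : WordMap 𝕜 d I J M) (Γ : OGraph I J) :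
    F.lin (cls 𝕜 d Γ) = F.toFun Γ.graph Γ.word := by
  change Finsupp.linearCombination 𝕜 _ (Finsupp.single Γ 1) = _
  rw [Finsupp.linearCombination_single, one_smul]

theorem WordMap.lin_wcls [Finite E] [Finite V] (F : WordMap 𝕜 d I J M) (γ : Graph I J E V)
    {w : List (E ⊕ V)} (h : IsOrientation w) : F.lin (wcls 𝕜 d γ w) = F.toFun γ w := by
  rw [wcls_eq 𝕜 d h, F.lin_cls]
  rfl

theorem span_cls : Submodule.span 𝕜 (Set.range (cls 𝕜 d (I := I) (J := J))) = ⊤ := by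
  rw [← DG_top, DG]
  congr
  ext x
  exact ⟨fun ⟨Γ, h⟩ => ⟨Γ, fun _ => le_top, h.symm⟩, fun ⟨Γ, _, h⟩ => ⟨Γ, h.symm⟩⟩

/-- Linear maps on the space of graphs agree if they do so on oriented graphs. -/
theorem DGInf.hom_ext {f g : DGInf 𝕜 d I J →ₗ[𝕜] M}
    (h : ∀ {E V : Type} [Finite E] [Finite V] (γ : Graph I J E V) (w : List (E ⊕ V)),
      IsOrientation w → f (wcls 𝕜 d γ w) = g (wcls 𝕜 d γ w)) : f = g := by
  refine LinearMap.ext_on span_cls ?_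
  rintro _ ⟨Γ, rfl⟩
  rw [cls_eq_wcls]
  exact h _ _ Γ.isOrientation

end Lift

end RibbonProp

namespace RibbonProp

/-! ### Types of vertices in gluings and expansions -/

variable {I I' J J' K K' A B E E' V V' E1 E1' V1 V1' E2 E2' V2 V2' : Type}

theorem card_subtype_sum [Finite E1] [Finite E2] (p : E1 ⊕ E2 → Prop) :
    Nat.card {x // p x} = Nat.card {e // p (inl e)} + Nat.card {e // p (inr e)} := by
  rw [Nat.card_congr subtypeSum, Nat.card_sum]

theorem card_subtype_option [Finite E] (p : Option E → Prop) :
    Nat.card {x // p x} = Nat.card {e // p (some e)} + if p none then 1 else 0 := by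
  rw [Nat.card_congr ((optionEquivSumPUnit.{0} E).subtypeEquiv
    (q := fun x => p ((optionEquivSumPUnit E).symm x)) fun x => by simp),
    card_subtype_sum]
  congr 1
  split_ifs with h
  · have : Unique {_e : PUnit // p none} := ⟨⟨⟨⟨⟩, h⟩⟩, fun _ => rfl⟩
    exact Nat.card_unique (α := {_e : PUnit // p none})
  · have : IsEmpty {_e : PUnit // p none} := ⟨fun x => h x.2⟩
    exact Nat.card_of_isEmpty (α := {_e : PUnit // p none})

namespace Graph

@[simp] theorem letterDeg_inl (d : ℤ) (γ : Graph I J E V) (e : E) : γ.letterDeg d (inl e) = 1 := rfl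

theorem letterDeg_inr (d : ℤ) (γ : Graph I J E V) (v : V) :
    γ.letterDeg d (inr v) = (γ.type v : ℤ) * (2 - d) + (d - 4) := rfl

theorem letterDeg_map (d : ℤ) (γ : Graph I J E V) (α : I ≃ I') (β : J ≃ J') (a : E ≃ E')
    (b : V ≃ V') (x : E ⊕ V) : (γ.map α β a b).letterDeg d (Sum.map a b x) = γ.letterDeg d x := by
  rcases x with e | v
  · rfl
  · rw [Sum.map_inr, letterDeg_inr, letterDeg_inr, type_map]

theorem map_symm_map (γ : Graph I J E V) (α : I ≃ I') (β : J ≃ J') (a : E ≃ E') (b : V ≃ V') :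
    (γ.map α β a b).map α.symm β.symm a.symm b.symm = γ := by
  rw [map_map]
  simp [map_refl]

/-- Renaming, as a bijection between sets of graphs. -/
def mapEquiv (α : I ≃ I') (β : J ≃ J') (a : E ≃ E') (b : V ≃ V') :
    Graph I J E V ≃ Graph I' J' E' V' where
  toFun γ := γ.map α β a b
  invFun γ := γ.map α.symm β.symm a.symm b.symm
  left_inv γ := γ.map_symm_map α β a b
  right_inv γ := γ.map_symm_map α.symm β.symm a.symm b.symm

section Gluing

variable {γ1 : Graph I J E1 V1} {γ2 : Graph J K E2 V2} {γ : Graph I K (E1 ⊕ E2) (V1 ⊕ V2)}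

theorem IsGluing.map [Finite E1] [Finite E2] (h : IsGluing γ1 γ2 γ) (α : I ≃ I') (β : J ≃ J')
    (δ : K ≃ K') (a1 : E1 ≃ E1') (b1 : V1 ≃ V1') (a2 : E2 ≃ E2') (b2 : V2 ≃ V2') :
    IsGluing (γ1.map α β a1 b1) (γ2.map β δ a2 b2)
      (γ.map α δ (a1.sumCongr a2) (b1.sumCongr b2)) := by
  have h1 := h.isGl.ren ((α.sumCongr b1).sumCongr b2) (β.sumCongr b2) δ a1 a2
  refine IsGl.isGluing ?_
  rw [Rib.add_ren, ← toRib_map, ← toRib_map] at h1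
  rw [IsGl, toRib_map γ, Rib.ren_ren]
  rw [Rib.ren_ren] at h1
  convert h1 using 2
  · ext (i | v | v) <;> rfl
  · rfl
  · rfl

theorem isGluing_map_iff [Finite E1] [Finite E2] (α : I ≃ I') (β : J ≃ J') (δ : K ≃ K')
    (a1 : E1 ≃ E1') (b1 : V1 ≃ V1') (a2 : E2 ≃ E2') (b2 : V2 ≃ V2') :
    IsGluing (γ1.map α β a1 b1) (γ2.map β δ a2 b2)
      (γ.map α δ (a1.sumCongr a2) (b1.sumCongr b2)) ↔ IsGluing γ1 γ2 γ := by
  refine ⟨fun h => ?_, fun h => h.map α β δ a1 b1 a2 b2⟩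
  have : Finite E1' := Finite.of_equiv _ a1
  have : Finite E2' := Finite.of_equiv _ a2
  have := h.map α.symm β.symm δ.symm a1.symm b1.symm a2.symm b2.symm
  rw [map_symm_map, map_symm_map] at this
  convert this
  exact (γ.map_symm_map α δ (a1.sumCongr a2) (b1.sumCongr b2)).symm

theorem IsGluing.vtx_inl_eq_iff (h : IsGluing γ1 γ2 γ) (e : E1) (s : Bool) (v : V1) :
    γ.vtx (inl e, s) = inr (inl v) ↔ γ1.vtx (e, s) = inr v := by
  rw [h.vtx_left]
  rcases γ1.vtx (e, s) with i | v' <;> simp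

theorem IsGluing.vtx_inl_ne (h : IsGluing γ1 γ2 γ) (e : E1) (s : Bool) (v : V2) :
    γ.vtx (inl e, s) ≠ inr (inr v) := by
  rw [h.vtx_left]
  rcases γ1.vtx (e, s) with i | v' <;> simp

theorem IsGluing.vtx_source (h : IsGluing γ1 γ2 γ) (e : E2) :
    ∃ v, γ2.vtx (e, true) = inr v ∧ γ.vtx (inr e, true) = inr (inr v) := by
  rcases hv : γ2.vtx (e, true) with j | v
  · exact absurd hv (γ2.source_ne e j)
  · exact ⟨v, rfl, h.vtx_right e true v hv⟩

theorem IsGluing.type_left [Finite E1] [Finite E2] (h : IsGluing γ1 γ2 γ) (v : V1) :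
    γ.type (inl v) = γ1.type v := by
  rw [type, card_subtype_sum, type]
  simp only [h.vtx_inl_eq_iff]
  have : IsEmpty {e : E2 // γ.vtx (inr e, true) = inr (inl v)} := ⟨fun x => by
    obtain ⟨w, -, hw⟩ := h.vtx_source x.1
    rw [x.2] at hw
    simp at hw⟩
  rw [Nat.card_of_isEmpty (α := {e : E2 // _}), add_zero]

theorem IsGluing.type_right [Finite E1] [Finite E2] (h : IsGluing γ1 γ2 γ) (v : V2) :
    γ.type (inr v) = γ2.type v := by
  rw [type, card_subtype_sum, type]
  have : IsEmpty {e : E1 // γ.vtx (inl e, true) = inr (inr v)} := ⟨fun x => h.vtx_inl_ne _ _ _ x.2⟩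
  rw [Nat.card_of_isEmpty (α := {e : E1 // _}), zero_add]
  refine Nat.card_congr (subtypeEquivRight fun e => ?_)
  obtain ⟨w, hw, hw'⟩ := h.vtx_source e
  rw [hw, hw']
  simp

end Gluing

section Expansion

variable {γ : Graph I J E V} {u : I ⊕ V} {γ' : Graph I J (Option E) (Option V)}

theorem map_eps {P P' : Type} (α : P ≃ P') (u : P) :
    (eps u).map (optionCongr α) α (.refl Bool) (fun _ => rfl) = eps (α u) := by
  refine Rib.ext ?_ (Equiv.ext fun _ => rfl) rfl ?_
  · ext b : 1
    cases b <;> rfl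
  · ext p j
    change (eps u).T _ _ ↔ _
    rw [eps_T, eps_T, Ne, Ne, symm_apply_eq, symm_apply_eq]
    simp

theorem IsExpansion.map [Finite E] (h : IsExpansion γ u γ') (α : I ≃ I') (β : J ≃ J')
    (a : E ≃ E') (b : V ≃ V') :
    IsExpansion (γ.map α β a b) (Sum.map α b u) (γ'.map α β (optionCongr a) (optionCongr b)) := by
  have : Finite E' := Finite.of_equiv _ a
  rw [isExpansion_iff_gl] at h ⊢
  have h1 := Gl.map (splitOption E) h (optionCongr (α.sumCongr b)) (α.sumCongr b) β
    (.refl Bool) (a.prodCongr (.refl Bool))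
    ((optionCongr a).prodCongr (.refl Bool)) (i1' := fun s => (none, s))
    (i2' := Prod.map some id)
    (φ1' := boolNot) (φ2' := flip E') (φ' := flip (Option E'))
    (fun _ => rfl) (fun _ => rfl) (by rintro ⟨_ | e, s⟩ <;> rfl) (fun _ => rfl) (fun _ => rfl)
  rw [map_eps] at h1
  rw [toRib_map, toRib_map]
  convert h1 using 1
  · rfl
  · rfl
  change _ = (γ'.toRib.ren (optionSum I V) (.refl J) (.refl (Option E))).ren
    (optionCongr (α.sumCongr b)) β (optionCongr a)
  rw [Rib.ren_ren, Rib.ren_ren]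
  congr 1
  ext1 (i | _ | v) <;> rfl

theorem exists_isExpansion_map_iff [Finite E] (α : I ≃ I') (β : J ≃ J') (a : E ≃ E')
    (b : V ≃ V') :
    (∃ u, IsExpansion (γ.map α β a b) u
      (γ'.map α β (optionCongr a) (optionCongr b))) ↔ ∃ u, IsExpansion γ u γ' := by
  have : Finite E' := Finite.of_equiv _ a
  constructor
  · rintro ⟨u, h⟩
    have := h.map α.symm β.symm a.symm b.symm
    rw [map_symm_map] at this
    refine ⟨Sum.map α.symm b.symm u, ?_⟩
    convert this
    exact (γ'.map_symm_map α β (optionCongr a) (optionCongr b)).symm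
  · rintro ⟨u, h⟩
    exact ⟨_, h.map α β a b⟩

theorem IsExpansion.type_of_input [Finite E] {i : I} (h : IsExpansion γ (inl i) γ') :
    γ'.type none = 1 := by
  rw [type, card_subtype_option, if_pos h.source]
  have : IsEmpty {e : E // γ'.vtx (some e, true) = inr none} := ⟨fun x => by
    have := h.vtx x.1 true
    rw [x.2] at this
    exact γ.source_ne _ _ this.symm⟩
  rw [Nat.card_of_isEmpty (α := {e : E // _})]

theorem IsExpansion.type_of_ne [Finite E] (h : IsExpansion γ u γ') {v : V} (hv : inr v ≠ u) :
    γ'.type (some v) = γ.type v := by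
  rw [type, card_subtype_option, if_neg (by rw [h.source]; simp), add_zero, type]
  refine Nat.card_congr (subtypeEquivRight fun e => ?_)
  rw [← h.vtx]
  rcases γ'.vtx (some e, true) with i | _ | w
  · simp
  · simp [hv.symm]
  · simp

theorem IsExpansion.type_add [Finite E] {v : V} (h : IsExpansion γ (inr v) γ') :
    γ'.type none + γ'.type (some v) = γ.type v + 1 := by
  rw [type, type, card_subtype_option, card_subtype_option, if_pos h.source,
    if_neg (by rw [h.source]; simp), type]
  have key : Nat.card {e : E // γ.vtx (e, true) = inr v} =
      Nat.card {e : E // γ'.vtx (some e, true) = inr none} +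
        Nat.card {e : E // γ'.vtx (some e, true) = inr (some v)} := by
    rw [← Nat.card_sum, ← Nat.card_congr (subtypeOrEquiv _ _ ?_)]
    · refine Nat.card_congr (subtypeEquivRight fun e => ?_)
      rw [← h.vtx]
      rcases γ'.vtx (some e, true) with i | _ | w <;> simp
    · refine Pi.disjoint_iff.mpr fun e => ?_
      rw [Prop.disjoint_iff]
      rintro ⟨h1, h2⟩
      rw [h1] at h2
      simp at h2
  omega

theorem IsExpansion.letterDeg_some [Finite E] (d : ℤ) (h : IsExpansion γ u γ') {x : E ⊕ V}
    (hx : ∀ v, x = inr v → inr v ≠ u) :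
    γ'.letterDeg d (Sum.map some some x) = γ.letterDeg d x := by
  rcases x with e | v
  · rfl
  · rw [Sum.map_inr, letterDeg_inr, letterDeg_inr, h.type_of_ne (hx v rfl)]

theorem IsExpansion.letterDeg_add [Finite E] (d : ℤ) {v : V} (h : IsExpansion γ (inr v) γ') :
    γ'.letterDeg d (inr none) + γ'.letterDeg d (inr (some v)) = γ.letterDeg d (inr v) - 2 := by
  have := h.type_add
  rw [letterDeg_inr, letterDeg_inr, letterDeg_inr,
    show (γ.type v : ℤ) = γ'.type none + γ'.type (some v) - 1 by omega]
  ring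

theorem letterDeg_of_type_one (d : ℤ) (γ : Graph I J E V) {v : V} (h : γ.type v = 1) :
    γ.letterDeg d (inr v) = -2 := by
  rw [letterDeg_inr, h]
  push_cast
  ring

theorem IsExpansion.target_unique {u' : I ⊕ V} {γ1 γ2 : Graph I J E V}
    (h : IsExpansion γ1 u γ') (h' : IsExpansion γ2 u' γ') : u = u' :=
  Sum.map_injective.mpr ⟨Function.injective_id, Option.some_injective V⟩
    (h.target.symm.trans h'.target)

end Expansion

end Graph

/-! ### The linear operations on the spaces of graphs -/

section Join

/-- The orientation of the second graph attached to that of the first. -/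
def joinWord (w1 : List (E1 ⊕ V1)) (w2 : List (E2 ⊕ V2)) : List ((E1 ⊕ E2) ⊕ (V1 ⊕ V2)) :=
  w1.map (Sum.map inl inl) ++ w2.map (Sum.map inr inr)

theorem isOrientation_joinWord {w1 : List (E1 ⊕ V1)} {w2 : List (E2 ⊕ V2)}
    (h1 : IsOrientation w1) (h2 : IsOrientation w2) : IsOrientation (joinWord w1 w2) := by
  constructor
  · refine List.Nodup.append (h1.1.map (Sum.inl_injective.sumMap Sum.inl_injective))
      (h2.1.map (Sum.inr_injective.sumMap Sum.inr_injective)) ?_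
    intro x hx hy
    obtain ⟨a, -, rfl⟩ := List.mem_map.mp hx
    obtain ⟨b, -, hb⟩ := List.mem_map.mp hy
    rcases a with a | a <;> rcases b with b | b <;> simp at hb
  · rintro ((e | e) | (v | v))
    · exact List.mem_append_left _ (List.mem_map.mpr ⟨inl e, h1.2 _, rfl⟩)
    · exact List.mem_append_right _ (List.mem_map.mpr ⟨inl e, h2.2 _, rfl⟩)
    · exact List.mem_append_left _ (List.mem_map.mpr ⟨inr v, h1.2 _, rfl⟩)
    · exact List.mem_append_right _ (List.mem_map.mpr ⟨inr v, h2.2 _, rfl⟩)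

theorem joinWord_map (a1 : E1 ≃ E1') (b1 : V1 ≃ V1') (a2 : E2 ≃ E2') (b2 : V2 ≃ V2')
    (w1 : List (E1 ⊕ V1)) (w2 : List (E2 ⊕ V2)) :
    joinWord (w1.map (Sum.map a1 b1)) (w2.map (Sum.map a2 b2)) =
      (joinWord w1 w2).map (Sum.map (a1.sumCongr a2) (b1.sumCongr b2)) := by
  simp only [joinWord, List.map_append, List.map_map]
  congr 1 <;> refine List.map_congr_left fun x _ => ?_ <;> rcases x with x | x <;> rfl

/-- A relation between pairs of graphs and the graphs made of them, which is compatible with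
isomorphisms and preserves the types of the vertices. -/
structure JoinRel (I J I' J' A B : Type) where
  rel : ∀ {E1 V1 E2 V2 : Type} [Finite E1] [Finite V1] [Finite E2] [Finite V2],
    Graph I J E1 V1 → Graph I' J' E2 V2 → Graph A B (E1 ⊕ E2) (V1 ⊕ V2) → Prop
  map_iff : ∀ {E1 V1 E2 V2 E1' V1' E2' V2' : Type} [Finite E1] [Finite V1] [Finite E2]
    [Finite V2] [Finite E1'] [Finite V1'] [Finite E2'] [Finite V2']
    (γ1 : Graph I J E1 V1) (γ2 : Graph I' J' E2 V2)
    (γ : Graph A B (E1 ⊕ E2) (V1 ⊕ V2)) (a1 : E1 ≃ E1') (b1 : V1 ≃ V1') (a2 : E2 ≃ E2')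
    (b2 : V2 ≃ V2'), rel γ1 γ2 γ ↔ rel (γ1.map (.refl I) (.refl J) a1 b1)
      (γ2.map (.refl I') (.refl J') a2 b2)
      (γ.map (.refl A) (.refl B) (a1.sumCongr a2) (b1.sumCongr b2))
  type_left : ∀ {E1 V1 E2 V2 : Type} [Finite E1] [Finite V1] [Finite E2] [Finite V2]
    {γ1 : Graph I J E1 V1} {γ2 : Graph I' J' E2 V2} {γ : Graph A B (E1 ⊕ E2) (V1 ⊕ V2)},
    rel γ1 γ2 γ → ∀ v, γ.type (inl v) = γ1.type v
  type_right : ∀ {E1 V1 E2 V2 : Type} [Finite E1] [Finite V1] [Finite E2] [Finite V2]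
    {γ1 : Graph I J E1 V1} {γ2 : Graph I' J' E2 V2} {γ : Graph A B (E1 ⊕ E2) (V1 ⊕ V2)},
    rel γ1 γ2 γ → ∀ v, γ.type (inr v) = γ2.type v

namespace JoinRel

variable (𝕜 : Type*) [Field 𝕜] (d : ℤ) (R : JoinRel I J I' J' A B)
  [Finite E1] [Finite V1] [Finite E2] [Finite V2] [Finite E1'] [Finite V1'] [Finite E2']
  [Finite V2']

theorem letterDeg_left {R : JoinRel I J I' J' A B} {γ1 : Graph I J E1 V1}
    {γ2 : Graph I' J' E2 V2} {γ : Graph A B (E1 ⊕ E2) (V1 ⊕ V2)} (h : R.rel γ1 γ2 γ)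
    (x : E1 ⊕ V1) : γ.letterDeg d (Sum.map inl inl x) = γ1.letterDeg d x := by
  rcases x with e | v
  · rfl
  · rw [Sum.map_inr, Graph.letterDeg_inr, Graph.letterDeg_inr, R.type_left h]

theorem letterDeg_right {R : JoinRel I J I' J' A B} {γ1 : Graph I J E1 V1}
    {γ2 : Graph I' J' E2 V2} {γ : Graph A B (E1 ⊕ E2) (V1 ⊕ V2)} (h : R.rel γ1 γ2 γ)
    (x : E2 ⊕ V2) : γ.letterDeg d (Sum.map inr inr x) = γ2.letterDeg d x := by
  rcases x with e | v
  · rfl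
  · rw [Sum.map_inr, Graph.letterDeg_inr, Graph.letterDeg_inr, R.type_right h]

/-- The sum of all graphs made of two oriented graphs. -/
def total (γ1 : Graph I J E1 V1) (w1 : List (E1 ⊕ V1)) (γ2 : Graph I' J' E2 V2)
    (w2 : List (E2 ⊕ V2)) : DGInf 𝕜 d A B :=
  ∑ᶠ γ : {γ // R.rel γ1 γ2 γ}, wcls 𝕜 d γ.1 (joinWord w1 w2)

theorem total_swap_left (γ1 : Graph I J E1 V1) (l1 l2 : List (E1 ⊕ V1)) (x y : E1 ⊕ V1)
    (γ2 : Graph I' J' E2 V2) (w2 : List (E2 ⊕ V2)) :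
    R.total 𝕜 d γ1 (l1 ++ x :: y :: l2) γ2 w2 = (γ1.letterDeg d x * γ1.letterDeg d y).negOnePow •
        R.total 𝕜 d γ1 (l1 ++ y :: x :: l2) γ2 w2 := by
  rw [total, total, units_smul_finsum]
  refine finsum_congr fun γ => ?_
  simp only [joinWord, List.map_append, List.map_cons, List.append_assoc, List.cons_append]
  rw [wcls_swap, letterDeg_left d γ.2, letterDeg_left d γ.2]

theorem total_swap_right (γ1 : Graph I J E1 V1) (w1 : List (E1 ⊕ V1))
    (γ2 : Graph I' J' E2 V2) (l1 l2 : List (E2 ⊕ V2)) (x y : E2 ⊕ V2) :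
    R.total 𝕜 d γ1 w1 γ2 (l1 ++ x :: y :: l2) = (γ2.letterDeg d x * γ2.letterDeg d y).negOnePow •
        R.total 𝕜 d γ1 w1 γ2 (l1 ++ y :: x :: l2) := by
  rw [total, total, units_smul_finsum]
  refine finsum_congr fun γ => ?_
  simp only [joinWord, List.map_append, List.map_cons, ← List.append_assoc]
  rw [wcls_swap, letterDeg_right d γ.2, letterDeg_right d γ.2]

theorem total_iso (γ1 : Graph I J E1 V1) (w1 : List (E1 ⊕ V1))
    (γ2 : Graph I' J' E2 V2) (w2 : List (E2 ⊕ V2)) (a1 : E1 ≃ E1') (b1 : V1 ≃ V1')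
    (a2 : E2 ≃ E2') (b2 : V2 ≃ V2') :
    R.total 𝕜 d (γ1.map (.refl I) (.refl J) a1 b1) (w1.map (Sum.map a1 b1))
      (γ2.map (.refl I') (.refl J') a2 b2) (w2.map (Sum.map a2 b2)) =
      R.total 𝕜 d γ1 w1 γ2 w2 := by
  refine (finsum_subtype_equiv (P := R.rel γ1 γ2) (Q := R.rel _ _)
    (f := fun γ => wcls 𝕜 d γ (joinWord w1 w2)) (g := fun γ => wcls 𝕜 d γ (joinWord _ _))
    (Graph.mapEquiv (.refl A) (.refl B) (a1.sumCongr a2) (b1.sumCongr b2))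
    (fun γ => R.map_iff γ1 γ2 γ a1 b1 a2 b2) fun γ _ => ?_).symm
  rw [joinWord_map]
  exact (wcls_map 𝕜 d γ _ _ _).symm

/-- The bilinear operation given by a relation between graphs. -/
def lin : DGInf 𝕜 d I J →ₗ[𝕜] DGInf 𝕜 d I' J' →ₗ[𝕜] DGInf 𝕜 d A B :=
  let F {E1 V1 : Type} [Finite E1] [Finite V1] (γ1 : Graph I J E1 V1) (w1 : List (E1 ⊕ V1)) :
      WordMap 𝕜 d I' J' (DGInf 𝕜 d A B) :=
    { toFun := R.total 𝕜 d γ1 w1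
      swap := fun γ2 l1 l2 x y _ => R.total_swap_right 𝕜 d γ1 w1 γ2 l1 l2 x y
      iso := fun γ2 a b w _ => by
        have := R.total_iso 𝕜 d γ1 w1 γ2 w (.refl E1) (.refl V1) a b
        simpa [Graph.map_refl] using this }
  WordMap.lin
    { toFun := fun γ1 w1 => (F γ1 w1).lin
      swap := fun γ1 l1 l2 x y _ => DGInf.hom_ext fun γ2 w2 h2 => by
        rw [Units.smul_def, LinearMap.smul_apply, ← Units.smul_def, WordMap.lin_wcls _ _ h2,
          WordMap.lin_wcls _ _ h2]
        exact R.total_swap_left 𝕜 d γ1 l1 l2 x y γ2 w2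
      iso := fun γ1 a b w _ => DGInf.hom_ext fun γ2 w2 h2 => by
        rw [WordMap.lin_wcls _ _ h2, WordMap.lin_wcls _ _ h2]
        have := R.total_iso 𝕜 d γ1 w γ2 w2 a b (.refl _) (.refl _)
        simpa [Graph.map_refl] using this }

theorem lin_wcls (γ1 : Graph I J E1 V1) {w1 : List (E1 ⊕ V1)} (γ2 : Graph I' J' E2 V2)
    {w2 : List (E2 ⊕ V2)} (h1 : IsOrientation w1) (h2 : IsOrientation w2) :
    R.lin 𝕜 d (wcls 𝕜 d γ1 w1) (wcls 𝕜 d γ2 w2) = R.total 𝕜 d γ1 w1 γ2 w2 := by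
  rw [lin, WordMap.lin_wcls _ _ h1, WordMap.lin_wcls _ _ h2]

end JoinRel

namespace Graph

theorem type_disjUnion [Finite E1] [Finite E2] (γ1 : Graph I J E1 V1)
    (γ2 : Graph I' J' E2 V2) : (∀ v, (γ1.disjUnion γ2).type (inl v) = γ1.type v) ∧
      ∀ v, (γ1.disjUnion γ2).type (inr v) = γ2.type v :=
  card_union γ1.vtx γ2.vtx true

theorem disjUnion_T (γ1 : Graph I J E1 V1) (γ2 : Graph I' J' E2 V2) (p j) :
    (γ1.disjUnion γ2).toRib.T p j ↔
      (∃ i k, p = inl (inl i) ∧ j = inl k ∧ γ1.toRib.T (inl i) k) ∨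
      ∃ i k, p = inl (inr i) ∧ j = inr k ∧ γ2.toRib.T (inl i) k := by
  constructor
  · rintro ⟨i | i, hi, rfl, rfl⟩
    · exact Or.inl ⟨i, _, rfl, rfl, (γ1.toRib_T _ _).mpr ⟨_, rfl⟩⟩
    · exact Or.inr ⟨i, _, rfl, rfl, (γ2.toRib_T _ _).mpr ⟨_, rfl⟩⟩
  · rintro (⟨i, k, rfl, rfl, h⟩ | ⟨i, k, rfl, rfl, h⟩)
    · obtain ⟨hi, rfl⟩ := (γ1.toRib_T _ _).mp h
      refine ((γ1.disjUnion γ2).toRib_T _ _).mpr ⟨?_, rfl⟩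
      rintro ⟨e | e, s⟩ he
      · change Sum.map inl inl (γ1.vtx (e, s)) = _ at he
        rcases hh : γ1.vtx (e, s) with w | w <;> simp [hh] at he
        exact hi (e, s) (by rw [hh, he])
      · change Sum.map inr inr (γ2.vtx (e, s)) = _ at he
        rcases hh : γ2.vtx (e, s) with w | w <;> simp [hh] at he
    · obtain ⟨hi, rfl⟩ := (γ2.toRib_T _ _).mp h
      refine ((γ1.disjUnion γ2).toRib_T _ _).mpr ⟨?_, rfl⟩
      rintro ⟨e | e, s⟩ he
      · change Sum.map inl inl (γ1.vtx (e, s)) = _ at he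
        rcases hh : γ1.vtx (e, s) with w | w <;> simp [hh] at he
      · change Sum.map inr inr (γ2.vtx (e, s)) = _ at he
        rcases hh : γ2.vtx (e, s) with w | w <;> simp [hh] at he
        exact hi (e, s) (by rw [hh, he])

theorem disjUnion_map {I1 I1' J1 J1' I2 I2' J2 J2' : Type} (γ1 : Graph I1 J1 E1 V1)
    (γ2 : Graph I2 J2 E2 V2) (α1 : I1 ≃ I1') (β1 : J1 ≃ J1') (a1 : E1 ≃ E1') (b1 : V1 ≃ V1')
    (α2 : I2 ≃ I2') (β2 : J2 ≃ J2') (a2 : E2 ≃ E2') (b2 : V2 ≃ V2') :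
    (γ1.map α1 β1 a1 b1).disjUnion (γ2.map α2 β2 a2 b2) = (γ1.disjUnion γ2).map
      (α1.sumCongr α2) (β1.sumCongr β2) (a1.sumCongr a2) (b1.sumCongr b2) := by
  apply toRib_injective
  rw [toRib_map]
  refine Rib.ext ?_ ?_ ?_ ?_
  · ext1 ⟨e | e, s⟩
    · change Sum.map inl inl (Sum.map α1 b1 (γ1.vtx (a1.symm e, s))) =
        Sum.map _ _ (Sum.map inl inl (γ1.vtx (a1.symm e, s)))
      rcases γ1.vtx (a1.symm e, s) with i | v <;> rfl
    · change Sum.map inr inr (Sum.map α2 b2 (γ2.vtx (a2.symm e, s))) =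
        Sum.map _ _ (Sum.map inr inr (γ2.vtx (a2.symm e, s)))
      rcases γ2.vtx (a2.symm e, s) with i | v <;> rfl
  · ext1 ⟨e | e, s⟩ <;> rfl
  · ext1 ⟨e | e, s⟩ <;> rfl
  · ext p j
    rw [disjUnion_T, Rib.ren_T, disjUnion_T]
    simp only [toRib_map, Rib.ren_T]
    rcases p with (i | i) | v <;> rcases j with j | j <;> simp

end Graph

/-- Disjoint unions as a relation. -/
def unionRel (I J I' J' : Type) : JoinRel I J I' J' (I ⊕ I') (J ⊕ J') where
  rel γ1 γ2 γ := γ = γ1.disjUnion γ2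
  map_iff γ1 γ2 γ a1 b1 a2 b2 := by
    rw [Graph.disjUnion_map, sumCongr_refl, sumCongr_refl]
    exact (Graph.mapEquiv (.refl _) (.refl _) (a1.sumCongr a2)
      (b1.sumCongr b2)).injective.eq_iff.symm
  type_left h := h ▸ (Graph.type_disjUnion _ _).1
  type_right h := h ▸ (Graph.type_disjUnion _ _).2

/-- Gluings as a relation. -/
def gluingRel (I J K : Type) : JoinRel I J J K I K where
  rel := Graph.IsGluing
  map_iff _ _ _ _ _ _ _ := (Graph.isGluing_map_iff _ _ _ _ _ _ _).symm
  type_left h := h.type_left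
  type_right h := h.type_right

end Join

section Operations

variable (𝕜 : Type*) [Field 𝕜] (d : ℤ)

/-- The composition of graphs. -/
def glueMap {I J K : Type} :
    DGInf 𝕜 d I J →ₗ[𝕜] DGInf 𝕜 d J K →ₗ[𝕜] DGInf 𝕜 d I K := (gluingRel I J K).lin 𝕜 d

/-- The disjoint union of graphs. -/
def unionMap {I J I' J' : Type} :
    DGInf 𝕜 d I J →ₗ[𝕜] DGInf 𝕜 d I' J' →ₗ[𝕜] DGInf 𝕜 d (I ⊕ I') (J ⊕ J') :=
  (unionRel I J I' J').lin 𝕜 d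

/-- Renumbering of the inputs and outputs. -/
def relabelMap (α : I ≃ I') (β : J ≃ J') : DGInf 𝕜 d I J →ₗ[𝕜] DGInf 𝕜 d I' J' :=
  WordMap.lin
    { toFun := fun γ w => wcls 𝕜 d (γ.map α β (.refl _) (.refl _)) w
      swap := fun γ l1 l2 x y _ => by
        rw [wcls_swap]
        have h := fun x => γ.letterDeg_map d α β (.refl _) (.refl _) x
        simp only [Equiv.coe_refl, Sum.map_id_id, id] at h
        rw [h, h]
      iso := fun γ a b w _ => by
        rw [Graph.map_map, ← wcls_map 𝕜 d (γ.map α β (.refl _) (.refl _)) a b,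
          Graph.map_map]
        rfl }

variable {𝕜 d} [Finite E] [Finite V] [Finite E1] [Finite V1] [Finite E2] [Finite V2]

theorem relabelMap_wcls (α : I ≃ I') (β : J ≃ J') (γ : Graph I J E V) {w : List (E ⊕ V)}
    (h : IsOrientation w) : relabelMap 𝕜 d α β (wcls 𝕜 d γ w) =
      wcls 𝕜 d (γ.map α β (.refl _) (.refl _)) w := by
  rw [relabelMap, WordMap.lin_wcls _ _ h]

theorem glueMap_wcls (γ1 : Graph I J E1 V1) {w1 : List (E1 ⊕ V1)}
    (γ2 : Graph J K E2 V2) {w2 : List (E2 ⊕ V2)} (h1 : IsOrientation w1) (h2 : IsOrientation w2) :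
    glueMap 𝕜 d (wcls 𝕜 d γ1 w1) (wcls 𝕜 d γ2 w2) =
      ∑ᶠ γ : {γ // γ1.IsGluing γ2 γ}, wcls 𝕜 d γ.1 (joinWord w1 w2) :=
  (gluingRel I J K).lin_wcls 𝕜 d γ1 γ2 h1 h2

theorem unionMap_wcls (γ1 : Graph I J E1 V1)
    {w1 : List (E1 ⊕ V1)} (γ2 : Graph I' J' E2 V2) {w2 : List (E2 ⊕ V2)} (h1 : IsOrientation w1)
    (h2 : IsOrientation w2) : unionMap 𝕜 d (wcls 𝕜 d γ1 w1) (wcls 𝕜 d γ2 w2) =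
      wcls 𝕜 d (γ1.disjUnion γ2) (joinWord w1 w2) := by
  refine ((unionRel I J I' J').lin_wcls 𝕜 d γ1 γ2 h1 h2).trans ?_
  have : Unique {γ // (unionRel I J I' J').rel γ1 γ2 γ} := ⟨⟨⟨_, rfl⟩⟩, fun γ => Subtype.ext γ.2⟩
  exact (finsum_unique fun γ : {γ // (unionRel I J I' J').rel γ1 γ2 γ} =>
    wcls 𝕜 d γ.1 (joinWord w1 w2)).trans
      (congrArg (fun γ => wcls 𝕜 d γ _) (default : {γ // (unionRel I J I' J').rel γ1 γ2 γ}).2)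

theorem relabelMap_cls (α : I ≃ I') (β : J ≃ J') (Γ : OGraph I J) :
    relabelMap 𝕜 d α β (cls 𝕜 d Γ) = cls 𝕜 d (Γ.relabel α β) := by
  rw [cls_eq_wcls, relabelMap_wcls α β _ Γ.isOrientation, ← Graph.relabel_eq_map, cls_eq_wcls]
  rfl

theorem glueMap_cls (Γ1 : OGraph I J) (Γ2 : OGraph J K) :
    glueMap 𝕜 d (cls 𝕜 d Γ1) (cls 𝕜 d Γ2) = Γ1.glue 𝕜 d Γ2 := by
  rw [cls_eq_wcls, cls_eq_wcls, glueMap_wcls _ _ Γ1.isOrientation Γ2.isOrientation, OGraph.glue]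
  refine finsum_congr fun γ => ?_
  rw [cls_eq_wcls]
  rfl

end Operations

theorem exists_eq_append_of_isOrientation {w : List (E ⊕ V)} (hw : IsOrientation w) (x : E ⊕ V) :
    ∃ l1 l2, w = l1 ++ x :: l2 ∧ x ∉ l1 := by
  obtain ⟨l1, l2, h⟩ := List.append_of_mem (hw.2 x)
  refine ⟨l1, l2, h, fun hx => ?_⟩
  have := hw.1
  rw [h] at this
  exact (List.disjoint_of_nodup_append this) hx (by simp)

theorem notMem_of_isOrientation {l1 l2 : List (E ⊕ V)} {x : E ⊕ V}
    (hw : IsOrientation (l1 ++ x :: l2)) : x ∉ l1 := fun hx =>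
  (List.disjoint_of_nodup_append hw.1) hx (by simp)

section Differential

open RibbonProp.Graph

variable (𝕜 : Type*) [Field 𝕜] (d : ℤ) [Finite E] [Finite V] [Finite E'] [Finite V']

/-- The term of an expansion in the differential of a graph with orientation `w`.  If the expanded
vertex is `v`, and `w = l1 v l2`, then the term has the orientation `l1 e v' v l2` and the sign
`(-1) ^ (deg l1)`, where `e` is the new edge and `v'` its source. -/
def expTerm (γ' : Graph I J (Option E) (Option V)) (w : List (E ⊕ V)) : DGInf 𝕜 d I J :=
  match γ'.vtx (none, false) with
  | inl _ => wcls 𝕜 d γ' (inl none :: inr none :: w.map (Sum.map some some))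
  | inr none => 0
  | inr (some v) =>
    (wordDeg d γ' ((w.takeWhile (· ≠ inr v)).map (Sum.map some some))).negOnePow •
      wcls 𝕜 d γ' ((w.takeWhile (· ≠ inr v)).map (Sum.map some some) ++
        inl none :: inr none :: (w.dropWhile (· ≠ inr v)).map (Sum.map some some))

variable {𝕜 d} {γ : Graph I J E V} {u : I ⊕ V} {γ' : Graph I J (Option E) (Option V)}

theorem expTerm_input {i : I} (h : γ'.vtx (none, false) = inl i) (w : List (E ⊕ V)) :
    expTerm 𝕜 d γ' w = wcls 𝕜 d γ' (inl none :: inr none :: w.map (Sum.map some some)) := by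
  rw [expTerm, h]

theorem expTerm_vertex {v : V} (h : γ'.vtx (none, false) = inr (some v))
    {l1 l2 : List (E ⊕ V)} (hv : inr v ∉ l1) :
    expTerm 𝕜 d γ' (l1 ++ inr v :: l2) = (wordDeg d γ' (l1.map (Sum.map some some))).negOnePow •
        wcls 𝕜 d γ' (l1.map (Sum.map some some) ++ inl none :: inr none ::
          inr (some v) :: l2.map (Sum.map some some)) := by
  have h1 : (l1 ++ inr v :: l2).takeWhile (· ≠ inr v) = l1 := by
    rw [List.takeWhile_append_of_pos (fun x hx => by
      simpa using fun hxv : x = inr v => hv (hxv ▸ hx))]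
    simp
  have h2 : (l1 ++ inr v :: l2).dropWhile (· ≠ inr v) = inr v :: l2 := by
    rw [List.dropWhile_append_of_pos (fun x hx => by
      simpa using fun hxv : x = inr v => hv (hxv ▸ hx))]
    simp
  rw [expTerm, h]
  simp only [h1, h2, List.map_cons, Sum.map_inr]

/-- A new vertex of type `1` may be put, with the new edge, at the front of the orientation. -/
theorem expTerm_of_type_one (h : γ'.type none = 1) {w : List (E ⊕ V)} (hw : IsOrientation w)
    (hv : γ'.vtx (none, false) ≠ inr none) :
    expTerm 𝕜 d γ' w = wcls 𝕜 d γ' (inl none :: inr none :: w.map (Sum.map some some)) := by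
  rcases hu : γ'.vtx (none, false) with i | _ | v
  · exact expTerm_input hu w
  · exact absurd hu hv
  · obtain ⟨l1, l2, rfl, hl⟩ := exists_eq_append_of_isOrientation hw (inr v)
    rw [expTerm_vertex hu hl]
    have := wcls_block 𝕜 d γ' [] [inl none, inr none] (l1.map (Sum.map some some))
      (inr (some v) :: l2.map (Sum.map some some))
    simp only [List.nil_append, List.cons_append, wordDeg_cons, wordDeg_nil,
      letterDeg_inl, γ'.letterDeg_of_type_one d h] at this
    rw [List.map_append, List.map_cons, Sum.map_inr, this]
    congr 1
    rw [Int.negOnePow_eq_iff]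
    exact ⟨wordDeg d γ' (l1.map (Sum.map some some)), by ring⟩

theorem expTerm_swap_aux {v : V} (h : γ.IsExpansion (inr v) γ') {l1 l2 : List (E ⊕ V)}
    {y : E ⊕ V} (hw : IsOrientation (l1 ++ inr v :: y :: l2)) :
    expTerm 𝕜 d γ' (l1 ++ inr v :: y :: l2) = (γ.letterDeg d (inr v) * γ.letterDeg d y).negOnePow •
        expTerm 𝕜 d γ' (l1 ++ y :: inr v :: l2) := by
  have hy : y ≠ inr v := by
    rintro rfl
    have := (List.nodup_append.mp hw.1).2.1
    simp at this
  have hl : inr v ∉ l1 ++ [y] := by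
    simp [notMem_of_isOrientation hw, hy.symm]
  have hdy := h.letterDeg_some d (x := y) fun v' hv' hv =>
    hy (hv'.trans (by rw [Sum.inr_injective hv]))
  rw [expTerm_vertex h.target (notMem_of_isOrientation hw),
    show l1 ++ y :: inr v :: l2 = (l1 ++ [y]) ++ inr v :: l2 by simp,
    expTerm_vertex h.target hl]
  have h1 := wcls_block 𝕜 d γ' (l1.map (Sum.map some some))
    [inl none, inr none, inr (some v)] [Sum.map some some y]
    (l2.map (Sum.map some some))
  simp only [List.map_append, List.map_cons, List.map_nil, List.append_assoc, List.cons_append,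
    List.nil_append, wordDeg_append, wordDeg_cons, wordDeg_nil] at h1 ⊢
  rw [h1, smul_smul, smul_smul, ← Int.negOnePow_add, ← Int.negOnePow_add]
  congr 1
  rw [Int.negOnePow_eq_iff, hdy, letterDeg_inl, add_zero, h.letterDeg_add, add_zero]
  exact ⟨-γ.letterDeg d y, by ring⟩

theorem expTerm_swap (h : γ.IsExpansion u γ') {l1 l2 : List (E ⊕ V)} {x y : E ⊕ V}
    (hw : IsOrientation (l1 ++ x :: y :: l2)) :
    expTerm 𝕜 d γ' (l1 ++ x :: y :: l2) =
      (γ.letterDeg d x * γ.letterDeg d y).negOnePow • expTerm 𝕜 d γ' (l1 ++ y :: x :: l2) := by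
  have hw' := hw.perm ((List.Perm.swap y x l2).append_left l1)
  rcases u with i | v
  · rw [expTerm_input h.target, expTerm_input h.target]
    simp only [List.map_append, List.map_cons]
    rw [← List.cons_append, ← List.cons_append, wcls_swap, h.letterDeg_some d (by simp),
      h.letterDeg_some d (by simp)]
    rfl
  · by_cases hx : x = inr v
    · subst hx
      exact expTerm_swap_aux h hw
    by_cases hy : y = inr v
    · subst hy
      rw [expTerm_swap_aux h hw', smul_smul, ← Int.negOnePow_add, mul_comm, ← two_mul,
        Int.negOnePow_even _ (even_two_mul _), one_smul]
    have hdx := h.letterDeg_some d (x := x) fun v' hv' hv =>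
      hx (hv'.trans (by rw [Sum.inr_injective hv]))
    have hdy := h.letterDeg_some d (x := y) fun v' hv' hv =>
      hy (hv'.trans (by rw [Sum.inr_injective hv]))
    have hmem : inr v ∈ l1 ∨ inr v ∈ l2 := by
      have := hw.2 (inr v)
      simpa [Ne.symm hx, Ne.symm hy] using this
    rcases hmem with hm | hm
    · obtain ⟨p, q, rfl⟩ := List.append_of_mem hm
      simp only [List.append_assoc, List.cons_append] at hw hw' ⊢
      rw [expTerm_vertex h.target (notMem_of_isOrientation hw),
        expTerm_vertex h.target (notMem_of_isOrientation hw)]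
      have h1 := wcls_swap 𝕜 d γ' (p.map (Sum.map some some) ++ inl none :: inr none ::
        inr (some v) :: q.map (Sum.map some some)) (l2.map (Sum.map some some))
        (Sum.map some some x) (Sum.map some some y)
      simp only [List.map_append, List.map_cons, List.append_assoc, List.cons_append] at h1 ⊢
      rw [h1, hdx, hdy, smul_comm]
    · obtain ⟨p, q, rfl⟩ := List.append_of_mem hm
      rw [show l1 ++ x :: y :: (p ++ inr v :: q) = (l1 ++ x :: y :: p) ++ inr v :: q by simp]
        at hw ⊢
      rw [show l1 ++ y :: x :: (p ++ inr v :: q) = (l1 ++ y :: x :: p) ++ inr v :: q by simp]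
        at hw' ⊢
      rw [expTerm_vertex h.target (notMem_of_isOrientation hw),
        expTerm_vertex h.target (notMem_of_isOrientation hw')]
      simp only [List.map_append, List.map_cons, List.append_assoc, List.cons_append,
        wordDeg_append, wordDeg_cons]
      rw [wcls_swap, hdx, hdy, smul_comm, add_left_comm (γ.letterDeg d x)]

theorem expTerm_map (h : γ.IsExpansion u γ') {w : List (E ⊕ V)} (hw : IsOrientation w)
    (α : I ≃ I') (β : J ≃ J') (a : E ≃ E') (b : V ≃ V') :
    expTerm 𝕜 d (γ'.map α β (optionCongr a) (optionCongr b))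
      (w.map (Sum.map a b)) = relabelMap 𝕜 d α β (expTerm 𝕜 d γ' w) := by
  have key : ∀ w : List (Option E ⊕ Option V), wcls 𝕜 d
      (γ'.map α β (optionCongr a) (optionCongr b))
      (w.map (Sum.map (optionCongr a) (optionCongr b))) =
        relabelMap 𝕜 d α β (wcls 𝕜 d γ' w) := by
    intro w
    by_cases hw : IsOrientation w
    · rw [relabelMap_wcls α β γ' hw, ← wcls_map 𝕜 d _ (optionCongr a) (optionCongr b),
        map_map]
      rfl
    · rw [wcls_of_not 𝕜 d hw, map_zero, wcls_of_not]
      rwa [isOrientation_map]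
  have hS : ∀ l : List (E ⊕ V), (l.map (Sum.map a b)).map (Sum.map some some) =
      (l.map (Sum.map some some)).map (Sum.map (optionCongr a) (optionCongr b)) := by
    intro l
    rw [List.map_map, List.map_map]
    refine List.map_congr_left fun x _ => ?_
    rcases x with x | x <;> rfl
  have ht : (γ'.map α β (optionCongr a) (optionCongr b)).vtx (none, false) =
      Sum.map id some (Sum.map α b u) := by
    change Sum.map α (optionCongr b) (γ'.vtx (none, false)) = _
    rw [h.target]
    rcases u with i | v <;> rfl
  rcases u with i | v
  · rw [expTerm_input h.target, expTerm_input ht, ← key, hS]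
    rfl
  · obtain ⟨l1, l2, rfl, hl⟩ := exists_eq_append_of_isOrientation hw (inr v)
    have hl' : inr (b v) ∉ l1.map (Sum.map a b) := fun hm => by
      obtain ⟨x, hx, hxv⟩ := List.mem_map.mp hm
      rcases x with x | x
      · simp at hxv
      · rw [Sum.map_inr, Sum.inr.injEq, b.injective.eq_iff] at hxv
        exact hl (hxv ▸ hx)
    rw [expTerm_vertex h.target hl, List.map_append, List.map_cons, Sum.map_inr,
      expTerm_vertex ht hl', map_units_smul, ← key, hS, hS]
    congr 1
    · rw [wordDeg_map_eq d γ']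
      exact fun x _ => γ'.letterDeg_map d _ _ _ _ x
    · simp only [List.map_append, List.map_cons]
      rfl

theorem relabelMap_refl (x : DGInf 𝕜 d I J) : relabelMap 𝕜 d (.refl I) (.refl J) x = x := by
  suffices h : relabelMap 𝕜 d (.refl I) (.refl J) = LinearMap.id by rw [h]; rfl
  refine DGInf.hom_ext fun γ w hw => ?_
  rw [relabelMap_wcls _ _ _ hw, γ.map_refl]
  rfl

/-- The terms of the differential do not depend on the names of the edges and vertices. -/
theorem sum_expTerm_map [Finite I] [Finite J] (γ : Graph I J E V) {w : List (E ⊕ V)}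
    (hw : IsOrientation w) [Finite I'] [Finite J'] (α : I ≃ I') (β : J ≃ J') (a : E ≃ E')
    (b : V ≃ V') :
    ∑ᶠ γ' : {γ' // ∃ u, (γ.map α β a b).IsExpansion u γ'},
      expTerm 𝕜 d γ'.1 (w.map (Sum.map a b)) = relabelMap 𝕜 d α β
        (∑ᶠ γ' : {γ' // ∃ u, γ.IsExpansion u γ'}, expTerm 𝕜 d γ'.1 w) := by
  refine Eq.trans ?_ (map_finsum_of_finite (relabelMap 𝕜 d α β).toAddMonoidHom _).symm
  refine (finsum_subtype_equiv (P := fun γ' => ∃ u, γ.IsExpansion u γ')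
    (Q := fun γ' => ∃ u, (γ.map α β a b).IsExpansion u γ')
    (f := fun γ' => relabelMap 𝕜 d α β (expTerm 𝕜 d γ' w))
    (g := fun γ' => expTerm 𝕜 d γ' (w.map (Sum.map a b)))
    (mapEquiv α β (optionCongr a) (optionCongr b))
    (fun γ' => (exists_isExpansion_map_iff α β a b).symm) fun γ' h => ?_).symm
  obtain ⟨u, h⟩ := h
  exact (expTerm_map h hw α β a b).symm

/-- The differential. -/
def expMap (𝕜 : Type*) [Field 𝕜] (d : ℤ) {I J : Type} [Finite I] [Finite J] :
    DGInf 𝕜 d I J →ₗ[𝕜] DGInf 𝕜 d I J :=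
  WordMap.lin
    { toFun := fun γ w => ∑ᶠ γ' : {γ' // ∃ u, γ.IsExpansion u γ'}, expTerm 𝕜 d γ'.1 w
      swap := fun γ l1 l2 x y hw => by
        rw [units_smul_finsum]
        exact finsum_congr fun γ' => expTerm_swap γ'.2.choose_spec hw
      iso := fun γ a b w hw => (sum_expTerm_map γ hw _ _ a b).trans (relabelMap_refl _) }

theorem expMap_wcls [Finite I] [Finite J] (γ : Graph I J E V) {w : List (E ⊕ V)}
    (hw : IsOrientation w) : expMap 𝕜 d (wcls 𝕜 d γ w) =
      ∑ᶠ γ' : {γ' // ∃ u, γ.IsExpansion u γ'}, expTerm 𝕜 d γ'.1 w := by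
  rw [expMap, WordMap.lin_wcls _ _ hw]

theorem expMap_cls [Finite I] [Finite J] (Γ : OGraph I J) :
    expMap 𝕜 d (cls 𝕜 d Γ) = Γ.diff 𝕜 d := by
  rw [cls_eq_wcls, expMap_wcls _ Γ.isOrientation, OGraph.diff]
  rw [finsum_subtype_add (f := fun γ' => expTerm 𝕜 d γ' Γ.word)
    (R := fun γ' => ∃ u, Γ.graph.IsExpansion u γ')
    (P := fun γ' => ∃ i, Γ.graph.IsExpansion (inl i) γ')
    (Q := fun γ' => ∃ v, Γ.graph.IsExpansion (inr v) γ') (fun γ' => Sum.exists)]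
  · congr 1
    · rw [← finsum_finsum_subtype (f := fun γ' => expTerm 𝕜 d γ' Γ.word)
        (Q := fun i γ' => Γ.graph.IsExpansion (inl i) γ')
        (fun _ _ _ h h' => Sum.inl_injective (h.target_unique h'))]
      refine finsum_congr fun i => finsum_congr fun γ' => ?_
      rw [expTerm_input γ'.2.target, cls_eq_wcls]
      rfl
    · rw [← finsum_finsum_subtype (f := fun γ' => expTerm 𝕜 d γ' Γ.word)
        (Q := fun v γ' => Γ.graph.IsExpansion (inr v) γ')
        (fun _ _ _ h h' => Sum.inr_injective (h.target_unique h'))]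
      refine finsum_congr fun v => finsum_congr fun γ' => ?_
      have h := γ'.2
      obtain ⟨l1, l2, hl, hv⟩ := exists_eq_append_of_isOrientation Γ.isOrientation (inr v)
      have hv2 : inr v ∉ l2 := fun hm => by
        have := (List.nodup_append.mp (hl ▸ Γ.nodup)).2.1
        exact (List.nodup_cons.mp this).1 hm
      have h1 : (l1 ++ inr v :: l2).takeWhile (· ≠ inr v) = l1 := by
        rw [List.takeWhile_append_of_pos (fun x hx => by
          simpa using fun hxv : x = inr v => hv (hxv ▸ hx))]
        simp
      have hf : ∀ l : List (Γ.E ⊕ Γ.V), inr v ∉ l → l.filter (· ≠ inr v) = l :=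
        fun l hl => List.filter_eq_self.mpr fun x hx => by
          simpa using fun hxv : x = inr v => hl (hxv ▸ hx)
      have h2 : (l1 ++ inr v :: l2).filter (· ≠ inr v) = l1 ++ l2 := by
        rw [List.filter_append, hf l1 hv, List.filter_cons_of_neg (by simp), hf l2 hv2]
      have h3 : wordDeg d γ'.1 (l1.map (Sum.map some some)) = wordDeg d Γ.graph l1 :=
        wordDeg_map_eq d _ _ fun x hx => h.letterDeg_some d fun v' hv' hh => hv (by
            rw [← Sum.inr_injective hh, ← hv']
            exact hx)
      have h4 := wcls_block 𝕜 d γ'.1 [] [inl none, inr none, inr (some v)]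
        (l1.map (Sum.map some some)) (l2.map (Sum.map some some))
      rw [cls_eq_wcls]
      change _ = (Γ.graph.letterDeg d (inr v) * ((Γ.word.takeWhile (· ≠ inr v)).map
        (Γ.graph.letterDeg d)).sum).negOnePow • wcls 𝕜 d γ'.1 (inl none :: inr none ::
          inr (some v) :: (Γ.word.filter (· ≠ inr v)).map (Sum.map some some))
      rw [hl, h1, h2, expTerm_vertex h.target hv, List.map_append]
      simp only [List.nil_append, List.cons_append] at h4
      rw [h4, smul_smul, h3]
      congr 1
      simp only [wordDeg_cons, wordDeg_nil, letterDeg_inl, add_zero]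
      rw [h.letterDeg_add, ← Int.negOnePow_add, Int.negOnePow_eq_iff]
      change Even (wordDeg d Γ.graph l1 - (_ * wordDeg d Γ.graph l1 + _ * wordDeg d Γ.graph l1))
      exact ⟨-(Γ.graph.letterDeg d (inr v) - 1) * wordDeg d Γ.graph l1, by ring⟩
  · rintro γ' ⟨i, h⟩ ⟨v, h'⟩
    exact Sum.inl_ne_inr (h.target_unique h')

end Differential

end RibbonProp

namespace RibbonProp

/-! ### Associativity of gluing -/

section RenIff

variable {P P' P'' J J' J'' K K' K'' E E' E1 E1' E2 E2' : Type}

theorem gl_ren_iff {j1 : E1 → E} {j2 : E2 → E} {j1' : E1' → E'} {j2' : E2' → E'}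
    (S : Split (Prod.map j1 id) (Prod.map j2 id) (flip E1) (flip E2) (flip E))
    (S' : Split (Prod.map j1' id) (Prod.map j2' id) (flip E1') (flip E2') (flip E'))
    {γ1 : Rib P J (flip E1)} {γ2 : Rib J K (flip E2)} {γ : Rib P K (flip E)}
    (α : P ≃ P') (β : J ≃ J') (δ : K ≃ K') (a1 : E1 ≃ E1') (a2 : E2 ≃ E2') (a : E ≃ E')
    (c1 : ∀ x, a (j1 x) = j1' (a1 x)) (c2 : ∀ x, a (j2 x) = j2' (a2 x)) :
    Gl (Prod.map j1' id) (Prod.map j2' id) (γ1.ren α β a1) (γ2.ren β δ a2) (γ.ren α δ a) ↔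
      Gl (Prod.map j1 id) (Prod.map j2 id) γ1 γ2 γ := by
  constructor
  · intro h
    have := Gl.map (i1' := Prod.map j1 id) (i2' := Prod.map j2 id) S' h α.symm β.symm δ.symm
      (a1.symm.prodCongr (.refl Bool)) (a2.symm.prodCongr (.refl Bool))
      (a.symm.prodCongr (.refl Bool)) (φ1' := flip E1) (φ2' := flip E2) (φ' := flip E)
      (fun _ => rfl) (fun _ => rfl) (fun _ => rfl)
      (fun x => Prod.ext (by
        change a.symm (j1' x.1) = j1 (a1.symm x.1)
        rw [symm_apply_eq, c1, a1.apply_symm_apply]) rfl)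
      (fun x => Prod.ext (by
        change a.symm (j2' x.1) = j2 (a2.symm x.1)
        rw [symm_apply_eq, c2, a2.apply_symm_apply]) rfl)
    change Gl _ _ ((γ1.ren α β a1).ren _ _ a1.symm) ((γ2.ren β δ a2).ren _ _ a2.symm)
      ((γ.ren α δ a).ren _ _ a.symm) at this
    simpa only [Rib.ren_ren, self_trans_symm, Rib.ren_refl] using this
  · exact fun h => Gl.map S h α β δ (a1.prodCongr (.refl Bool))
      (a2.prodCongr (.refl Bool)) (a.prodCongr (.refl Bool)) (fun _ => rfl)
      (fun _ => rfl) (fun _ => rfl)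
      (fun x => Prod.ext (c1 x.1) rfl) (fun x => Prod.ext (c2 x.1) rfl)

/-- Exchange of the last two summands. -/
def sumRightComm (A B C : Type) : (A ⊕ B) ⊕ C ≃ (A ⊕ C) ⊕ B where
  toFun := Sum.elim (Sum.elim (fun a => inl (inl a)) inr) fun c => inl (inr c)
  invFun := Sum.elim (Sum.elim (fun a => inl (inl a)) inr) fun c => inl (inr c)
  left_inv := by rintro ((a | b) | c) <;> rfl
  right_inv := by rintro ((a | b) | c) <;> rfl

theorem Rib.add_add (γ : Rib P J (flip E)) (Q Q' : Type) :
    (γ.add (Q ⊕ Q')).ren (sumAssoc P Q Q').symm (sumAssoc J Q Q').symm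
      (.refl E) = (γ.add Q).add Q' := by
  refine Rib.ext rfl (Equiv.ext fun _ => rfl) rfl ?_
  ext p j
  rcases p with (p | p) | p <;> rcases j with (j | j) | j <;> simp

theorem Rib.add_add_comm (γ : Rib P J (flip E)) (Q Q' : Type) :
    ((γ.add Q).add Q').ren (sumRightComm P Q Q') (sumRightComm J Q Q') (.refl E) =
      (γ.add Q').add Q := by
  refine Rib.ext rfl (Equiv.ext fun _ => rfl) rfl ?_
  ext p j
  rw [ren_T]
  rcases p with (p | p) | p <;> rcases j with (j | j) | j <;> simp [sumRightComm]

end RenIff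

variable {I I' J J' K K' L A B E E' V V' E1 E1' V1 V1' E2 E2' V2 V2' E3 V3 : Type}

namespace Graph

variable {γ1 : Graph I J E1 V1} {γ2 : Graph J K E2 V2}

/-- Gluings of graphs are graphs. -/
theorem admissible_of_gl [Finite E1] [Finite E2] {ρ : Rib ((I ⊕ V1) ⊕ V2) K (flip (E1 ⊕ E2))}
    (h : Gl (Prod.map inl id) (Prod.map inr id) (γ1.toRib.add V2) γ2.toRib ρ) :
    (ρ.ren (sumAssoc I V1 V2) (.refl K) (.refl (E1 ⊕ E2))).Admissible := by
  have h1 : ∀ e s, ρ.vtx (inl e, s) = inl (γ1.vtx (e, s)) := fun e s => h.vtx1 (e, s)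
  have h2 : ∀ e s v, γ2.vtx (e, s) = inr v → ρ.vtx (inr e, s) = inr v :=
    fun e s v hv => h.vtx2 (e, s) (inr v) (by rw [toRib_vtx, hv, Rib.add_T_inr])
  have hs : ∀ e, ∃ v, γ2.vtx (e, true) = inr v := fun e => by
    rcases hv : γ2.vtx (e, true) with j | v
    · exact absurd hv (γ2.source_ne e j)
    · exact ⟨v, rfl⟩
  have hd1 : ∀ v, ρ.deg true (inl (inr v)) = γ1.toRib.deg true (inr v) := by
    intro v
    rw [Rib.deg, card_subtype_sum, Rib.deg]
    have : IsEmpty {e : E2 // ρ.vtx (inr e, true) = inl (inr v)} := ⟨fun x => by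
      obtain ⟨w, hw⟩ := hs x.1
      have := x.2
      rw [h2 _ _ w hw] at this
      simp at this⟩
    rw [Nat.card_of_isEmpty (α := {e : E2 // _}), add_zero]
    exact Nat.card_congr (subtypeEquivRight fun e => by simp [h1])
  have hd1' : ∀ v, γ1.toRib.deg false (inr v) ≤ ρ.deg false (inl (inr v)) := by
    intro v
    rw [Rib.deg, Rib.deg, card_subtype_sum]
    refine le_trans (le_of_eq ?_) (Nat.le_add_right _ _)
    exact Nat.card_congr (subtypeEquivRight fun e => by simp [h1])
  have hd2 : ∀ v, ρ.deg true (inr v) = γ2.toRib.deg true (inr v) := by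
    intro v
    rw [Rib.deg, card_subtype_sum, Rib.deg]
    have : IsEmpty {e : E1 // ρ.vtx (inl e, true) = inr v} := ⟨fun x => by
      have := x.2
      simp [h1] at this⟩
    rw [Nat.card_of_isEmpty (α := {e : E1 // _}), zero_add]
    refine Nat.card_congr (subtypeEquivRight fun e => ?_)
    obtain ⟨w, hw⟩ := hs e
    rw [h2 _ _ w hw, toRib_vtx, hw]
    simp
  have hd2' : ∀ v, γ2.toRib.deg false (inr v) ≤ ρ.deg false (inr v) := by
    intro v
    rw [Rib.deg, Rib.deg]
    exact Nat.card_le_card_of_injective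
      (fun x : {e // γ2.vtx (e, false) = inr v} =>
        (⟨inr x.1, h2 _ _ _ x.2⟩ : {e // ρ.vtx (e, false) = inr v}))
      fun x y hxy => Subtype.ext (Sum.inr_injective (congrArg Subtype.val hxy))
  constructor
  · rintro (e | e) i hi
    · rw [Rib.ren_vtx] at hi
      change sumAssoc I V1 V2 (ρ.vtx (inl e, true)) = _ at hi
      rw [h1] at hi
      rcases hv : γ1.vtx (e, true) with i' | v
      · exact γ1.source_ne _ _ hv
      · rw [hv] at hi
        exact Sum.inr_ne_inl hi
    · obtain ⟨w, hw⟩ := hs e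
      change sumAssoc I V1 V2 (ρ.vtx (inr e, true)) = _ at hi
      rw [h2 _ _ w hw] at hi
      exact Sum.inr_ne_inl hi
  · rintro (v | v)
    · obtain ⟨e, he⟩ := γ1.exists_source v
      refine ⟨inl e, ?_⟩
      change sumAssoc I V1 V2 (ρ.vtx (inl e, true)) = _
      rw [h1, he]
      rfl
    · obtain ⟨e, he⟩ := γ2.exists_source v
      refine ⟨inr e, ?_⟩
      change sumAssoc I V1 V2 (ρ.vtx (inr e, true)) = _
      rw [h2 _ _ v he]
      rfl
  · have key : ∀ s v, (ρ.ren (sumAssoc I V1 V2) (.refl K)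
        (.refl (E1 ⊕ E2))).deg s v = ρ.deg s ((sumAssoc I V1 V2).symm v) :=
      fun s v => by
        rw [← ρ.deg_ren (sumAssoc I V1 V2) (.refl K) (.refl (E1 ⊕ E2)),
          apply_symm_apply]
    rintro (v | v) hv
    · rw [key] at hv ⊢
      exact (γ1.two_le_of_type_one v ((hd1 v).symm.trans hv)).trans (hd1' v)
    · rw [key] at hv ⊢
      exact (γ2.two_le_of_type_one v ((hd2 v).symm.trans hv)).trans (hd2' v)

theorem exists_isGluing_of_gl [Finite E1] [Finite E2] {ρ : Rib ((I ⊕ V1) ⊕ V2) K (flip (E1 ⊕ E2))}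
    (h : Gl (Prod.map inl id) (Prod.map inr id) (γ1.toRib.add V2) γ2.toRib ρ) :
    ∃ γ : Graph I K (E1 ⊕ E2) (V1 ⊕ V2), IsGluing γ1 γ2 γ ∧
      γ.toRib.ren (sumAssoc I V1 V2).symm (.refl K) (.refl (E1 ⊕ E2)) = ρ := by
  have he : (ofRib _ (admissible_of_gl h)).toRib.ren (sumAssoc I V1 V2).symm (.refl K)
      (.refl (E1 ⊕ E2)) = ρ := by
    rw [toRib_ofRib, Rib.ren_ren, self_trans_symm]
    exact ρ.ren_refl
  exact ⟨_, IsGl.isGluing (by rw [IsGl, he]; exact h), he⟩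

theorem IsGluing.unique_of_next [Finite E1] [Finite E2] {γ γ' : Graph I K (E1 ⊕ E2) (V1 ⊕ V2)}
    (h : IsGluing γ1 γ2 γ) (h' : IsGluing γ1 γ2 γ') (hn : γ.next = γ'.next) : γ = γ' := by
  apply toRib_injective
  refine Rib.ren_injective (sumAssoc I V1 V2).symm (.refl K) (.refl _) ?_
  exact h.isGl.unique (splitSum E1 E2) h'.isGl (by rwa [ren_refl_next, ren_refl_next])

theorem IsGluing.next_left [Finite E1] [Finite E2] {γ : Graph I K (E1 ⊕ E2) (V1 ⊕ V2)}
    (h : IsGluing γ1 γ2 γ) : Induces (Prod.map inl id) γ.next γ1.next := h.shuffle.ind1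

theorem IsGluing.next_right [Finite E1] [Finite E2] {γ : Graph I K (E1 ⊕ E2) (V1 ⊕ V2)}
    (h : IsGluing γ1 γ2 γ) : Induces (Prod.map inr id) γ.gluingWalk γ2.next :=
  fun x => h.walk_right x.1 x.2

theorem splitAssoc (E1 E2 E3 : Type) : Split3
    (Prod.map inl id : E1 × Bool → (E1 ⊕ E2) × Bool) (Prod.map inr id)
    (Prod.map inl id : (E1 ⊕ E2) × Bool → ((E1 ⊕ E2) ⊕ E3) × Bool) (Prod.map inr id)
    (Prod.map inl id : E2 × Bool → (E2 ⊕ E3) × Bool) (Prod.map inr id)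
    (Prod.map (fun x => (sumAssoc E1 E2 E3).symm (inl x)) id)
    (Prod.map (fun x => (sumAssoc E1 E2 E3).symm (inr x)) id)
    (flip E1) (flip E2) (flip E3) (flip (E1 ⊕ E2)) (flip (E2 ⊕ E3))
    (flip ((E1 ⊕ E2) ⊕ E3)) where
  split12 := splitSum E1 E2
  split123 := splitSum (E1 ⊕ E2) E3
  split23 := splitSum E2 E3
  split123' :=
    { inj1 := ((Equiv.injective _).comp Sum.inl_injective).prodMap Function.injective_id
      inj2 := ((Equiv.injective _).comp Sum.inr_injective).prodMap Function.injective_id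
      ne := fun h x hh => Sum.inl_ne_inr ((Equiv.injective _) (congrArg Prod.fst hh))
      cover := by
        rintro ⟨(e | e) | e, s⟩
        · exact Or.inl ⟨(e, s), rfl⟩
        · exact Or.inr ⟨(inl e, s), rfl⟩
        · exact Or.inr ⟨(inr e, s), rfl⟩
      map1 := fun _ => rfl
      map2 := fun _ => rfl }
  comp1 _ := rfl
  comp2 _ := rfl
  comp3 _ := rfl

variable {γ3 : Graph K L E3 V3}

/-- The surfaces in an iterated gluing to the left. -/
theorem isGluing_left_iff [Finite E1] [Finite E2] [Finite E3]
    {γ12 : Graph I K (E1 ⊕ E2) (V1 ⊕ V2)} {γ : Graph I L ((E1 ⊕ E2) ⊕ E3) ((V1 ⊕ V2) ⊕ V3)} :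
    IsGluing γ12 γ3 γ ↔ Gl (Prod.map inl id) (Prod.map inr id)
      ((γ12.toRib.ren (sumAssoc I V1 V2).symm (Equiv.refl K) (.refl _)).add V3)
      γ3.toRib (γ.toRib.ren ((sumAssoc I (V1 ⊕ V2) V3).symm.trans
        ((sumAssoc I V1 V2).symm.sumCongr (Equiv.refl V3))) (Equiv.refl L) (.refl _)) := by
  rw [isGluing_iff, IsGl, ← gl_ren_iff (splitSum _ _) (splitSum _ _)
    ((sumAssoc I V1 V2).symm.sumCongr (Equiv.refl V3))
    ((Equiv.refl K).sumCongr (Equiv.refl V3)) (Equiv.refl L) (.refl _) (.refl _)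
    (.refl _) (fun _ => rfl) (fun _ => rfl), Rib.add_ren, sumCongr_refl, Rib.ren_refl,
    Rib.ren_ren]
  rfl

/-- The surfaces in an iterated gluing to the right. -/
theorem isGluing_right_iff [Finite E1] [Finite E2] [Finite E3]
    {γ23 : Graph J L (E2 ⊕ E3) (V2 ⊕ V3)} {γ : Graph I L (E1 ⊕ (E2 ⊕ E3)) (V1 ⊕ (V2 ⊕ V3))} :
    IsGluing γ1 γ23 γ ↔ Gl (Prod.map (fun x => (sumAssoc E1 E2 E3).symm (inl x)) id)
        (Prod.map (fun x => (sumAssoc E1 E2 E3).symm (inr x)) id)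
      ((γ1.toRib.add V2).add V3)
      (γ23.toRib.ren (sumAssoc J V2 V3).symm (.refl L) (.refl _))
      (γ.toRib.ren ((sumAssoc I V1 (V2 ⊕ V3)).symm.trans
        (sumAssoc (I ⊕ V1) V2 V3).symm) (.refl L) (sumAssoc E1 E2 E3).symm) := by
  rw [isGluing_iff, IsGl, ← gl_ren_iff (splitSum _ _) (splitAssoc E1 E2 E3).split123'
    (sumAssoc (I ⊕ V1) V2 V3).symm (sumAssoc J V2 V3).symm (.refl L)
    (.refl _) (.refl _) (sumAssoc E1 E2 E3).symm (fun _ => rfl) (fun _ => rfl),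
    Rib.add_add, Rib.ren_ren]
  rfl

theorem ren_assoc_eq (γ : Graph I L ((E1 ⊕ E2) ⊕ E3) ((V1 ⊕ V2) ⊕ V3)) :
    (γ.map (.refl I) (.refl L) (sumAssoc E1 E2 E3)
      (sumAssoc V1 V2 V3)).toRib.ren ((sumAssoc I V1 (V2 ⊕ V3)).symm.trans
        (sumAssoc (I ⊕ V1) V2 V3).symm) (.refl L) (sumAssoc E1 E2 E3).symm =
      γ.toRib.ren ((sumAssoc I (V1 ⊕ V2) V3).symm.trans
        ((sumAssoc I V1 V2).symm.sumCongr (.refl V3))) (.refl L) (.refl _) := by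
  rw [toRib_map, Rib.ren_ren, self_trans_symm]
  congr 1
  ext1 (i | (v | v) | v) <;> rfl

/-- Associativity of gluing for graphs; both iterated gluings have the same edges and vertices up to
the associativity of sums of types. -/
theorem isGluing_assoc [Finite E1] [Finite E2] [Finite E3]
    (γ : Graph I L ((E1 ⊕ E2) ⊕ E3) ((V1 ⊕ V2) ⊕ V3)) :
    (∃ γ12, IsGluing γ1 γ2 γ12 ∧ IsGluing γ12 γ3 γ) ↔
      ∃ γ23, IsGluing γ2 γ3 γ23 ∧ IsGluing γ1 γ23 (γ.map (.refl I) (.refl L)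
        (sumAssoc E1 E2 E3) (sumAssoc V1 V2 V3)) := by
  constructor
  · rintro ⟨γ12, h, h'⟩
    obtain ⟨ρ, h1, h2⟩ := (h.isGl.add V3).assoc (splitAssoc E1 E2 E3) (isGluing_left_iff.mp h')
    obtain ⟨γ23, h3, rfl⟩ := exists_isGluing_of_gl h1
    refine ⟨γ23, h3, isGluing_right_iff.mpr ?_⟩
    rwa [ren_assoc_eq]
  · rintro ⟨γ23, h, h'⟩
    rw [isGluing_right_iff, ren_assoc_eq] at h'
    obtain ⟨ρ, h1, h2⟩ := h.isGl.assoc' (splitAssoc E1 E2 E3) h'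
    obtain ⟨ρ', rfl, hρ⟩ := h1.exists_of_add (splitSum E1 E2)
    obtain ⟨γ12, h3, rfl⟩ := exists_isGluing_of_gl hρ
    exact ⟨γ12, h3, isGluing_left_iff.mpr h2⟩

end Graph

variable {𝕜 : Type*} [Field 𝕜] {d : ℤ}

theorem DGInf.induction {p : DGInf 𝕜 d I J → Prop} (zero : p 0)
    (add : ∀ x y, p x → p y → p (x + y)) (smul : ∀ (c : 𝕜) x, p x → p (c • x))
    (wcls : ∀ {E V : Type} [Finite E] [Finite V] (γ : Graph I J E V) (w : List (E ⊕ V)),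
      IsOrientation w → p (wcls 𝕜 d γ w)) (x : DGInf 𝕜 d I J) : p x := by
  have hx : x ∈ Submodule.span 𝕜 (Set.range (cls 𝕜 d (I := I) (J := J))) := by
    rw [span_cls]
    trivial
  induction hx using Submodule.span_induction with
  | mem x h =>
    obtain ⟨Γ, rfl⟩ := h
    rw [cls_eq_wcls]
    exact wcls _ _ Γ.isOrientation
  | zero => exact zero
  | add x y _ _ hx hy => exact add x y hx hy
  | smul c x _ hx => exact smul c x hx

theorem Graph.IsGluing.unique_left [Finite E1] [Finite E2] [Finite E3] {γ1 : Graph I J E1 V1}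
    {γ2 : Graph J K E2 V2} {γ3 : Graph K L E3 V3} {γ12 γ12' : Graph I K (E1 ⊕ E2) (V1 ⊕ V2)}
    {γ : Graph I L ((E1 ⊕ E2) ⊕ E3) ((V1 ⊕ V2) ⊕ V3)} (h : γ1.IsGluing γ2 γ12)
    (h' : γ1.IsGluing γ2 γ12') (hγ : γ12.IsGluing γ3 γ) (hγ' : γ12'.IsGluing γ3 γ) :
    γ12 = γ12' :=
  h.unique_of_next h' (hγ.next_left.unique (splitSum _ _).inj1 hγ'.next_left)

theorem Graph.IsGluing.unique_right [Finite E1] [Finite E2] [Finite E3] {γ1 : Graph I J E1 V1}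
    {γ2 : Graph J K E2 V2} {γ3 : Graph K L E3 V3} {γ23 γ23' : Graph J L (E2 ⊕ E3) (V2 ⊕ V3)}
    {γ : Graph I L (E1 ⊕ (E2 ⊕ E3)) (V1 ⊕ (V2 ⊕ V3))} (h : γ2.IsGluing γ3 γ23)
    (h' : γ2.IsGluing γ3 γ23') (hγ : γ1.IsGluing γ23 γ) (hγ' : γ1.IsGluing γ23' γ) :
    γ23 = γ23' :=
  h.unique_of_next h' (hγ.next_right.unique (splitSum _ _).inj2 hγ'.next_right)

theorem joinWord_assoc {E1 V1 E2 V2 E3 V3 : Type} (w1 : List (E1 ⊕ V1)) (w2 : List (E2 ⊕ V2))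
    (w3 : List (E3 ⊕ V3)) :
    (joinWord (joinWord w1 w2) w3).map (Sum.map (sumAssoc E1 E2 E3)
      (sumAssoc V1 V2 V3)) = joinWord w1 (joinWord w2 w3) := by
  simp only [joinWord, List.map_append, List.map_map, List.append_assoc]
  congr 1
  · refine List.map_congr_left fun x _ => ?_
    rcases x with x | x <;> rfl
  · congr 1 <;> refine List.map_congr_left fun x _ => ?_ <;> rcases x with x | x <;> rfl

theorem glueMap_assoc [Finite I] [Finite J] [Finite K] [Finite L] (a : DGInf 𝕜 d I J)
    (b : DGInf 𝕜 d J K) (c : DGInf 𝕜 d K L) :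
    glueMap 𝕜 d (glueMap 𝕜 d a b) c = glueMap 𝕜 d a (glueMap 𝕜 d b c) := by
  induction a using DGInf.induction with
  | zero | add | smul => simp [*]
  | wcls γ1 w1 h1 =>
  induction b using DGInf.induction with
  | zero | add | smul => simp [*]
  | wcls γ2 w2 h2 =>
  induction c using DGInf.induction with
  | zero | add | smul => simp [*]
  | wcls γ3 w3 h3 =>
  have h12 := isOrientation_joinWord h1 h2
  have h23 := isOrientation_joinWord h2 h3
  rw [glueMap_wcls _ _ h1 h2, glueMap_wcls _ _ h2 h3]
  have e1 := map_finsum_of_finite ((glueMap 𝕜 d).flip (wcls 𝕜 d γ3 w3)).toAddMonoidHom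
    fun γ : {γ // γ1.IsGluing γ2 γ} => wcls 𝕜 d γ.1 (joinWord w1 w2)
  have e2 := map_finsum_of_finite (glueMap 𝕜 d (wcls 𝕜 d γ1 w1)).toAddMonoidHom
    fun γ : {γ // γ2.IsGluing γ3 γ} => wcls 𝕜 d γ.1 (joinWord w2 w3)
  refine e1.trans (Eq.trans ?_ e2.symm)
  change ∑ᶠ γ : {γ // γ1.IsGluing γ2 γ}, glueMap 𝕜 d (wcls 𝕜 d γ.1 _) (wcls 𝕜 d γ3 w3) =
    ∑ᶠ γ : {γ // γ2.IsGluing γ3 γ}, glueMap 𝕜 d (wcls 𝕜 d γ1 w1) (wcls 𝕜 d γ.1 _)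
  simp only [glueMap_wcls _ _ h12 h3, glueMap_wcls _ _ h1 h23]
  rw [finsum_subtype_finsum_subtype (f := fun γ => wcls 𝕜 d γ (joinWord (joinWord w1 w2) w3))
      (P := fun γ => γ1.IsGluing γ2 γ) (Q := fun γ γ' => γ.IsGluing γ3 γ')
      fun _ _ _ h h' hγ hγ' => Graph.IsGluing.unique_left h h' hγ hγ',
    finsum_subtype_finsum_subtype (f := fun γ => wcls 𝕜 d γ (joinWord w1 (joinWord w2 w3)))
      (P := fun γ => γ2.IsGluing γ3 γ) (Q := fun γ γ' => γ1.IsGluing γ γ')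
      fun _ _ _ h h' hγ hγ' => Graph.IsGluing.unique_right h h' hγ hγ']
  refine finsum_subtype_equiv (P := fun γ => ∃ γ', γ1.IsGluing γ2 γ' ∧ γ'.IsGluing γ3 γ)
    (Q := fun γ => ∃ γ', γ2.IsGluing γ3 γ' ∧ γ1.IsGluing γ' γ)
    (f := fun γ => wcls 𝕜 d γ (joinWord (joinWord w1 w2) w3))
    (g := fun γ => wcls 𝕜 d γ (joinWord w1 (joinWord w2 w3)))
    (Graph.mapEquiv (.refl I) (.refl L) (sumAssoc _ _ _) (sumAssoc _ _ _))
    (fun γ => Graph.isGluing_assoc γ) fun γ _ => ?_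
  rw [← joinWord_assoc]
  exact (wcls_map 𝕜 d γ _ _ _).symm

end RibbonProp

namespace RibbonProp

/-! ### Renumbering and disjoint unions -/

variable {I I' I'' J J' J'' K K' L A B E E' V V' E1 E1' V1 V1' E2 E2' V2 V2' E3 V3 : Type}
  {I1 I2 I3 J1 J2 J3 I1' I2' J1' J2' : Type}

namespace Graph

theorem disjUnion_assoc (γ1 : Graph I1 J1 E1 V1) (γ2 : Graph I2 J2 E2 V2)
    (γ3 : Graph I3 J3 E3 V3) :
    ((γ1.disjUnion γ2).disjUnion γ3).map (sumAssoc I1 I2 I3) (sumAssoc J1 J2 J3)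
      (sumAssoc E1 E2 E3) (sumAssoc V1 V2 V3) =
    γ1.disjUnion (γ2.disjUnion γ3) := by
  apply toRib_injective
  rw [toRib_map]
  refine Rib.ext ?_ ?_ ?_ ?_
  · ext1 ⟨e | e | e, s⟩
    · change Sum.map _ _ (Sum.map inl inl (Sum.map inl inl (γ1.vtx (e, s)))) =
        Sum.map inl inl (γ1.vtx (e, s))
      rcases γ1.vtx (e, s) with i | v <;> rfl
    · change Sum.map _ _ (Sum.map inl inl (Sum.map inr inr (γ2.vtx (e, s)))) =
        Sum.map inr inr (Sum.map inl inl (γ2.vtx (e, s)))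
      rcases γ2.vtx (e, s) with i | v <;> rfl
    · change Sum.map _ _ (Sum.map inr inr (γ3.vtx (e, s))) =
        Sum.map inr inr (Sum.map inr inr (γ3.vtx (e, s)))
      rcases γ3.vtx (e, s) with i | v <;> rfl
  · ext1 ⟨e | e | e, s⟩ <;> rfl
  · ext1 ⟨e | e | e, s⟩ <;> rfl
  · ext p j
    rw [Rib.ren_T, disjUnion_T, disjUnion_T]
    simp only [disjUnion_T]
    rcases p with (i | i | i) | v <;> rcases j with j | j | j <;> simp

theorem disjUnion_comm (γ1 : Graph I1 J1 E1 V1) (γ2 : Graph I2 J2 E2 V2) :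
    (γ1.disjUnion γ2).map (sumComm I1 I2) (sumComm J1 J2)
      (sumComm E1 E2) (sumComm V1 V2) = γ2.disjUnion γ1 := by
  apply toRib_injective
  rw [toRib_map]
  refine Rib.ext ?_ ?_ ?_ ?_
  · ext1 ⟨e | e, s⟩
    · change Sum.map _ _ (Sum.map inr inr (γ2.vtx (e, s))) =
        Sum.map inl inl (γ2.vtx (e, s))
      rcases γ2.vtx (e, s) with i | v <;> rfl
    · change Sum.map _ _ (Sum.map inl inl (γ1.vtx (e, s))) =
        Sum.map inr inr (γ1.vtx (e, s))
      rcases γ1.vtx (e, s) with i | v <;> rfl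
  · ext1 ⟨e | e, s⟩ <;> rfl
  · ext1 ⟨e | e, s⟩ <;> rfl
  · ext p j
    rw [Rib.ren_T, disjUnion_T, disjUnion_T]
    rcases p with (i | i) | v <;> rcases j with j | j <;> simp

theorem toRib_trivial_T (p : I ⊕ Empty) (j : I) :
    (Graph.trivial I).toRib.T p j ↔ p = inl j := by
  rcases p with i | v
  · rw [toRib_T]
    constructor
    · rintro ⟨hi, h⟩
      exact congrArg inl h
    · intro h
      exact ⟨fun x => x.1.elim, Sum.inl_injective h⟩
  · exact v.elim

theorem trivial_disjUnion [IsEmpty I] (γ : Graph I' J' E V) :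
    ((Graph.trivial I).disjUnion γ).map (emptySum I I') (emptySum I J')
      (emptySum Empty E) (emptySum Empty V) = γ := by
  apply toRib_injective
  rw [toRib_map]
  refine Rib.ext ?_ ?_ ?_ ?_
  · ext1 ⟨e, s⟩
    change Sum.map _ _ (Sum.map inr inr (γ.vtx (e, s))) = γ.vtx (e, s)
    rcases γ.vtx (e, s) with i | v <;> rfl
  · ext1 ⟨e, s⟩
    rfl
  · ext1 ⟨e, s⟩
    rfl
  · ext p j
    rw [Rib.ren_T, disjUnion_T]
    rcases p with i | v <;> simp

theorem trivial_disjUnion_trivial (I I' : Type) :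
    ((Graph.trivial I).disjUnion (Graph.trivial I')).map (.refl _) (.refl _)
      (emptySum Empty Empty) (emptySum Empty Empty) = Graph.trivial (I ⊕ I') := by
  apply toRib_injective
  rw [toRib_map]
  refine Rib.ext (funext fun x => x.1.elim) (Equiv.ext fun x => x.1.elim)
    (funext fun x => x.1.elim) ?_
  ext p j
  rw [Rib.ren_T, disjUnion_T]
  simp only [toRib_trivial_T]
  rcases p with (i | i) | v
  · rcases j with j | j <;> simp
  · rcases j with j | j <;> simp
  · exact v.elim

theorem trivial_map (α : I ≃ I') : (Graph.trivial I).map α α (.refl Empty)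
    (.refl Empty) = Graph.trivial I' := by
  apply toRib_injective
  rw [toRib_map]
  refine Rib.ext (funext fun x => x.1.elim) (Equiv.ext fun x => x.1.elim)
    (funext fun x => x.1.elim) ?_
  ext p j
  rw [Rib.ren_T, toRib_trivial_T, toRib_trivial_T]
  rcases p with i | v
  · simp
  · exact v.elim

end Graph

variable {𝕜 : Type*} [Field 𝕜] {d : ℤ}

/-- The graph with vertices `I` and without edges. -/
def oneMap (𝕜 : Type*) [Field 𝕜] (d : ℤ) (I : Type) : DGInf 𝕜 d I I := wcls 𝕜 d (Graph.trivial I) []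

theorem isOrientation_nil : IsOrientation ([] : List (Empty ⊕ Empty)) :=
  ⟨List.nodup_nil, fun x => x.elim Empty.elim Empty.elim⟩

theorem relabelMap_one (α : I ≃ I') : relabelMap 𝕜 d α α (oneMap 𝕜 d I) = oneMap 𝕜 d I' := by
  rw [oneMap, relabelMap_wcls _ _ _ isOrientation_nil, Graph.trivial_map, oneMap]

theorem relabelMap_relabelMap (α : I ≃ I') (β : J ≃ J') (α' : I' ≃ I'') (β' : J' ≃ J'')
    (x : DGInf 𝕜 d I J) : relabelMap 𝕜 d α' β' (relabelMap 𝕜 d α β x) =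
      relabelMap 𝕜 d (α.trans α') (β.trans β') x := by
  induction x using DGInf.induction with
  | zero | add | smul => simp [*]
  | wcls γ w h =>
    rw [relabelMap_wcls _ _ _ h, relabelMap_wcls _ _ _ h, relabelMap_wcls _ _ _ h, Graph.map_map]
    rfl

theorem glueMap_relabelMap [Finite I] [Finite I'] [Finite K] [Finite K'] (α : I ≃ I')
    (β : J ≃ J') (δ : K ≃ K') (a : DGInf 𝕜 d I J) (b : DGInf 𝕜 d J K) :
    glueMap 𝕜 d (relabelMap 𝕜 d α β a) (relabelMap 𝕜 d β δ b) =
      relabelMap 𝕜 d α δ (glueMap 𝕜 d a b) := by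
  induction a using DGInf.induction with
  | zero | add | smul => simp [*]
  | wcls γ1 w1 h1 =>
  induction b using DGInf.induction with
  | zero | add | smul => simp [*]
  | wcls γ2 w2 h2 =>
  rw [relabelMap_wcls _ _ _ h1, relabelMap_wcls _ _ _ h2, glueMap_wcls _ _ h1 h2,
    glueMap_wcls _ _ h1 h2]
  refine Eq.trans ?_ (map_finsum_of_finite (relabelMap 𝕜 d α δ).toAddMonoidHom _).symm
  refine (finsum_subtype_equiv (P := fun γ => γ1.IsGluing γ2 γ) (Q := fun γ => _)
    (f := fun γ => relabelMap 𝕜 d α δ (wcls 𝕜 d γ (joinWord w1 w2)))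
    (g := fun γ => wcls 𝕜 d γ (joinWord w1 w2))
    (Graph.mapEquiv α δ (.refl _) (.refl _))
    (fun γ => ?_) fun γ _ => ?_).symm
  · rw [← Graph.isGluing_map_iff α β δ (.refl _) (.refl _) (.refl _)
      (.refl _), sumCongr_refl, sumCongr_refl]
    rfl
  · rw [relabelMap_wcls _ _ _ (isOrientation_joinWord h1 h2)]
    rfl

theorem unionMap_relabelMap (α : I ≃ I1) (β : J ≃ J1) (α' : I' ≃ I1') (β' : J' ≃ J1')
    (a : DGInf 𝕜 d I J) (b : DGInf 𝕜 d I' J') :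
    unionMap 𝕜 d (relabelMap 𝕜 d α β a) (relabelMap 𝕜 d α' β' b) =
      relabelMap 𝕜 d (α.sumCongr α') (β.sumCongr β') (unionMap 𝕜 d a b) := by
  induction a using DGInf.induction with
  | zero | add | smul => simp [*]
  | wcls γ1 w1 h1 =>
  induction b using DGInf.induction with
  | zero | add | smul => simp [*]
  | wcls γ2 w2 h2 =>
  rw [relabelMap_wcls _ _ _ h1, relabelMap_wcls _ _ _ h2, unionMap_wcls _ _ h1 h2,
    unionMap_wcls _ _ h1 h2, relabelMap_wcls _ _ _ (isOrientation_joinWord h1 h2),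
    Graph.disjUnion_map, sumCongr_refl, sumCongr_refl]

theorem wcls_map' [Finite E] [Finite V] [Finite E'] [Finite V'] (γ : Graph I J E V) (α : I ≃ I')
    (β : J ≃ J') (a : E ≃ E') (b : V ≃ V') {w : List (E ⊕ V)} (hw : IsOrientation w) :
    wcls 𝕜 d (γ.map α β a b) (w.map (Sum.map a b)) = relabelMap 𝕜 d α β (wcls 𝕜 d γ w) := by
  rw [relabelMap_wcls α β γ hw, ← wcls_map 𝕜 d _ a b, Graph.map_map]
  rfl

theorem unionMap_assoc (a : DGInf 𝕜 d I1 J1) (b : DGInf 𝕜 d I2 J2) (c : DGInf 𝕜 d I3 J3) :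
    relabelMap 𝕜 d (sumAssoc I1 I2 I3) (sumAssoc J1 J2 J3) (unionMap 𝕜 d (unionMap 𝕜 d a b) c) =
      unionMap 𝕜 d a (unionMap 𝕜 d b c) := by
  induction a using DGInf.induction with
  | zero | add | smul => simp [*]
  | wcls γ1 w1 h1 =>
  induction b using DGInf.induction with
  | zero | add | smul => simp [*]
  | wcls γ2 w2 h2 =>
  induction c using DGInf.induction with
  | zero | add | smul => simp [*]
  | wcls γ3 w3 h3 =>
  have h12 := isOrientation_joinWord h1 h2
  have h23 := isOrientation_joinWord h2 h3
  rw [unionMap_wcls _ _ h1 h2, unionMap_wcls _ _ h2 h3, unionMap_wcls _ _ h12 h3,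
    unionMap_wcls _ _ h1 h23,
    ← wcls_map' _ _ _ (sumAssoc _ _ _) (sumAssoc _ _ _)
      (isOrientation_joinWord h12 h3), Graph.disjUnion_assoc, joinWord_assoc]

/-- The elements of orientation degree `p`. -/
def grInf (𝕜 : Type*) [Field 𝕜] (d : ℤ) (I J : Type) (p : ℤ) : Submodule 𝕜 (DGInf 𝕜 d I J) :=
  Submodule.span 𝕜 {x | ∃ Γ : OGraph I J, Γ.orientationDegree d = p ∧ x = cls 𝕜 d Γ}

/-- Induction over homogeneous elements, as linear combinations of graphs with words of degree `p`.
-/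
theorem grInf_induction {p : ℤ} {P : DGInf 𝕜 d I J → Prop} (zero : P 0)
    (add : ∀ x y, P x → P y → P (x + y)) (smul : ∀ (c : 𝕜) x, P x → P (c • x))
    (wcls : ∀ {E V : Type} [Finite E] [Finite V] (γ : Graph I J E V) (w : List (E ⊕ V)),
      IsOrientation w → wordDeg d γ w = p → P (wcls 𝕜 d γ w))
    {x : DGInf 𝕜 d I J} (hx : x ∈ grInf 𝕜 d I J p) : P x := by
  induction hx using Submodule.span_induction with
  | mem x h =>
    obtain ⟨Γ, hp, rfl⟩ := h
    rw [cls_eq_wcls]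
    exact wcls _ _ Γ.isOrientation hp
  | zero => exact zero
  | add x y _ _ hx hy => exact add x y hx hy
  | smul c x _ hx => exact smul c x hx

theorem wcls_mem_grInf [Finite E] [Finite V] (γ : Graph I J E V) {w : List (E ⊕ V)}
    (hw : IsOrientation w) : wcls 𝕜 d γ w ∈ grInf 𝕜 d I J (wordDeg d γ w) := by
  rw [wcls_eq 𝕜 d hw]
  exact Submodule.subset_span ⟨_, rfl, rfl⟩

/-- The disjoint union is commutative up to the Koszul sign. -/
theorem unionMap_comm {p q : ℤ} {a : DGInf 𝕜 d I J} {b : DGInf 𝕜 d I' J'}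
    (ha : a ∈ grInf 𝕜 d I J p) (hb : b ∈ grInf 𝕜 d I' J' q) :
    relabelMap 𝕜 d (sumComm I I') (sumComm J J') (unionMap 𝕜 d a b) =
      (p * q).negOnePow • unionMap 𝕜 d b a := by
  refine grInf_induction (P := fun a => relabelMap 𝕜 d (sumComm I I') (sumComm J J')
    (unionMap 𝕜 d a b) = (p * q).negOnePow • unionMap 𝕜 d b a) (by simp)
    (fun x y hx hy => by simp [hx, hy]) (fun c x hx => by simp [hx, smul_comm c])
    (fun γ1 w1 h1 hp => ?_) ha
  refine grInf_induction (P := fun b => relabelMap 𝕜 d (sumComm I I') (sumComm J J')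
    (unionMap 𝕜 d (wcls 𝕜 d γ1 w1) b) = (p * q).negOnePow •
      unionMap 𝕜 d b (wcls 𝕜 d γ1 w1)) (by simp)
    (fun x y hx hy => by simp [hx, hy]) (fun c x hx => by simp [hx, smul_comm c])
    (fun γ2 w2 h2 hq => ?_) hb
  rw [unionMap_wcls _ _ h1 h2, unionMap_wcls _ _ h2 h1, ← wcls_map' _ _ _ (sumComm _ _)
    (sumComm _ _) (isOrientation_joinWord h1 h2), Graph.disjUnion_comm]
  have h := wcls_block 𝕜 d (γ2.disjUnion γ1) [] (w1.map (Sum.map inr inr))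
    (w2.map (Sum.map inl inl)) []
  simp only [List.append_nil, List.nil_append] at h
  have d1 : wordDeg d (γ2.disjUnion γ1) (w1.map (Sum.map inr inr)) = p :=
    (wordDeg_map_eq d _ _ fun x _ =>
      JoinRel.letterDeg_right (R := unionRel _ _ _ _) d rfl x).trans hp
  have d2 : wordDeg d (γ2.disjUnion γ1) (w2.map (Sum.map inl inl)) = q :=
    (wordDeg_map_eq d _ _ fun x _ =>
      JoinRel.letterDeg_left (R := unionRel _ _ _ _) d rfl x).trans hq
  rw [d1, d2] at h
  rw [joinWord, joinWord, ← h]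
  congr 1
  simp only [List.map_append, List.map_map]
  congr 1 <;> refine List.map_congr_left fun x _ => ?_ <;> rcases x with x | x <;> rfl

theorem one_unionMap [IsEmpty I] (a : DGInf 𝕜 d I' J') :
    relabelMap 𝕜 d (emptySum I I') (emptySum I J') (unionMap 𝕜 d (oneMap 𝕜 d I) a) = a := by
  induction a using DGInf.induction with
  | zero | add | smul => simp [*]
  | wcls γ w h =>
    have ho := isOrientation_joinWord isOrientation_nil h
    rw [oneMap, unionMap_wcls _ _ isOrientation_nil h, ← wcls_map' _ _ _ (emptySum Empty _)
      (emptySum Empty _) ho, Graph.trivial_disjUnion]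
    congr 1
    simp only [joinWord, List.map_nil, List.nil_append, List.map_map]
    conv_rhs => rw [← List.map_id w]
    refine List.map_congr_left fun x _ => ?_
    rcases x with x | x <;> rfl

theorem unionMap_one_one (I I' : Type) :
    unionMap 𝕜 d (oneMap 𝕜 d I) (oneMap 𝕜 d I') = oneMap 𝕜 d (I ⊕ I') := by
  have ho := isOrientation_joinWord isOrientation_nil isOrientation_nil
  rw [oneMap, oneMap, unionMap_wcls _ _ isOrientation_nil isOrientation_nil, oneMap,
    ← Graph.trivial_disjUnion_trivial, ← wcls_map 𝕜 d _ (emptySum Empty Empty)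
      (emptySum Empty Empty)]
  rfl

theorem oneMap_mem (I : Type) : oneMap 𝕜 d I ∈ grInf 𝕜 d I I 0 := by
  rw [oneMap, ← wordDeg_nil d (Graph.trivial I)]
  exact wcls_mem_grInf _ isOrientation_nil

theorem unionMap_one_comm (a : DGInf 𝕜 d I J) (L : Type) :
    relabelMap 𝕜 d (sumComm I L) (sumComm J L)
      (unionMap 𝕜 d a (oneMap 𝕜 d L)) = unionMap 𝕜 d (oneMap 𝕜 d L) a := by
  induction a using DGInf.induction with
  | zero | add | smul => simp [*]
  | wcls γ w h =>
    rw [unionMap_comm (wcls_mem_grInf γ h) (oneMap_mem L), mul_zero, Int.negOnePow_zero, one_smul]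

theorem relabelMap_expMap [Finite I] [Finite J] [Finite I'] [Finite J'] (α : I ≃ I') (β : J ≃ J')
    (a : DGInf 𝕜 d I J) :
    expMap 𝕜 d (relabelMap 𝕜 d α β a) = relabelMap 𝕜 d α β (expMap 𝕜 d a) := by
  induction a using DGInf.induction with
  | zero | add | smul => simp [*]
  | wcls γ w h =>
    rw [relabelMap_wcls _ _ _ h, expMap_wcls _ h, expMap_wcls _ h,
      ← sum_expTerm_map γ h α β (.refl _) (.refl _)]
    simp

theorem expMap_one (I : Type) [Finite I] : expMap 𝕜 d (oneMap 𝕜 d I) = 0 := by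
  rw [oneMap, expMap_wcls _ isOrientation_nil]
  have : IsEmpty {γ' // ∃ u, (Graph.trivial I).IsExpansion u γ'} := ⟨by
    rintro ⟨γ', u, h⟩
    rcases u with i | v
    · have h2 := γ'.two_le_of_type_one none h.type_of_input
      rw [card_subtype_option, Nat.card_of_isEmpty] at h2
      split_ifs at h2
      · omega
      · omega
    · exact v.elim⟩
  exact finsum_of_isEmpty _

end RibbonProp

namespace RibbonProp

/-! ### Vertices without edges -/

variable {I I' J J' K K' L E E' V V' E1 V1 E2 V2 Q : Type}

namespace Graph

/-- The disjoint union of a graph and vertices without edges, with the edges and vertices of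
positive type of the graph. -/
def addTriv (γ : Graph I J E V) (Q : Type) : Graph (I ⊕ Q) (J ⊕ Q) E V :=
  (γ.disjUnion (Graph.trivial Q)).map (.refl _) (.refl _) (sumEmpty E Empty) (sumEmpty V Empty)

theorem toRib_addTriv (γ : Graph I J E V) (Q : Type) : (γ.addTriv Q).toRib =
    (γ.toRib.add Q).ren (sumRightComm I V Q) (.refl _) (.refl E) := by
  rw [addTriv, toRib_map]
  refine Rib.ext ?_ ?_ ?_ ?_
  · ext1 ⟨e, s⟩
    change Sum.map _ _ (Sum.map inl inl (γ.vtx (e, s))) =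
      sumRightComm I V Q (inl (γ.vtx (e, s)))
    rcases γ.vtx (e, s) with i | v <;> rfl
  · ext1 ⟨e, s⟩
    rfl
  · ext1 ⟨e, s⟩
    rfl
  · ext p j
    rw [Rib.ren_T, Rib.ren_T, disjUnion_T]
    simp only [toRib_trivial_T]
    rcases p with (i | i) | v <;> rcases j with j | j <;> simp [sumRightComm]

theorem addTriv_injective (Q : Type) : Function.Injective fun γ : Graph I J E V => γ.addTriv Q := by
  intro γ γ' h
  have h' : (γ.addTriv Q).toRib = (γ'.addTriv Q).toRib := congrArg toRib h
  rw [toRib_addTriv, toRib_addTriv] at h'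
  exact toRib_injective (Rib.add_injective Q (Rib.ren_injective _ _ _ h'))

theorem isGluing_addTriv_iff_gl [Finite E1] [Finite E2] {γ1 : Graph I J E1 V1}
    {γ2 : Graph J K E2 V2} {γ : Graph (I ⊕ Q) (K ⊕ Q) (E1 ⊕ E2) (V1 ⊕ V2)} :
    IsGluing (γ1.addTriv Q) (γ2.addTriv Q) γ ↔ Gl (Prod.map inl id) (Prod.map inr id)
      ((γ1.toRib.add V2).add Q) (γ2.toRib.add Q)
      (γ.toRib.ren ((sumRightComm I Q (V1 ⊕ V2)).trans
        ((sumAssoc I V1 V2).symm.sumCongr (.refl Q))) (.refl _)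
        (.refl _)) := by
  rw [isGluing_iff, IsGl, toRib_addTriv, toRib_addTriv, ← gl_ren_iff (splitSum _ _) (splitSum _ _)
      ((sumRightComm (I ⊕ V1) V2 Q).trans
        ((sumRightComm I V1 Q).sumCongr (.refl V2))) (sumRightComm J V2 Q) (.refl _)
      (.refl _) (.refl _) (.refl _) (fun _ => rfl) (fun _ => rfl),
    Rib.ren_ren]
  have h1 : ((γ1.toRib.add V2).add Q).ren ((sumRightComm (I ⊕ V1) V2 Q).trans
      ((sumRightComm I V1 Q).sumCongr (.refl V2))) (sumRightComm J V2 Q) (.refl E1) =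
      ((γ1.toRib.add Q).ren (sumRightComm I V1 Q) (.refl _) (.refl E1)).add V2 := by
    rw [← Rib.add_ren _ _ _ _ (.refl V2), ← Rib.add_add_comm, Rib.ren_ren]
    congr 1
    · ext1 (((i | v) | q) | v) <;> rfl
    · ext1 ((j | q) | v) <;> rfl
  rw [h1]
  have h2 : (((sumRightComm I Q (V1 ⊕ V2)).trans ((sumAssoc I V1 V2).symm.sumCongr
      (.refl Q))).trans ((sumRightComm (I ⊕ V1) V2 Q).trans
        ((sumRightComm I V1 Q).sumCongr (.refl V2)))) =
      (sumAssoc (I ⊕ Q) V1 V2).symm := by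
    ext1 ((i | q) | v | v) <;> rfl
  rw [h2]
  rfl

/-- If vertices without edges are added to both graphs and glued to each other, then they are added
to the gluings. -/
theorem isGluing_addTriv_iff [Finite E1] [Finite E2] {γ1 : Graph I J E1 V1}
    {γ2 : Graph J K E2 V2} {γ : Graph (I ⊕ Q) (K ⊕ Q) (E1 ⊕ E2) (V1 ⊕ V2)} :
    IsGluing (γ1.addTriv Q) (γ2.addTriv Q) γ ↔ ∃ γ', IsGluing γ1 γ2 γ' ∧ γ'.addTriv Q = γ := by
  have key : ∀ γ' : Graph I K (E1 ⊕ E2) (V1 ⊕ V2), (γ'.addTriv Q).toRib.ren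
      ((sumRightComm I Q (V1 ⊕ V2)).trans ((sumAssoc I V1 V2).symm.sumCongr
        (.refl Q))) (.refl _) (.refl _) =
      (γ'.toRib.ren (sumAssoc I V1 V2).symm (.refl K) (.refl _)).add Q := by
    intro γ'
    rw [toRib_addTriv, Rib.ren_ren, ← Rib.add_ren _ _ _ _ (.refl Q), sumCongr_refl]
    congr 1
    ext1 ((i | v | v) | q) <;> rfl
  rw [isGluing_addTriv_iff_gl]
  constructor
  · intro h
    obtain ⟨ρ, hρ, h'⟩ := h.exists_of_add (splitSum E1 E2)
    obtain ⟨γ', h1, rfl⟩ := exists_isGluing_of_gl h'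
    refine ⟨γ', h1, toRib_injective (Rib.ren_injective _ _ _ ((key γ').trans hρ.symm))⟩
  · rintro ⟨γ', h, rfl⟩
    rw [key]
    exact h.isGl.add Q

/-- No edge can be expanded at a vertex without edges. -/
theorem IsExpansion.not_trivial [Finite E] {γ : Graph I J E V} {i : I}
    {γ' : Graph I J (Option E) (Option V)} (h : γ.IsExpansion (inl i) γ') :
    ¬ γ.Trivial i := by
  intro hi
  have h2 := γ'.two_le_of_type_one none h.type_of_input
  rw [card_subtype_option] at h2
  have : IsEmpty {e : E // γ'.vtx (some e, false) = inr none} := ⟨fun x => by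
    have := h.vtx x.1 false
    rw [x.2] at this
    exact hi _ this.symm⟩
  rw [Nat.card_of_isEmpty (α := {e : E // _}), h.target, if_neg (by simp)] at h2
  omega

/-- Names of the vertices of an expansion together with further vertices. -/
def optionSumComm (P Q : Type) : Option P ⊕ Q ≃ Option (P ⊕ Q) where
  toFun := Sum.elim (fun p => p.map inl) fun q => some (inr q)
  invFun p := p.elim (inl none) (Sum.map some id)
  left_inv := by rintro ((_ | p) | q) <;> rfl
  right_inv := by rintro (_ | p | q) <;> rfl

theorem _root_.RibbonProp.Rib.map_map {P P' P'' J J' J'' H : Type} {φ : Perm H}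
    (γ : Rib P J φ) (α : P ≃ P') (β : J ≃ J') (α' : P' ≃ P'') (β' : J' ≃ J'') :
    (γ.map α β (.refl H) (fun _ => rfl)).map α' β' (.refl H) (fun _ => rfl) =
      γ.map (α.trans α') (β.trans β') (.refl H) (fun _ => rfl) :=
  Rib.ext rfl (Equiv.ext fun _ => rfl) rfl rfl

theorem _root_.RibbonProp.Rib.ren_eq_map {P P' J J' : Type} (γ : Rib P J (flip E)) (α : P ≃ P')
    (β : J ≃ J') : γ.ren α β (.refl E) = γ.map α β (.refl _) (fun _ => rfl) :=
  Rib.ext rfl (Equiv.ext fun _ => rfl) rfl rfl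

theorem _root_.RibbonProp.gl_map_iff {P P' J J' K K' H1 H2 H : Type} {φ1 : Perm H1}
    {φ2 : Perm H2} {φ : Perm H} {i1 : H1 → H} {i2 : H2 → H}
    (S : Split i1 i2 φ1 φ2 φ) {γ1 : Rib P J φ1} {γ2 : Rib J K φ2} {γ : Rib P K φ}
    (α : P ≃ P') (β : J ≃ J') (δ : K ≃ K') :
    Gl i1 i2 (γ1.map α β (.refl H1) (fun _ => rfl))
      (γ2.map β δ (.refl H2) (fun _ => rfl)) (γ.map α δ (.refl H) (fun _ => rfl)) ↔
      Gl i1 i2 γ1 γ2 γ := by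
  constructor
  · intro h
    have := h.map S α.symm β.symm δ.symm (.refl _) (.refl _) (.refl _)
      (fun _ => rfl) (fun _ => rfl) (fun _ => rfl) (fun _ => rfl) (fun _ => rfl)
    simpa only [Rib.map_map, self_trans_symm, Rib.map_refl] using this
  · exact fun h => h.map S α β δ _ _ _ _ _ _ (fun _ => rfl) (fun _ => rfl)

/-- Further vertices without edges do not change the shape of the surface with one edge. -/
theorem eps_add {P : Type} (u : P) (Q : Type) : ((eps u).add Q).map (optionSumComm P Q)
    (.refl _) (.refl Bool) (fun _ => rfl) = eps (inl u : P ⊕ Q) := by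
  refine Rib.ext ?_ (Equiv.ext fun _ => rfl) rfl ?_
  · ext b : 1
    cases b <;> rfl
  · ext p j
    change ((eps u).add Q).T _ _ ↔ _
    rw [eps_T]
    rcases p with _ | p | q <;> rcases j with j | j <;> simp [optionSumComm, eps_T]

theorem admissible_of_add {ρ : Rib (I ⊕ V) J (flip E)}
    (h : ((ρ.add Q).ren (sumRightComm I V Q) (.refl _) (.refl E)).Admissible) :
    ρ.Admissible := by
  have hv : ∀ e s, ((ρ.add Q).ren (sumRightComm I V Q) (.refl _) (.refl E)).vtx (e, s) =
      Sum.map inl id (ρ.vtx (e, s)) := by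
    intro e s
    change sumRightComm I V Q (inl (ρ.vtx (e, s))) = _
    rcases ρ.vtx (e, s) with i | v <;> rfl
  have hv' : ∀ e s v, ((ρ.add Q).ren (sumRightComm I V Q) (.refl _) (.refl E)).vtx (e, s)
      = inr v ↔ ρ.vtx (e, s) = inr v := by
    intro e s v
    rw [hv]
    rcases ρ.vtx (e, s) with i | v <;> simp
  refine ⟨fun e i hi => h.source_ne e (inl i) (by rw [hv, hi]; rfl), fun v => ?_, fun v => ?_⟩
  · obtain ⟨e, he⟩ := h.exists_source v
    exact ⟨e, (hv' _ _ _).mp he⟩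
  · have := h.two_le v
    simpa only [Rib.deg, hv'] using this

/-- As vertices without edges have no expansions into admissible graphs, only `γ` is expanded. -/
theorem isExpansion_addTriv_iff [Finite E] {γ : Graph I J E V}
    {δ : Graph (I ⊕ Q) (J ⊕ Q) (Option E) (Option V)} :
    (∃ u, IsExpansion (γ.addTriv Q) u δ) ↔ ∃ γ', (∃ u, IsExpansion γ u γ') ∧
      γ'.addTriv Q = δ := by
  have key : ∀ u, IsExpansion (γ.addTriv Q) (Sum.map inl id u) δ ↔
      Gl (fun s => ((none : Option E), s)) (Prod.map some id) ((eps u).add Q) (γ.toRib.add Q)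
        (δ.toRib.ren ((optionSum (I ⊕ Q) V).trans ((optionCongr
          (sumRightComm I Q V)).trans (optionSumComm (I ⊕ V) Q).symm)) (.refl _)
          (.refl _)) := by
    intro u
    have hu : Sum.map inl id u = sumRightComm I V Q (inl u) := by
      rcases u with i | v <;> rfl
    rw [isExpansion_iff_gl, toRib_addTriv, hu, ← map_eps, ← eps_add, Rib.map_map,
      Rib.ren_eq_map, ← gl_map_iff (splitOption E) ((optionSumComm (I ⊕ V) Q).trans
        (optionCongr (sumRightComm I V Q))) (sumRightComm I V Q) (.refl (J ⊕ Q))]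
    have h1 : (δ.toRib.ren ((optionSum (I ⊕ Q) V).trans ((optionCongr
        (sumRightComm I Q V)).trans (optionSumComm (I ⊕ V) Q).symm)) (.refl _)
        (.refl _)).map ((optionSumComm (I ⊕ V) Q).trans
          (optionCongr (sumRightComm I V Q))) (.refl _) (.refl _)
          (fun _ => rfl) =
        δ.toRib.ren (optionSum (I ⊕ Q) V) (.refl _) (.refl _) := by
      rw [← Rib.ren_eq_map, Rib.ren_ren]
      congr 1
      ext1 ((i | q) | _ | v) <;> rfl
    rw [h1]
    rfl
  have key2 : ∀ γ' : Graph I J (Option E) (Option V), (γ'.addTriv Q).toRib.ren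
      ((optionSum (I ⊕ Q) V).trans ((optionCongr (sumRightComm I Q V)).trans
        (optionSumComm (I ⊕ V) Q).symm)) (.refl _) (.refl _) =
      (γ'.toRib.ren (optionSum I V) (.refl J) (.refl _)).add Q := by
    intro γ'
    rw [toRib_addTriv, Rib.ren_ren, ← Rib.add_ren _ _ _ _ (.refl Q), sumCongr_refl]
    congr 1
    ext1 ((i | _ | v) | q) <;> rfl
  constructor
  · rintro ⟨u, h⟩
    obtain ⟨u, rfl⟩ : ∃ u' : I ⊕ V, u = Sum.map inl id u' := by
      rcases u with (i | q) | v
      · exact ⟨inl i, rfl⟩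
      · refine absurd ?_ h.not_trivial
        rintro ⟨e, s⟩ he
        have : Sum.map inl id (γ.vtx (e, s)) = (inl (inr q) : (I ⊕ Q) ⊕ V) := by
          refine Eq.trans ?_ he
          change _ = (γ.addTriv Q).toRib.vtx (e, s)
          rw [toRib_addTriv]
          change _ = sumRightComm I V Q (inl (γ.vtx (e, s)))
          rcases γ.vtx (e, s) with i | v <;> rfl
        rcases hv : γ.vtx (e, s) with i | v <;> simp [hv] at this
      · exact ⟨inr v, rfl⟩
    rw [key] at h
    obtain ⟨ρ, hρ, h'⟩ := h.exists_of_add (splitOption E)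
    have hδ : δ.toRib = ((ρ.ren (optionSum I V).symm (.refl J) (.refl _)).add Q).ren
        (sumRightComm I (Option V) Q) (.refl _) (.refl _) := by
      rw [← Rib.add_ren _ _ _ _ (.refl Q), ← hρ, Rib.ren_ren, Rib.ren_ren]
      refine Eq.trans (Rib.ren_refl _).symm ?_
      congr 1
      · ext1 ((i | q) | _ | v) <;> rfl
      · simp
    have hA := admissible_of_add (hδ ▸ δ.toRib_admissible)
    refine ⟨ofRib _ hA, ⟨u, ?_⟩, ?_⟩
    · rw [isExpansion_iff_gl, toRib_ofRib, Rib.ren_ren, symm_trans_self]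
      exact h'
    · apply toRib_injective
      rw [toRib_addTriv, toRib_ofRib, hδ]
  · rintro ⟨γ', ⟨u, h⟩, rfl⟩
    refine ⟨Sum.map inl id u, ?_⟩
    rw [isExpansion_iff_gl] at h
    rw [key, key2]
    exact h.add Q

end Graph

/-! ### Disjoint unions as compositions -/

namespace Graph

/-- The disjoint union of vertices without edges and a graph, with the edges and vertices of
positive type of the graph. -/
def trivAdd (Q : Type) (γ : Graph I J E V) : Graph (Q ⊕ I) (Q ⊕ J) E V :=
  ((Graph.trivial Q).disjUnion γ).map (.refl _) (.refl _) (emptySum Empty E) (emptySum Empty V)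

theorem addTriv_vtx (γ : Graph I J E V) (Q : Type) (e s) :
    (γ.addTriv Q).vtx (e, s) = Sum.map inl id (γ.vtx (e, s)) := by
  change (γ.addTriv Q).toRib.vtx (e, s) = _
  rw [toRib_addTriv]
  change sumRightComm I V Q (inl (γ.vtx (e, s))) = _
  rcases γ.vtx (e, s) with i | v <;> rfl

theorem addTriv_T (γ : Graph I J E V) (Q : Type) (p j) : (γ.addTriv Q).toRib.T p j ↔
    (∃ i k, p = inl (inl i) ∧ j = inl k ∧ γ.toRib.T (inl i) k) ∨
      ∃ q, p = inl (inr q) ∧ j = inr q := by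
  rw [toRib_addTriv, Rib.ren_T]
  rcases p with (i | i) | v <;> rcases j with j | j <;> simp [sumRightComm, eq_comm]

theorem trivAdd_vtx (γ : Graph I J E V) (Q : Type) (e s) :
    (γ.trivAdd Q).vtx (e, s) = Sum.map inr id (γ.vtx (e, s)) := by
  change Sum.map _ _ (Sum.map inr inr (γ.vtx (e, s))) = _
  rcases γ.vtx (e, s) with i | v <;> rfl

theorem trivAdd_T (γ : Graph I J E V) (Q : Type) (p j) : (γ.trivAdd Q).toRib.T p j ↔
    (∃ i k, p = inl (inr i) ∧ j = inr k ∧ γ.toRib.T (inl i) k) ∨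
      ∃ q, p = inl (inl q) ∧ j = inl q := by
  rw [trivAdd, toRib_map, Rib.ren_T, disjUnion_T]
  simp only [toRib_trivial_T]
  rcases p with (i | i) | v <;> rcases j with j | j <;> simp [eq_comm]

/-- If `γ1` is glued only to vertices without edges, and `γ2` only to boundary components around
such vertices, then there is just one gluing, the disjoint union. -/
theorem isGluing_addTriv_trivAdd_iff [Finite E1] [Finite E2] {γ1 : Graph I J E1 V1}
    {γ2 : Graph I' J' E2 V2} {γ : Graph (I ⊕ I') (J ⊕ J') (E1 ⊕ E2) (V1 ⊕ V2)} :
    IsGluing (γ1.addTriv I') (γ2.trivAdd J) γ ↔ γ = γ1.disjUnion γ2 := by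
  have S := splitSum E1 E2
  have hN1 : ∀ h, (γ1.addTriv I').next h = γ1.next h := fun h => rfl
  have hN2 : ∀ h, (γ2.trivAdd J).next h = γ2.next h := fun h => rfl
  have hO1 : ∀ h, (γ1.addTriv I').out h = inl (γ1.out h) := fun h => rfl
  have hO2 : ∀ h, (γ2.trivAdd J).out h = inr (γ2.out h) := fun h => rfl
  -- in a gluing, the edges of the two graphs are at different vertices
  have hsep : ∀ {δ : Graph (I ⊕ I') (J ⊕ J') (E1 ⊕ E2) (V1 ⊕ V2)},
      IsGluing (γ1.addTriv I') (γ2.trivAdd J) δ → ∀ h x,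
        δ.vtx (Prod.map inl id h) ≠ δ.vtx (Prod.map inr id x) := by
    rintro δ hδ ⟨e, s⟩ ⟨e', s'⟩ hh
    change δ.vtx (inl e, s) = δ.vtx (inr e', s') at hh
    rw [hδ.vtx_left, addTriv_vtx] at hh
    rcases hx : γ2.vtx (e', s') with i' | v
    · have := hδ.isGl.vtx2 (e', s') (inl (inl (inr i'))) (by
        rw [toRib_vtx, trivAdd_vtx, hx]
        change ((γ1.addTriv I').toRib.add V2).T _ (inl (inr i'))
        rw [Rib.add_T_inl, addTriv_T]
        exact Or.inr ⟨i', rfl, rfl⟩)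
      change (sumAssoc _ V1 V2).symm (δ.vtx (inr e', s')) = _ at this
      rw [symm_apply_eq] at this
      rw [this] at hh
      rcases hv : γ1.vtx (e, s) with i | v <;> simp [hv] at hh
    · rw [hδ.vtx_right e' s' v (by rw [trivAdd_vtx, hx]; rfl)] at hh
      rcases hv : γ1.vtx (e, s) with i | v <;> simp [hv] at hh
  have hnext : ∀ {δ : Graph (I ⊕ I') (J ⊕ J') (E1 ⊕ E2) (V1 ⊕ V2)},
      IsGluing (γ1.addTriv I') (γ2.trivAdd J) δ → δ.next = sumPerm γ1.next γ2.next := by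
    intro δ hδ
    have hv : ∀ y, δ.vtx (δ.next y) = δ.vtx y := fun y =>
      ((δ.sameCycle_next _ _).mp ⟨1, rfl⟩).symm
    ext1 y
    rcases S.cover y with ⟨h, rfl⟩ | ⟨x, rfl⟩
    · rw [sumPerm_left]
      rcases S.cover (δ.next (Prod.map inl id h)) with ⟨h', hh⟩ | ⟨x', hh⟩
      · have h1 := FirstReturn.of_apply (s := Set.range (Prod.map inl id)) hh.symm ⟨h', rfl⟩
        have := h1.unique (hδ.next_left h)
        rw [← hh, this, hN1]
      · exact absurd ((hv _).symm.trans (congrArg δ.vtx hh.symm)) (hsep hδ _ _)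
    · rw [sumPerm_right]
      rcases S.cover (δ.next (Prod.map inr id x)) with ⟨h', hh⟩ | ⟨x', hh⟩
      · exact absurd ((congrArg δ.vtx hh).trans (hv _)) (hsep hδ _ _)
      · have h1 : δ.gluingWalk (Prod.map inr id x) = Prod.map inr id x' := by
          change sumPerm _ _ (δ.next _) = _
          rw [← hh, sumPerm_right]
          rfl
        have := (FirstReturn.of_apply (s := Set.range (Prod.map inr id)) h1 ⟨x', rfl⟩).unique
          (hδ.next_right x)
        rw [← hh, this, hN2]
  have hex : IsGluing (γ1.addTriv I') (γ2.trivAdd J) (γ1.disjUnion γ2) := by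
    apply IsGl.isGluing
    have hn : ((γ1.disjUnion γ2).toRib.ren (sumAssoc (I ⊕ I') V1 V2).symm (.refl _)
        (.refl _)).next = sumPerm γ1.next γ2.next := Equiv.ext fun _ => rfl
    have hw : extendPerm (Prod.map inl id : E1 × Bool → (E1 ⊕ E2) × Bool) (flip E1) *
        sumPerm γ1.next γ2.next = sumPerm γ1.walk γ2.next := by
      ext1 y
      rw [Perm.mul_apply]
      rcases S.cover y with ⟨h, rfl⟩ | ⟨x, rfl⟩
      · rw [sumPerm_left, sumPerm_left, extendPerm_apply S.inj1]
        rfl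
      · rw [sumPerm_right, sumPerm_right, extendPerm_of_notMem _ _ (S.notMem1 _)]
    refine { ind1 := ?_, ind2 := ?_, glue := ?_, vtx1 := ?_, out2 := ?_, vtx2 := ?_,
             out1 := ?_, T_iff := ?_ }
    · rw [hn]
      exact fun h => .of_apply (sumPerm_left _ _ _) ⟨_, rfl⟩
    · rw [hn]
      exact fun h => .of_apply (congrArg (flip _) (sumPerm_right _ _ _)) ⟨_, rfl⟩
    · intro h x
      rw [hn, hw]
      refine iff_of_false (fun hs => ?_) ?_
      · have := hs.eq_of_invariant (f := fun y => y.1.isLeft) fun y => by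
          rcases S.cover y with ⟨h, rfl⟩ | ⟨x, rfl⟩
          · rw [sumPerm_left]; rfl
          · rw [sumPerm_right]; rfl
        exact Bool.noConfusion this
      · change (inl (inl (γ1.out h)) : (J ⊕ I') ⊕ V2) ≠ (γ2.trivAdd J).vtx (x.1, x.2)
        rw [trivAdd_vtx]
        rcases γ2.vtx (x.1, x.2) with i | v <;> simp
    · rintro ⟨e, s⟩
      change (sumAssoc _ V1 V2).symm (Sum.map inl inl (γ1.vtx (e, s))) =
        inl ((γ1.addTriv I').vtx (e, s))
      rw [addTriv_vtx]
      rcases γ1.vtx (e, s) with i | v <;> rfl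
    · exact fun x => rfl
    · rintro ⟨e, s⟩ p hp
      rw [toRib_vtx, trivAdd_vtx] at hp
      change (sumAssoc _ V1 V2).symm (Sum.map inr inr (γ2.vtx (e, s))) = p
      rcases hv : γ2.vtx (e, s) with i | v
      · rw [hv] at hp
        rcases p with p | p
        · change ((γ1.addTriv I').toRib.add V2).T _ (inl (inr i)) at hp
          rw [Rib.add_T_inl, addTriv_T] at hp
          rcases hp with ⟨i', k, -, h, -⟩ | ⟨q, rfl, h⟩
          · simp at h
          · rw [Sum.inr.injEq] at h
            rw [h]
            rfl
        · simp at hp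
      · rw [hv] at hp
        rcases p with p | p
        · simp at hp
        · change ((γ1.addTriv I').toRib.add V2).T _ (inr v) at hp
          rw [Rib.add_T_inr] at hp
          rw [hp]
          rfl
    · rintro h k hk
      change (γ2.trivAdd J).toRib.T (inl (inl (γ1.out h))) k at hk
      rw [trivAdd_T] at hk
      rcases hk with ⟨i, k, h, -, -⟩ | ⟨q, h, rfl⟩
      · simp at h
      · rw [Sum.inl.injEq, Sum.inl.injEq] at h
        rw [← h]
        rfl
    · intro p k
      rw [Rib.ren_T, disjUnion_T]
      constructor
      · rintro (⟨i, k, hp, hk, h⟩ | ⟨i, k, hp, hk, h⟩)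
        · obtain rfl := (symm_apply_eq _).mp hp
          obtain rfl := (symm_apply_eq _).mp hk
          refine ⟨inl (inl k), ?_, ?_⟩
          · refine (Rib.add_T_inl _ _ _ _).mpr ((addTriv_T _ _ _ _).mpr
              (Or.inl ⟨i, k, rfl, rfl, h⟩))
          · exact (trivAdd_T _ _ _ _).mpr (Or.inr ⟨k, rfl, rfl⟩)
        · obtain rfl := (symm_apply_eq _).mp hp
          obtain rfl := (symm_apply_eq _).mp hk
          refine ⟨inl (inr i), ?_, ?_⟩
          · refine (Rib.add_T_inl _ _ _ _).mpr ((addTriv_T _ _ _ _).mpr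
              (Or.inr ⟨i, rfl, rfl⟩))
          · exact (trivAdd_T _ _ _ _).mpr (Or.inl ⟨i, k, rfl, rfl, h⟩)
      · rintro ⟨j | v, h, h'⟩
        · rw [trivAdd_T] at h'
          rcases p with p | p
          swap
          · simp at h
          rw [Rib.add_T_inl, addTriv_T] at h
          rcases h with ⟨i, k', rfl, rfl, h⟩ | ⟨q, rfl, rfl⟩
          · rcases h' with ⟨i', k, h', rfl, -⟩ | ⟨q, h', rfl⟩
            · simp at h'
            · rw [Sum.inl.injEq, Sum.inl.injEq] at h'
              exact Or.inl ⟨i, q, rfl, rfl, h' ▸ h⟩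
          · rcases h' with ⟨i', k, h', rfl, h⟩ | ⟨q, h', rfl⟩
            · rw [Sum.inl.injEq, Sum.inr.injEq] at h'
              exact Or.inr ⟨i', k, by rw [h']; rfl, rfl, h⟩
            · simp at h'
        · exact absurd h' (not_toRib_T _ _ _)
  exact ⟨fun h => h.unique_of_next hex ((hnext h).trans (hnext hex).symm), fun h => h ▸ hex⟩

end Graph

section Union

variable {𝕜 : Type*} [Field 𝕜] {d : ℤ}

theorem map_sumEmpty_joinWord (w : List (E ⊕ V)) : (joinWord w ([] : List (Empty ⊕ Empty))).map
      (Sum.map (sumEmpty E Empty) (sumEmpty V Empty)) = w := by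
  simp only [joinWord, List.map_nil, List.append_nil, List.map_map]
  conv_rhs => rw [← List.map_id w]
  refine List.map_congr_left fun x _ => ?_
  rcases x with x | x <;> rfl

theorem map_emptySum_joinWord (w : List (E ⊕ V)) : (joinWord ([] : List (Empty ⊕ Empty)) w).map
      (Sum.map (emptySum Empty E) (emptySum Empty V)) = w := by
  simp only [joinWord, List.map_nil, List.nil_append, List.map_map]
  conv_rhs => rw [← List.map_id w]
  refine List.map_congr_left fun x _ => ?_
  rcases x with x | x <;> rfl

section Linear

variable [Finite E] [Finite V]

theorem wcls_unionMap_one (γ : Graph I J E V) {w : List (E ⊕ V)} (hw : IsOrientation w)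
    (Q : Type) : unionMap 𝕜 d (wcls 𝕜 d γ w) (oneMap 𝕜 d Q) = wcls 𝕜 d (γ.addTriv Q) w := by
  rw [oneMap, unionMap_wcls _ _ hw isOrientation_nil,
    ← wcls_map 𝕜 d _ (sumEmpty E Empty) (sumEmpty V Empty), map_sumEmpty_joinWord]
  rfl

theorem one_unionMap_wcls (γ : Graph I J E V) {w : List (E ⊕ V)} (hw : IsOrientation w)
    (Q : Type) : unionMap 𝕜 d (oneMap 𝕜 d Q) (wcls 𝕜 d γ w) = wcls 𝕜 d (γ.trivAdd Q) w := by
  rw [oneMap, unionMap_wcls _ _ isOrientation_nil hw,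
    ← wcls_map 𝕜 d _ (emptySum Empty E) (emptySum Empty V), map_emptySum_joinWord]
  rfl

end Linear

/-- The disjoint union as a composition. -/
theorem glueMap_one_one (a : DGInf 𝕜 d I J) (b : DGInf 𝕜 d I' J') :
    glueMap 𝕜 d (unionMap 𝕜 d a (oneMap 𝕜 d I'))
      (unionMap 𝕜 d (oneMap 𝕜 d J) b) = unionMap 𝕜 d a b := by
  induction a using DGInf.induction with
  | zero | add | smul => simp [*]
  | wcls γ1 w1 h1 =>
  induction b using DGInf.induction with
  | zero | add | smul => simp [*]
  | wcls γ2 w2 h2 =>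
  rw [wcls_unionMap_one _ h1, one_unionMap_wcls _ h2, glueMap_wcls _ _ h1 h2,
    unionMap_wcls _ _ h1 h2]
  have : Unique {γ // (γ1.addTriv I').IsGluing (γ2.trivAdd J) γ} :=
    ⟨⟨⟨_, Graph.isGluing_addTriv_trivAdd_iff.mpr rfl⟩⟩,
      fun γ => Subtype.ext (Graph.isGluing_addTriv_trivAdd_iff.mp γ.2)⟩
  rw [finsum_unique]
  exact congrArg (fun γ => wcls 𝕜 d γ _) (Graph.isGluing_addTriv_trivAdd_iff.mp
    (default : {γ // (γ1.addTriv I').IsGluing (γ2.trivAdd J) γ}).2)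

theorem finsum_subtype_image {A B M : Type*} [AddCommGroup M] {P : A → Prop} {Q : B → Prop}
    {f : A → M} {g : B → M} (e : A → B) (he : Function.Injective e)
    (h : ∀ y, Q y ↔ ∃ x, P x ∧ e x = y) (hfg : ∀ x, P x → f x = g (e x)) :
    ∑ᶠ x : {x // P x}, f x = ∑ᶠ y : {y // Q y}, g y := by
  refine finsum_eq_of_bijective (fun x => ⟨e x.1, (h _).mpr ⟨x.1, x.2, rfl⟩⟩) ⟨?_, ?_⟩
    fun x => hfg x.1 x.2
  · exact fun x y hxy => Subtype.ext (he (congrArg Subtype.val hxy))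
  · rintro ⟨y, hy⟩
    obtain ⟨x, hx, rfl⟩ := (h y).mp hy
    exact ⟨⟨x, hx⟩, rfl⟩

/-- The interchange law in the special case where the second factors are identities. -/
theorem glueMap_unionMap_one [Finite I] [Finite K] [Finite Q] (a : DGInf 𝕜 d I J)
    (b : DGInf 𝕜 d J K) : glueMap 𝕜 d (unionMap 𝕜 d a (oneMap 𝕜 d Q))
      (unionMap 𝕜 d b (oneMap 𝕜 d Q)) =
      unionMap 𝕜 d (glueMap 𝕜 d a b) (oneMap 𝕜 d Q) := by
  induction a using DGInf.induction with
  | zero | add | smul => simp [*]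
  | wcls γ1 w1 h1 =>
  induction b using DGInf.induction with
  | zero | add | smul => simp [*]
  | wcls γ2 w2 h2 =>
  rw [wcls_unionMap_one _ h1, wcls_unionMap_one _ h2, glueMap_wcls _ _ h1 h2,
    glueMap_wcls _ _ h1 h2]
  refine Eq.trans ?_ (map_finsum_of_finite ((unionMap 𝕜 d).flip
    (oneMap 𝕜 d Q)).toAddMonoidHom _).symm
  exact (finsum_subtype_image (P := fun γ => γ1.IsGluing γ2 γ)
    (Q := fun γ => (γ1.addTriv Q).IsGluing (γ2.addTriv Q) γ)
    (f := fun γ => unionMap 𝕜 d (wcls 𝕜 d γ (joinWord w1 w2)) (oneMap 𝕜 d Q))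
    (g := fun γ => wcls 𝕜 d γ (joinWord w1 w2))
    (fun γ => γ.addTriv Q) (Graph.addTriv_injective Q)
    (fun γ => Graph.isGluing_addTriv_iff)
    fun γ _ => wcls_unionMap_one _ (isOrientation_joinWord h1 h2) Q).symm

/-- Words which are not orientations are allowed here. -/
theorem wcls_unionMap_one' [Finite E] [Finite V] (γ : Graph I J E V) (w : List (E ⊕ V))
    (Q : Type) : unionMap 𝕜 d (wcls 𝕜 d γ w) (oneMap 𝕜 d Q) = wcls 𝕜 d (γ.addTriv Q) w := by
  by_cases hw : IsOrientation w
  · exact wcls_unionMap_one γ hw Q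
  · rw [wcls_of_not 𝕜 d hw, wcls_of_not 𝕜 d hw, map_zero, LinearMap.zero_apply]

/-- The Leibniz rule for the disjoint union in the special case of an identity. -/
theorem expMap_unionMap_one [Finite I] [Finite J] [Finite Q] (a : DGInf 𝕜 d I J) :
    expMap 𝕜 d (unionMap 𝕜 d a (oneMap 𝕜 d Q)) = unionMap 𝕜 d (expMap 𝕜 d a) (oneMap 𝕜 d Q) := by
  induction a using DGInf.induction with
  | zero | add | smul => simp [*]
  | wcls γ w hw =>
  rw [wcls_unionMap_one _ hw, expMap_wcls _ hw, expMap_wcls _ hw]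
  refine Eq.trans ?_ (map_finsum_of_finite ((unionMap 𝕜 d).flip
    (oneMap 𝕜 d Q)).toAddMonoidHom _).symm
  refine (finsum_subtype_image (P := fun γ' => ∃ u, γ.IsExpansion u γ')
    (Q := fun γ' => ∃ u, (γ.addTriv Q).IsExpansion u γ')
    (f := fun γ' => unionMap 𝕜 d (expTerm 𝕜 d γ' w) (oneMap 𝕜 d Q))
    (g := fun γ' => expTerm 𝕜 d γ' w)
    (fun γ => γ.addTriv Q) (Graph.addTriv_injective Q)
    (fun γ' => Graph.isExpansion_addTriv_iff) ?_).symm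
  rintro γ' ⟨u, h⟩
  have ht := γ'.addTriv_vtx Q none false
  have hd : ∀ w, wordDeg d (γ'.addTriv Q) w = wordDeg d γ' w := by
    intro w
    conv_lhs => rw [← List.map_id w]
    refine wordDeg_map_eq d _ _ fun x _ => ?_
    rcases x with x | x
    · rfl
    · have hx : (γ'.addTriv Q).type x = γ'.type x := Nat.card_congr (subtypeEquivRight fun e => by
          rw [Graph.addTriv_vtx]
          rcases γ'.vtx (e, true) with i | v <;> simp)
      exact congrArg (fun n : ℕ => (n : ℤ) * (2 - d) + (d - 4)) hx
  rw [expTerm, expTerm, ht, h.target]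
  rcases u with i | v
  · exact wcls_unionMap_one' _ _ _
  · change unionMap 𝕜 d (Int.negOnePow _ • _) _ = Int.negOnePow _ • _
    rw [hd, map_units_smul, Units.smul_def, LinearMap.smul_apply, ← Units.smul_def,
      wcls_unionMap_one']

/-! ### Consequences for the composition and the disjoint union -/

theorem relabelMap_unionMap_one (a : DGInf 𝕜 d I J) (Q : Type) : relabelMap 𝕜 d
    (sumComm Q I) (sumComm Q J) (unionMap 𝕜 d (oneMap 𝕜 d Q) a) =
      unionMap 𝕜 d a (oneMap 𝕜 d Q) := by
  rw [← unionMap_one_comm, relabelMap_relabelMap, ← sumComm_symm Q I,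
    ← sumComm_symm Q J, symm_trans_self, symm_trans_self, relabelMap_refl]

/-- The unit law is `glueMap_one_one` for the empty graph as first factor. -/
theorem one_glueMap [Finite I] [Finite J] (a : DGInf 𝕜 d I J) :
    glueMap 𝕜 d (oneMap 𝕜 d I) a = a := by
  have h := glueMap_one_one (oneMap 𝕜 d Empty) a
  rw [unionMap_one_one] at h
  have h' := congrArg (relabelMap 𝕜 d (emptySum Empty I) (emptySum Empty J)) h
  rw [← glueMap_relabelMap _ (emptySum Empty I), relabelMap_one, one_unionMap] at h'
  exact h'

theorem unionMap_one_empty (a : DGInf 𝕜 d I J) :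
    relabelMap 𝕜 d (sumEmpty I Empty) (sumEmpty J Empty)
      (unionMap 𝕜 d a (oneMap 𝕜 d Empty)) = a := by
  conv_rhs => rw [← one_unionMap (I := Empty) a, ← unionMap_one_comm, relabelMap_relabelMap]
  congr 2
  · ext1 (i | i)
    · rfl
    · exact i.elim
  · ext1 (i | i)
    · rfl
    · exact i.elim

theorem glueMap_one [Finite I] [Finite J] (a : DGInf 𝕜 d I J) :
    glueMap 𝕜 d a (oneMap 𝕜 d J) = a := by
  have h := glueMap_one_one a (oneMap 𝕜 d Empty)
  rw [unionMap_one_one] at h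
  have h' := congrArg (relabelMap 𝕜 d (sumEmpty I Empty) (sumEmpty J Empty)) h
  rw [← glueMap_relabelMap _ (sumEmpty J Empty), relabelMap_one, unionMap_one_empty] at h'
  exact h'

/-- Operations on different inputs and outputs commute up to the Koszul sign. -/
theorem glueMap_one_one' [Finite I] [Finite I'] [Finite J] [Finite J'] {p q : ℤ}
    {a : DGInf 𝕜 d I J} {b : DGInf 𝕜 d I' J'} (ha : a ∈ grInf 𝕜 d I J p)
    (hb : b ∈ grInf 𝕜 d I' J' q) :
    glueMap 𝕜 d (unionMap 𝕜 d (oneMap 𝕜 d I) b) (unionMap 𝕜 d a (oneMap 𝕜 d J')) =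
      (p * q).negOnePow • unionMap 𝕜 d a b := by
  rw [← unionMap_one_comm b, ← relabelMap_unionMap_one a, glueMap_relabelMap, glueMap_one_one,
    unionMap_comm hb ha, mul_comm]

theorem interchange_unionMap [Finite I] [Finite J] [Finite K] [Finite I'] [Finite J'] [Finite K']
    {p q : ℤ} (a : DGInf 𝕜 d I J) {b : DGInf 𝕜 d I' J'} {c : DGInf 𝕜 d J K}
    (e : DGInf 𝕜 d J' K') (hb : b ∈ grInf 𝕜 d I' J' p) (hc : c ∈ grInf 𝕜 d J K q) :
    glueMap 𝕜 d (unionMap 𝕜 d a b) (unionMap 𝕜 d c e) =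
      (p * q).negOnePow • unionMap 𝕜 d (glueMap 𝕜 d a c) (glueMap 𝕜 d b e) := by
  have hl : unionMap 𝕜 d (oneMap 𝕜 d K) (glueMap 𝕜 d b e) =
      glueMap 𝕜 d (unionMap 𝕜 d (oneMap 𝕜 d K) b) (unionMap 𝕜 d (oneMap 𝕜 d K) e) := by
    rw [← unionMap_one_comm, ← glueMap_unionMap_one, ← glueMap_relabelMap _ (sumComm _ _),
      unionMap_one_comm, unionMap_one_comm]
  rw [← glueMap_one_one a b, ← glueMap_one_one c e, ← glueMap_one_one (glueMap 𝕜 d a c),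
    ← glueMap_unionMap_one, hl, glueMap_assoc, glueMap_assoc,
    ← glueMap_assoc (unionMap 𝕜 d (oneMap 𝕜 d J) b), glueMap_one_one' hc hb,
    ← glueMap_assoc (unionMap 𝕜 d c (oneMap 𝕜 d I')),
    ← glueMap_assoc _ _ (unionMap 𝕜 d (oneMap 𝕜 d K) e), glueMap_one_one]
  rw [map_units_smul, Units.smul_def, map_zsmul, LinearMap.smul_apply, glueMap_assoc,
    mul_comm q p, Units.smul_def]

end Union

/-! ### Expansions of gluings -/

/-- The edges of a gluing of two graphs and one further edge `none`, which is counted with the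
edges of the first or of the second graph. -/
theorem splitExpandLeft (E1 E2 : Type) : Split3
    (fun s => ((none : Option E1), s)) (Prod.map some id : E1 × Bool → Option E1 × Bool)
    (Prod.map (Option.map inl) id : Option E1 × Bool → Option (E1 ⊕ E2) × Bool)
    (Prod.map (fun x => some (inr x)) id : E2 × Bool → Option (E1 ⊕ E2) × Bool)
    (Prod.map inl id) (Prod.map inr id)
    (fun s => ((none : Option (E1 ⊕ E2)), s)) (Prod.map some id)
    boolNot (flip E1) (flip E2) (flip (Option E1)) (flip (E1 ⊕ E2))
    (flip (Option (E1 ⊕ E2))) where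
  split12 := splitOption E1
  split123 :=
    { inj1 := (Option.map_injective Sum.inl_injective).prodMap Function.injective_id
      inj2 := ((Option.some_injective _).comp Sum.inr_injective).prodMap Function.injective_id
      ne := by
        rintro ⟨_ | e, s⟩ ⟨x, t⟩ h
        · exact absurd (congrArg Prod.fst h) (by simp)
        · exact absurd (congrArg Prod.fst h) (by simp)
      cover := by
        rintro ⟨_ | e | e, s⟩
        · exact Or.inl ⟨(none, s), rfl⟩
        · exact Or.inl ⟨(some e, s), rfl⟩
        · exact Or.inr ⟨(e, s), rfl⟩
      map1 := fun _ => rfl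
      map2 := fun _ => rfl }
  split23 := splitSum E1 E2
  split123' := splitOption (E1 ⊕ E2)
  comp1 _ := rfl
  comp2 _ := rfl
  comp3 _ := rfl

/-- The half-edges of an expansion of a gluing: those of `E1`, the new ones, and those of `E2`. -/
theorem splitExpandRight (E1 E2 : Type) : Split3
    (Prod.map some id : E1 × Bool → Option E1 × Bool) (fun s => ((none : Option E1), s))
    (Prod.map (Option.map inl) id : Option E1 × Bool → Option (E1 ⊕ E2) × Bool)
    (Prod.map (fun x => some (inr x)) id : E2 × Bool → Option (E1 ⊕ E2) × Bool)
    (fun s => ((none : Option E2), s)) (Prod.map some id : E2 × Bool → Option E2 × Bool)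
    (Prod.map (fun x => some (inl x)) id : E1 × Bool → Option (E1 ⊕ E2) × Bool)
    (Prod.map (Option.map inr) id : Option E2 × Bool → Option (E1 ⊕ E2) × Bool)
    (flip E1) boolNot (flip E2) (flip (Option E1)) (flip (Option E2))
    (flip (Option (E1 ⊕ E2))) where
  split12 :=
    { inj1 := (splitOption E1).inj2
      inj2 := (splitOption E1).inj1
      ne := fun h x hh => (splitOption E1).ne x h hh.symm
      cover := fun y => ((splitOption E1).cover y).symm
      map1 := fun _ => rfl
      map2 := fun _ => rfl }
  split123 := (splitExpandLeft E1 E2).split123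
  split23 := splitOption E2
  split123' :=
    { inj1 := ((Option.some_injective _).comp Sum.inl_injective).prodMap Function.injective_id
      inj2 := (Option.map_injective Sum.inr_injective).prodMap Function.injective_id
      ne := by
        rintro ⟨x, t⟩ ⟨_ | e, s⟩ h
        · exact absurd (congrArg Prod.fst h) (by simp)
        · exact absurd (congrArg Prod.fst h) (by simp)
      cover := by
        rintro ⟨_ | e | e, s⟩
        · exact Or.inr ⟨(none, s), rfl⟩
        · exact Or.inl ⟨(e, s), rfl⟩
        · exact Or.inr ⟨(some e, s), rfl⟩
      map1 := fun _ => rfl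
      map2 := fun _ => rfl }
  comp1 _ := rfl
  comp2 _ := rfl
  comp3 _ := rfl

namespace Graph

/-- Names of the vertices of an expansion of a gluing. -/
def expVertices (I V1 V2 : Type) : I ⊕ Option (V1 ⊕ V2) ≃ Option ((I ⊕ V1) ⊕ V2) :=
  (optionSum I (V1 ⊕ V2)).trans (optionCongr (sumAssoc I V1 V2).symm)

/-- The surface of an expansion of a gluing. -/
abbrev expRib (δ : Graph I K (Option (E1 ⊕ E2)) (Option (V1 ⊕ V2))) :
    Rib (Option ((I ⊕ V1) ⊕ V2)) K (flip (Option (E1 ⊕ E2))) :=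
  δ.toRib.ren (expVertices I V1 V2) (.refl K) (.refl _)

theorem isExpansion_iff_gl_ren [Finite E] {P : Type} {γ : Graph I J E V} {u : I ⊕ V}
    {γ' : Graph I J (Option E) (Option V)} (a : I ⊕ V ≃ P) : IsExpansion γ u γ' ↔
      Gl (fun s => (none, s)) (Prod.map some id) (eps (a u)) (γ.toRib.ren a (.refl J) (.refl E))
        (γ'.toRib.ren ((optionSum I V).trans (optionCongr a)) (.refl J) (.refl (Option E))) := by
  rw [isExpansion_iff_gl, ← gl_map_iff (splitOption E) (optionCongr a) a (.refl J),
    map_eps, ← Rib.ren_eq_map, ← Rib.ren_eq_map, Rib.ren_ren]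
  rfl

variable {γ1 : Graph I J E1 V1} {γ2 : Graph J K E2 V2}
  {δ : Graph I K (Option (E1 ⊕ E2)) (Option (V1 ⊕ V2))}

/-- `δ` is an expansion of a gluing of `γ1` and `γ2`.  Its surface is glued from an expansion `ρ`
of the surface of `γ1`, together with the vertices of positive type of `γ2`, and the surface of
`γ2`. -/
structure IsExpGl (γ1 : Graph I J E1 V1) (γ2 : Graph J K E2 V2)
    (δ : Graph I K (Option (E1 ⊕ E2)) (Option (V1 ⊕ V2))) (u : (I ⊕ V1) ⊕ V2)
    (ρ : Rib (Option ((I ⊕ V1) ⊕ V2)) (J ⊕ V2) (flip (Option E1))) : Prop where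
  exp : Gl (fun s => (none, s)) (Prod.map some id) (eps u) (γ1.toRib.add V2) ρ
  glue : Gl (Prod.map (Option.map inl) id) (Prod.map (fun x => some (inr x)) id) ρ
    γ2.toRib δ.expRib

/-- An expansion of a gluing is a gluing of `eps u` with a gluing of the surfaces of `γ1` and `γ2`.
The structure `IsExpGl` arises by associativity. -/
theorem exists_isExpGl_iff [Finite E1] [Finite E2] :
    (∃ γ, γ1.IsGluing γ2 γ ∧ ∃ u, γ.IsExpansion u δ) ↔ ∃ u ρ, IsExpGl γ1 γ2 δ u ρ := by
  constructor
  · rintro ⟨γ, h, u, h'⟩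
    rw [isExpansion_iff_gl_ren (sumAssoc I V1 V2).symm] at h'
    obtain ⟨ρ, h1, h2⟩ := h.isGl.assoc' (splitExpandLeft E1 E2) h'
    exact ⟨_, ρ, h1, h2⟩
  · rintro ⟨u, ρ, h1, h2⟩
    obtain ⟨γ', h3, h4⟩ := h1.assoc (splitExpandLeft E1 E2) h2
    obtain ⟨γ, h₅, rfl⟩ := exists_isGluing_of_gl h3
    refine ⟨γ, h₅, sumAssoc I V1 V2 u, ?_⟩
    rw [isExpansion_iff_gl_ren (sumAssoc I V1 V2).symm, symm_apply_apply]
    exact h4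

theorem IsExpGl.next_unique [Finite E1] [Finite E2] {u u' ρ ρ'} (h : IsExpGl γ1 γ2 δ u ρ)
    (h' : IsExpGl γ1 γ2 δ u' ρ') : ρ.next = ρ'.next :=
  h.glue.ind1.unique (splitExpandLeft E1 E2).split123.inj1 h'.glue.ind1

/-- An expansion of a gluing determines the expanded vertex and the expanded surface of `γ1`. -/
theorem IsExpGl.unique [Finite E1] [Finite E2] {u u' ρ ρ'} (h : IsExpGl γ1 γ2 δ u ρ)
    (h' : IsExpGl γ1 γ2 δ u' ρ') : u = u' ∧ ρ = ρ' := by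
  have hu : u = u' := by
    have h1 := h.glue.vtx1 (none, false)
    rw [h'.glue.vtx1, h.exp.isExp.target, h'.exp.isExp.target] at h1
    exact (Option.some_injective _ h1).symm
  subst hu
  exact ⟨rfl, h.exp.unique (splitOption E1) h'.exp (h.next_unique h')⟩

/-- The expansion takes place in the first graph. -/
theorem isGluing_left_iff_gl [Finite E1] [Finite E2] {γ1' : Graph I J (Option E1) (Option V1)} :
    γ1'.IsGluing γ2 (δ.map (Equiv.refl I) (Equiv.refl K) (optionSumComm E1 E2).symm
      (optionSumComm V1 V2).symm) ↔
    Gl (Prod.map (Option.map inl) id) (Prod.map (fun x => some (inr x)) id)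
      (((γ1'.toRib.ren (optionSum I V1) (Equiv.refl J) (.refl _)).add V2).ren
        (optionSumComm (I ⊕ V1) V2) (.refl _) (.refl _)) γ2.toRib δ.expRib := by
  rw [isGluing_iff, IsGl, ← gl_ren_iff (splitSum _ _) (splitExpandLeft E1 E2).split123
    (((optionSum I V1).sumCongr (Equiv.refl V2)).trans (optionSumComm (I ⊕ V1) V2))
    (.refl _) (Equiv.refl K) (.refl _) (.refl _) (optionSumComm E1 E2)
    (by rintro (_ | e) <;> rfl) (fun _ => rfl), Rib.ren_refl, toRib_map, Rib.ren_ren, Rib.ren_ren,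
    ← Rib.add_ren _ _ _ _ (Equiv.refl V2), sumCongr_refl, Rib.ren_ren]
  have h1 : (((Equiv.refl I).sumCongr (optionSumComm V1 V2).symm).trans
      ((sumAssoc I (Option V1) V2).symm.trans (((optionSum I V1).sumCongr
        (Equiv.refl V2)).trans (optionSumComm (I ⊕ V1) V2)))) = expVertices I V1 V2 := by
    ext1 (i | _ | v | v) <;> rfl
  have h2 : (optionSumComm E1 E2).symm.trans ((Equiv.refl _).trans (optionSumComm E1 E2)) =
      .refl _ := by
    ext1 (_ | v | v) <;> rfl
  rw [h1, h2]
  rfl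

theorem add_option (γ : Rib (I ⊕ V) J (flip E)) (Q : Type) :
    (γ.add (Option Q)).ren (optionSum (I ⊕ V) Q) (optionSum J Q) (.refl E) =
      (γ.add Q).addPoint := by
  refine Rib.ext rfl (Equiv.ext fun _ => rfl) rfl ?_
  ext p j
  rw [Rib.ren_T]
  rcases p with _ | p | p <;> rcases j with _ | j | j <;> simp [optionSum]

/-- The expansion takes place in the second graph. -/
theorem isGluing_right_iff_gl [Finite E1] [Finite E2] {γ2' : Graph J K (Option E2) (Option V2)} :
    γ1.IsGluing γ2' (δ.map (Equiv.refl I) (Equiv.refl K) (optionSum E1 E2).symm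
      (optionSum V1 V2).symm) ↔
    Gl (Prod.map (fun x => some (inl x)) id) (Prod.map (Option.map inr) id)
      (γ1.toRib.add V2).addPoint (γ2'.toRib.ren (optionSum J V2) (Equiv.refl K) (.refl _))
      δ.expRib := by
  rw [isGluing_iff, IsGl, ← gl_ren_iff (splitSum _ _) (splitExpandRight E1 E2).split123'
    (optionSum (I ⊕ V1) V2) (optionSum J V2) (Equiv.refl K) (.refl _) (.refl _)
    (optionSum E1 E2) (fun _ => rfl) (by rintro (_ | e) <;> rfl), toRib_map, Rib.ren_ren,
    Rib.ren_ren, add_option]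
  have h1 : ((Equiv.refl I).sumCongr (optionSum V1 V2).symm).trans
      ((sumAssoc I V1 (Option V2)).symm.trans (optionSum (I ⊕ V1) V2)) = expVertices I V1 V2 := by
    ext1 (i | _ | v | v) <;> rfl
  have h2 : (optionSum E1 E2).symm.trans ((Equiv.refl _).trans (optionSum E1 E2)) = .refl _ := by
    ext1 (_ | v | v) <;> rfl
  rw [h1, h2]
  rfl

end Graph

/-! ### Bivalent vertices in expansions of gluings -/

/-- A vertex with the only outgoing edge `f` has an incoming edge different from any given edge
`f'`. -/
theorem Rib.Admissible.exists_target_ne {ρ : Rib (I ⊕ V) J (flip E)} (h : ρ.Admissible) {v : V}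
    {f : E} (hf : ρ.vtx (f, true) = inr v) (hu : ∀ e, ρ.vtx (e, true) = inr v → e = f)
    (f' : E) : ∃ e, e ≠ f' ∧ ρ.vtx (e, false) = inr v := by
  by_contra! hc
  have h1 : ρ.deg true (inr v) = 1 := by
    have : Unique {e // ρ.vtx (e, true) = inr v} := ⟨⟨⟨f, hf⟩⟩, fun x => Subtype.ext (hu _ x.2)⟩
    exact Nat.card_unique
  have h2 := h.two_le v h1
  have : Subsingleton {e // ρ.vtx (e, false) = inr v} := ⟨fun x y => Subtype.ext (by
    rw [not_not.mp fun hx => hc x.1 hx x.2, not_not.mp fun hx => hc y.1 hx y.2])⟩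
  have h3 : ρ.deg false (inr v) ≤ 1 := Finite.card_le_one_iff_subsingleton.mpr this
  omega

theorem Rib.vtx_next {P : Type} {H : Type} {φ : Perm H} (ρ : Rib P J φ) (y : H) :
    ρ.vtx (ρ.next y) = ρ.vtx y := ((ρ.sameCycle_next _ _).mp ⟨1, rfl⟩).symm

theorem Rib.eq_of_next_eq {P : Type} {H : Type} {φ : Perm H} (ρ : Rib P J φ) {x y : H}
    (hx : ρ.next x = x) (hy : ρ.vtx y = ρ.vtx x) : y = x := by
  obtain ⟨n, hn⟩ := (ρ.sameCycle_next x y).mpr hy.symm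
  rw [← hn]
  exact Perm.zpow_apply_eq_self_of_apply_eq_self hx n

theorem Rib.eq_or_eq_of_next {P : Type} {H : Type} {φ : Perm H} (ρ : Rib P J φ) {x x' y : H}
    (hx : ρ.next x = x') (hx' : ρ.next x' = x) (hy : ρ.vtx y = ρ.vtx x) : y = x ∨ y = x' :=
  (sameCycle_of_two_cycle hx hx' y).mp ((ρ.sameCycle_next x y).mpr hy.symm)

namespace Graph

variable {γ1 : Graph I J E1 V1} {γ2 : Graph J K E2 V2}
  {δ : Graph I K (Option (E1 ⊕ E2)) (Option (V1 ⊕ V2))} {u : (I ⊕ V1) ⊕ V2}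
  {ρ : Rib (Option ((I ⊕ V1) ⊕ V2)) (J ⊕ V2) (flip (Option E1))}

/-- The new edge runs between two vertices, one of which has only one further edge `f`; it is the
source of the new edge if `b = true`, and the target if `b = false`. -/
def Bivalent (ρ : Rib (Option ((I ⊕ V1) ⊕ V2)) (J ⊕ V2) (flip (Option E1))) (b : Bool) (f : E1) :
    Prop :=
  ρ.next (none, b) = (some f, !b) ∧ ρ.next (some f, !b) = (none, b)

namespace IsExpGl

theorem vtx_none (h : IsExpGl γ1 γ2 δ u ρ) (s : Bool) :
    expVertices I V1 V2 (δ.vtx (none, s)) = ρ.vtx (none, s) := h.glue.vtx1 (none, s)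

theorem vtx_inl (h : IsExpGl γ1 γ2 δ u ρ) (e : E1) (s : Bool) :
    expVertices I V1 V2 (δ.vtx (some (inl e), s)) = ρ.vtx (some e, s) :=
  h.glue.vtx1 (some e, s)

theorem source (h : IsExpGl γ1 γ2 δ u ρ) : ρ.vtx (none, true) = none := h.exp.isExp.source

theorem target (h : IsExpGl γ1 γ2 δ u ρ) : ρ.vtx (none, false) = some u := h.exp.isExp.target

theorem elim_vtx (h : IsExpGl γ1 γ2 δ u ρ) (e : E1) (s : Bool) :
    (ρ.vtx (some e, s)).elim u id = inl (γ1.vtx (e, s)) := h.exp.isExp.vtx (e, s)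

theorem vtx_of_eq_none (h : IsExpGl γ1 γ2 δ u ρ) {e : E1} {s : Bool}
    (he : ρ.vtx (some e, s) = none) : u = inl (γ1.vtx (e, s)) := by
  rw [← h.elim_vtx, he]
  rfl

theorem vtx_of_eq_some (h : IsExpGl γ1 γ2 δ u ρ) {e : E1} {s : Bool} {p}
    (he : ρ.vtx (some e, s) = some p) : p = inl (γ1.vtx (e, s)) := by
  rw [← h.elim_vtx, he]
  rfl

/-- The half-edges of the second graph stay at their vertices of positive type, unless these are
expanded. -/
theorem vtx_inr (h : IsExpGl γ1 γ2 δ u ρ) {w : V2} (hw : inr w ≠ u) {e : E2} {s : Bool}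
    (he : γ2.vtx (e, s) = inr w) : δ.vtx (some (inr e), s) = inr (some (inr w)) := by
  have h1 := h.glue.vtx2 (e, s) (some (inr w)) (by
    rw [toRib_vtx, he, h.exp.isExp.T_iff _ _ hw, Rib.add_T_inr])
  change expVertices I V1 V2 (δ.vtx (some (inr e), s)) = _ at h1
  exact ((symm_apply_eq _).mpr h1.symm).symm

theorem exists_source_inr (h : IsExpGl γ1 γ2 δ (inl u0) ρ) (e : E2) :
    ∃ w, δ.vtx (some (inr e), true) = inr (some (inr w)) := by
  rcases hw : γ2.vtx (e, true) with j | w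
  · exact absurd hw (γ2.source_ne e j)
  · exact ⟨w, h.vtx_inr Sum.inr_ne_inl hw⟩

/-- If a vertex of positive type of the second graph is expanded, then the source of the new edge
has no edge of the first graph. -/
theorem next_of_inr [Finite E1] {v : V2} (h : IsExpGl γ1 γ2 δ (inr v) ρ) :
    ρ.next (none, true) = (none, true) := by
  have hv := ρ.vtx_next (none, true)
  rw [h.source] at hv
  rcases hh : ρ.next (none, true) with ⟨_ | e, s⟩
  · rw [hh] at hv
    cases s
    · rw [h.target] at hv
      simp at hv
    · rfl
  · rw [hh] at hv
    exact absurd (h.vtx_of_eq_none hv) Sum.inr_ne_inl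

/-- If a vertex of the first graph is expanded, then the vertices of positive type of the second
graph remain without edges in `ρ`, and `ρ` is an expansion of the surface of `γ1`. -/
theorem exists_expansion [Finite E1] {u0 : I ⊕ V1} (h : IsExpGl γ1 γ2 δ (inl u0) ρ) :
    ∃ ρ' : Rib (Option (I ⊕ V1)) J (flip (Option E1)),
      (ρ'.add V2).ren (optionSumComm (I ⊕ V1) V2) (.refl _) (.refl _) = ρ ∧
      Gl (fun s => (none, s)) (Prod.map some id) (eps u0) γ1.toRib ρ' := by
  have h1 := h.exp
  have hρ : (ρ.ren (optionSumComm (I ⊕ V1) V2).symm (.refl _) (.refl _)).ren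
      (optionSumComm (I ⊕ V1) V2) (.refl _) (.refl _) = ρ := by
    rw [Rib.ren_ren, symm_trans_self]
    exact ρ.ren_refl
  have h2 : (γ1.toRib.add V2).map (.refl _) (.refl _) (.refl _) (fun _ => rfl) =
      γ1.toRib.add V2 := Rib.map_refl _
  rw [← eps_add, ← hρ, Rib.ren_eq_map, ← h2, gl_map_iff (splitOption E1)] at h1
  obtain ⟨ρ', h3, h4⟩ := h1.exists_of_add (splitOption E1)
  refine ⟨ρ', ?_, h4⟩
  rw [← h3]
  exact hρ

/-- If the target of the new edge is bivalent, then its source has, in `ρ`, a further half-edge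
besides an incoming one: otherwise the vertex of `γ1` would have type `1` and at most one incoming
edge. -/
theorem bivalent_not [Finite E1] (h : IsExpGl γ1 γ2 δ u ρ) {f f' : E1} (hf : Bivalent ρ false f)
    (hf' : ∀ y, ρ.vtx y = none → y = (none, true) ∨ y = (some f', false)) : False := by
  have hv : ρ.vtx (some f, true) = some u := by
    have h1 : ρ.next (none, false) = (some f, true) := hf.1
    rw [← h.target, ← h1, ρ.vtx_next]
  have hu := h.vtx_of_eq_some hv
  rcases hv1 : γ1.vtx (f, true) with i | v
  · exact γ1.source_ne _ _ hv1
  rw [hv1] at hu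
  have key : ∀ e s, γ1.vtx (e, s) = inr v → (e, s) = (f, true) ∨ (e, s) = (f', false) := by
    intro e s he
    rcases hp : ρ.vtx (some e, s) with _ | p
    · rcases hf' _ hp with h' | h'
      · simp at h'
      · exact Or.inr (by simpa using h')
    · have := h.vtx_of_eq_some hp
      rw [he, ← hu] at this
      rw [this, ← h.target] at hp
      rcases ρ.eq_or_eq_of_next hf.1 hf.2 hp with h' | h'
      · simp at h'
      · exact Or.inl (by simpa using h')
  obtain ⟨e, he, he'⟩ := γ1.toRib_admissible.exists_target_ne hv1
    (fun e he => by simpa using key e true he) f'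
  rcases key e false he' with h' | h'
  · simp at h'
  · exact he (congrArg Prod.fst h')

theorem bivalent_unique [Finite E1] (h : IsExpGl γ1 γ2 δ u ρ) {b b' : Bool} {f f' : E1}
    (hf : Bivalent ρ b f) (hf' : Bivalent ρ b' f') : b = b' ∧ f = f' := by
  have key : ∀ {f f'}, Bivalent ρ false f → ¬ Bivalent ρ true f' := fun hf hf' =>
    h.bivalent_not hf fun y hy => ρ.eq_or_eq_of_next hf'.1 hf'.2 (hy.trans h.source.symm)
  have hb : b = b' := by
    cases b <;> cases b'
    · rfl
    · exact absurd hf' (key hf)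
    · exact absurd hf (key hf')
    · rfl
  subst hb
  exact ⟨rfl, Option.some_injective _ (congrArg Prod.fst (hf.1.symm.trans hf'.1))⟩

theorem not_bivalent_of_next [Finite E1] (h : IsExpGl γ1 γ2 δ u ρ)
    (hn : ρ.next (none, true) = (none, true)) (b : Bool) (f : E1) : ¬ Bivalent ρ b f := by
  intro hf
  cases b
  · exact h.bivalent_not (f' := f) hf fun y hy =>
      Or.inl (ρ.eq_of_next_eq hn (hy.trans h.source.symm))
  · have := hn.symm.trans hf.1
    simp at this

section Left

variable {u0 : I ⊕ V1} {ρ' : Rib (Option (I ⊕ V1)) J (flip (Option E1))}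

theorem ren_add_vtx (x : Option E1) (s : Bool) :
    ((ρ'.add V2).ren (optionSumComm (I ⊕ V1) V2) (.refl _) (.refl _)).vtx (x, s) =
      (ρ'.vtx (x, s)).map inl := rfl

/-- The expansion of the first graph is not a directed graph if one end of the new edge has only
one further edge. -/
theorem not_bivalent_of_admissible [Finite E1]
    (h : Gl (fun s => (none, s)) (Prod.map some id) (eps u0) γ1.toRib ρ')
    (hA : (ρ'.ren (optionSum I V1).symm (.refl _) (.refl _)).Admissible)
    (b : Bool) (f : E1) : ¬ Bivalent ((ρ'.add V2).ren (optionSumComm (I ⊕ V1) V2)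
      (.refl _) (.refl _)) b f := by
  rintro ⟨h1, h2⟩
  change ρ'.next (none, b) = (some f, !b) at h1
  change ρ'.next (some f, !b) = (none, b) at h2
  have hv : ρ'.vtx (some f, !b) = ρ'.vtx (none, b) := by rw [← h1, ρ'.vtx_next]
  have key := fun y => ρ'.eq_or_eq_of_next (y := y) h1 h2
  cases b
  · -- the target of the new edge
    have ht : ρ'.vtx (none, false) = some u0 := h.isExp.target
    rcases u0 with i | v
    · exact hA.source_ne (some f) i (by
        change (optionSum I V1).symm (ρ'.vtx (some f, true)) = _
        rw [show ρ'.vtx (some f, true) = _ from hv.trans ht]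
        rfl)
    · obtain ⟨e, he, he'⟩ := hA.exists_target_ne (v := some v) (f := some f) (by
        change (optionSum I V1).symm (ρ'.vtx (some f, true)) = _
        rw [show ρ'.vtx (some f, true) = _ from hv.trans ht]
        rfl) (fun e he => by
          have h3 := key (e, true) ((symm_apply_eq _).mp he |>.trans ht.symm)
          simpa using h3) none
      have h3 := key (e, false) ((symm_apply_eq _).mp he' |>.trans ht.symm)
      simp [he] at h3
  · have ht : ρ'.vtx (none, true) = none := h.isExp.source
    obtain ⟨e, he, he'⟩ := hA.exists_target_ne (v := none) (f := none) (by
      change (optionSum I V1).symm (ρ'.vtx (none, true)) = _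
      rw [ht]
      rfl) (fun e he => by
        have h3 := key (e, true) ((symm_apply_eq _).mp he |>.trans ht.symm)
        simpa using h3) (some f)
    have h3 := key (e, false) ((symm_apply_eq _).mp he' |>.trans ht.symm)
    simp [he] at h3

/-- The source of the new edge of an admissible expansion has another half-edge, since a vertex of
type `1` has incoming edges. -/
theorem next_ne_of_admissible [Finite E1]
    (h : Gl (fun s => (none, s)) (Prod.map some id) (eps u0) γ1.toRib ρ')
    (hA : (ρ'.ren (optionSum I V1).symm (.refl _) (.refl _)).Admissible) :
    ρ'.next (none, true) ≠ (none, true) := by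
  intro hn
  have ht : ρ'.vtx (none, true) = none := h.isExp.source
  have key : ∀ e s, (ρ'.ren (optionSum I V1).symm (.refl _) (.refl _)).vtx (e, s) =
      inr none → (e, s) = (none, true) := fun e s he =>
    ρ'.eq_of_next_eq hn ((symm_apply_eq _).mp he |>.trans ht.symm)
  obtain ⟨e, he, he'⟩ := hA.exists_target_ne (v := none) (f := none) (by
    change (optionSum I V1).symm (ρ'.vtx (none, true)) = _
    rw [ht]
    rfl) (fun e he => congrArg Prod.fst (key e true he)) none
  have := key e false he'
  simp at this

/-- If no end of the new edge is bivalent in the surface of the expansion of the first graph, then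
this expansion is a directed graph. -/
theorem admissible [Finite E1] (h : IsExpGl γ1 γ2 δ (inl u0) ρ)
    (hρ : (ρ'.add V2).ren (optionSumComm (I ⊕ V1) V2) (.refl _) (.refl _) = ρ)
    (h' : Gl (fun s => (none, s)) (Prod.map some id) (eps u0) γ1.toRib ρ')
    (hn : ρ.next (none, true) ≠ (none, true)) (hf : ∀ b f, ¬ Bivalent ρ b f) :
    (ρ'.ren (optionSum I V1).symm (.refl _) (.refl _)).Admissible := by
  have hs : ρ'.vtx (none, true) = none := h'.isExp.source
  have ht : ρ'.vtx (none, false) = some u0 := h'.isExp.target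
  have hv : ∀ e s, (ρ'.vtx (some e, s)).elim u0 id = γ1.vtx (e, s) :=
    fun e s => h'.isExp.vtx (e, s)
  have hn' : ρ'.next = ρ.next := by rw [← hρ]; rfl
  have hiff : ∀ e s (p : I ⊕ Option V1), (ρ'.ren (optionSum I V1).symm (.refl _)
      (.refl _)).vtx (e, s) = p ↔ ρ'.vtx (e, s) = optionSum I V1 p :=
    fun e s p => symm_apply_eq _
  -- a vertex with one outgoing and at most one incoming edge
  have hone : ∀ p, (ρ'.ren (optionSum I V1).symm (.refl _) (.refl _)).deg true p = 1 →
      ¬ 2 ≤ (ρ'.ren (optionSum I V1).symm (.refl _) (.refl _)).deg false p →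
      ∃ x, ρ'.vtx (x, true) = optionSum I V1 p ∧
        (∀ x', ρ'.vtx (x', true) = optionSum I V1 p → x' = x) ∧
        ∀ y y', ρ'.vtx (y, false) = optionSum I V1 p → ρ'.vtx (y', false) = optionSum I V1 p →
          y = y' := by
    intro p h1 h2
    obtain ⟨⟨x, hx⟩, hx'⟩ := Nat.card_eq_one_iff_exists.mp h1
    have h3 : Subsingleton {e // (ρ'.ren (optionSum I V1).symm (.refl _)
      (.refl _)).vtx (e, false) = p} := Finite.card_le_one_iff_subsingleton.mp (by
        change (ρ'.ren (optionSum I V1).symm (.refl _) (.refl _)).deg false p ≤ 1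
        omega)
    refine ⟨x, (hiff _ _ _).mp hx, fun x' h => ?_, fun y y' h h' => ?_⟩
    · exact congrArg Subtype.val (hx' ⟨x', (hiff _ _ _).mpr h⟩)
    · exact congrArg Subtype.val (Subsingleton.elim
        (⟨y, (hiff _ _ _).mpr h⟩ : {e // (ρ'.ren (optionSum I V1).symm (.refl _)
          (.refl _)).vtx (e, false) = p}) ⟨y', (hiff _ _ _).mpr h'⟩)
  refine ⟨?_, ?_, ?_⟩
  · rintro (_ | e) i hi
    · rw [hiff, hs] at hi
      simp at hi
    · rw [hiff] at hi
      have := hv e true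
      rw [hi] at this
      exact γ1.source_ne e i this.symm
  · rintro (_ | v)
    · exact ⟨none, by rw [hiff, hs]; rfl⟩
    · obtain ⟨x, hx⟩ := δ.exists_source (some (inl v))
      rcases x with _ | x | x
      · have := h.vtx_none true
        rw [hx, h.source] at this
        exact absurd (show some (inl (inr v)) = none from this) (Option.some_ne_none _)
      · refine ⟨some x, ?_⟩
        have h1 := h.vtx_inl x true
        rw [hx, ← hρ, ren_add_vtx] at h1
        rw [hiff]
        rcases h2 : ρ'.vtx (some x, true) with _ | p
        · rw [h2] at h1
          exact absurd (show some (inl (inr v)) = none from h1) (Option.some_ne_none _)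
        · rw [h2] at h1
          simp only [Option.map_some] at h1
          exact congrArg some (Sum.inl_injective (Option.some_injective _ h1.symm))
      · obtain ⟨w, hw⟩ := h.exists_source_inr x
        rw [hx] at hw
        simp at hw
  · rintro (_ | v) h1 <;> by_contra h2
    · obtain ⟨x, hx, hx', hy⟩ := hone _ h1 h2
      obtain rfl := hx' none hs
      have hN : ρ'.vtx (ρ'.next (none, true)) = none := (ρ'.vtx_next _).trans hs
      rcases hh : ρ'.next (none, true) with ⟨f, _ | _⟩
      · rw [hh] at hN
        rcases f with _ | f
        · rw [ht] at hN
          simp at hN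
        · refine hf true f ⟨by rw [← hn', hh]; rfl, ?_⟩
          rw [← hn']
          change ρ'.next (some f, false) = (none, true)
          have hN' : ρ'.vtx (ρ'.next (some f, false)) = none := (ρ'.vtx_next _).trans hN
          rcases hh' : ρ'.next (some f, false) with ⟨f', _ | _⟩
          · rw [hh'] at hN'
            obtain rfl := hy _ _ hN hN'
            exact absurd (ρ'.next.injective (hh.trans hh'.symm)) (by simp)
          · rw [hh'] at hN'
            rw [hx' _ hN']
      · rw [hh] at hN
        obtain rfl := hx' _ hN
        exact hn (by rw [← hn', hh])
    · by_cases hu : u0 = inr v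
      · subst hu
        obtain ⟨x, hx, hx', hy⟩ := hone _ h1 h2
        rcases x with _ | f
        · rw [hs] at hx
          simp at hx
        have hN : ρ'.vtx (ρ'.next (none, false)) = some (inr v) := (ρ'.vtx_next _).trans ht
        rcases hh : ρ'.next (none, false) with ⟨f', _ | _⟩
        · rw [hh] at hN
          obtain rfl := hy _ _ ht hN
          have := ρ'.eq_of_next_eq hh (hx.trans ht.symm)
          simp at this
        · rw [hh] at hN
          obtain rfl := hx' _ hN
          refine hf false f ⟨by rw [← hn', hh]; rfl, ?_⟩
          rw [← hn']
          change ρ'.next (some f, true) = (none, false)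
          have hN' : ρ'.vtx (ρ'.next (some f, true)) = some (inr v) :=
            (ρ'.vtx_next _).trans hN
          rcases hh' : ρ'.next (some f, true) with ⟨f', _ | _⟩
          · rw [hh'] at hN'
            rw [hy _ _ ht hN']
          · rw [hh'] at hN'
            obtain rfl := hx' _ hN'
            exact absurd (ρ'.next.injective (hh.trans hh'.symm)) (by simp)
      · have hd : ∀ s, (ρ'.ren (optionSum I V1).symm (.refl _) (.refl _)).deg s
            (inr (some v)) = γ1.toRib.deg s (inr v) := by
          intro s
          rw [Rib.deg, card_subtype_option, if_neg, add_zero]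
          · refine Nat.card_congr (subtypeEquivRight fun e => ?_)
            rw [hiff, toRib_vtx, ← hv]
            rcases ρ'.vtx (some e, s) with _ | p
            · simp [hu]
            · simp
          · rw [hiff]
            cases s
            · rw [ht]
              simpa using hu
            · rw [hs]
              simp
        rw [hd] at h1 h2
        exact h2 (γ1.two_le_of_type_one v h1)

end Left

end IsExpGl

end Graph

/-! ### Expansions of one factor, and the exchange of the parts of a subdivided edge -/

namespace Graph

variable {γ1 : Graph I J E1 V1} {γ2 : Graph J K E2 V2}
  {δ : Graph I K (Option (E1 ⊕ E2)) (Option (V1 ⊕ V2))} {u : (I ⊕ V1) ⊕ V2}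
  {ρ : Rib (Option ((I ⊕ V1) ⊕ V2)) (J ⊕ V2) (flip (Option E1))}

/-- The expansions of a gluing which arise from expansions of the first graph. -/
theorem exists_expansion_left_iff [Finite E1] [Finite E2] :
    (∃ γ1' : Graph I J (Option E1) (Option V1), (∃ u, γ1.IsExpansion u γ1') ∧
      γ1'.IsGluing γ2 (δ.map (.refl I) (.refl K) (optionSumComm E1 E2).symm
        (optionSumComm V1 V2).symm)) ↔
    ∃ u ρ, IsExpGl γ1 γ2 δ u ρ ∧ ρ.next (none, true) ≠ (none, true) ∧
      ∀ b f, ¬ Bivalent ρ b f := by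
  constructor
  · rintro ⟨γ1', ⟨u, h⟩, h'⟩
    rw [isExpansion_iff_gl] at h
    rw [isGluing_left_iff_gl] at h'
    have hA : ((γ1'.toRib.ren (optionSum I V1) (.refl J) (.refl _)).ren
        (optionSum I V1).symm (.refl _) (.refl _)).Admissible := by
      rw [Rib.ren_ren, self_trans_symm]
      exact γ1'.toRib_admissible
    have h1 := IsExpGl.next_ne_of_admissible h hA
    refine ⟨inl u, _, ⟨?_, h'⟩, h1, IsExpGl.not_bivalent_of_admissible h hA⟩
    rw [← eps_add]
    exact (gl_map_iff (splitOption E1) (optionSumComm (I ⊕ V1) V2) (.refl _)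
      (.refl _)).mpr (h.add V2)
  · rintro ⟨u | v, ρ, h, hn, hf⟩
    · obtain ⟨ρ', hρ, h'⟩ := h.exists_expansion
      have hA := h.admissible hρ h' hn hf
      have hr : (ofRib _ hA).toRib.ren (optionSum I V1) (.refl J) (.refl _) = ρ' := by
        rw [toRib_ofRib, Rib.ren_ren, symm_trans_self]
        exact ρ'.ren_refl
      refine ⟨ofRib _ hA, ⟨u, ?_⟩, ?_⟩
      · rw [isExpansion_iff_gl, hr]
        exact h'
      · rw [isGluing_left_iff_gl, hr, hρ]
        exact h.glue
    · exact absurd h.next_of_inr hn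

/-- The surface which is glued to the first graph with an additional point, giving an expansion of
a gluing, is a directed graph. -/
theorem admissible_of_gl_addPoint [Finite E1] [Finite E2] {q : J ⊕ V2}
    {ρ2 : Rib (Option (J ⊕ V2)) K (flip (Option E2))}
    (h : Gl (fun s => (none, s)) (Prod.map some id) (eps q) γ2.toRib ρ2)
    (h' : Gl (Prod.map (fun x => some (inl x)) id) (Prod.map (Option.map inr) id)
      (γ1.toRib.add V2).addPoint ρ2 δ.expRib) :
    (ρ2.ren (optionSum J V2).symm (.refl _) (.refl _)).Admissible := by
  have key : ∀ x s (w : Option V2), ρ2.vtx (x, s) = optionSum J V2 (inr w) ↔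
      δ.vtx (x.map inr, s) = inr (w.map inr) := by
    have hfw : ∀ x s (w : Option V2), ρ2.vtx (x, s) = optionSum J V2 (inr w) →
        δ.vtx (x.map inr, s) = inr (w.map inr) := by
      intro x s w hw
      rcases w with _ | w
      · have h1 := h'.vtx2 (x, s) none (by rw [hw]; exact Rib.addPoint_T_none _)
        exact (expVertices I V1 V2).injective h1
      · have h1 := h'.vtx2 (x, s) (some (inr w)) (by
          rw [hw]
          exact (Rib.addPoint_T_some _ _ _).mpr ((Rib.add_T_inr _ _ _ _).mpr rfl))
        exact (expVertices I V1 V2).injective h1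
    intro x s w
    refine ⟨hfw x s w, fun hx => ?_⟩
    rcases hw : (optionSum J V2).symm (ρ2.vtx (x, s)) with j | w'
    · exfalso
      rw [symm_apply_eq] at hw
      rcases h'.attached (x, s) with ⟨_ | p, hp⟩ | ⟨y, hy⟩
      · rw [hw] at hp
        exact Rib.addPoint_T_none_some _ _ hp
      · have h1 := h'.vtx2 _ _ hp
        rw [hw] at hp
        rcases p with (i | v) | v
        · have h2 : δ.vtx (x.map inr, s) = inl i := (expVertices I V1 V2).injective h1
          rw [hx] at h2
          simp at h2
        · exact not_toRib_T _ _ _ ((Rib.add_T_inl _ _ _ _).mp ((Rib.addPoint_T_some _ _ _).mp hp))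
        · exact Rib.add_T_inr_inl _ _ _ _ ((Rib.addPoint_T_some _ _ _).mp hp)
      · have h1 := (δ.expRib.sameCycle_next _ _).mp hy
        rw [h'.vtx1] at h1
        change expVertices I V1 V2 (δ.vtx (x.map inr, s)) = some (inl (γ1.vtx y)) at h1
        rw [hx] at h1
        rcases w with _ | w
        · exact absurd (show none = some _ from h1) (by simp)
        · exact absurd (show some (inr w) = some (inl _) from h1) (by simp)
    · rw [symm_apply_eq] at hw
      have h1 := hfw _ _ _ hw
      rw [hx] at h1
      rw [hw, Option.map_injective Sum.inr_injective (Sum.inr_injective h1)]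
  have hleft : ∀ e s (w : Option V2), δ.vtx (some (inl e), s) ≠ inr (w.map inr) := by
    intro e s w hw
    have h1 : expVertices I V1 V2 (δ.vtx (some (inl e), s)) = some (inl (γ1.vtx (e, s))) :=
      h'.vtx1 (e, s)
    rw [hw] at h1
    rcases w with _ | w
    · exact absurd (show none = some _ from h1) (by simp)
    · exact absurd (show some (inr w) = some (inl _) from h1) (by simp)
  have hiff : ∀ x s (w : Option V2), (ρ2.ren (optionSum J V2).symm (.refl _)
      (.refl _)).vtx (x, s) = inr w ↔
        δ.vtx (x.map inr, s) = inr (w.map inr) :=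
    fun x s w => (symm_apply_eq _).trans (key x s w)
  have hdeg : ∀ s w, (ρ2.ren (optionSum J V2).symm (.refl _) (.refl _)).deg s
      (inr w) = Nat.card {x // δ.vtx (x, s) = inr (w.map inr)} := by
    intro s w
    refine Nat.card_congr (ofBijective
      (fun x => ⟨x.1.map inr, (hiff _ _ _).mp x.2⟩) ⟨?_, ?_⟩)
    · exact fun x y hxy =>
        Subtype.ext (Option.map_injective Sum.inr_injective (congrArg Subtype.val hxy))
    · rintro ⟨_ | x | x, hx⟩
      · exact ⟨⟨none, (hiff none s w).mpr hx⟩, rfl⟩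
      · exact absurd hx (hleft x s w)
      · exact ⟨⟨some x, (hiff (some x) s w).mpr hx⟩, rfl⟩
  refine ⟨?_, ?_, ?_⟩
  · rintro (_ | e) j hj
    · have h1 : ρ2.vtx (none, true) = none := h.isExp.source
      have h2 : ρ2.vtx (none, true) = _ := (symm_apply_eq _).mp hj
      rw [h1] at h2
      simp at h2
    · have h1 := h.isExp.vtx (e, true)
      have h2 : ρ2.vtx (some e, true) = _ := (symm_apply_eq _).mp hj
      change (ρ2.vtx (some e, true)).elim q id = γ2.vtx (e, true) at h1
      rw [h2] at h1
      exact γ2.source_ne e j h1.symm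
  · intro w
    obtain ⟨x, hx⟩ := δ.exists_source (w.map inr)
    rcases x with _ | x | x
    · exact ⟨none, (hiff none true w).mpr hx⟩
    · exact absurd hx (hleft x true w)
    · exact ⟨some x, (hiff (some x) true w).mpr hx⟩
  · intro w
    rw [hdeg, hdeg]
    exact δ.two_le_of_type_one _

/-- The expansions of a gluing which arise from expansions of the second graph. -/
theorem exists_expansion_right_iff [Finite E1] [Finite E2] :
    (∃ γ2' : Graph J K (Option E2) (Option V2), (∃ q, γ2.IsExpansion q γ2') ∧
      γ1.IsGluing γ2' (δ.map (.refl I) (.refl K) (optionSum E1 E2).symm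
        (optionSum V1 V2).symm)) ↔
    ∃ u ρ, IsExpGl γ1 γ2 δ u ρ ∧ ρ.next (none, true) = (none, true) := by
  constructor
  · rintro ⟨γ2', ⟨q, h⟩, h'⟩
    rw [isExpansion_iff_gl] at h
    rw [isGluing_right_iff_gl] at h'
    obtain ⟨ρ, h1, h2⟩ := h.assoc' (splitExpandRight E1 E2) h'
    obtain ⟨u, h3, h4⟩ := h1.exists_isExp_of_addPoint (splitOption E1)
      (splitExpandRight E1 E2).split12
    exact ⟨u, ρ, ⟨h3.gl (splitOption E1), h2⟩, h4⟩
  · rintro ⟨u, ρ, h, hn⟩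
    have h1 := h.exp.isExp.gl_addPoint (splitOption E1) (splitExpandRight E1 E2).split12 hn
    obtain ⟨ρ2, h2, h3⟩ := h1.assoc (splitExpandRight E1 E2) h.glue
    have hA := admissible_of_gl_addPoint h2 h3
    have hr : (ofRib _ hA).toRib.ren (optionSum J V2) (.refl K) (.refl _) = ρ2 := by
      rw [toRib_ofRib, Rib.ren_ren, symm_trans_self]
      exact ρ2.ren_refl
    refine ⟨ofRib _ hA, ⟨ρ.out (none, true), ?_⟩, ?_⟩
    · rw [isExpansion_iff_gl, hr]
      exact h2
    · rw [isGluing_right_iff_gl, hr]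
      exact h3

/-- Exchanging the new edge and the edge `f`, if they meet in a vertex without further edges. -/
abbrev swapNew (f : E1) (v : V1) (δ : Graph I K (Option (E1 ⊕ E2)) (Option (V1 ⊕ V2))) :
    Graph I K (Option (E1 ⊕ E2)) (Option (V1 ⊕ V2)) :=
  δ.map (.refl I) (.refl K) (Equiv.swap none (some (inl f)))
    (Equiv.swap none (some (inl v)))

/-- The exchange of the new edge with an edge `f` which it meets in a bivalent vertex; this vertex
becomes the other end of the new edge. -/
theorem IsExpGl.swap [Finite E1] [Finite E2] (h : IsExpGl γ1 γ2 δ u ρ) {b : Bool} {f : E1} {v : V1}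
    (hv : γ1.vtx (f, true) = inr v) (hf : Bivalent ρ b f) :
    ∃ u' ρ', IsExpGl γ1 γ2 (δ.swapNew f v) u' ρ' ∧ Bivalent ρ' (!b) f := by
  let e : Perm (Option E1 × Bool) := (Equiv.swap none (some f)).prodCongr (Equiv.refl Bool)
  have hsw : ∀ x, x ≠ f → Equiv.swap none (some f) (some x) = some x := fun x hx =>
    swap_apply_of_ne_of_ne (Option.some_ne_none _) (by simpa using hx)
  have h1 := h.exp.isExp.swap (splitOption E1) (j := fun s => (f, s)) (b := b)
    (fun s t hst => congrArg Prod.snd hst) (fun _ => rfl) hf.1 hf.2 e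
    (fun s => Prod.ext (swap_apply_left _ _) rfl)
    (fun s => Prod.ext (swap_apply_right _ _) rfl)
    (by
      rintro ⟨x, s⟩ hx
      refine Prod.ext (hsw x ?_) rfl
      rintro rfl
      exact hx ⟨s, rfl⟩) (fun _ => rfl)
  have hp : (γ1.toRib.add V2).vtx (f, true) = inl (inr v) := congrArg inl hv
  obtain ⟨σ, hσ, u', h1⟩ : ∃ σ : Perm (Option ((I ⊕ V1) ⊕ V2)),
      Equiv.swap none (some (inl (inr v))) = σ ∧
        ∃ u', IsExp (fun s => (none, s)) (Prod.map some id) u' (γ1.toRib.add V2)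
          (ρ.map σ (Equiv.refl (J ⊕ V2)) e (φ' := flip _) fun _ => rfl) := by
    refine ⟨_, ?_, h1⟩
    rw [← hp]
    congr
    exact Subsingleton.elim _ _
  refine ⟨u', _, ⟨h1.gl (splitOption E1), ?_⟩, ?_, ?_⟩
  · have h2 := h.glue.map (splitExpandLeft E1 E2).split123 σ (.refl _) (Equiv.refl K) e
      (.refl _) ((Equiv.swap none (some (inl f))).prodCongr (Equiv.refl Bool))
      (φ1' := flip _) (φ2' := flip _) (φ' := flip _)
      (i1' := Prod.map (Option.map inl) id) (i2' := Prod.map (fun x => some (inr x)) id)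
      (fun _ => rfl) (fun _ => rfl) (fun _ => rfl)
      (fun x => Prod.ext
        ((Option.map_injective Sum.inl_injective).map_swap none (some f) x.1).symm rfl)
      (fun x => Prod.ext (swap_apply_of_ne_of_ne (Option.some_ne_none _) (by simp)) rfl)
    rw [show γ2.toRib.map (.refl _) (.refl _) (.refl _) (fun _ => rfl) = γ2.toRib
      from Rib.map_refl _] at h2
    rw [expRib, toRib_map, Rib.ren_ren]
    have hV : ((Equiv.refl I).sumCongr (Equiv.swap none (some (inl v)))).trans
        (expVertices I V1 V2) = (expVertices I V1 V2).trans σ := by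
      have h3 := Perm.sumCongr_refl_swap (α := I) (none : Option (V1 ⊕ V2))
        (some (inl v))
      change (Equiv.refl I).sumCongr (Equiv.swap none (some (inl v))) = _ at h3
      rw [h3, ← hσ]
      exact Equiv.ext fun x => (expVertices I V1 V2).injective.map_swap _ _ x
    rw [hV]
    exact h2
  · change e (ρ.next (e.symm (none, !b))) = _
    rw [show e.symm (none, !b) = (some f, !b) from Prod.ext (swap_apply_left _ _) rfl, hf.2]
    exact Prod.ext (swap_apply_left _ _) (Bool.not_not b).symm
  · change e (ρ.next (e.symm (some f, !!b))) = _
    rw [show e.symm (some f, !!b) = (none, b) from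
      Prod.ext (swap_apply_right _ _) (Bool.not_not b), hf.1]
    exact Prod.ext (swap_apply_right _ _) rfl

theorem swapNew_swapNew (f : E1) (v : V1) (δ : Graph I K (Option (E1 ⊕ E2)) (Option (V1 ⊕ V2))) :
    (δ.swapNew f v).swapNew f v = δ := by
  rw [swapNew, swapNew, map_map, swap_swap, swap_swap]
  exact δ.map_refl

/-- The exchange is a bijection between the graphs with a bivalent source and those with a bivalent
target of the new edge. -/
theorem exists_bivalent_swap_iff [Finite E1] [Finite E2] {b : Bool} {f : E1} {v : V1}
    (hv : γ1.vtx (f, true) = inr v) :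
    (∃ u ρ, IsExpGl γ1 γ2 δ u ρ ∧ Bivalent ρ b f) ↔
      ∃ u ρ, IsExpGl γ1 γ2 (δ.swapNew f v) u ρ ∧ Bivalent ρ (!b) f := by
  refine ⟨fun ⟨u, ρ, h, hf⟩ => h.swap hv hf, fun ⟨u, ρ, h, hf⟩ => ?_⟩
  have := h.swap hv hf
  rwa [swapNew_swapNew, Bool.not_not] at this

theorem IsExpGl.eq_inl_of_next [Finite E1] (h : IsExpGl γ1 γ2 δ u ρ)
    (hn : ρ.next (none, true) ≠ (none, true)) : ∃ u0, u = inl u0 := by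
  rcases u with u | v
  · exact ⟨u, rfl⟩
  · exact absurd h.next_of_inr hn

theorem IsExpGl.target_ne (h : IsExpGl γ1 γ2 δ u ρ) : δ.vtx (none, false) ≠ inr none := by
  intro h1
  have h2 := h.vtx_none false
  rw [h1, h.target] at h2
  exact absurd (show none = some u from h2) (by simp)

/-- A bivalent source of the new edge has type `1`: the edges of the second graph which are attached
to it are incoming, since their sources are of positive type in the second graph. -/
theorem IsExpGl.type_none [Finite E1] (h : IsExpGl γ1 γ2 δ u ρ) {f : E1}
    (hf : Bivalent ρ true f) : δ.type none = 1 := by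
  obtain ⟨u0, rfl⟩ := h.eq_inl_of_next fun hn => h.not_bivalent_of_next hn true f hf
  have hs : δ.vtx (none, true) = inr none :=
    (expVertices I V1 V2).injective ((h.vtx_none true).trans h.source)
  have : Unique {x // δ.vtx (x, true) = inr none} := by
    refine ⟨⟨⟨none, hs⟩⟩, ?_⟩
    rintro ⟨_ | x | x, hx⟩
    · rfl
    · have h1 := h.vtx_inl x true
      rw [hx] at h1
      rcases ρ.eq_or_eq_of_next hf.1 hf.2 (h1.symm.trans h.source.symm) with h2 | h2 <;> simp at h2
    · obtain ⟨w, hw⟩ := h.exists_source_inr x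
      rw [hx] at hw
      simp at hw
  exact Nat.card_unique

/-- A bivalent target of the new edge is the source of `f`, and has type `1`. -/
theorem IsExpGl.type_target [Finite E1] (h : IsExpGl γ1 γ2 δ u ρ) {f : E1} {v : V1}
    (hv : γ1.vtx (f, true) = inr v) (hf : Bivalent ρ false f) :
    δ.vtx (none, false) = inr (some (inl v)) ∧ δ.type (some (inl v)) = 1 := by
  obtain ⟨u0, rfl⟩ := h.eq_inl_of_next fun hn => h.not_bivalent_of_next hn false f hf
  have hu : ρ.vtx (some f, true) = some (inl u0) := by
    have h1 : ρ.next (none, false) = (some f, true) := hf.1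
    rw [← h.target, ← h1, ρ.vtx_next]
  have hu' := h.vtx_of_eq_some hu
  rw [hv] at hu'
  obtain rfl := Sum.inl_injective hu'
  refine ⟨(expVertices I V1 V2).injective ((h.vtx_none false).trans h.target), ?_⟩
  have : Unique {x // δ.vtx (x, true) = inr (some (inl v))} := by
    refine ⟨⟨⟨some (inl f),
      (expVertices I V1 V2).injective ((h.vtx_inl f true).trans hu)⟩⟩, ?_⟩
    have key : ∀ y, ρ.vtx y = some (inl (inr v)) → y = (none, false) ∨ y = (some f, true) :=
      fun y hy => ρ.eq_or_eq_of_next hf.1 hf.2 (hy.trans h.target.symm)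
    rintro ⟨_ | x | x, hx⟩
    · have h1 := h.vtx_none true
      rw [hx] at h1
      rcases key _ h1.symm with h2 | h2 <;> simp at h2
    · have h1 := h.vtx_inl x true
      rw [hx] at h1
      rcases key _ h1.symm with h2 | h2
      · simp at h2
      · simp only [Prod.mk.injEq, Option.some.injEq, and_true] at h2
        subst h2
        rfl
    · obtain ⟨w, hw⟩ := h.exists_source_inr x
      rw [hx] at hw
      simp at hw
  exact Nat.card_unique

end Graph

/-! ### The terms of the expansions of a gluing and their signs -/

/-- In a gluing, the vertices of the second surface are determined by the gluing: two half-edges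
are attached to the same boundary component or point of the first surface. -/
theorem Gl.vtx_right_unique {P J K H1 H2 H : Type} {φ1 : Perm H1} {φ2 : Perm H2}
    {φ : Perm H} {i1 : H1 → H} {i2 : H2 → H} {γ1 : Rib P J φ1} {γ2 γ2' : Rib J K φ2}
    {γ : Rib P K φ} (h : Gl i1 i2 γ1 γ2 γ) (h' : Gl i1 i2 γ1 γ2' γ) : γ2.vtx = γ2'.vtx := by
  funext x
  by_cases hx : ∃ y, γ1.out y = γ2.vtx x
  · obtain ⟨y, hy⟩ := hx
    rw [← hy]
    exact (h'.glue y x).mp ((h.glue y x).mpr hy)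
  · by_cases hx' : ∃ y, γ1.out y = γ2'.vtx x
    · obtain ⟨y, hy⟩ := hx'
      rw [← hy]
      exact ((h.glue y x).mp ((h'.glue y x).mpr hy)).symm
    · obtain ⟨p, hp⟩ := (γ1.T_right _).mpr (not_exists.mp hx)
      obtain ⟨p', hp'⟩ := (γ1.T_right _).mpr (not_exists.mp hx')
      rw [← h'.vtx2 x p' hp', h.vtx2 x p hp] at hp'
      exact γ1.T_fun _ _ _ hp hp'

namespace Graph

theorem IsExpansion.unique_of_next [Finite E] {γ : Graph I J E V} {u u' : I ⊕ V}
    {γ' γ'' : Graph I J (Option E) (Option V)} (h : γ.IsExpansion u γ')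
    (h' : γ.IsExpansion u' γ'') (hv : γ'.vtx (none, false) = γ''.vtx (none, false))
    (hn : γ'.next = γ''.next) : γ' = γ'' := by
  rw [h.target, h'.target] at hv
  obtain rfl := (Function.injective_id.sumMap (Option.some_injective _)) hv
  rw [isExpansion_iff_gl] at h h'
  exact toRib_injective (Rib.ren_injective _ _ _ (h.unique (splitOption E) h' (by
    rw [ren_refl_next, ren_refl_next, hn])))

/-- A graph determines the cyclic orders of the graph from which it is expanded. -/
theorem IsExpansion.source_unique {γ1 γ2 : Graph I J E V} {u u' : I ⊕ V}
    {γ' : Graph I J (Option E) (Option V)} (h : γ1.IsExpansion u γ')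
    (h' : γ2.IsExpansion u' γ') : γ1.next = γ2.next := by
  have h1 : γ1.toRib.walk = γ2.toRib.walk :=
    (isExpansion_iff.mp h).walk.unique (splitOption E).inj2 (isExpansion_iff.mp h').walk
  exact mul_left_cancel h1

variable {γ1 : Graph I J E1 V1} {γ2 : Graph J K E2 V2}

theorem IsExpansion.unique_of_gluing_left [Finite E1] [Finite E2]
    {γ : Graph I K (Option E1 ⊕ E2) (Option V1 ⊕ V2)}
    {u u' : I ⊕ V1} {γ' γ'' : Graph I J (Option E1) (Option V1)} (h : γ1.IsExpansion u γ')
    (h' : γ1.IsExpansion u' γ'') (hγ : γ'.IsGluing γ2 γ) (hγ' : γ''.IsGluing γ2 γ) : γ' = γ'' := by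
  refine h.unique_of_next h' ?_ (hγ.next_left.unique (splitSum _ _).inj1 hγ'.next_left)
  have h1 := hγ.vtx_left none false
  rw [hγ'.vtx_left] at h1
  exact ((Function.injective_id.sumMap Sum.inl_injective) h1).symm

theorem IsExpansion.unique_of_gluing_right [Finite E1] [Finite E2]
    {γ : Graph I K (E1 ⊕ Option E2) (V1 ⊕ Option V2)}
    {u u' : J ⊕ V2} {γ' γ'' : Graph J K (Option E2) (Option V2)} (h : γ2.IsExpansion u γ')
    (h' : γ2.IsExpansion u' γ'') (hγ : γ1.IsGluing γ' γ) (hγ' : γ1.IsGluing γ'' γ) : γ' = γ'' :=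
  h.unique_of_next h' (congrFun (hγ.isGl.vtx_right_unique hγ'.isGl) (none, false))
    (hγ.next_right.unique (splitSum _ _).inj2 hγ'.next_right)

end Graph

section Terms

open RibbonProp.Graph

variable {𝕜 : Type*} [Field 𝕜] {d : ℤ}

theorem isOrientation_exp {w : List (E ⊕ V)} (hw : IsOrientation w) :
    IsOrientation (inl none :: inr none :: w.map (Sum.map some some) :
      List (Option E ⊕ Option V)) := by
  have hinj : Function.Injective (Sum.map (some : E → _) (some : V → _)) :=
    (Option.some_injective _).sumMap (Option.some_injective _)
  refine ⟨List.nodup_cons.mpr ⟨by simp, List.nodup_cons.mpr ⟨by simp, hw.1.map hinj⟩⟩, ?_⟩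
  rintro ((_ | e) | (_ | v))
  · simp
  · simp [hw.2]
  · simp
  · simp [hw.2]

theorem map_joinWord_left (w1 : List (Option E1 ⊕ Option V1)) (w2 : List (E2 ⊕ V2)) :
    (joinWord w1 w2).map (Sum.map (optionSumComm E1 E2) (optionSumComm V1 V2)) =
      w1.map (Sum.map (Option.map inl) (Option.map inl)) ++
        w2.map (Sum.map (fun x => some (inr x)) (fun x => some (inr x))) := by
  simp only [joinWord, List.map_append, List.map_map]
  congr 1 <;> refine List.map_congr_left fun x _ => ?_
  · rcases x with (_ | x) | (_ | x) <;> rfl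
  · rcases x with x | x <;> rfl

theorem map_joinWord_right (w1 : List (E1 ⊕ V1)) (w2 : List (Option E2 ⊕ Option V2)) :
    (joinWord w1 w2).map (Sum.map (optionSum E1 E2) (optionSum V1 V2)) =
      w1.map (Sum.map (fun x => some (inl x)) (fun x => some (inl x))) ++
        w2.map (Sum.map (Option.map inr) (Option.map inr)) := by
  simp only [joinWord, List.map_append, List.map_map]
  congr 1 <;> refine List.map_congr_left fun x _ => ?_
  · rcases x with x | x <;> rfl
  · rcases x with (_ | x) | (_ | x) <;> rfl

theorem map_some_joinWord (w1 : List (E1 ⊕ V1)) (w2 : List (E2 ⊕ V2)) :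
    (joinWord w1 w2).map (Sum.map some some) =
      w1.map (Sum.map (fun x => some (inl x)) (fun x => some (inl x))) ++
        w2.map (Sum.map (fun x => some (inr x)) (fun x => some (inr x))) := by
  simp only [joinWord, List.map_append, List.map_map]
  congr 1 <;> refine List.map_congr_left fun x _ => ?_ <;> rcases x with x | x <;> rfl

theorem map_map_option (f : E → E1) (g : V → V1) (w : List (E ⊕ V)) :
    (w.map (Sum.map some some)).map (Sum.map (Option.map f) (Option.map g)) =
      w.map (Sum.map (fun x => some (f x)) (fun x => some (g x))) := by
  rw [List.map_map]
  refine List.map_congr_left fun x _ => ?_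
  rcases x with x | x <;> rfl

variable {γ1 : Graph I J E1 V1} {γ2 : Graph J K E2 V2} [Finite E1] [Finite V1] [Finite E2]
  [Finite V2]

/-- Expanding the first graph gives the same sign `s` and the same word `w` before and after the
gluing. -/
theorem expTerm_gluing_left {γ1' : Graph I J (Option E1) (Option V1)} {u : I ⊕ V1}
    (h : γ1.IsExpansion u γ1') (γ2 : Graph J K E2 V2) {w1 : List (E1 ⊕ V1)}
    (h1 : IsOrientation w1) (w2 : List (E2 ⊕ V2)) :
    ∃ (s : ℤˣ) (w : List (Option E1 ⊕ Option V1)), IsOrientation w ∧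
      expTerm 𝕜 d γ1' w1 = s • wcls 𝕜 d γ1' w ∧
      ∀ γ : Graph I K (Option E1 ⊕ E2) (Option V1 ⊕ V2), γ1'.IsGluing γ2 γ →
      expTerm 𝕜 d (γ.map (.refl I) (.refl K) (optionSumComm E1 E2)
        (optionSumComm V1 V2)) (joinWord w1 w2) = s • wcls 𝕜 d γ (joinWord w w2) := by
  have hv : ∀ γ : Graph I K (Option E1 ⊕ E2) (Option V1 ⊕ V2), γ1'.IsGluing γ2 γ →
      (γ.map (.refl I) (.refl K) (optionSumComm E1 E2)
        (optionSumComm V1 V2)).vtx (none, false) =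
      Sum.map id (optionSumComm V1 V2) (Sum.map id inl (Sum.map id some u)) := by
    intro γ hγ
    rw [map_vtx, ← h.target, ← hγ.vtx_left]
    rfl
  rcases u with i | v
  · refine ⟨1, _, isOrientation_exp h1, ?_, fun γ hγ => ?_⟩
    · rw [one_smul, expTerm_input h.target]
    · rw [expTerm_input (hv γ hγ), one_smul, ← wcls_map 𝕜 d γ (optionSumComm E1 E2)
        (optionSumComm V1 V2), map_joinWord_left, List.map_cons, List.map_cons,
        map_map_option, map_some_joinWord]
      rfl
  · obtain ⟨l1, l2, rfl, hl⟩ := exists_eq_append_of_isOrientation h1 (inr v)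
    refine ⟨_, _, ?_, expTerm_vertex h.target hl, fun γ hγ => ?_⟩
    · refine (isOrientation_exp h1).perm ?_
      rw [List.map_append]
      exact (List.perm_append_comm (l₁ := [inl none, inr none])).append_right _ |>.trans
        (by simp)
    · have hw : joinWord (l1 ++ inr v :: l2) w2 = l1.map (Sum.map inl inl) ++
          inr (inl v) ::
            (l2.map (Sum.map inl inl) ++ w2.map (Sum.map inr inr)) := by
        simp [joinWord]
      rw [hw, expTerm_vertex (v := inl v) (hv γ hγ), ← wcls_map 𝕜 d γ (optionSumComm E1 E2)
        (optionSumComm V1 V2), map_joinWord_left]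
      · congr 2
        · rw [show (l1.map (Sum.map inl inl)).map (Sum.map some some) =
            (l1.map (Sum.map some some)).map
              (Sum.map (Option.map (inl : E1 → E1 ⊕ E2)) (Option.map inl)) by
            simp only [List.map_map, Sum.map_comp_map]; rfl]
          refine wordDeg_map_eq _ _ _ fun x _ => ?_
          rw [← JoinRel.letterDeg_left (R := gluingRel I J K) d hγ x, ← letterDeg_map d γ
            (.refl I) (.refl K) (optionSumComm E1 E2) (optionSumComm V1 V2)]
          rcases x with (_ | x) | (_ | x) <;> rfl
        · simp only [List.map_append, List.map_cons, List.map_map, Sum.map_comp_map,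
            List.append_assoc, List.cons_append]
          rfl
      · intro hx
        obtain ⟨x, hx, hxv⟩ := List.mem_map.mp hx
        rcases x with x | x
        · simp at hxv
        · simp only [Sum.map_inr, Sum.inr.injEq, Sum.inl.injEq] at hxv
          exact hl (hxv ▸ hx)

/-- As before for the second graph, with the Koszul sign for moving the differential past the first
word. -/
theorem expTerm_gluing_right {γ2' : Graph J K (Option E2) (Option V2)} {q : J ⊕ V2}
    (h : γ2.IsExpansion q γ2') (γ1 : Graph I J E1 V1) {w1 : List (E1 ⊕ V1)}
    {w2 : List (E2 ⊕ V2)} (h1 : IsOrientation w1)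
    (h2 : IsOrientation w2) :
    ∃ (s : ℤˣ) (w : List (Option E2 ⊕ Option V2)), IsOrientation w ∧
      expTerm 𝕜 d γ2' w2 = s • wcls 𝕜 d γ2' w ∧
      ∀ γ : Graph I K (E1 ⊕ Option E2) (V1 ⊕ Option V2), γ1.IsGluing γ2' γ →
        (γ.map (.refl I) (.refl K) (optionSum E1 E2)
          (optionSum V1 V2)).vtx (none, false) ≠ inr none →
      expTerm 𝕜 d (γ.map (.refl I) (.refl K) (optionSum E1 E2)
        (optionSum V1 V2)) (joinWord w1 w2) =
          (wordDeg d γ1 w1).negOnePow • s • wcls 𝕜 d γ (joinWord w1 w) := by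
  have hdeg1 : ∀ γ : Graph I K (E1 ⊕ Option E2) (V1 ⊕ Option V2), γ1.IsGluing γ2' γ →
      wordDeg d γ (w1.map (Sum.map inl inl)) = wordDeg d γ1 w1 := fun γ hγ =>
    wordDeg_map_eq _ _ _ fun x _ => JoinRel.letterDeg_left (R := gluingRel I J K) d hγ x
  rcases q with j | v
  · refine ⟨1, _, isOrientation_exp h2, ?_, fun γ hγ ht => ?_⟩
    · rw [one_smul, expTerm_input h.target]
    · have htype : ∀ v, γ.type (inr v) = γ2'.type v := hγ.type_right
      rw [expTerm_of_type_one _ (isOrientation_joinWord h1 h2) ht, one_smul,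
        show joinWord w1 (inl none :: inr none :: w2.map (Sum.map some some)) =
          [] ++ (w1.map (Sum.map inl inl) ++ ([inl (inr none),
            inr (inr none)] ++ (w2.map (Sum.map some some)).map (Sum.map inr inr)))
          from rfl, wcls_block, smul_smul, hdeg1 γ hγ]
      · -- The new vertex has type `1`, so that it has, with the new edge, degree `-1`.
        have hs : (wordDeg d γ1 w1).negOnePow * (wordDeg d γ1 w1 * wordDeg d γ
            [inl (inr none), inr (inr none)]).negOnePow = 1 := by
          rw [wordDeg_cons, wordDeg_cons, letterDeg_inl, letterDeg_of_type_one d γ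
            ((htype none).trans h.type_of_input), wordDeg_nil, ← Int.negOnePow_add]
          exact Int.negOnePow_even _ ⟨0, by ring⟩
        rw [hs, one_smul, ← wcls_map 𝕜 d γ (optionSum E1 E2) (optionSum V1 V2),
          map_some_joinWord]
        simp only [List.map_append, List.map_cons, List.map_map, Sum.map_comp_map,
            List.cons_append, List.nil_append]
        rfl
      · exact (γ.type_map _ _ _ _ _).trans ((htype none).trans h.type_of_input)
  · obtain ⟨l1, l2, rfl, hl⟩ := exists_eq_append_of_isOrientation h2 (inr v)
    refine ⟨_, _, ?_, expTerm_vertex h.target hl, fun γ hγ _ => ?_⟩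
    · refine (isOrientation_exp h2).perm ?_
      rw [List.map_append]
      exact (List.perm_append_comm (l₁ := [inl none, inr none])).append_right _ |>.trans
        (by simp)
    · have hv : (γ.map (.refl I) (.refl K) (optionSum E1 E2)
          (optionSum V1 V2)).vtx (none, false) = inr (some (inr v)) := by
        rw [map_vtx, show (optionSum E1 E2).symm none = inr none from rfl,
          hγ.vtx_right _ _ _ h.target]
        rfl
      have hw : joinWord w1 (l1 ++ inr v :: l2) = (w1.map (Sum.map inl inl) ++
          l1.map (Sum.map inr inr)) ++
          inr (inr v) :: l2.map (Sum.map inr inr) := by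
        simp [joinWord]
      rw [hw, expTerm_vertex (v := inr v) hv, smul_smul, ← Int.negOnePow_add,
        ← wcls_map 𝕜 d γ (optionSum E1 E2) (optionSum V1 V2), map_joinWord_right]
      · congr 2
        · rw [List.map_append, wordDeg_append]
          congr 1
          · rw [← hdeg1 γ hγ, show (w1.map (Sum.map inl inl)).map (Sum.map some some) =
              (w1.map (Sum.map inl inl)).map
                (Sum.map (optionSum E1 E2) (optionSum V1 V2)) by
              simp only [List.map_map, Sum.map_comp_map]; rfl]
            exact wordDeg_map_eq _ _ _ fun x _ => letterDeg_map _ _ _ _ _ _ _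
          · rw [show (l1.map (Sum.map inr inr)).map (Sum.map some some) =
              (l1.map (Sum.map some some)).map
                (Sum.map (Option.map (inr : E2 → E1 ⊕ E2)) (Option.map inr)) by
              simp only [List.map_map, Sum.map_comp_map]; rfl]
            refine wordDeg_map_eq _ _ _ fun x _ => ?_
            rw [← JoinRel.letterDeg_right (R := gluingRel I J K) d hγ x, ← letterDeg_map d γ
              (.refl I) (.refl K) (optionSum E1 E2) (optionSum V1 V2)]
            rcases x with (_ | x) | (_ | x) <;> rfl
        · simp only [List.map_append, List.map_cons, List.map_map, Sum.map_comp_map,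
            List.append_assoc]
          rfl
      · intro hx
        rcases List.mem_append.mp hx with hx | hx <;> obtain ⟨x, hx, hxv⟩ := List.mem_map.mp hx <;>
          rcases x with x | x
        · simp at hxv
        · simp at hxv
        · simp at hxv
        · simp only [Sum.map_inr, Sum.inr.injEq] at hxv
          exact hl (hxv ▸ hx)

/-- Exchanging two edges in an orientation changes the sign. -/
theorem wcls_transpose [Finite E] [Finite V] (γ : Graph I J E V) (e f : E) (l0 m l : List (E ⊕ V)) :
    wcls 𝕜 d γ (l0 ++ inl e :: (m ++ inl f :: l)) =
      -wcls 𝕜 d γ (l0 ++ inl f :: (m ++ inl e :: l)) := by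
  have h := wcls_swap 𝕜 d γ (l0 ++ m) l (inl e) (inl f)
  simp only [letterDeg_inl, mul_one, Int.negOnePow_one, List.append_assoc] at h
  rw [wcls_move, wcls_move 𝕜 d γ l0 m, h, letterDeg_inl, letterDeg_inl,
    smul_comm, Units.neg_smul, one_smul]

/-- The terms of two expansions of a gluing, in which a new bivalent vertex subdivides an edge on
one or the other side, cancel. -/
theorem expTerm_swapNew {δ : Graph I K (Option (E1 ⊕ E2)) (Option (V1 ⊕ V2))} {f : E1} {v : V1}
    {w : List ((E1 ⊕ E2) ⊕ (V1 ⊕ V2))} (hw : IsOrientation w) (ht : δ.type none = 1)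
    (hn : δ.vtx (none, false) ≠ inr none)
    (hv : (δ.swapNew f v).vtx (none, false) = inr (some (inl v)))
    (hs : (δ.swapNew f v).type (some (inl v)) = 1) :
    -expTerm 𝕜 d δ w = expTerm 𝕜 d (δ.swapNew f v) w := by
  set a : Perm (Option (E1 ⊕ E2)) := swap none (some (inl f)) with ha
  set b : Perm (Option (V1 ⊕ V2)) := swap none (some (inl v)) with hb
  have ha1 : ∀ x, x ≠ inl f → a (some x) = some x := fun x hx =>
    swap_apply_of_ne_of_ne (Option.some_ne_none _) (by simpa using hx)
  have hb1 : ∀ x, x ≠ inl v → b (some x) = some x := fun x hx =>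
    swap_apply_of_ne_of_ne (Option.some_ne_none _) (by simpa using hx)
  rw [expTerm_of_type_one ht hw hn]
  obtain ⟨l1, l2, rfl, hl⟩ := exists_eq_append_of_isOrientation hw (inr (inl v))
  have hl2 : inr (inl v) ∉ l2 := fun hx =>
    (List.nodup_cons.mp (List.nodup_append.mp hw.1).2.1).1 hx
  rw [expTerm_vertex hv hl]
  -- the new edge is moved to the front, followed by the vertex of even degree
  have h1 := wcls_move 𝕜 d (δ.swapNew f v) [] (l1.map (Sum.map some some))
    (inr none :: inr (some (inl v)) :: l2.map (Sum.map some some)) (inl none)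
  have h2 := wcls_move 𝕜 d (δ.swapNew f v) [inl none]
    (l1.map (Sum.map some some) ++ [inr none]) (l2.map (Sum.map some some))
    (inr (some (inl v)))
  rw [letterDeg_inl, one_mul] at h1
  rw [letterDeg_of_type_one d _ hs, Int.negOnePow_even _ ⟨-wordDeg d _ _, by ring⟩,
    one_smul] at h2
  simp only [List.nil_append, List.append_assoc, List.cons_append] at h1 h2
  rw [← h1, ← h2]
  -- the word arises from the one of `δ` by exchanging the new edge and `f`
  have hmap : ∀ l : List ((E1 ⊕ E2) ⊕ (V1 ⊕ V2)), inr (inl v) ∉ l →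
      l.map (Sum.map some some) =
        ((l.map (Sum.map some some)).map (Sum.map a id)).map (Sum.map a b) := by
    intro l hlv
    rw [List.map_map, List.map_map]
    refine List.map_congr_left fun x hx => ?_
    rcases x with x | x
    · simp [ha]
    · have : x ≠ inl v := fun h => hlv (h ▸ hx)
      simp [hb1 x this]
  have hword : (inl none :: inr (some (inl v)) :: (l1.map (Sum.map some some) ++
      inr none :: l2.map (Sum.map some some)) :
      List (Option (E1 ⊕ E2) ⊕ Option (V1 ⊕ V2))) =
      (inl (some (inl f)) :: inr none ::
        ((l1 ++ inr (inl v) :: l2).map (Sum.map some some)).map (Sum.map a id)).map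
          (Sum.map a b) := by
    simp only [List.map_append, List.map_cons]
    rw [← hmap l1 hl, ← hmap l2 hl2]
    simp [ha, hb]
  rw [hword, wcls_map]
  obtain ⟨m1, m2, hm, hf⟩ := exists_eq_append_of_isOrientation hw (inl (inl f))
  have hf2 : inl (inl f) ∉ m2 := fun hx =>
    (List.nodup_cons.mp (List.nodup_append.mp (hm ▸ hw.1)).2.1).1 hx
  have hmap' : ∀ l : List ((E1 ⊕ E2) ⊕ (V1 ⊕ V2)), inl (inl f) ∉ l →
      (l.map (Sum.map some some)).map (Sum.map a id) =
        l.map (Sum.map some some) := by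
    intro l hlf
    rw [List.map_map]
    refine List.map_congr_left fun x hx => ?_
    rcases x with x | x
    · have : x ≠ inl f := fun h => hlf (h ▸ hx)
      simp [ha1 x this]
    · rfl
  rw [hm]
  simp only [List.map_append, List.map_cons]
  rw [hmap' m1 hf, hmap' m2 hf2]
  have h3 := wcls_transpose (𝕜 := 𝕜) (d := d) δ none (some (inl f)) []
    (inr none :: m1.map (Sum.map some some)) (m2.map (Sum.map some some))
  simp only [List.nil_append, List.cons_append] at h3
  simp only [Sum.map_inl]
  rw [h3, neg_neg]
  simp [ha]

end Terms

/-! ### The Leibniz rule for the composition -/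

section Leibniz

open RibbonProp.Graph

variable {𝕜 : Type*} [Field 𝕜] {d : ℤ} [Finite I] [Finite J] [Finite K] [Finite E1] [Finite V1]
  [Finite E2] [Finite V2] (γ1 : Graph I J E1 V1) (γ2 : Graph J K E2 V2)

/-- The sum of the terms of the expansions of gluings whose surfaces satisfy `p`. -/
def expGlSum (𝕜 : Type*) [Field 𝕜] (d : ℤ) (w : List ((E1 ⊕ E2) ⊕ (V1 ⊕ V2)))
    (p : Rib (Option ((I ⊕ V1) ⊕ V2)) (J ⊕ V2) (flip (Option E1)) → Prop) : DGInf 𝕜 d I K :=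
  ∑ᶠ δ : {δ // ∃ u ρ, IsExpGl γ1 γ2 δ u ρ ∧ p ρ}, expTerm 𝕜 d δ.1 w

theorem expGlSum_split (w : List ((E1 ⊕ E2) ⊕ (V1 ⊕ V2)))
    (p q : Rib (Option ((I ⊕ V1) ⊕ V2)) (J ⊕ V2) (flip (Option E1)) → Prop) :
    expGlSum γ1 γ2 𝕜 d w p = expGlSum γ1 γ2 𝕜 d w (fun ρ => p ρ ∧ q ρ) +
      expGlSum γ1 γ2 𝕜 d w (fun ρ => p ρ ∧ ¬ q ρ) := by
  refine finsum_subtype_add (f := fun δ => expTerm 𝕜 d δ w)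
    (P := fun δ => ∃ u ρ, IsExpGl γ1 γ2 δ u ρ ∧ p ρ ∧ q ρ)
    (Q := fun δ => ∃ u ρ, IsExpGl γ1 γ2 δ u ρ ∧ p ρ ∧ ¬ q ρ)
    (R := fun δ => ∃ u ρ, IsExpGl γ1 γ2 δ u ρ ∧ p ρ) (fun δ => ⟨?_, ?_⟩) ?_
  · rintro ⟨u, ρ, h, hp⟩
    by_cases hq : q ρ
    · exact Or.inl ⟨u, ρ, h, hp, hq⟩
    · exact Or.inr ⟨u, ρ, h, hp, hq⟩
  · rintro (⟨u, ρ, h, hp, -⟩ | ⟨u, ρ, h, hp, -⟩) <;> exact ⟨u, ρ, h, hp⟩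
  · rintro δ ⟨u, ρ, h, -, hq⟩ ⟨u', ρ', h', -, hq'⟩
    exact hq' ((h.unique h').2 ▸ hq)

theorem expGlSum_congr {w : List ((E1 ⊕ E2) ⊕ (V1 ⊕ V2))}
    {p q : Rib (Option ((I ⊕ V1) ⊕ V2)) (J ⊕ V2) (flip (Option E1)) → Prop}
    (h : ∀ δ u ρ, IsExpGl γ1 γ2 δ u ρ → (p ρ ↔ q ρ)) :
    expGlSum γ1 γ2 𝕜 d w p = expGlSum γ1 γ2 𝕜 d w q :=
  finsum_subtype_congr (f := fun δ => expTerm 𝕜 d δ w) (g := fun δ => expTerm 𝕜 d δ w)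
    (fun _ => exists_congr fun _ => exists_congr fun _ => and_congr_right (h _ _ _)) fun _ _ => rfl

theorem expGlSum_exists {w : List ((E1 ⊕ E2) ⊕ (V1 ⊕ V2))}
    {p : E1 → Rib (Option ((I ⊕ V1) ⊕ V2)) (J ⊕ V2) (flip (Option E1)) → Prop}
    (h : ∀ δ u ρ, IsExpGl γ1 γ2 δ u ρ → ∀ f f', p f ρ → p f' ρ → f = f') :
    expGlSum γ1 γ2 𝕜 d w (fun ρ => ∃ f, p f ρ) = ∑ᶠ f, expGlSum γ1 γ2 𝕜 d w (p f) := by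
  refine Eq.trans ?_ (finsum_finsum_subtype (f := fun δ => expTerm 𝕜 d δ w)
    (Q := fun f δ => ∃ u ρ, IsExpGl γ1 γ2 δ u ρ ∧ p f ρ) ?_).symm
  · refine finsum_subtype_congr (f := fun δ => expTerm 𝕜 d δ w) (g := fun δ => expTerm 𝕜 d δ w)
      (fun δ => ⟨?_, ?_⟩) fun _ _ => rfl
    · rintro ⟨u, ρ, h, f, hf⟩
      exact ⟨f, u, ρ, h, hf⟩
    · rintro ⟨f, u, ρ, h, hf⟩
      exact ⟨u, ρ, h, f, hf⟩
  · rintro f f' δ ⟨u, ρ, h1, hf⟩ ⟨u', ρ', h', hf'⟩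
    exact h δ u ρ h1 f f' hf ((h1.unique h').2 ▸ hf')

/-- The terms in which the new edge is a part of a subdivided edge `f` cancel in pairs. -/
theorem expGlSum_bivalent_add {w : List ((E1 ⊕ E2) ⊕ (V1 ⊕ V2))} (hw : IsOrientation w) (f : E1) :
    expGlSum γ1 γ2 𝕜 d w (fun ρ => Bivalent ρ true f) +
      expGlSum γ1 γ2 𝕜 d w (fun ρ => Bivalent ρ false f) = 0 := by
  rcases hv : γ1.vtx (f, true) with i | v
  · exact absurd hv (γ1.source_ne f i)
  rw [add_comm, ← eq_neg_iff_add_eq_zero, expGlSum, expGlSum, ← finsum_neg_distrib]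
  refine (finsum_subtype_equiv (f := fun δ => -expTerm 𝕜 d δ w) (g := fun δ => expTerm 𝕜 d δ w)
    (P := fun δ => ∃ u ρ, IsExpGl γ1 γ2 δ u ρ ∧ Bivalent ρ true f)
    (Q := fun δ => ∃ u ρ, IsExpGl γ1 γ2 δ u ρ ∧ Bivalent ρ false f)
    (mapEquiv (.refl I) (.refl K) (swap none (some (inl f)))
      (swap none (some (inl v)))) (fun δ => exists_bivalent_swap_iff hv)
      fun δ hδ => ?_).symm
  have hδ' := (exists_bivalent_swap_iff hv).mp hδ
  obtain ⟨u, ρ, h, hf⟩ := hδ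
  obtain ⟨u', ρ', h', hf'⟩ := hδ'
  obtain ⟨h1, h2⟩ := h'.type_target hv hf'
  exact expTerm_swapNew hw (h.type_none hf) h.target_ne h1 h2

theorem expGlSum_bivalent {w : List ((E1 ⊕ E2) ⊕ (V1 ⊕ V2))} (hw : IsOrientation w) :
    expGlSum γ1 γ2 𝕜 d w (fun ρ => ∃ f, Bivalent ρ true f) +
      expGlSum γ1 γ2 𝕜 d w (fun ρ => ∃ f, Bivalent ρ false f) = 0 := by
  rw [expGlSum_exists _ _ fun δ u ρ h f f' hf hf' => (h.bivalent_unique hf hf').2,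
    expGlSum_exists _ _ fun δ u ρ h f f' hf hf' => (h.bivalent_unique hf hf').2,
    ← finsum_add_distrib (Set.toFinite _) (Set.toFinite _)]
  simp only [expGlSum_bivalent_add γ1 γ2 hw, finsum_zero]

/-- Only the terms coming from expansions of one of the factors remain. -/
theorem expGlSum_true {w : List ((E1 ⊕ E2) ⊕ (V1 ⊕ V2))} (hw : IsOrientation w) :
    expGlSum γ1 γ2 𝕜 d w (fun _ => True) =
      expGlSum γ1 γ2 𝕜 d w (fun ρ => ρ.next (none, true) ≠ (none, true) ∧
        ∀ b f, ¬ Bivalent ρ b f) +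
      expGlSum γ1 γ2 𝕜 d w (fun ρ => ρ.next (none, true) = (none, true)) := by
  -- The sum is split by whether the source of the new edge has no other half-edge in `ρ`, whether
  -- an end of the new edge is bivalent, and which end this is.
  have h1 := expGlSum_bivalent (𝕜 := 𝕜) (d := d) γ1 γ2 hw
  have h2 := expGlSum_split (𝕜 := 𝕜) (d := d) γ1 γ2 w (fun _ => True)
    fun ρ => ρ.next (none, true) = (none, true)
  have h3 := expGlSum_split (𝕜 := 𝕜) (d := d) γ1 γ2 w
    (fun ρ => True ∧ ¬ ρ.next (none, true) = (none, true)) fun ρ => ∃ b f, Bivalent ρ b f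
  have h4 := expGlSum_split (𝕜 := 𝕜) (d := d) γ1 γ2 w
    (fun ρ => (True ∧ ¬ ρ.next (none, true) = (none, true)) ∧ ∃ b f, Bivalent ρ b f)
    fun ρ => ∃ f, Bivalent ρ true f
  have e1 : ∀ δ u ρ, IsExpGl γ1 γ2 δ u ρ →
      ((((True ∧ ¬ ρ.next (none, true) = (none, true)) ∧ ∃ b f, Bivalent ρ b f) ∧
        ∃ f, Bivalent ρ true f) ↔ ∃ f, Bivalent ρ true f) := fun δ u ρ h =>
    ⟨fun h' => h'.2, fun ⟨f, hf⟩ =>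
      ⟨⟨⟨trivial, fun hn => h.not_bivalent_of_next hn _ _ hf⟩, true, f, hf⟩, f, hf⟩⟩
  have e2 : ∀ δ u ρ, IsExpGl γ1 γ2 δ u ρ →
      ((((True ∧ ¬ ρ.next (none, true) = (none, true)) ∧ ∃ b f, Bivalent ρ b f) ∧
        ¬ ∃ f, Bivalent ρ true f) ↔ ∃ f, Bivalent ρ false f) := by
    refine fun δ u ρ h => ⟨?_, fun ⟨f, hf⟩ =>
      ⟨⟨⟨trivial, fun hn => h.not_bivalent_of_next hn _ _ hf⟩, false, f, hf⟩, ?_⟩⟩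
    · rintro ⟨⟨-, _ | _, f, hf⟩, h'⟩
      · exact ⟨f, hf⟩
      · exact absurd ⟨f, hf⟩ h'
    · rintro ⟨f', hf'⟩
      exact absurd (h.bivalent_unique hf hf').1 Bool.false_ne_true
  rw [expGlSum_congr γ1 γ2 e1, expGlSum_congr γ1 γ2 e2, h1] at h4
  rw [h2, h3, h4, zero_add, add_comm]
  congr 1 <;> exact expGlSum_congr γ1 γ2 fun δ u ρ h => by simp

/-- Expansions of the first factor are those where `ρ` satisfies the conditions for a graph. -/
theorem glueMap_expMap_left {w1 : List (E1 ⊕ V1)} {w2 : List (E2 ⊕ V2)} (h1 : IsOrientation w1)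
    (h2 : IsOrientation w2) :
    glueMap 𝕜 d (expMap 𝕜 d (wcls 𝕜 d γ1 w1)) (wcls 𝕜 d γ2 w2) =
      expGlSum γ1 γ2 𝕜 d (joinWord w1 w2) (fun ρ => ρ.next (none, true) ≠ (none, true) ∧
        ∀ b f, ¬ Bivalent ρ b f) := by
  rw [expMap_wcls _ h1]
  refine (map_finsum_of_finite ((glueMap 𝕜 d).flip (wcls 𝕜 d γ2 w2)).toAddMonoidHom
    fun γ : {γ // ∃ u, γ1.IsExpansion u γ} => expTerm 𝕜 d γ.1 w1).trans ?_
  have key : ∀ γ' : {γ // ∃ u, γ1.IsExpansion u γ},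
      glueMap 𝕜 d (expTerm 𝕜 d γ'.1 w1) (wcls 𝕜 d γ2 w2) =
        ∑ᶠ γ : {γ // γ'.1.IsGluing γ2 γ}, expTerm 𝕜 d (γ.1.map (.refl I) (.refl K)
          (optionSumComm E1 E2) (optionSumComm V1 V2)) (joinWord w1 w2) := by
    rintro ⟨γ', u, h⟩
    obtain ⟨s, w, hw, h3, h4⟩ := expTerm_gluing_left (𝕜 := 𝕜) (d := d) h γ2 h1 w2
    change glueMap 𝕜 d (expTerm 𝕜 d γ' w1) _ = _
    rw [h3, map_units_smul, Units.smul_def, LinearMap.smul_apply, ← Units.smul_def,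
      glueMap_wcls _ _ hw h2, units_smul_finsum]
    exact finsum_congr fun γ => (h4 γ.1 γ.2).symm
  refine (finsum_congr key).trans ?_
  rw [finsum_subtype_finsum_subtype (P := fun γ' => ∃ u, γ1.IsExpansion u γ')
    (Q := fun γ' γ => γ'.IsGluing γ2 γ)
    (f := fun γ => expTerm 𝕜 d (γ.map (.refl I) (.refl K)
      (optionSumComm E1 E2) (optionSumComm V1 V2)) (joinWord w1 w2))
    fun _ _ _ ⟨_, h⟩ ⟨_, h'⟩ hγ hγ' => h.unique_of_gluing_left h' hγ hγ']
  refine finsum_subtype_equiv (P := fun γ => ∃ γ', (∃ u, γ1.IsExpansion u γ') ∧ γ'.IsGluing γ2 γ)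
    (Q := fun δ => ∃ u ρ, IsExpGl γ1 γ2 δ u ρ ∧ ρ.next (none, true) ≠ (none, true) ∧
        ∀ b f, ¬ Bivalent ρ b f) (g := fun δ => expTerm 𝕜 d δ (joinWord w1 w2))
    (mapEquiv (.refl I) (.refl K) (optionSumComm E1 E2)
      (optionSumComm V1 V2)) (fun γ => ?_) fun _ _ => rfl
  rw [← exists_expansion_left_iff]
  have h := γ.map_symm_map (.refl I) (.refl K) (optionSumComm E1 E2)
      (optionSumComm V1 V2)
  exact exists_congr fun γ' => and_congr_right fun _ => iff_of_eq (congrArg _ h.symm)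

/-- Expansions of the second factor are those where the source of the new edge has no half-edge of
the first graph. -/
theorem glueMap_expMap_right {w1 : List (E1 ⊕ V1)} {w2 : List (E2 ⊕ V2)} (h1 : IsOrientation w1)
    (h2 : IsOrientation w2) :
    (wordDeg d γ1 w1).negOnePow • glueMap 𝕜 d (wcls 𝕜 d γ1 w1) (expMap 𝕜 d (wcls 𝕜 d γ2 w2)) =
      expGlSum γ1 γ2 𝕜 d (joinWord w1 w2) (fun ρ => ρ.next (none, true) = (none, true)) := by
  have hQ : ∀ γ : Graph I K (E1 ⊕ Option E2) (V1 ⊕ Option V2),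
      (∃ γ', (∃ u, γ2.IsExpansion u γ') ∧ γ1.IsGluing γ' γ) ↔
      ∃ u ρ, IsExpGl γ1 γ2 (γ.map (.refl I) (.refl K) (optionSum E1 E2)
        (optionSum V1 V2)) u ρ ∧ ρ.next (none, true) = (none, true) := by
    intro γ
    rw [← exists_expansion_right_iff]
    have h := γ.map_symm_map (.refl I) (.refl K) (optionSum E1 E2) (optionSum V1 V2)
    exact exists_congr fun γ' => and_congr_right fun _ => iff_of_eq (congrArg _ h.symm)
  rw [expMap_wcls _ h2]
  refine (congrArg _ (map_finsum_of_finite (glueMap 𝕜 d (wcls 𝕜 d γ1 w1)).toAddMonoidHom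
    fun γ : {γ // ∃ u, γ2.IsExpansion u γ} => expTerm 𝕜 d γ.1 w2)).trans ?_
  rw [units_smul_finsum]
  have key : ∀ γ' : {γ // ∃ u, γ2.IsExpansion u γ},
      (wordDeg d γ1 w1).negOnePow • glueMap 𝕜 d (wcls 𝕜 d γ1 w1) (expTerm 𝕜 d γ'.1 w2) =
        ∑ᶠ γ : {γ // γ1.IsGluing γ'.1 γ}, expTerm 𝕜 d (γ.1.map (.refl I) (.refl K)
          (optionSum E1 E2) (optionSum V1 V2)) (joinWord w1 w2) := by
    rintro ⟨γ', u, h⟩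
    obtain ⟨s, w, hw, h3, h4⟩ := expTerm_gluing_right (𝕜 := 𝕜) (d := d) h γ1 h1 h2
    change _ • glueMap 𝕜 d _ (expTerm 𝕜 d γ' w2) = _
    rw [h3, map_units_smul, glueMap_wcls _ _ h1 hw, units_smul_finsum, units_smul_finsum]
    refine finsum_congr fun γ => (h4 γ.1 γ.2 ?_).symm
    obtain ⟨_, _, h₅, -⟩ := (hQ γ.1).mp ⟨γ', ⟨u, h⟩, γ.2⟩
    exact h₅.target_ne
  refine (finsum_congr key).trans ?_
  rw [finsum_subtype_finsum_subtype (P := fun γ' => ∃ u, γ2.IsExpansion u γ')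
    (Q := fun γ' γ => γ1.IsGluing γ' γ)
    (f := fun γ => expTerm 𝕜 d (γ.map (.refl I) (.refl K)
      (optionSum E1 E2) (optionSum V1 V2)) (joinWord w1 w2))
    fun _ _ _ ⟨_, h⟩ ⟨_, h'⟩ hγ hγ' => h.unique_of_gluing_right h' hγ hγ']
  exact finsum_subtype_equiv (P := fun γ => ∃ γ', (∃ u, γ2.IsExpansion u γ') ∧ γ1.IsGluing γ' γ)
    (Q := fun δ => ∃ u ρ, IsExpGl γ1 γ2 δ u ρ ∧ ρ.next (none, true) = (none, true))
    (g := fun δ => expTerm 𝕜 d δ (joinWord w1 w2))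
    (mapEquiv (.refl I) (.refl K) (optionSum E1 E2)
      (optionSum V1 V2)) hQ fun _ _ => rfl

theorem expMap_glueMap_wcls {w1 : List (E1 ⊕ V1)} {w2 : List (E2 ⊕ V2)} (h1 : IsOrientation w1)
    (h2 : IsOrientation w2) :
    expMap 𝕜 d (glueMap 𝕜 d (wcls 𝕜 d γ1 w1) (wcls 𝕜 d γ2 w2)) =
      expGlSum γ1 γ2 𝕜 d (joinWord w1 w2) (fun _ => True) := by
  rw [glueMap_wcls _ _ h1 h2]
  refine (map_finsum_of_finite (expMap 𝕜 d).toAddMonoidHom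
    fun γ : {γ // γ1.IsGluing γ2 γ} => wcls 𝕜 d γ.1 (joinWord w1 w2)).trans ?_
  refine (finsum_congr fun γ : {γ // γ1.IsGluing γ2 γ} =>
    expMap_wcls γ.1 (isOrientation_joinWord h1 h2)).trans ?_
  rw [finsum_subtype_finsum_subtype (P := fun γ => γ1.IsGluing γ2 γ)
    (Q := fun γ δ => ∃ u, γ.IsExpansion u δ) (f := fun δ => expTerm 𝕜 d δ (joinWord w1 w2))
    fun _ _ _ h h' ⟨_, hγ⟩ ⟨_, hγ'⟩ => h.unique_of_next h' (hγ.source_unique hγ')]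
  exact finsum_subtype_congr (f := fun δ => expTerm 𝕜 d δ (joinWord w1 w2))
    (g := fun δ => expTerm 𝕜 d δ (joinWord w1 w2))
    (fun δ => by simpa using exists_isExpGl_iff (γ1 := γ1) (γ2 := γ2) (δ := δ)) fun _ _ => rfl

end Leibniz

variable {𝕜 : Type*} [Field 𝕜] {d : ℤ}

/-- The expansion of edges is a derivation with respect to the composition. -/
theorem expMap_glueMap [Finite I] [Finite J] [Finite K] {p : ℤ} {a : DGInf 𝕜 d I J}
    (b : DGInf 𝕜 d J K) (ha : a ∈ grInf 𝕜 d I J p) :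
    expMap 𝕜 d (glueMap 𝕜 d a b) = glueMap 𝕜 d (expMap 𝕜 d a) b +
      p.negOnePow • glueMap 𝕜 d a (expMap 𝕜 d b) := by
  have hlin : ∀ (c : 𝕜) (y : DGInf 𝕜 d I K), p.negOnePow • c • y = c • p.negOnePow • y :=
    fun c y => smul_comm _ _ _
  refine grInf_induction (P := fun a => expMap 𝕜 d (glueMap 𝕜 d a b) =
    glueMap 𝕜 d (expMap 𝕜 d a) b +
      p.negOnePow • glueMap 𝕜 d a (expMap 𝕜 d b)) (by simp) ?_ ?_ ?_ ha
  · intro x y hx hy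
    simp only [map_add, LinearMap.add_apply, smul_add, hx, hy]
    abel
  · intro c x hx
    simp only [map_smul, LinearMap.smul_apply, hx, smul_add, hlin]
  · intro E1 V1 _ _ γ1 w1 h1 hp
    subst hp
    induction b using DGInf.induction with
    | zero => simp
    | add x y hx hy =>
      simp only [map_add, smul_add, hx, hy]
      abel
    | smul c x hx => simp only [map_smul, hx, smul_add, hlin]
    | wcls γ2 w2 h2 =>
      rw [expMap_glueMap_wcls γ1 γ2 h1 h2, expGlSum_true γ1 γ2 (isOrientation_joinWord h1 h2),
        glueMap_expMap_left γ1 γ2 h1 h2, glueMap_expMap_right γ1 γ2 h1 h2]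

end RibbonProp

namespace RibbonProp

/-! ### Degrees and gradings -/

variable {I I' J J' K K' L A B E E' V V' E1 V1 E2 V2 Q : Type}

namespace Graph

theorem sum_type [Finite E] [Finite V] (γ : Graph I J E V) :
    ∑ᶠ v, (γ.type v : ℤ) = Nat.card E := by
  have := Fintype.ofFinite V
  rw [finsum_eq_sum_of_fintype, ← Nat.cast_sum, Nat.cast_inj]
  have h := Nat.card_sigma (β := fun v => {e : E // γ.vtx (e, true) = inr v})
  refine h.symm.trans (Nat.card_congr (ofBijective (fun x => x.2.1) ⟨?_, ?_⟩))
  · rintro ⟨v, e, h⟩ ⟨v', e', h'⟩ (rfl : e = e')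
    obtain rfl := Sum.inr_injective (h.symm.trans h')
    rfl
  · intro e
    rcases h : γ.vtx (e, true) with i | v
    · exact absurd h (γ.source_ne e i)
    · exact ⟨⟨v, e, h⟩, rfl⟩

theorem sum_indeg [Finite I] [Finite E] [Finite V] (γ : Graph I J E V) :
    ∑ᶠ i, (γ.indeg (inl i) : ℤ) + ∑ᶠ v, (γ.indeg (inr v) : ℤ) = Nat.card E := by
  have := Fintype.ofFinite V
  have := Fintype.ofFinite I
  rw [finsum_eq_sum_of_fintype, finsum_eq_sum_of_fintype, ← Fintype.sum_sum_type
    (f := fun w => (γ.indeg w : ℤ)), ← Nat.cast_sum, Nat.cast_inj]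
  have h := Nat.card_sigma (β := fun w => {e : E // γ.vtx (e, false) = w})
  refine h.symm.trans (Nat.card_congr (ofBijective (fun x => x.2.1) ⟨?_, ?_⟩))
  · rintro ⟨v, e, rfl⟩ ⟨v', e', rfl⟩ (rfl : e = e')
    rfl
  · exact fun e => ⟨⟨_, e, rfl⟩, rfl⟩

/-- The degree in terms of numbers, by summing incoming and outgoing edges over all vertices. -/
theorem degree_eq [Finite I] [Finite E] [Finite V] (γ : Graph I J E V) :
    γ.degree = 3 * Nat.card E - 4 * Nat.card V - Nat.card {i // ¬ γ.Trivial i} := by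
  have hI : ∀ i, ((γ.indeg (inl i) - 1 : ℕ) : ℤ) =
      (γ.indeg (inl i) : ℤ) - if ¬ γ.Trivial i then 1 else 0 := by
    intro i
    by_cases h : γ.Trivial i
    · have : γ.indeg (inl i) = 0 := by
        have : IsEmpty {e // γ.vtx (e, false) = inl i} := ⟨fun x => h _ x.2⟩
        exact Nat.card_of_isEmpty
      simp [h, this]
    · have : γ.indeg (inl i) ≠ 0 := by
        obtain ⟨⟨e, s⟩, he⟩ := not_forall_not.mp h
        cases s
        · have : Nonempty {e // γ.vtx (e, false) = inl i} := ⟨⟨e, he⟩⟩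
          exact Nat.card_pos.ne'
        · exact absurd he (γ.source_ne e i)
      simp only [h, not_false_eq_true, if_true]
      omega
  have hcard : ∑ᶠ i, (if ¬ γ.Trivial i then (1 : ℤ) else 0) = Nat.card {i // ¬ γ.Trivial i} := by
    have := Fintype.ofFinite I
    rw [finsum_eq_sum_of_fintype, Finset.sum_boole, Nat.card_eq_fintype_card,
      Fintype.card_subtype]
  have hV : ∑ᶠ v : V, (4 : ℤ) = 4 * Nat.card V := by
    have := Fintype.ofFinite V
    rw [finsum_eq_sum_of_fintype]
    simp [mul_comm]
  rw [degree, finsum_congr hI, finsum_sub_distrib (Set.toFinite _) (Set.toFinite _), hcard,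
    finsum_sub_distrib (Set.toFinite _) (Set.toFinite _),
    finsum_add_distrib (Set.toFinite _) (Set.toFinite _), ← mul_finsum, sum_type, hV]
  linarith [γ.sum_indeg]

/-- Every vertex has a non-negative contribution; for type `1` this is the condition on the number
of incoming edges. -/
theorem degree_nonneg (γ : Graph I J E V) [Finite E] : 0 ≤ γ.degree := by
  refine add_nonneg (finsum_nonneg fun i => by positivity) (finsum_nonneg fun v => ?_)
  have h0 : γ.type v ≠ 0 := by
    obtain ⟨e, he⟩ := γ.exists_source v
    have : Nonempty {e // γ.vtx (e, true) = inr v} := ⟨⟨e, he⟩⟩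
    exact Nat.card_pos.ne'
  have h1 : γ.type v = 1 → 2 ≤ γ.indeg (inr v) := γ.two_le_of_type_one v
  omega

theorem degree_map [Finite I] [Finite E] [Finite V] [Finite E'] [Finite V'] (γ : Graph I J E V)
    (a : E ≃ E') (b : V ≃ V') :
    (γ.map (.refl I) (.refl J) a b).degree = γ.degree := by
  rw [degree_eq, degree_eq, Nat.card_congr a, Nat.card_congr b]
  congr 2
  refine Nat.card_congr (subtypeEquivRight fun i => not_congr ⟨fun h y hy => ?_,
    fun h y hy => ?_⟩)
  · refine h (a y.1, y.2) ?_
    rw [map_vtx, symm_apply_apply, hy]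
    rfl
  · obtain ⟨e, s⟩ := y
    rw [map_vtx] at hy
    refine h (a.symm e, s) ?_
    rcases hh : γ.vtx (a.symm e, s) with i' | v <;> rw [hh] at hy <;> simp at hy
    rw [hy]

theorem IsExpansion.degree [Finite I] [Finite E] [Finite V] {γ : Graph I J E V} {u : I ⊕ V}
    {γ' : Graph I J (Option E) (Option V)} (h : γ.IsExpansion u γ') :
    γ'.degree = γ.degree - 1 := by
  have hT : ∀ i, γ'.Trivial i ↔ γ.Trivial i := by
    refine fun i => ⟨fun hi ⟨e, s⟩ he => ?_, fun hi ⟨e, s⟩ he => ?_⟩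
    · have h1 := h.vtx e s
      rw [he] at h1
      rcases h2 : γ'.vtx (some e, s) with i' | _ | v <;> rw [h2] at h1
      · exact hi (some e, s) (h2.trans (congrArg _ (Sum.inl_injective h1)))
      · refine hi (none, false) ?_
        rw [h.target, show u = inl i from h1]
        rfl
      · simp at h1
    · rcases e with _ | e
      · cases s
        · rw [h.target] at he
          rcases u with i' | v
          · obtain rfl : i' = i := Sum.inl_injective he
            exact h.not_trivial hi
          · simp at he
        · exact γ'.source_ne _ _ he
      · refine hi (e, s) ?_
        rw [← h.vtx, he]
        rfl
  rw [degree_eq, degree_eq, Finite.card_option, Finite.card_option,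
    Nat.card_congr (subtypeEquivRight fun i => not_congr (hT i))]
  push_cast
  ring

theorem IsExpansion.type_le [Finite E] {γ : Graph I J E V} {u : I ⊕ V}
    {γ' : Graph I J (Option E) (Option V)} (h : γ.IsExpansion u γ') {k : ℕ∞} (hk : 1 ≤ k)
    (hγ : ∀ v, (γ.type v : ℕ∞) ≤ k) (v : Option V) : (γ'.type v : ℕ∞) ≤ k := by
  have hpos : ∀ v, 1 ≤ γ'.type v := fun v => by
    obtain ⟨e, he⟩ := γ'.exists_source v
    have : Nonempty {e // γ'.vtx (e, true) = inr v} := ⟨⟨e, he⟩⟩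
    exact Nat.card_pos
  rcases u with i | w
  · rcases v with _ | v
    · rw [h.type_of_input]
      exact_mod_cast hk
    · rw [h.type_of_ne (by simp)]
      exact hγ v
  · have h1 := h.type_add
    have h2 := hpos none
    have h3 := hpos (some w)
    by_cases hv : v = none ∨ v = some w
    · refine le_trans (Nat.cast_le.mpr ?_) (hγ w)
      rcases hv with rfl | rfl <;> omega
    · obtain ⟨v, rfl⟩ := Option.ne_none_iff_exists'.mp (not_or.mp hv).1
      rw [h.type_of_ne fun hw => (not_or.mp hv).2 (congrArg some (Sum.inr_injective hw))]
      exact hγ v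

end Graph

/-- The orientation degree in terms of numbers, by summing the types of the vertices. -/
theorem wordDeg_eq (d : ℤ) [Finite E] [Finite V] (γ : Graph I J E V) {w : List (E ⊕ V)}
    (hw : IsOrientation w) : wordDeg d γ w = Nat.card E * (3 - d) + Nat.card V * (d - 4) := by
  have := Fintype.ofFinite V
  have := Fintype.ofFinite E
  have h1 : wordDeg d γ w = ∑ x, γ.letterDeg d x := by
    rw [wordDeg, ← List.sum_toFinset _ hw.1]
    congr 1
    ext x
    simp [hw.2 x]
  have h2 := γ.sum_type
  rw [finsum_eq_sum_of_fintype] at h2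
  rw [h1, Fintype.sum_sum_type]
  simp only [Graph.letterDeg_inl, Graph.letterDeg_inr, Finset.sum_add_distrib, Finset.sum_const,
    ← Finset.sum_mul, h2, Finset.card_univ, Nat.card_eq_fintype_card]
  simp
  ring

theorem orientationDegree_eq (d : ℤ) (Γ : OGraph I J) :
    Γ.orientationDegree d = Nat.card Γ.E * (3 - d) + Nat.card Γ.V * (d - 4) :=
  wordDeg_eq d Γ.graph Γ.isOrientation

theorem orientationDegree_join (d : ℤ) (Γ1 : OGraph I J) (Γ2 : OGraph I' J')
    (γ : Graph A B (Γ1.E ⊕ Γ2.E) (Γ1.V ⊕ Γ2.V)) : (OGraph.join Γ1 Γ2 γ).orientationDegree d =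
      Γ1.orientationDegree d + Γ2.orientationDegree d := by
  simp only [orientationDegree_eq]
  rw [show Nat.card (OGraph.join Γ1 Γ2 γ).E = _ from Nat.card_sum,
    show Nat.card (OGraph.join Γ1 Γ2 γ).V = _ from Nat.card_sum]
  push_cast
  ring

section Span

variable {𝕜 : Type*} [Field 𝕜] {d : ℤ}

/-- The subspace spanned by the oriented graphs with the property `f`. -/
def spanBy (𝕜 : Type*) [Field 𝕜] (d : ℤ) (f : OGraph I J → Prop) : Submodule 𝕜 (DGInf 𝕜 d I J) :=
  Submodule.span 𝕜 {x | ∃ Γ, f Γ ∧ x = cls 𝕜 d Γ}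

theorem wcls_mem_spanBy [Finite E] [Finite V] {f : OGraph I J → Prop} (γ : Graph I J E V)
    (w : List (E ⊕ V)) (h : ∀ hw, f (OGraph.ofWord γ w hw)) : wcls 𝕜 d γ w ∈ spanBy 𝕜 d f := by
  by_cases hw : IsOrientation w
  · rw [wcls_eq 𝕜 d hw]
    exact Submodule.subset_span ⟨_, h hw, rfl⟩
  · rw [wcls_of_not 𝕜 d hw]
    exact zero_mem _

theorem units_smul_mem {M : Type*} [AddCommGroup M] [Module 𝕜 M] (N : Submodule 𝕜 M) (u : ℤˣ)
    {x : M} (hx : x ∈ N) : u • x ∈ N := by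
  rw [Units.smul_def]
  exact zsmul_mem hx _

theorem finsum_mem_submodule {M α : Type*} [AddCommGroup M] [Module 𝕜 M] (N : Submodule 𝕜 M)
    {g : α → M} (h : ∀ x, g x ∈ N) : ∑ᶠ x, g x ∈ N :=
  finsum_induction (· ∈ N) (zero_mem N) (fun _ _ => add_mem) h

theorem JoinRel.lin_mem_spanBy (R : JoinRel I J I' J' A B) {f1 f2 f}
    (h : ∀ Γ1 Γ2 γ, f1 Γ1 → f2 Γ2 → R.rel Γ1.graph Γ2.graph γ → f (OGraph.join Γ1 Γ2 γ))
    {a : DGInf 𝕜 d I J} {b : DGInf 𝕜 d I' J'} (ha : a ∈ spanBy 𝕜 d f1) (hb : b ∈ spanBy 𝕜 d f2) :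
    R.lin 𝕜 d a b ∈ spanBy 𝕜 d f := by
  induction ha using Submodule.span_induction with
  | zero => simp
  | add x y _ _ hx hy =>
    rw [map_add]
    exact add_mem hx hy
  | smul c x _ hx =>
    rw [map_smul]
    exact Submodule.smul_mem _ c hx
  | mem x hx =>
  obtain ⟨Γ1, h1, rfl⟩ := hx
  induction hb using Submodule.span_induction with
  | zero => simp
  | add x y _ _ hx hy =>
    rw [map_add]
    exact add_mem hx hy
  | smul c x _ hx =>
    rw [map_smul]
    exact Submodule.smul_mem _ c hx
  | mem x hx =>
  obtain ⟨Γ2, h2, rfl⟩ := hx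
  rw [cls_eq_wcls, cls_eq_wcls, R.lin_wcls _ _ _ _ Γ1.isOrientation Γ2.isOrientation]
  exact finsum_mem_submodule _ fun γ =>
    wcls_mem_spanBy _ _ fun hw => h Γ1 Γ2 γ.1 h1 h2 γ.2

theorem relabelMap_mem_spanBy (α : I ≃ I') (β : J ≃ J') {f : OGraph I J → Prop}
    {f' : OGraph I' J' → Prop} (h : ∀ Γ, f Γ → f' (Γ.relabel α β))
    {a : DGInf 𝕜 d I J} (ha : a ∈ spanBy 𝕜 d f) : relabelMap 𝕜 d α β a ∈ spanBy 𝕜 d f' := by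
  induction ha using Submodule.span_induction with
  | zero => simp
  | add x y _ _ hx hy =>
    rw [map_add]
    exact add_mem hx hy
  | smul c x _ hx =>
    rw [map_smul]
    exact Submodule.smul_mem _ c hx
  | mem x hx =>
    obtain ⟨Γ, hΓ, rfl⟩ := hx
    rw [relabelMap_cls]
    exact Submodule.subset_span ⟨_, h Γ hΓ, rfl⟩

theorem expMap_mem_spanBy [Finite I] [Finite J] {f f' : OGraph I J → Prop}
    (h : ∀ Γ, f Γ → ∀ u γ', Γ.graph.IsExpansion u γ' → ∀ w hw, f' (OGraph.ofWord γ' w hw))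
    {a : DGInf 𝕜 d I J} (ha : a ∈ spanBy 𝕜 d f) : expMap 𝕜 d a ∈ spanBy 𝕜 d f' := by
  induction ha using Submodule.span_induction with
  | zero => simp
  | add x y _ _ hx hy =>
    rw [map_add]
    exact add_mem hx hy
  | smul c x _ hx =>
    rw [map_smul]
    exact Submodule.smul_mem _ c hx
  | mem x hx =>
    obtain ⟨Γ, hΓ, rfl⟩ := hx
    rw [cls_eq_wcls, expMap_wcls _ Γ.isOrientation]
    refine finsum_mem_submodule _ fun γ' => ?_
    obtain ⟨u, hu⟩ := γ'.2
    have hγ : ∀ w, wcls 𝕜 d γ'.1 w ∈ spanBy 𝕜 d f' := fun w =>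
      wcls_mem_spanBy _ _ fun hw => h Γ hΓ u γ'.1 hu w hw
    unfold expTerm
    split
    · exact hγ _
    · exact zero_mem _
    · exact units_smul_mem _ _ (hγ _)

/-- The projection to the part of degree `p`, for a degree of graphs which only depends on the
isomorphism class. -/
def projMap (𝕜 : Type*) [Field 𝕜] (d : ℤ) (D : OGraph I J → ℤ)
    (hr : ∀ Γ w hw, D (Γ.reorient w hw) = D Γ)
    (hi : ∀ Γ Γ' a b, Γ.graph.IsIso Γ'.graph a b → D Γ = D Γ') (p : ℤ) :
    DGInf 𝕜 d I J →ₗ[𝕜] DGInf 𝕜 d I J :=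
  Submodule.liftQ _ (Finsupp.linearCombination 𝕜 fun Γ => if D Γ = p then cls 𝕜 d Γ else 0) <| by
    rw [Submodule.span_le]
    rintro r (⟨Γ, l1, l2, x, y, hw⟩ | ⟨Γ, Γ', a, b, h, hw⟩)
    · rw [SetLike.mem_coe, LinearMap.mem_ker, map_sub, map_units_smul]
      simp only [Finsupp.linearCombination_single, one_smul, hr]
      split_ifs
      · rw [cls_eq_of_relation 𝕜 d (Relation.swap Γ l1 l2 x y hw), sub_self]
      · simp
    · rw [SetLike.mem_coe, LinearMap.mem_ker, map_sub]
      simp only [Finsupp.linearCombination_single, one_smul, hi Γ Γ' a b h]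
      split_ifs
      · have h1 := cls_eq_of_relation 𝕜 d (Γ := Γ) (Γ' := Γ') (u := 1)
          (by rw [one_smul]; exact Relation.iso Γ Γ' a b h hw)
        rw [h1, one_smul, sub_self]
      · simp

/-- The parts of the degrees are independent because the projections separate them. -/
theorem isInternal_span (k : ℕ∞) (D : OGraph I J → ℤ)
    (hr : ∀ Γ w hw, D (Γ.reorient w hw) = D Γ)
    (hi : ∀ Γ Γ' a b, Γ.graph.IsIso Γ'.graph a b → D Γ = D Γ') :
    DirectSum.IsInternal fun p => Submodule.span 𝕜 {x : DG 𝕜 d k I J |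
      ∃ (Γ : OGraph I J) (h : Γ.TypeLE k), D Γ = p ∧ x = gen 𝕜 d Γ h} := by
  have hproj : ∀ p q, ∀ x ∈ Submodule.span 𝕜 {x : DG 𝕜 d k I J |
      ∃ (Γ : OGraph I J) (h : Γ.TypeLE k), D Γ = q ∧ x = gen 𝕜 d Γ h},
      projMap 𝕜 d D hr hi p x = if q = p then (x : DGInf 𝕜 d I J) else 0 := by
    intro p q x hx
    induction hx using Submodule.span_induction with
    | zero => simp
    | add x y _ _ hx hy =>
      rw [Submodule.coe_add, map_add, hx, hy]
      split_ifs <;> simp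
    | smul c x _ hx =>
      rw [Submodule.coe_smul, map_smul, hx]
      split_ifs <;> simp
    | mem x hx =>
      obtain ⟨Γ, h, rfl, rfl⟩ := hx
      change Finsupp.linearCombination 𝕜 _ (Finsupp.single Γ 1) = _
      rw [Finsupp.linearCombination_single, one_smul]
      rfl
  rw [DirectSum.isInternal_submodule_iff_iSupIndep_and_iSup_eq_top]
  constructor
  · rw [iSupIndep_def]
    refine fun p => Submodule.disjoint_def.mpr fun x hx hx' => ?_
    have h1 := hproj p p x hx
    rw [if_pos rfl] at h1
    have h2 : x ∈ LinearMap.ker ((projMap 𝕜 d D hr hi p).comp (DG 𝕜 d k I J).subtype) := by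
      refine (iSup₂_le fun q hq => ?_ : _ ≤ LinearMap.ker _) hx'
      intro y hy
      rw [LinearMap.mem_ker, LinearMap.comp_apply, Submodule.subtype_apply, hproj p q y hy,
        if_neg hq]
    exact Subtype.ext (h1.symm.trans h2)
  · refine eq_top_iff.mpr ?_
    rintro ⟨x, hx⟩ -
    induction hx using Submodule.span_induction with
    | zero => exact zero_mem _
    | add x y hx hy h1 h2 => exact add_mem h1 h2
    | smul c x hx h1 => exact Submodule.smul_mem _ c h1
    | mem x hx =>
      obtain ⟨Γ, h, rfl⟩ := hx
      exact Submodule.mem_iSup_of_mem (D Γ) (Submodule.subset_span ⟨Γ, h, rfl, rfl⟩)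

theorem mem_span_gen_iff {k : ℕ∞} {f : OGraph I J → Prop} {x : DG 𝕜 d k I J} :
    x ∈ Submodule.span 𝕜 {x : DG 𝕜 d k I J |
      ∃ (Γ : OGraph I J) (h : Γ.TypeLE k), f Γ ∧ x = gen 𝕜 d Γ h} ↔
    (x : DGInf 𝕜 d I J) ∈ spanBy 𝕜 d fun Γ : OGraph I J => Γ.TypeLE k ∧ f Γ := by
  refine ⟨fun hx => ?_, fun hx => ?_⟩
  · have := Submodule.mem_map_of_mem (f := (DG 𝕜 d k I J).subtype) hx
    rw [Submodule.map_span] at this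
    refine Submodule.span_mono ?_ this
    rintro _ ⟨_, ⟨Γ, h, hf, rfl⟩, rfl⟩
    exact ⟨Γ, ⟨h, hf⟩, rfl⟩
  · have : spanBy 𝕜 d (fun Γ : OGraph I J => Γ.TypeLE k ∧ f Γ) ≤
        (Submodule.span 𝕜 {x : DG 𝕜 d k I J |
          ∃ (Γ : OGraph I J) (h : Γ.TypeLE k), f Γ ∧ x = gen 𝕜 d Γ h}).map
            (DG 𝕜 d k I J).subtype := by
      rw [Submodule.map_span]
      refine Submodule.span_mono ?_
      rintro _ ⟨Γ, ⟨h, hf⟩, rfl⟩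
      exact ⟨_, ⟨Γ, h, hf, rfl⟩, rfl⟩
    obtain ⟨y, hy, hxy⟩ := this hx
    exact Subtype.ext hxy ▸ hy

theorem unionMap_mem_grInf {p q : ℤ} {a : DGInf 𝕜 d I J} {b : DGInf 𝕜 d I' J'}
    (ha : a ∈ grInf 𝕜 d I J p) (hb : b ∈ grInf 𝕜 d I' J' q) :
    unionMap 𝕜 d a b ∈ grInf 𝕜 d (I ⊕ I') (J ⊕ J') (p + q) := by
  refine JoinRel.lin_mem_spanBy (unionRel I J I' J') (f := fun Γ => Γ.orientationDegree d = p + q)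
    (f1 := fun Γ => Γ.orientationDegree d = p) (f2 := fun Γ => Γ.orientationDegree d = q)
    (fun Γ1 Γ2 γ h1 h2 _ => ?_) ha hb
  rw [orientationDegree_join, h1, h2]

/-- The expansion of edges is a derivation with respect to the tensor product. -/
theorem expMap_unionMap [Finite I] [Finite J] [Finite I'] [Finite J'] {p : ℤ} {a : DGInf 𝕜 d I J}
    (b : DGInf 𝕜 d I' J') (ha : a ∈ grInf 𝕜 d I J p) :
    expMap 𝕜 d (unionMap 𝕜 d a b) = unionMap 𝕜 d (expMap 𝕜 d a) b +
      p.negOnePow • unionMap 𝕜 d a (expMap 𝕜 d b) := by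
  have ha' := unionMap_mem_grInf ha (oneMap_mem I')
  rw [add_zero] at ha'
  rw [← glueMap_one_one a b, expMap_glueMap _ ha', expMap_unionMap_one, glueMap_one_one,
    ← unionMap_one_comm b, relabelMap_expMap, expMap_unionMap_one, unionMap_one_comm,
    glueMap_one_one]

end Span

/-! ### The square of the differential -/

namespace Graph

variable {γ : Graph I J E V} {u : I ⊕ V} {γ' : Graph I J (Option E) (Option V)}
  {u' : I ⊕ Option V} {γ'' : Graph I J (Option (Option E)) (Option (Option V))}

/-- Collapsing an edge of a directed graph gives a directed graph, unless this produces a vertex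
of type `0` with outgoing edges. -/
theorem admissible_of_isExp [Finite E] {β : Rib (I ⊕ V) J (flip E)}
    (h : IsExp (fun s => ((none : Option E), s)) (Prod.map some id) u β
      (γ'.toRib.ren (optionSum I V) (.refl J) (.refl (Option E))))
    (hs : ∀ e i, β.vtx (e, true) ≠ inl i) : β.Admissible := by
  have hsrc : γ'.vtx (none, true) = inr none := (optionSum I V).injective h.source
  have htgt : γ'.vtx (none, false) = Sum.map id some u :=
    (eq_symm_apply (optionSum I V)).mpr h.target
  have hvtx : ∀ e s, β.vtx (e, s) =
      Sum.elim inl (fun v => v.elim u inr) (γ'.vtx (some e, s)) := by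
    intro e s
    rw [← h.vtx]
    change Option.elim (optionSum I V (γ'.vtx (some e, s))) u id = _
    rcases γ'.vtx (some e, s) with i | _ | v <;> rfl
  have hex : ∀ v, ∃ e, γ'.vtx (some e, true) = inr (some v) := by
    intro v
    obtain ⟨_ | e, he⟩ := γ'.exists_source (some v)
    · rw [hsrc] at he
      simp at he
    · exact ⟨e, he⟩
  refine ⟨hs, fun v => (hex v).imp fun e he => by rw [hvtx, he]; rfl, fun v hv => ?_⟩
  by_cases hu : u = inr v
  · -- both vertices of the collapsed edge have type `1`
    have hsub : Subsingleton {e : E // β.vtx (e, true) = inr v} :=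
      Finite.card_le_one_iff_subsingleton.mp (le_of_eq hv)
    obtain ⟨e1, he1⟩ := hex v
    have hemp : IsEmpty {e : E // γ'.vtx (some e, true) = inr none} := ⟨fun ⟨e, he⟩ => by
      have : e = e1 := congrArg Subtype.val (hsub.elim
        (⟨e, by rw [hvtx, he]; exact hu⟩ : {e : E // β.vtx (e, true) = inr v})
        ⟨e1, by rw [hvtx, he1]; rfl⟩)
      rw [← this, he] at he1
      simp at he1⟩
    have h1 : γ'.type none = 1 := by
      rw [type, card_subtype_option, if_pos hsrc, Nat.card_of_isEmpty (α := {e : E // _})]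
    refine (γ'.two_le_of_type_one _ h1).trans ?_
    rw [card_subtype_option, if_neg (by rw [htgt, hu]; simp), add_zero]
    exact Nat.card_le_card_of_injective
      (Subtype.map id fun e he => by
        change β.vtx (e, false) = _
        rw [hvtx, he]
        exact hu) (Subtype.map_injective _ Function.injective_id)
  · have key : ∀ s, β.deg s (inr v) = Nat.card {e // γ'.vtx (e, s) = inr (some v)} := by
      intro s
      rw [card_subtype_option, if_neg, add_zero, Rib.deg]
      · refine Nat.card_congr (subtypeEquivRight fun e => ?_)
        rw [hvtx]
        rcases γ'.vtx (some e, s) with i | _ | w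
        · simp
        · simp [hu]
        · simp
      · cases s
        · rw [htgt]
          rcases u with i | w
          · simp
          · simpa using fun hw => hu (congrArg inr hw)
        · rw [hsrc]
          simp
    rw [key] at hv ⊢
    exact γ'.two_le_of_type_one _ hv

/-- Two edges may be expanded in the other order, after a permutation of the vertices. -/
theorem IsExpansion.exists_swap [Finite E] (h1 : γ.IsExpansion u γ') (h2 : γ'.IsExpansion u' γ'') :
    ∃ (π : Perm (Option (Option V))) (γ1 : Graph I J (Option E) (Option V)),
      (∃ u, γ.IsExpansion u γ1) ∧ ∃ u, γ1.IsExpansion u (γ''.map (.refl I) (.refl J)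
        (swap none (some none)) π) := by
  have h1' := (isExpansion_iff_gl.mp h1).isExp
  have h2' := ((isExpansion_iff_gl_ren (optionSum I V)).mp h2).isExp
  set ι := (optionSum I (Option V)).trans (optionCongr (optionSum I V)) with hι
  set a : Perm (Option (Option E)) := swap none (some none) with ha
  set ρ := γ''.toRib.ren ι (.refl J) (.refl _) with hρ
  obtain ⟨π, hπ⟩ : ∃ π : Perm (Option (Option V)),
      ∀ x, swapVertices (ρ.vtx (some none, true)) (ρ.vtx (some none, false)) (ι x) =
        ι (Sum.map id π x) := by
    have hsw : ∀ s t : Option (Option V), ∀ x, swap (ι (inr s)) (ι (inr t)) (ι x) =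
        ι (Sum.map id (swap s t) x) := by
      intro s t x
      refine (ι.injective.map_swap _ _ _).symm.trans (congrArg ι ?_)
      rcases x with i | x
      · exact swap_apply_of_ne_of_ne (by simp) (by simp)
      · exact (Sum.inr_injective.map_swap _ _ _).symm
    unfold swapVertices
    split_ifs with hs
    · have hs' : γ''.vtx (some none, true) = inr none := ι.injective hs
      have h3 := h2.vtx none true
      rw [hs', h1.source] at h3
      obtain rfl : u' = inr none := h3
      rcases ht : γ''.vtx (some none, false) with i | t
      · -- an input cannot be the target, as the source would have type `2` instead of `1`
        exfalso
        have h4 := h2.vtx none false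
        rw [ht, h1.target] at h4
        obtain ⟨i', rfl⟩ : ∃ i', u = inl i' := by
          rcases u with i' | v
          · exact ⟨i', rfl⟩
          · simp at h4
        have h₅ := h2.type_add
        rw [h1.type_of_input] at h₅
        have h₆ : 2 ≤ γ''.type none := by
          rw [type, card_subtype_option, card_subtype_option, if_pos hs', if_pos h2.source]
          omega
        obtain ⟨e, he⟩ := γ''.exists_source (some none)
        have h₇ : γ''.type (some none) ≠ 0 := by
          have : Nonempty {e // γ''.vtx (e, true) = inr (some none)} := ⟨⟨e, he⟩⟩
          exact Nat.card_pos.ne'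
        omega
      · refine ⟨swap (some none) t, fun x => ?_⟩
        have : ρ.vtx (some none, false) = ι (inr t) := congrArg ι ht
        rw [this]
        convert hsw (some none) t x
        rfl
    · exact ⟨_, hsw none (some none)⟩
  obtain ⟨v1, v2, β, h3, h4⟩ := IsExp.swap_two (splitOption E) (splitOption (Option E)) h1' h2'
    (a.prodCongr (Equiv.refl Bool)) (fun s => by simp [ha]) (fun s => by simp [ha])
    (fun x => Prod.ext
      (swap_apply_of_ne_of_ne (by simp) (by simp)) rfl) (fun y => rfl)
  have he : (γ''.map (.refl I) (.refl J) a π).toRib.ren ι (.refl J)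
      (.refl _) = ρ.map (swapVertices (ρ.vtx (some none, true)) (ρ.vtx (some none, false)))
        (Equiv.refl J) (a.prodCongr (Equiv.refl Bool)) (φ' := flip _) (fun y => rfl) := by
    rw [toRib_map]
    change γ''.toRib.ren (((Equiv.refl I).sumCongr π).trans ι) (Equiv.refl J) a =
      γ''.toRib.ren (ι.trans (swapVertices _ _)) (Equiv.refl J) a
    congr 1
    ext1 x
    exact (hπ x).symm
  replace h4 : IsExp _ _ v2 β _ := he ▸ h4
  obtain ⟨v2, rfl⟩ := (optionSum I V).surjective v2
  set δ := γ''.map (.refl I) (.refl J) a π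
  set β0 := β.ren (optionSum I V).symm (Equiv.refl J) (.refl _) with hβ0
  have hβ : β0.ren (optionSum I V) (.refl J) (.refl _) = β := by
    rw [hβ0, Rib.ren_ren, symm_trans_self]
    exact Rib.ren_refl β
  have h₅ : Gl (fun s => (none, s)) (Prod.map some id) (eps v2) β0
      (δ.toRib.ren (optionSum I (Option V)) (Equiv.refl J) (.refl _)) := by
    rw [← gl_map_iff (splitOption (Option E)) (optionCongr (optionSum I V)) (optionSum I V)
      (Equiv.refl J), map_eps, ← Rib.ren_eq_map, ← Rib.ren_eq_map, hβ]
    exact h4.gl (splitOption (Option E))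
  have hA : β0.Admissible := by
    refine admissible_of_isExp h₅.isExp fun e i hi => ?_
    have hi' : β.vtx (e, true) = some (inl i) := (symm_apply_eq _).mp hi
    rcases e with _ | e
    · rw [h3.source] at hi'
      simp at hi'
    · have h₆ := h3.vtx (e, true)
      rw [show β.vtx (Prod.map some id (e, true)) = _ from hi'] at h₆
      exact γ.source_ne e i h₆.symm
  refine ⟨π, ofRib β0 hA, ⟨v1, ?_⟩, v2, ?_⟩
  · rw [isExpansion_iff_gl, toRib_ofRib, hβ]
    exact h3.gl (splitOption E)
  · rw [isExpansion_iff_gl, toRib_ofRib]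
    exact h₅

/-- An expansion is determined by the cyclic orders of the half-edges. -/
theorem IsExpansion.eq_of_next [Finite E] {v : I ⊕ V} {δ : Graph I J (Option E) (Option V)}
    (h : γ.IsExpansion u γ') (h' : γ.IsExpansion v δ) (hn : γ'.next = δ.next) : γ' = δ := by
  refine h.unique_of_next h' ?_ hn
  obtain ⟨⟨e, s⟩, hx⟩ : ∃ x, γ.vtx x = u := by
    rcases u with i | w
    · exact not_forall_not.mp h.not_trivial
    · exact (γ.exists_source w).imp' (fun e => (e, true)) fun _ h => h
  obtain ⟨b, hb⟩ : ∃ b, γ'.vtx (none, b) = γ'.vtx (some e, s) := by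
    have h1 := h.vtx e s
    rw [hx] at h1
    rcases h2 : γ'.vtx (some e, s) with i | _ | w
    · rw [h2] at h1
      exact ⟨false, by rw [h.target, ← h1]; rfl⟩
    · exact ⟨true, h.source⟩
    · rw [h2] at h1
      exact ⟨false, by rw [h.target, ← h1]; rfl⟩
  rw [← γ'.sameCycle_next, hn, δ.sameCycle_next] at hb
  have h1 := h'.vtx e s
  rw [← hb, hx] at h1
  rw [h.target, h'.target, ← h1]
  cases b
  · rw [h'.target]
    rcases v with i | w <;> rfl
  · rw [h'.source]
    rfl

theorem next_map_map (γ : Graph I J E V) {a : Perm E} (ha : a.trans a = .refl E) (b b' : Perm V) :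
    ((γ.map (.refl I) (.refl J) a b).map (.refl I) (.refl J) a b').next =
      γ.next := by
  rw [map_map, ha]
  change (γ.map ((Equiv.refl I).trans (Equiv.refl I)) ((Equiv.refl J).trans (Equiv.refl J))
    (Equiv.refl E) (b.trans b')).toRib.next = _
  rw [toRib_map]
  exact Equiv.ext fun _ => rfl

/-- The graphs which arise from `γ` by expanding two edges, `some none` and then `none`. -/
def IsExpansionTwo (γ : Graph I J E V) (δ : Graph I J (Option (Option E)) (Option (Option V))) :
    Prop :=
  ∃ γ' : Graph I J (Option E) (Option V), (∃ u, γ.IsExpansion u γ') ∧ ∃ u, γ'.IsExpansion u δ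

/-- A twofold expansion is determined by the cyclic orders of the half-edges. -/
theorem IsExpansionTwo.eq_of_next [Finite E]
    {δ ε : Graph I J (Option (Option E)) (Option (Option V))} (h : γ.IsExpansionTwo δ)
    (h' : γ.IsExpansionTwo ε) (hn : δ.next = ε.next) : δ = ε := by
  obtain ⟨γ1, ⟨_, h1⟩, _, h2⟩ := h
  obtain ⟨γ2, ⟨_, h3⟩, _, h4⟩ := h'
  have hw : δ.toRib.walk = ε.toRib.walk := congrArg (flip _ * ·) hn
  have h₅ : γ1.toRib.walk = γ2.toRib.walk :=
    (isExpansion_iff.mp h2).walk.unique (splitOption _).inj2 (hw ▸ (isExpansion_iff.mp h4).walk)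
  obtain rfl := h1.eq_of_next h3 (mul_left_cancel h₅)
  exact h2.eq_of_next h4 hn

/-- The cyclic orders of a twofold expansion are not symmetric under the exchange of the two new
edges. -/
theorem IsExpansionTwo.map_next_ne [Finite E]
    {δ : Graph I J (Option (Option E)) (Option (Option V))} (h : γ.IsExpansionTwo δ)
    (π : Perm (Option (Option V))) :
    (δ.map (.refl I) (.refl J) (swap none (some none)) π).next ≠ δ.next := by
  intro hn
  obtain ⟨γ', ⟨u, h1⟩, u', h2⟩ := h
  set a : Perm (Option (Option E)) := swap none (some none) with ha
  have hcomm : ∀ y, δ.next (Prod.map a id y) = Prod.map a id (δ.next y) := by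
    intro ⟨e, s⟩
    have : (δ.map (.refl I) (.refl J) a π).next (a e, s) =
        Prod.map a id (δ.next (a.symm (a e), s)) := by
      change (δ.map (.refl I) (.refl J) a π).toRib.next _ = _
      rw [toRib_map]
      rfl
    rw [hn, symm_apply_apply] at this
    exact this
  -- a vertex of one of the new edges has no other edges
  have hnew : ∀ b e s, δ.vtx (none, b) = δ.vtx (e, s) → e = none ∨ e = some none := by
    intro b e s hbe
    by_contra hne
    push Not at hne
    have hfix : a e = e := swap_apply_of_ne_of_ne hne.1 hne.2
    obtain ⟨k, hk⟩ := (δ.sameCycle_next _ _).mpr hbe.symm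
    have hpow : ∀ y, (δ.next ^ k) (Prod.map a id y) = Prod.map a id ((δ.next ^ k) y) := by
      have hc : Commute δ.next (a.prodCongr (.refl Bool)) := Equiv.ext fun y => hcomm y
      exact fun y => Equiv.congr_fun (hc.zpow_left k) y
    have h3 := hpow (e, s)
    rw [show Prod.map a id (e, s) = (e, s) from Prod.ext hfix rfl, hk] at h3
    have h4 : none = a none := congrArg Prod.fst h3
    rw [ha, swap_apply_left] at h4
    simp at h4
  have htgt : δ.vtx (none, false) ≠ inr none := by
    rw [h2.target]
    rcases u' with i | v <;> simp
  by_cases hs : δ.vtx (some none, true) = inr none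
  · have h3 : 2 ≤ δ.type none := by
      rw [type, card_subtype_option, card_subtype_option, if_pos hs, if_pos h2.source]
      omega
    rcases hv : u' with i | v
    · subst hv
      rw [h2.type_of_input] at h3
      omega
    · obtain ⟨e, he⟩ := δ.exists_source (some v)
      have ht := h2.target
      rw [hv] at ht
      rcases hnew false e true (ht.trans he.symm) with rfl | rfl
      · rw [h2.source] at he
        simp at he
      · rw [hs] at he
        simp at he
  · have h3 : δ.type none = 1 := by
      refine le_antisymm (Finite.card_le_one_iff_subsingleton.mpr ⟨?_⟩) ?_
      · have : ∀ e, δ.vtx (e, true) = inr none → e = none := fun e he =>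
          (hnew true e true (h2.source.trans he.symm)).resolve_right
            (by rintro rfl; exact hs he)
        exact fun x y => Subtype.ext ((this _ x.2).trans (this _ y.2).symm)
      · have : Nonempty {e // δ.vtx (e, true) = inr none} := ⟨⟨none, h2.source⟩⟩
        exact Nat.card_pos
    have h4 : Nat.card {e // δ.vtx (e, false) = inr none} ≤ 1 := by
      refine Finite.card_le_one_iff_subsingleton.mpr ⟨?_⟩
      have : ∀ e, δ.vtx (e, false) = inr none → e = some none := fun e he =>
        (hnew true e false (h2.source.trans he.symm)).resolve_left (by rintro rfl; exact htgt he)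
      exact fun x y => Subtype.ext ((this _ x.2).trans (this _ y.2).symm)
    have h₅ := δ.two_le_of_type_one none h3
    omega

end Graph

section Square

variable {𝕜 : Type*} [Field 𝕜] {d : ℤ}

/-- For even `d`, the vertices have even degree, and in characteristic `2` there are no signs.
In both cases vertices may be moved freely in orientation words. -/
theorem letterDeg_mul_smul (hd : Even d ∨ (2 : 𝕜) = 0) (γ : Graph I J E V) (v : V) (n : ℤ)
    {M : Type*} [AddCommGroup M] [Module 𝕜 M] (x : M) :
    (γ.letterDeg d (inr v) * n).negOnePow • x = x := by
  rcases hd with ⟨c, rfl⟩ | hd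
  · rw [Graph.letterDeg_inr, Int.negOnePow_even _
      ⟨((γ.type v : ℤ) * (1 - c) + (c - 2)) * n, by ring⟩,
      one_smul]
  · rcases Int.units_eq_one_or (γ.letterDeg d (inr v) * n).negOnePow with h | h
    · rw [h, one_smul]
    · rw [h, Units.neg_smul, one_smul, neg_eq_iff_add_eq_zero, ← two_smul 𝕜, hd, zero_smul]

variable [Finite E] [Finite V]

theorem wcls_move_vertex (hd : Even d ∨ (2 : 𝕜) = 0) (γ : Graph I J E V)
    (l1 m l2 : List (E ⊕ V)) (v : V) :
    wcls 𝕜 d γ (l1 ++ inr v :: (m ++ l2)) = wcls 𝕜 d γ (l1 ++ (m ++ inr v :: l2)) :=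
  (wcls_move 𝕜 d γ l1 m l2 (inr v)).trans (letterDeg_mul_smul hd γ v _ _)

/-- The vertices may be moved to the end of a word. -/
theorem wcls_sort (hd : Even d ∨ (2 : 𝕜) = 0) (γ : Graph I J E V) (p w : List (E ⊕ V)) :
    wcls 𝕜 d γ (p ++ w) = wcls 𝕜 d γ (p ++ ((w.filterMap Sum.getLeft?).map inl ++
      (w.filterMap Sum.getRight?).map inr)) := by
  induction w generalizing p with
  | nil => rfl
  | cons x w ih =>
    have h := ih (p ++ [x])
    rw [List.append_assoc, List.append_assoc] at h
    rcases x with e | v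
    · exact h
    · exact h.trans (wcls_move_vertex hd γ p ((w.filterMap Sum.getLeft?).map inl)
        ((w.filterMap Sum.getRight?).map inr) v)

theorem wcls_perm_vertices (hd : Even d ∨ (2 : 𝕜) = 0) (γ : Graph I J E V) (p : List (E ⊕ V))
    {l l' : List V}
    (h : l.Perm l') : wcls 𝕜 d γ (p ++ l.map inr) = wcls 𝕜 d γ (p ++ l'.map inr) := by
  induction h generalizing p with
  | nil => rfl
  | cons x _ ih =>
    have h := ih (p ++ [inr x])
    rwa [List.append_assoc, List.append_assoc] at h
  | swap x y l =>
    exact (wcls_swap 𝕜 d γ p _ (inr y) (inr x)).trans (letterDeg_mul_smul hd γ y _ _)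
  | trans _ _ h1 h2 => exact (h1 p).trans (h2 p)

/-- Only the order of the edges in an orientation matters. -/
theorem wcls_eq_of_edges (hd : Even d ∨ (2 : 𝕜) = 0) (γ : Graph I J E V) {w w' : List (E ⊕ V)}
    (hw : IsOrientation w)
    (hw' : IsOrientation w') (h : w.filterMap Sum.getLeft? = w'.filterMap Sum.getLeft?) :
    wcls 𝕜 d γ w = wcls 𝕜 d γ w' := by
  have hR : ∀ {w : List (E ⊕ V)}, IsOrientation w →
      (w.filterMap Sum.getRight?).Nodup ∧ ∀ v, v ∈ w.filterMap Sum.getRight? := by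
    refine fun {w} hw => ⟨hw.1.filterMap ?_, fun v => List.mem_filterMap.mpr ⟨_, hw.2 (inr v), rfl⟩⟩
    rintro (e | v) (e' | v') x hx hx' <;> simp_all
  have h1 := wcls_sort hd γ [] w
  have h2 := wcls_sort hd γ [] w'
  simp only [List.nil_append] at h1 h2
  rw [h1, h2, h]
  exact wcls_perm_vertices hd γ _ ((List.perm_ext_iff_of_nodup (hR hw).1 (hR hw').1).mpr
    fun v => ⟨fun _ => (hR hw').2 v, fun _ => (hR hw).2 v⟩)

/-- If the vertices may be moved freely, then the new edge and its source may be put in front of the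
word without a sign. -/
theorem expTerm_eq_wcls (hd : Even d ∨ (2 : 𝕜) = 0) {γ : Graph I J E V} {u : I ⊕ V}
    {γ' : Graph I J (Option E) (Option V)} (h : γ.IsExpansion u γ') {w : List (E ⊕ V)}
    (hw : IsOrientation w) :
    expTerm 𝕜 d γ' w = wcls 𝕜 d γ' (inl none :: inr none :: w.map (Sum.map some some)) := by
  rcases u with i | v
  · exact expTerm_input h.target w
  · obtain ⟨l1, l2, rfl, hl⟩ := exists_eq_append_of_isOrientation hw (inr v)
    rw [expTerm_vertex h.target hl, List.map_append, List.map_cons, Sum.map_inr]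
    have h1 := wcls_move 𝕜 d γ' [] (l1.map (Sum.map some some))
      (inr none :: inr (some v) :: l2.map (Sum.map some some)) (inl none)
    rw [Graph.letterDeg_inl, one_mul] at h1
    exact h1.symm.trans (wcls_move_vertex hd γ' [inl none] _ _ none).symm

/-- The terms for the two orders of expanding two edges cancel. -/
theorem wcls_swap_two (hd : Even d ∨ (2 : 𝕜) = 0)
    (γ : Graph I J (Option (Option E)) (Option (Option V)))
    (π : Perm (Option (Option V))) {w : List (E ⊕ V)} (hw : IsOrientation w) :
    wcls 𝕜 d (γ.map (.refl I) (.refl J) (swap none (some none)) π)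
      (inl none :: inr none ::
        (inl none :: inr none :: w.map (Sum.map some some)).map (Sum.map some some)) =
    -wcls 𝕜 d γ (inl none :: inr none ::
        (inl none :: inr none :: w.map (Sum.map some some)).map (Sum.map some some)) := by
  set a : Perm (Option (Option E)) := swap none (some none) with ha
  have hW := isOrientation_exp (isOrientation_exp hw)
  generalize hWW : (inl none :: inr none :: (inl none :: inr none ::
    w.map (Sum.map some some)).map (Sum.map some some) :
      List (Option (Option E) ⊕ Option (Option V))) = W at *
  have hmap : W = (W.map (Sum.map a.symm π.symm)).map (Sum.map a π) := by
    rw [List.map_map]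
    refine (List.map_id W).symm.trans (List.map_congr_left fun x _ => ?_)
    rcases x with x | x <;> simp
  have hsw := wcls_transpose (𝕜 := 𝕜) (d := d) γ none (some none) []
    [inr none] (inr (some none) :: (w.map (Sum.map some some)).map (Sum.map some some))
  have hW' : W = [] ++ inl none :: ([inr none] ++ inl (some none) ::
      (inr (some none) :: (w.map (Sum.map some some)).map (Sum.map some some))) := hWW.symm
  rw [← hW'] at hsw
  rw [hsw, neg_neg]
  conv_lhs => rw [hmap, wcls_map]
  refine wcls_eq_of_edges hd γ ((isOrientation_map _ _ _).mpr hW) ?_ ?_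
  · refine hW.perm ?_
    rw [hW']
    exact (List.Perm.swap _ _ _).trans (((List.Perm.swap _ _ _).cons _).trans
      (List.Perm.swap _ _ _))
  · have hfix : ∀ e : E, a.symm (some (some e)) = some (some e) := fun e =>
      swap_apply_of_ne_of_ne (by simp) (by simp)
    have hrest : ∀ l : List (E ⊕ V), ((((l.map (Sum.map some some)).map
        (Sum.map some some)).map (Sum.map a.symm π.symm)).filterMap Sum.getLeft?) =
          ((l.map (Sum.map some some)).map (Sum.map some some) :
            List (Option (Option E) ⊕ Option (Option V))).filterMap Sum.getLeft? := by
      intro l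
      rw [List.map_map, List.map_map, List.map_map, List.filterMap_map, List.filterMap_map]
      refine List.filterMap_congr fun x _ => ?_
      rcases x with e | v
      · exact congrArg some (hfix e)
      · rfl
    have h1 : a.symm none = some none := swap_apply_left _ _
    have h2 : a.symm (some none) = none := swap_apply_right _ _
    rw [hW']
    change a.symm none :: a.symm (some none) :: _ = some none :: none :: _
    rw [h1, h2]
    exact congrArg (fun l => some none :: none :: l) (hrest w)

/-- `D² = 0`: exchanging the two new edges is a fixed-point-free involution on twofold expansions,
and paired terms cancel. -/
theorem expMap_expMap [Finite I] [Finite J] (hd : Even d ∨ (2 : 𝕜) = 0) (a : DGInf 𝕜 d I J) :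
    expMap 𝕜 d (expMap 𝕜 d a) = 0 := by
  induction a using DGInf.induction with
  | zero => simp
  | add x y hx hy => rw [map_add, map_add, hx, hy, add_zero]
  | smul c x hx => rw [map_smul, map_smul, hx, smul_zero]
  | wcls γ w hw =>
    rename_i E' V' _ _
    set W : List (Option (Option E') ⊕ Option (Option V')) := inl none :: inr none ::
        (inl none :: inr none :: w.map (Sum.map some some)).map (Sum.map some some) with hW
    have h1 : expMap 𝕜 d (expMap 𝕜 d (wcls 𝕜 d γ w)) =
        ∑ᶠ δ : {δ // γ.IsExpansionTwo δ}, wcls 𝕜 d δ.1 W := by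
      rw [expMap_wcls _ hw]
      refine (map_finsum_of_finite (expMap 𝕜 d).toAddMonoidHom
        fun γ' : {γ' // ∃ u, γ.IsExpansion u γ'} => expTerm 𝕜 d γ'.1 w).trans ?_
      have key : ∀ γ' : {γ' // ∃ u, γ.IsExpansion u γ'}, expMap 𝕜 d (expTerm 𝕜 d γ'.1 w) =
            ∑ᶠ δ : {δ // ∃ u, γ'.1.IsExpansion u δ}, wcls 𝕜 d δ.1 W := by
        rintro ⟨γ', u, h⟩
        rw [expTerm_eq_wcls hd h hw, expMap_wcls _ (isOrientation_exp hw)]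
        refine finsum_congr fun δ => ?_
        obtain ⟨u', h'⟩ := δ.2
        exact expTerm_eq_wcls hd h' (isOrientation_exp hw)
      refine (finsum_congr key).trans ?_
      exact finsum_subtype_finsum_subtype (P := fun γ' => ∃ u, γ.IsExpansion u γ')
        (Q := fun γ' δ => ∃ u, γ'.IsExpansion u δ) (f := fun δ => wcls 𝕜 d δ W)
        fun _ _ _ ⟨_, h⟩ ⟨_, h'⟩ ⟨_, hγ⟩ ⟨_, hγ'⟩ => h.eq_of_next h' (hγ.source_unique hγ')
    rw [h1]
    have hex : ∀ δ : {δ // γ.IsExpansionTwo δ}, ∃ π : Perm (Option (Option V')),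
        γ.IsExpansionTwo (δ.1.map (.refl I) (.refl J) (swap none (some none)) π) := by
      rintro ⟨δ, γ', ⟨_, h⟩, _, h'⟩
      obtain ⟨π, γ1, h3, h4⟩ := h.exists_swap h'
      exact ⟨π, γ1, h3, h4⟩
    choose π hπ using hex
    have := Fintype.ofFinite {δ // γ.IsExpansionTwo δ}
    rw [finsum_eq_sum_of_fintype]
    -- A fixed point would be symmetric under the exchange of the two new edges.  The renamings `π`
    -- of the vertices are chosen, but a twofold expansion is determined by its cyclic orders, so
    -- that the exchange is an involution all the same.
    refine Finset.sum_involution (fun δ _ => ⟨_, hπ δ⟩) (fun δ _ => ?_) (fun δ _ _ h => ?_)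
      (fun _ _ => Finset.mem_univ _) fun δ _ => ?_
    · rw [wcls_swap_two hd δ.1 (π δ) hw, add_neg_cancel]
    · exact δ.2.map_next_ne (π δ) (congrArg (fun δ : {δ // γ.IsExpansionTwo δ} => δ.1.next) h)
    · refine Subtype.ext (Graph.IsExpansionTwo.eq_of_next (hπ _) δ.2 ?_)
      exact Graph.next_map_map δ.1 (swap_swap _ _) _ _

end Square

/-! ### The PROPs of graphs and their inclusions -/

section Restrict

/-- The restriction of a bilinear map to subspaces. -/
def restrict2 {𝕜 M N P : Type*} [Field 𝕜] [AddCommGroup M] [AddCommGroup N] [AddCommGroup P]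
    [Module 𝕜 M] [Module 𝕜 N] [Module 𝕜 P] (L : M →ₗ[𝕜] N →ₗ[𝕜] P) (M' : Submodule 𝕜 M)
    (N' : Submodule 𝕜 N) (P' : Submodule 𝕜 P) (h : ∀ a ∈ M', ∀ b ∈ N', L a b ∈ P') :
    M' →ₗ[𝕜] N' →ₗ[𝕜] P' :=
  LinearMap.mk₂ 𝕜 (fun a b => ⟨L a b, h a a.2 b b.2⟩)
    (fun _ _ _ => Subtype.ext (by simp)) (fun _ _ _ => Subtype.ext (by simp))
    (fun _ _ _ => Subtype.ext (by simp)) (fun _ _ _ => Subtype.ext (by simp))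

variable {𝕜 : Type*} [Field 𝕜] {d : ℤ} {k : ℕ∞}

/-- The part of orientation degree `p`. -/
def DGgr (𝕜 : Type*) [Field 𝕜] (d : ℤ) (k : ℕ∞) (I J : Type) (p : ℤ) : Submodule 𝕜 (DG 𝕜 d k I J) :=
  Submodule.span 𝕜 {x | ∃ (Γ : OGraph I J) (h : Γ.TypeLE k),
    Γ.orientationDegree d = p ∧ x = gen 𝕜 d Γ h}

theorem mem_DGgr_iff {p : ℤ} {x : DG 𝕜 d k I J} : x ∈ DGgr 𝕜 d k I J p ↔
    (x : DGInf 𝕜 d I J) ∈ spanBy 𝕜 d fun Γ : OGraph I J => Γ.TypeLE k ∧ Γ.orientationDegree d = p :=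
  mem_span_gen_iff

theorem coe_mem_grInf {p : ℤ} {x : DG 𝕜 d k I J} (hx : x ∈ DGgr 𝕜 d k I J p) :
    (x : DGInf 𝕜 d I J) ∈ grInf 𝕜 d I J p :=
  Submodule.span_mono (by rintro _ ⟨Γ, h, hΓ⟩; exact ⟨Γ, h.2, hΓ⟩) (mem_DGgr_iff.mp hx)

theorem typeLE_relabel {Γ : OGraph I J} (h : Γ.TypeLE k) (α : I ≃ I') (β : J ≃ J') :
    (Γ.relabel α β).TypeLE k := fun v => by
  have h1 := Γ.graph.type_map α β (.refl _) (.refl _) v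
  rw [← Graph.relabel_eq_map] at h1
  exact (congrArg Nat.cast h1).trans_le (h v)

theorem orientationDegree_relabel (Γ : OGraph I J) (α : I ≃ I') (β : J ≃ J') :
    (Γ.relabel α β).orientationDegree d = Γ.orientationDegree d :=
  (orientationDegree_eq d _).trans (orientationDegree_eq d Γ).symm

theorem JoinRel.typeLE_join (R : JoinRel I J I' J' A B) {Γ1 : OGraph I J} {Γ2 : OGraph I' J'}
    {γ : Graph A B (Γ1.E ⊕ Γ2.E) (Γ1.V ⊕ Γ2.V)} (h1 : Γ1.TypeLE k) (h2 : Γ2.TypeLE k)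
    (h : R.rel Γ1.graph Γ2.graph γ) : (OGraph.join Γ1 Γ2 γ).TypeLE k := by
  rintro (v | v)
  · exact (congrArg Nat.cast (R.type_left h v)).trans_le (h1 v)
  · exact (congrArg Nat.cast (R.type_right h v)).trans_le (h2 v)

theorem JoinRel.lin_mem (R : JoinRel I J I' J' A B) {a : DGInf 𝕜 d I J} {b : DGInf 𝕜 d I' J'}
    (ha : a ∈ DG 𝕜 d k I J) (hb : b ∈ DG 𝕜 d k I' J') : R.lin 𝕜 d a b ∈ DG 𝕜 d k A B :=
  R.lin_mem_spanBy (f1 := OGraph.TypeLE k) (f2 := OGraph.TypeLE k) (f := OGraph.TypeLE k)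
    (fun _ _ _ h1 h2 h => R.typeLE_join h1 h2 h) ha hb

theorem JoinRel.lin_mem_gr (R : JoinRel I J I' J' A B) {p q : ℤ} {a : DG 𝕜 d k I J}
    {b : DG 𝕜 d k I' J'} (ha : a ∈ DGgr 𝕜 d k I J p) (hb : b ∈ DGgr 𝕜 d k I' J' q) :
    R.lin 𝕜 d a b ∈ spanBy 𝕜 d fun Γ : OGraph A B =>
      Γ.TypeLE k ∧ Γ.orientationDegree d = p + q :=
  R.lin_mem_spanBy (fun _ _ _ h1 h2 h => ⟨R.typeLE_join h1.1 h2.1 h,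
    by rw [orientationDegree_join, h1.2, h2.2]⟩) (mem_DGgr_iff.mp ha) (mem_DGgr_iff.mp hb)

theorem relabelMap_mem (α : I ≃ I') (β : J ≃ J') {a : DGInf 𝕜 d I J} (ha : a ∈ DG 𝕜 d k I J) :
    relabelMap 𝕜 d α β a ∈ DG 𝕜 d k I' J' :=
  relabelMap_mem_spanBy α β (f := OGraph.TypeLE k) (f' := OGraph.TypeLE k)
    (fun _ h => typeLE_relabel h α β) ha

theorem expMap_mem [Finite I] [Finite J] (hk : 1 ≤ k) {a : DGInf 𝕜 d I J}
    (ha : a ∈ DG 𝕜 d k I J) : expMap 𝕜 d a ∈ DG 𝕜 d k I J :=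
  expMap_mem_spanBy (f := OGraph.TypeLE k) (f' := OGraph.TypeLE k)
    (fun _ h _ _ h' _ _ => h'.type_le hk h) ha

theorem oneMap_mem_DG (I : Type) : oneMap 𝕜 d I ∈ DG 𝕜 d k I I :=
  wcls_mem_spanBy (f := OGraph.TypeLE k) _ _ fun _ v => v.elim

theorem isInternal_gr (I J : Type) : DirectSum.IsInternal (DGgr 𝕜 d k I J) :=
  isInternal_span k (OGraph.orientationDegree d)
    (fun Γ _ _ => (orientationDegree_eq d _).trans (orientationDegree_eq d Γ).symm)
    fun Γ Γ' a b _ => by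
      rw [orientationDegree_eq, orientationDegree_eq, Nat.card_congr a, Nat.card_congr b]

theorem isInternal_deg (I J : Type) [Finite I] : DirectSum.IsInternal (DGdeg 𝕜 d k I J) :=
  isInternal_span k (fun Γ => Γ.graph.degree) (fun _ _ _ => rfl)
    fun Γ Γ' a b h => by rw [h.eq_map, Graph.degree_map]

variable (𝕜 d k)

/-- The disjoint union, with the inputs and outputs of the first graph numbered first. -/
def tensMap {m n m' n' : ℕ} : DGInf 𝕜 d (Fin m) (Fin n) →ₗ[𝕜] DGInf 𝕜 d (Fin m') (Fin n') →ₗ[𝕜]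
    DGInf 𝕜 d (Fin (m + m')) (Fin (n + n')) :=
  (unionMap 𝕜 d).compr₂ (relabelMap 𝕜 d finSumFinEquiv finSumFinEquiv)

variable {𝕜 d k}

theorem tensMap_apply {m n m' n' : ℕ} (a : DGInf 𝕜 d (Fin m) (Fin n))
    (b : DGInf 𝕜 d (Fin m') (Fin n')) : tensMap 𝕜 d a b =
      relabelMap 𝕜 d finSumFinEquiv finSumFinEquiv (unionMap 𝕜 d a b) := rfl

theorem tensMap_relabelMap {m n m' n' p q p' q' : ℕ} (α : Fin m ≃ Fin p) (β : Fin n ≃ Fin q)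
    (α' : Fin m' ≃ Fin p') (β' : Fin n' ≃ Fin q') (a : DGInf 𝕜 d (Fin m) (Fin n))
    (b : DGInf 𝕜 d (Fin m') (Fin n')) :
    tensMap 𝕜 d (relabelMap 𝕜 d α β a) (relabelMap 𝕜 d α' β' b) =
      relabelMap 𝕜 d (finSumFinEquiv.symm.trans ((sumCongr α α').trans finSumFinEquiv))
        (finSumFinEquiv.symm.trans ((sumCongr β β').trans finSumFinEquiv))
        (tensMap 𝕜 d a b) := by
  rw [tensMap_apply, tensMap_apply, unionMap_relabelMap, relabelMap_relabelMap,
    relabelMap_relabelMap]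
  congr 2 <;> rw [← trans_assoc, self_trans_symm, refl_trans]

theorem tensMap_assoc {m n m' n' m'' n'' : ℕ} (a : DGInf 𝕜 d (Fin m) (Fin n))
    (b : DGInf 𝕜 d (Fin m') (Fin n')) (c : DGInf 𝕜 d (Fin m'') (Fin n'')) :
    relabelMap 𝕜 d (finCongr (Nat.add_assoc m m' m'')) (finCongr (Nat.add_assoc n n' n''))
      (tensMap 𝕜 d (tensMap 𝕜 d a b) c) = tensMap 𝕜 d a (tensMap 𝕜 d b c) := by
  have key : ∀ p q r : ℕ, (((finSumFinEquiv (m := p) (n := q)).sumCongr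
      (Equiv.refl (Fin r))).trans finSumFinEquiv).trans (finCongr (Nat.add_assoc p q r)) =
        (sumAssoc _ _ _).trans (((Equiv.refl (Fin p)).sumCongr
          (finSumFinEquiv (m := q) (n := r))).trans finSumFinEquiv) := by
    intro p q r
    ext1 ((i | i) | i) <;> refine Fin.ext ?_ <;> simp [Nat.add_assoc]
  conv_lhs => rw [tensMap_apply, tensMap_apply, ← relabelMap_refl c, unionMap_relabelMap,
    relabelMap_relabelMap, relabelMap_relabelMap,
    ← trans_assoc, ← trans_assoc, key, key]
  conv_rhs => rw [tensMap_apply, tensMap_apply, ← relabelMap_refl a, unionMap_relabelMap,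
    relabelMap_relabelMap, ← unionMap_assoc, relabelMap_relabelMap]

theorem one_tensMap {m n : ℕ} (a : DGInf 𝕜 d (Fin m) (Fin n)) :
    relabelMap 𝕜 d (finCongr (Nat.zero_add m)) (finCongr (Nat.zero_add n))
      (tensMap 𝕜 d (oneMap 𝕜 d (Fin 0)) a) = a := by
  have key : ∀ p : ℕ, finSumFinEquiv.trans (finCongr (Nat.zero_add p)) =
      emptySum (Fin 0) (Fin p) := by
    intro p
    ext1 (i | i)
    · exact i.elim0
    · exact Fin.ext (by simp)
  rw [tensMap_apply, relabelMap_relabelMap, key, key, one_unionMap]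

theorem tensMap_one {m n : ℕ} (a : DGInf 𝕜 d (Fin m) (Fin n)) :
    relabelMap 𝕜 d (finCongr (Nat.add_zero m)) (finCongr (Nat.add_zero n))
      (tensMap 𝕜 d a (oneMap 𝕜 d (Fin 0))) = a := by
  have key : ∀ p : ℕ, finSumFinEquiv.trans (finCongr (Nat.add_zero p)) =
      (sumComm (Fin p) (Fin 0)).trans (emptySum (Fin 0) (Fin p)) := by
    intro p
    ext1 (i | i)
    · rfl
    · exact i.elim0
  rw [tensMap_apply, relabelMap_relabelMap, key, key, ← relabelMap_relabelMap, unionMap_one_comm,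
    one_unionMap]

theorem tensMap_cls {m n m' n' : ℕ} (Γ1 : OGraph (Fin m) (Fin n)) (Γ2 : OGraph (Fin m') (Fin n')) :
    tensMap 𝕜 d (cls 𝕜 d Γ1) (cls 𝕜 d Γ2) = cls 𝕜 d (Γ1.disjUnion Γ2) := by
  rw [tensMap_apply, cls_eq_wcls, cls_eq_wcls, unionMap_wcls _ _ Γ1.isOrientation Γ2.isOrientation,
    relabelMap_wcls _ _ _ (isOrientation_joinWord Γ1.isOrientation Γ2.isOrientation),
    ← Graph.relabel_eq_map, cls_eq_wcls]
  rfl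

theorem coe_units_smul (u : ℤˣ) (x : DG 𝕜 d k I J) : ((u • x : DG 𝕜 d k I J) : DGInf 𝕜 d I J) =
    u • (x : DGInf 𝕜 d I J) := map_units_smul (DG 𝕜 d k I J).subtype u x

end Restrict

/-- The graded PROP with derivation given by the graphs with vertices of type at most `k`. -/
def graphProp (𝕜 : Type*) [Field 𝕜] (d : ℤ) (k : ℕ∞) (hk : 1 ≤ k) : DerivProp 𝕜 (DGFin 𝕜 d k) where
  gr m n := DGgr 𝕜 d k (Fin m) (Fin n)
  act α β := (relabelMap 𝕜 d α β).restrict fun _ ha => relabelMap_mem α β ha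
  comp := restrict2 (glueMap 𝕜 d) _ _ _ fun _ ha _ hb => JoinRel.lin_mem _ ha hb
  tens := restrict2 (tensMap 𝕜 d) _ _ _ fun _ ha _ hb =>
    relabelMap_mem _ _ (JoinRel.lin_mem _ ha hb)
  one n := ⟨oneMap 𝕜 d (Fin n), oneMap_mem_DG _⟩
  D := (expMap 𝕜 d).restrict fun _ ha => expMap_mem hk ha
  isInternal m n := isInternal_gr _ _
  act_mem α β _ _ ha := mem_DGgr_iff.mpr (relabelMap_mem_spanBy α β
    (fun Γ h => ⟨typeLE_relabel h.1 α β, (orientationDegree_relabel Γ α β).trans h.2⟩)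
    (mem_DGgr_iff.mp ha))
  comp_mem ha hb := mem_DGgr_iff.mpr (JoinRel.lin_mem_gr (gluingRel _ _ _) ha hb)
  tens_mem ha hb := mem_DGgr_iff.mpr (relabelMap_mem_spanBy _ _
    (fun Γ h => ⟨typeLE_relabel h.1 _ _, (orientationDegree_relabel Γ _ _).trans h.2⟩)
    (JoinRel.lin_mem_gr (unionRel _ _ _ _) ha hb))
  one_mem n := mem_DGgr_iff.mpr (wcls_mem_spanBy _ _ fun _ => ⟨fun v => v.elim, rfl⟩)
  D_mem ha := mem_DGgr_iff.mpr (expMap_mem_spanBy (fun Γ h u γ' h' w hw =>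
    ⟨h'.type_le hk h.1, by
      rw [← h.2, orientationDegree_eq, orientationDegree_eq]
      change (Nat.card (Option Γ.E) : ℤ) * _ + Nat.card (Option Γ.V) * _ = _
      rw [Finite.card_option, Finite.card_option]
      push_cast
      ring⟩) (mem_DGgr_iff.mp ha))
  act_refl a := Subtype.ext (relabelMap_refl _)
  act_act α β α' β' a := Subtype.ext (relabelMap_relabelMap _ _ _ _ _)
  act_one α := Subtype.ext (relabelMap_one α)
  act_comp α β δ a b := Subtype.ext (glueMap_relabelMap _ _ _ _ _)
  act_tens α β α' β' a b := Subtype.ext (tensMap_relabelMap _ _ _ _ _ _)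
  comp_assoc a b c := Subtype.ext (glueMap_assoc _ _ _)
  one_comp a := Subtype.ext (one_glueMap _)
  comp_one a := Subtype.ext (glueMap_one _)
  tens_assoc a b c := Subtype.ext (tensMap_assoc _ _ _)
  one_tens a := Subtype.ext (one_tensMap _)
  tens_one a := Subtype.ext (tensMap_one _)
  one_tens_one m n := Subtype.ext <| by
    change tensMap 𝕜 d (oneMap 𝕜 d _) (oneMap 𝕜 d _) = oneMap 𝕜 d _
    rw [tensMap_apply, unionMap_one_one, relabelMap_one]
  tens_comm {m n m' n' p q a b} ha hb := Subtype.ext <| by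
    rw [coe_units_smul]
    change relabelMap 𝕜 d finAddFlip finAddFlip (relabelMap 𝕜 d finSumFinEquiv finSumFinEquiv
      (unionMap 𝕜 d a.1 b.1)) = _ • relabelMap 𝕜 d finSumFinEquiv finSumFinEquiv
      (unionMap 𝕜 d b.1 a.1)
    have h : ∀ r s : ℕ, finSumFinEquiv.trans (finAddFlip (m := r) (n := s)) =
        (sumComm _ _).trans finSumFinEquiv := fun r s => Equiv.ext fun x => by
      simp [finAddFlip]
    rw [relabelMap_relabelMap, h, h, ← relabelMap_relabelMap,
      unionMap_comm (coe_mem_grInf ha) (coe_mem_grInf hb), map_units_smul]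
  interchange {l m n l' m' n' p q} a b c e hb hc := Subtype.ext <| by
    rw [coe_units_smul]
    change glueMap 𝕜 d (relabelMap 𝕜 d finSumFinEquiv finSumFinEquiv
      (unionMap 𝕜 d a.1 b.1)) (relabelMap 𝕜 d finSumFinEquiv finSumFinEquiv
      (unionMap 𝕜 d c.1 e.1)) = _ • relabelMap 𝕜 d finSumFinEquiv finSumFinEquiv
      (unionMap 𝕜 d (glueMap 𝕜 d a.1 c.1) (glueMap 𝕜 d b.1 e.1))
    rw [glueMap_relabelMap, interchange_unionMap _ _ (coe_mem_grInf hb) (coe_mem_grInf hc),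
      map_units_smul]
  D_act α β a := Subtype.ext (relabelMap_expMap _ _ _)
  D_one n := Subtype.ext (expMap_one _)
  D_comp {l m n p a} b ha := Subtype.ext <| by
    rw [Submodule.coe_add, coe_units_smul]
    exact expMap_glueMap _ (coe_mem_grInf ha)
  D_tens {m n m' n' p a} b ha := Subtype.ext <| by
    rw [Submodule.coe_add, coe_units_smul]
    change expMap 𝕜 d (relabelMap 𝕜 d finSumFinEquiv finSumFinEquiv
      (unionMap 𝕜 d a.1 b.1)) = relabelMap 𝕜 d finSumFinEquiv finSumFinEquiv
      (unionMap 𝕜 d (expMap 𝕜 d a.1) b.1) + _ • relabelMap 𝕜 d finSumFinEquiv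
      finSumFinEquiv (unionMap 𝕜 d a.1 (expMap 𝕜 d b.1))
    rw [relabelMap_expMap, expMap_unionMap _ (coe_mem_grInf ha), map_add, map_units_smul]

theorem isGraphProp_graphProp (𝕜 : Type*) [Field 𝕜] (d : ℤ) (k : ℕ∞) (hk : 1 ≤ k) :
    IsGraphProp (graphProp 𝕜 d k hk) where
  gr _ _ _ := rfl
  act α β Γ _ := relabelMap_cls α β Γ
  comp Γ1 Γ2 _ _ := glueMap_cls Γ1 Γ2
  tens Γ1 Γ2 _ _ := tensMap_cls Γ1 Γ2
  one n := (cls_eq_wcls 𝕜 d (OGraph.trivial (Fin n))).symm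
  D Γ _ := expMap_cls Γ

theorem inclusion_mem_span_gen {𝕜 : Type*} [Field 𝕜] {d : ℤ} {k l : ℕ∞} (h : k ≤ l)
    {f : OGraph I J → Prop} {x : DG 𝕜 d k I J}
    (hx : x ∈ Submodule.span 𝕜 {x : DG 𝕜 d k I J |
      ∃ (Γ : OGraph I J) (h : Γ.TypeLE k), f Γ ∧ x = gen 𝕜 d Γ h}) :
    Submodule.inclusion (DG_mono 𝕜 d I J h) x ∈ Submodule.span 𝕜 {x : DG 𝕜 d l I J |
      ∃ (Γ : OGraph I J) (h : Γ.TypeLE l), f Γ ∧ x = gen 𝕜 d Γ h} := by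
  rw [mem_span_gen_iff] at hx ⊢
  refine Submodule.span_mono ?_ hx
  rintro _ ⟨Γ, hΓ, hx⟩
  exact ⟨Γ, ⟨fun v => (hΓ.1 v).trans h, hΓ.2⟩, hx⟩

theorem isPropHom_inclusion (𝕜 : Type*) [Field 𝕜] (d : ℤ) {k l : ℕ∞} (hk : 1 ≤ k) (hl : 1 ≤ l)
    (h : k ≤ l) : IsPropHom (graphProp 𝕜 d k hk) (graphProp 𝕜 d l hl) fun m n =>
      Submodule.inclusion (DG_mono 𝕜 d (Fin m) (Fin n) h) where
  gr ha := inclusion_mem_span_gen h ha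
  act _ _ _ := rfl
  comp _ _ := rfl
  tens _ _ := rfl
  one _ := rfl
  D _ := rfl

end RibbonProp
end

theorem mainTheorem10 (𝕜 : Type*) [Field 𝕜] (d : ℤ) :
    ∃ S : ∀ k : Set.Ici (1 : ℕ∞), RibbonProp.DerivProp 𝕜 (RibbonProp.DGFin 𝕜 d k),
      -- each `S k` is a graded PROP with derivation whose operations are those of graphs
      (∀ k, RibbonProp.IsGraphProp (S k)) ∧
      -- the inclusions are injective morphisms of PROPs, compatible with the derivation
      (∀ (k l : Set.Ici (1 : ℕ∞)) (h : k ≤ l),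
        RibbonProp.IsPropHom (S k) (S l) (fun m n =>
          Submodule.inclusion (RibbonProp.DG_mono 𝕜 d (Fin m) (Fin n) h)) ∧
        ∀ m n, Function.Injective
          (Submodule.inclusion (RibbonProp.DG_mono 𝕜 d (Fin m) (Fin n) h))) ∧
      -- the grading by the degree of graphs is preserved by the inclusions and lowered by `D`
      (∀ (k : Set.Ici (1 : ℕ∞)) (m n : ℕ),
        DirectSum.IsInternal (RibbonProp.DGdeg 𝕜 d k (Fin m) (Fin n)) ∧
        (∀ p < 0, RibbonProp.DGdeg 𝕜 d k (Fin m) (Fin n) p = ⊥) ∧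
        (∀ (p : ℤ) (x : RibbonProp.DGFin 𝕜 d k m n),
          x ∈ RibbonProp.DGdeg 𝕜 d k (Fin m) (Fin n) p →
            (S k).D x ∈ RibbonProp.DGdeg 𝕜 d k (Fin m) (Fin n) (p - 1)) ∧
        ∀ (l : Set.Ici (1 : ℕ∞)) (h : k ≤ l) (p : ℤ) (x : RibbonProp.DGFin 𝕜 d k m n),
          x ∈ RibbonProp.DGdeg 𝕜 d k (Fin m) (Fin n) p →
            Submodule.inclusion (RibbonProp.DG_mono 𝕜 d (Fin m) (Fin n) h) x ∈
              RibbonProp.DGdeg 𝕜 d l (Fin m) (Fin n) p) ∧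
      -- for even `d` they are differential graded PROPs
      (Even d ∨ (2 : 𝕜) = 0 → ∀ k, (S k).IsDG) := by
  refine ⟨fun k => RibbonProp.graphProp 𝕜 d k k.2,
    fun k => RibbonProp.isGraphProp_graphProp 𝕜 d k k.2,
    fun k l h => ⟨RibbonProp.isPropHom_inclusion 𝕜 d k.2 l.2 h,
      fun m n => Submodule.inclusion_injective _⟩,
    fun k m n => ⟨RibbonProp.isInternal_deg _ _, fun p hp => ?_, fun p x hx => ?_,
      fun l h p x hx => RibbonProp.inclusion_mem_span_gen h hx⟩,
    fun hd k m n a => Subtype.ext (RibbonProp.expMap_expMap hd _)⟩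
  · refine Submodule.span_eq_bot.mpr ?_
    rintro x ⟨Γ, -, hΓ, -⟩
    exact absurd Γ.graph.degree_nonneg (by omega)
  · refine RibbonProp.mem_span_gen_iff.mpr (RibbonProp.expMap_mem_spanBy
      (fun Γ h u γ' h' w hw => ?_)
      (RibbonProp.mem_span_gen_iff.mp hx))
    exact ⟨h'.type_le k.2 h.1, h'.degree.trans (congrArg (· - 1) h.2)⟩
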